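/- **Model.** The machine is a randomized real RAM with exact arithmetic: each of the following costs one step: $+,-,\times,/,\sqrt{\cdot}$ and comparison of real numbers; addition, truncated subtraction and comparison of natural numbers; conversion of a natural number to a real number; reading or writing a cell of a two-dimensional table at computed indices; a fair coin flip. Unused memory is initially zero. A real number $\omega\in[2,3]$ is a *matrix multiplication exponent* if some program of this machine multiplies any two real $m\times m$ matrices in $O(m^{\omega})$ steps, for all $m\ge 1$ (whatever the unrelated contents of the memory). For symmetric matrices, $N\preceq M$ means that $M-N$ is positive semidefinite, and $M\approx_{\kappa}N$ means $e^{-\kappa}N\preceq M\preceq e^{\kappa}N$. $\mathrm{nnz}(x)$ is the number of nonzero entries of a vector $x$. **Problem.** An instance consists of integers $n,d,r,\alpha$ with $r\ge 1$ and $1\le\alpha\le d$, a real number $\beta>2$, a matrix $A\in\mathbb R^{n\times d}$ and vectors $d^{(0)},\dots,d^{(r)}\in\mathbb R_{\ge 0}^{n}$. Let $D^{(k)}=\mathrm{diag}(d^{(k)})$ and $B^{(k)}=A^{T}D^{(k)}A$, and suppose that * $B^{(k)}$ is positive definite for every $k\in\{1,\dots,r\}$; * the number of pairs $(i,k)$ with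 $1\le k\le r$ and $d_i^{(k)}\ne d_i^{(k-1)}$ is at most $\alpha$; * $\beta^{-1}B^{(0)}\preceq B^{(k)}\preceq\beta B^{(0)}$ for every $k\in\{1,\dots,r\}$. The algorithm is first given $n,d,r,\alpha,\beta$, the matrix $A$ in random access memory, and the list of the pairs $(i,d^{(0)}_i)$ with $d^{(0)}_i\neq 0$. In round $k=1,\dots,r$ it is given the list of the pairs $(i,d^{(k)}_i)$ with $d^{(k)}_i\ne d^{(k-1)}_i$; it must process this list before it sees the next round. (Both lists are sorted by $i$, and presenting them costs no steps.) After this, in the same round, it may be asked any number of times to apply its current matrix to a vector $v\in\mathbb R^{d}$, and it continues with the memory that these queries leave. The vectors $d^{(0)},\dots,d^{(r)}$ do not depend on the coin flips of the algorithm; the queries may. **Theorem (Low Rank Inverse Maintenance).** There is an absolute constant $\kappa$ such that for every matrix multiplication exponent $\omega\in[2,3]$ and every $c>0$ there are an algorithm (a program for the preprocessing, one for the update of a round, and one for queries) and constants $C,p$, depending only on $\omega$ and $c$, for which the following holds on every instance. Let $s=\max\{\mathrm{nnz}(d^{(0)}),d\}$ and $L=C\,(\log(n+d+2))^{p}$.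 1. For all outcomes of the coin flips, the preprocessing and the updates of all $r$ rounds together take at most $$L\left(s\,d^{\omega-1}+\alpha\, r\, d\left(\frac{\alpha}{r}\right)^{\omega-2}+r\,\alpha^{\omega}\right)$$ steps, and each query takes at most $L\,d^{2}\log\beta$ steps. 2. With probability at least $1-n^{-c}$ over the coin flips there are symmetric matrices $K^{(1)},\dots,K^{(r)}\in\mathbb R^{d\times d}$ with $K^{(k)}\approx_{\kappa}\left(B^{(k)}\right)^{-1}$ such that every query $v$ in round $k$ is answered by exactly $K^{(k)}v$, for $k=1,\dots,r$. -/

import Mathlib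

open scoped MatrixOrder

noncomputable section

namespace RealRAM

/-! A real RAM with exact arithmetic.  Programs are structured (sequencing, branching, loops); each
elementary instruction and each test of a condition costs one step. -/

/-- The memory of the machine.  `idx` and `val` are the registers for natural numbers and for real
numbers; `idxTab a i j` and `valTab a i j` are the cells of two-dimensional tables, where the name
`a` of a table is fixed by the program text and the position `(i, j)` may be computed.  `coins` is
the stream of random bits that have not been read yet. -/
structure Store where
  idx : ℕ → ℕ
  val : ℕ → ℝ
  idxTab : ℕ → ℕ → ℕ → ℕ
  valTab : ℕ → ℕ → ℕ → ℝ
  coins : ℕ → Bool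

/-- Overwrite the single cell `(i, j)` of table `a`. -/
def setCell {V : Type} (f : ℕ → ℕ → ℕ → V) (a i j : ℕ) (v : V) : ℕ → ℕ → ℕ → V :=
  fun a' i' j' => if a' = a ∧ i' = i ∧ j' = j then v else f a' i' j'

/-- Elementary instructions; all arguments are names of registers or of tables, except the constant
`c` of `idxConst`.  The first argument is the target, except for the two `Store` instructions.
There is no operation from reals to natural numbers (in particular no rounding), and natural
numbers are only added and subtracted. -/
inductive Instr : Type
  | idxConst (a c : ℕ)
  | idxAdd (a b c : ℕ)
  | idxSub (a b c : ℕ)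
  | idxLoad (a tab i j : ℕ)
  | idxStore (tab i j b : ℕ)
  | flip (a : ℕ)
  | valCast (x a : ℕ)
  | valAdd (x y z : ℕ)
  | valSub (x y z : ℕ)
  | valMul (x y z : ℕ)
  | valDiv (x y z : ℕ)
  | valSqrt (x y : ℕ)
  | valLoad (x tab i j : ℕ)
  | valStore (tab i j y : ℕ)

/-- The effect of an elementary instruction.  Subtraction of natural numbers is truncated at `0`;
a division by zero and the square root of a negative number return `0`. -/
def Instr.effect : Instr → Store → Store
  | idxConst a c, σ => { σ with idx := Function.update σ.idx a c }
  | idxAdd a b c, σ => { σ with idx := Function.update σ.idx a (σ.idx b + σ.idx c) }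
  | idxSub a b c, σ => { σ with idx := Function.update σ.idx a (σ.idx b - σ.idx c) }
  | idxLoad a tab i j, σ =>
      { σ with idx := Function.update σ.idx a (σ.idxTab tab (σ.idx i) (σ.idx j)) }
  | idxStore tab i j b, σ =>
      { σ with idxTab := setCell σ.idxTab tab (σ.idx i) (σ.idx j) (σ.idx b) }
  | flip a, σ =>
      { σ with idx := Function.update σ.idx a (if σ.coins 0 then 1 else 0)
               coins := fun m => σ.coins (m + 1) }
  | valCast x a, σ => { σ with val := Function.update σ.val x (σ.idx a : ℝ) }
  | valAdd x y z, σ => { σ with val := Function.update σ.val x (σ.val y + σ.val z) }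
  | valSub x y z, σ => { σ with val := Function.update σ.val x (σ.val y - σ.val z) }
  | valMul x y z, σ => { σ with val := Function.update σ.val x (σ.val y * σ.val z) }
  | valDiv x y z, σ => { σ with val := Function.update σ.val x (σ.val y / σ.val z) }
  | valSqrt x y, σ => { σ with val := Function.update σ.val x (Real.sqrt (σ.val y)) }
  | valLoad x tab i j, σ =>
      { σ with val := Function.update σ.val x (σ.valTab tab (σ.idx i) (σ.idx j)) }
  | valStore tab i j y, σ =>
      { σ with valTab := setCell σ.valTab tab (σ.idx i) (σ.idx j) (σ.val y) }

/-- Conditions: comparison of two registers of the same kind. -/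
inductive Cond : Type
  | idxLt (a b : ℕ)
  | valLt (x y : ℕ)

def Cond.Holds : Cond → Store → Prop
  | idxLt a b, σ => σ.idx a < σ.idx b
  | valLt x y, σ => σ.val x < σ.val y

/-- Programs (finite objects, the same for inputs of all sizes). -/
inductive Prog : Type
  | skip
  | op (ins : Instr)
  | seq (P Q : Prog)
  | ite (c : Cond) (P Q : Prog)
  | loop (c : Cond) (P : Prog)

/-- `Exec P σ τ t`: started in `σ`, the program `P` halts in `τ` after exactly `t` steps. -/
inductive Exec : Prog → Store → Store → ℕ → Prop
  | skip (σ : Store) : Exec .skip σ σ 1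
  | op (ins : Instr) (σ : Store) : Exec (.op ins) σ (ins.effect σ) 1
  | seq {P Q : Prog} {σ τ ρ : Store} {s t : ℕ} :
      Exec P σ τ s → Exec Q τ ρ t → Exec (.seq P Q) σ ρ (s + t)
  | iteTrue {c : Cond} {P Q : Prog} {σ τ : Store} {t : ℕ} :
      c.Holds σ → Exec P σ τ t → Exec (.ite c P Q) σ τ (t + 1)
  | iteFalse {c : Cond} {P Q : Prog} {σ τ : Store} {t : ℕ} :
      ¬ c.Holds σ → Exec Q σ τ t → Exec (.ite c P Q) σ τ (t + 1)
  | loopDone {c : Cond} {P : Prog} {σ : Store} :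
      ¬ c.Holds σ → Exec (.loop c P) σ σ 1
  | loopStep {c : Cond} {P : Prog} {σ τ ρ : Store} {s t : ℕ} :
      c.Holds σ → Exec P σ τ s → Exec (.loop c P) τ ρ t → Exec (.loop c P) σ ρ (s + t + 1)

/-- The law of an infinite sequence of independent fair coin flips. -/
def coinLaw : MeasureTheory.Measure (ℕ → Bool) :=
  MeasureTheory.Measure.infinitePi fun _ : ℕ => (PMF.uniformOfFintype Bool).toMeasure

/-- `ω` is an exponent of matrix multiplication: one program multiplies any two real `m × m`
matrices in `O(m ^ ω)` steps.  The program finds `m` in index register `0` and the factors in the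
real tables `0` and `1`, and leaves the product in real table `2`; the rest of the memory is
arbitrary. -/
def IsMatMulExponent (ω : ℝ) : Prop :=
  ∃ (P : Prog) (C : ℝ), ∀ (m : ℕ) (X Y : Matrix (Fin m) (Fin m) ℝ) (σ : Store),
    1 ≤ m → σ.idx 0 = m →
    (∀ i j : Fin m, σ.valTab 0 i j = X i j) →
    (∀ i j : Fin m, σ.valTab 1 i j = Y i j) →
    ∃ (τ : Store) (t : ℕ), Exec P σ τ t ∧ (t : ℝ) ≤ C * (m : ℝ) ^ ω ∧
      ∀ i j : Fin m, τ.valTab 2 i j = (X * Y) i j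

end RealRAM

namespace InverseMaintenance

open RealRAM

/-- `Aᵀ D A`, where `D` is the diagonal matrix with diagonal `w`. -/
def weightedGram {n d : ℕ} (A : Matrix (Fin n) (Fin d) ℝ) (w : Fin n → ℝ) :
    Matrix (Fin d) (Fin d) ℝ :=
  A.transpose * Matrix.diagonal w * A

/-- `M ≈_ε N`, i.e. `e^{-ε} N ⪯ M ⪯ e^ε N` in the Loewner order. -/
def SpectralApprox {d : ℕ} (ε : ℝ) (M N : Matrix (Fin d) (Fin d) ℝ) : Prop :=
  Real.exp (-ε) • N ≤ M ∧ M ≤ Real.exp ε • N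

/-- The number of nonzero entries of a vector. -/
def nnz {n : ℕ} (w : Fin n → ℝ) : ℕ :=
  (Finset.univ.filter fun i => w i ≠ 0).card

/-- The coordinates in which two vectors differ. -/
def diffSet {n : ℕ} (w w' : Fin n → ℝ) : Finset (Fin n) :=
  Finset.univ.filter fun i => w' i ≠ w i

/-- Present to the machine the entries of `w` with index in `S`, as a list of pairs in increasing
order of the index: the length goes to index register `4`, the indices (counted from `0`) to column
`0` of index table `0`, and the values to column `0` of real table `1`. -/
def loadEntries {n : ℕ} (S : Finset (Fin n)) (w : Fin n → ℝ) (σ : Store) : Store :=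
  { σ with
    idx := Function.update σ.idx 4 S.card
    idxTab := Function.update σ.idxTab 0 fun j c =>
      if c = 0 then ((S.sort (· ≤ ·))[j]?).elim 0 (fun i => (i : ℕ)) else 0
    valTab := Function.update σ.valTab 1 fun j c =>
      if c = 0 then ((S.sort (· ≤ ·))[j]?).elim 0 w else 0 }

/-- Present a query vector to the machine, in column `0` of real table `2`. -/
def loadQuery {d : ℕ} (v : Fin d → ℝ) (σ : Store) : Store :=
  { σ with
    valTab := Function.update σ.valTab 2 fun j c =>
      if h : j < d then (if c = 0 then v ⟨j, h⟩ else 0) else 0 }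

/-- The initial memory: `n, d, r, α` in the index registers `0, 1, 2, 3`, `β` in real register `0`,
the matrix `A` in real table `0`, the nonzero entries of the initial vector `w` as a list, and `0`
everywhere else. -/
def initialStore {n d : ℕ} (r α : ℕ) (β : ℝ) (A : Matrix (Fin n) (Fin d) ℝ) (w : Fin n → ℝ)
    (coins : ℕ → Bool) : Store :=
  loadEntries (Finset.univ.filter fun i => w i ≠ 0) w
    { idx := fun a => if a = 0 then n else if a = 1 then d else if a = 2 then r
        else if a = 3 then α else 0
      val := fun x => if x = 0 then β else 0
      idxTab := fun _ _ _ => 0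
      valTab := fun a i j =>
        if h : a = 0 ∧ i < n ∧ j < d then A ⟨i, h.2.1⟩ ⟨j, h.2.2⟩ else 0
      coins := coins }

/-- A data structure for inverse maintenance: a program for the preprocessing, one for processing
the new vector of a round, and one for applying the current approximate inverse to a vector. -/
structure Maintainer where
  init : Prog
  update : Prog
  apply : Prog

/-- The memory before the update of round `k + 1`: the coordinates of `w (k + 1)` that differ from
`w k`, with their new values, are presented as a list. -/
def loadRound {n : ℕ} (w : ℕ → Fin n → ℝ) (k : ℕ) (σ : Store) : Store :=
  loadEntries (diffSet (w k) (w (k + 1))) (w (k + 1)) σ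

/-- `Reach 𝒟 r α β A w coins k σ T`: on the input `A, w 0, w 1, …` and with the random bits
`coins`, the memory can be `σ` at some time during round `k` (after its update), where the
preprocessing and the first `k` updates together took `T` steps.  Any number of queries, with any
vectors, may have been answered during the rounds up to now, and the algorithm works on with
the memory that they left. -/
inductive Reach (𝒟 : Maintainer) {n d : ℕ} (r α : ℕ) (β : ℝ) (A : Matrix (Fin n) (Fin d) ℝ)
    (w : ℕ → Fin n → ℝ) (coins : ℕ → Bool) : ℕ → Store → ℕ → Prop
  | init {τ : Store} {t : ℕ} :
      Exec 𝒟.init (initialStore r α β A (w 0) coins) τ t → Reach 𝒟 r α β A w coins 0 τ t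
  | update {k T t : ℕ} {σ τ : Store} :
      Reach 𝒟 r α β A w coins k σ T → k < r →
      Exec 𝒟.update (loadRound w k σ) τ t → Reach 𝒟 r α β A w coins (k + 1) τ (T + t)
  | query {k T t : ℕ} {σ τ : Store} (v : Fin d → ℝ) :
      Reach 𝒟 r α β A w coins k σ T → 1 ≤ k →
      Exec 𝒟.apply (loadQuery v σ) τ t → Reach 𝒟 r α β A w coins k τ T

/-- For these random bits, all preprocessing, updates and queries halt; preprocessing and all updates
together take at most `total` steps, and each query takes at most `perQuery` steps. -/
def RunsInTime (𝒟 : Maintainer) {n d : ℕ} (r α : ℕ) (β : ℝ) (A : Matrix (Fin n) (Fin d) ℝ)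
    (w : ℕ → Fin n → ℝ) (total perQuery : ℝ) (coins : ℕ → Bool) : Prop :=
  (∃ τ t, Exec 𝒟.init (initialStore r α β A (w 0) coins) τ t) ∧
  ∀ k σ T, Reach 𝒟 r α β A w coins k σ T →
    (T : ℝ) ≤ total ∧
    (k < r → ∃ τ t, Exec 𝒟.update (loadRound w k σ) τ t) ∧
    (1 ≤ k → ∀ v : Fin d → ℝ, ∃ τ t, Exec 𝒟.apply (loadQuery v σ) τ t ∧ (t : ℝ) ≤ perQuery)

/-- For these random bits there are symmetric matrices `K 1, …, K r` with
`K k ≈_κ (Aᵀ D⁽ᵏ⁾ A)⁻¹` such that every query `v` in round `k` is answered by `K k v`, left in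
column `0` of real table `3`. -/
def AnswersCorrectly (𝒟 : Maintainer) {n d : ℕ} (r α : ℕ) (β : ℝ)
    (A : Matrix (Fin n) (Fin d) ℝ) (w : ℕ → Fin n → ℝ) (κ : ℝ) (coins : ℕ → Bool) : Prop :=
  ∃ K : ℕ → Matrix (Fin d) (Fin d) ℝ,
    (∀ k, 1 ≤ k → k ≤ r →
      (K k).IsSymm ∧ SpectralApprox κ (K k) (weightedGram A (w k))⁻¹) ∧
    ∀ k σ T, Reach 𝒟 r α β A w coins k σ T → 1 ≤ k → ∀ v : Fin d → ℝ,
      ∃ τ t, Exec 𝒟.apply (loadQuery v σ) τ t ∧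
        ∀ i : Fin d, τ.valTab 3 i 0 = (K k).mulVec v i

end InverseMaintenance

end

open scoped MatrixOrder

noncomputable section

namespace RealRAM

/-! ### Determinism and renaming of programs -/

/-! Write B₀ for the initial matrix, B for the matrix of the current round and θ = 1/β. The data
structure works with H = B + θB₀, which satisfies B ⪯ H ⪯ 2B. Split H by the initial weights. The
rows aᵢ with nonzero initial weight ("old" rows) give B₂ = Σ (wᵢ + θwᵢ⁽⁰⁾) aᵢaᵢᵀ, and the changed
rows with zero initial weight ("new" rows) give UᵀU, so that H = B₂ + UᵀU (`midGram_add`). The term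
θB₀ is there because old weights may drop to zero: it guarantees B₂ ⪰ θB₀ (`le_midGram`).

Old rows are treated exactly. B₂ is (1+θ)B₀ plus a change of rank at most α, so B₂⁻¹ can be applied
through B₀⁻¹ and the capacitance matrix X = 1 + γMΔ of size α, with γ = 1/(1+θ) (`capX_mul`,
`inv_eq_of_lowRank`). The entries of M that matter are products of rows of A with rows of AB₀⁻¹ that
belong to old rows, and the latter are computed once in the preprocessing.

New rows are treated approximately. By the Woodbury identity one has to apply (1 + N)⁻¹ with N = U
B₂⁻¹ Uᵀ. Computing N would need aᵢᵀB₀⁻¹ for the arriving rows, which is too expensive. But N is the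
Gram matrix of the tall matrix D₂^{1/2} A B₂⁻¹ Uᵀ, where D₂ holds the weights in B₂ (`gram_sqrt`),
so a matrix S of m = O(α log n) rows of random signs preserves N up to the factors 1/25 and 25/4.
The product S D₀^{1/2} A B₀⁻¹ is computed once, and S D₂^{1/2} A B₂⁻¹ Uᵀ follows from it by algebra
with small matrices (`sketchR_eq`). The sketched Gram matrix preconditions a Richardson iteration
for 1 + N, whose error shrinks by 1 - (1/25)/(25/4) = 621/625 in each step and keeps its sign in the
Loewner order (`richardson_aux`). After T steps the answer is Kv for a symmetric K with H⁻¹ ⪯ K ⪯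
H⁻¹ + (621/625)^T B₂⁻¹ (`approx_inverse`). Since B₂⁻¹ ⪯ β²B⁻¹, T = O(log β) steps suffice
(`spectralApprox_of_le`).

Randomness: the sketched matrices depend on the weights only, so a single sign matrix, drawn at the
start, serves all rounds. For one round, a net of at most (20α+1)^α points in a column space of
dimension at most α and a Chernoff bound for sums of signs give failure probability (20α+1)^α ·
2e^{-m/12} (`card_not_sketchGood`). At most α + 1 different records of changes occur, so the union
bound does not involve r. Adaptive queries are harmless: K is a function of the weights and the
coins, and queries preserve all stored data.

Time: u new entries of the record extend the stored products by products with block size u, at cost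
m d u^{ω-2}; these sum to at most m d r (α/r)^{ω-2} by concavity (`sum_rpow_le`). The small systems
of a round cost m α^{ω-1}. Matrices are inverted by orthogonalization, with the column operations
delayed and grouped into block products along powers of two (`applied_before`, `sum_lowb_le`).
Programs are verified by triples `Tri` that describe the memory below a level and leave the scratch
names above it open. -/

theorem Exec.det {P : Prog} {σ τ τ' : Store} {t t' : ℕ} (h : Exec P σ τ t)
    (h' : Exec P σ τ' t') : τ = τ' ∧ t = t' := by
  induction h generalizing τ' t' with
  | skip σ => cases h'; exact ⟨rfl, rfl⟩
  | op ins σ => cases h'; exact ⟨rfl, rfl⟩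
  | seq _ _ ih1 ih2 =>
    cases h' with
    | seq a b =>
      obtain ⟨rfl, rfl⟩ := ih1 a
      obtain ⟨rfl, rfl⟩ := ih2 b
      exact ⟨rfl, rfl⟩
  | iteTrue hc _ ih =>
    cases h' with
    | iteTrue _ a => obtain ⟨rfl, rfl⟩ := ih a; exact ⟨rfl, rfl⟩
    | iteFalse hn _ => exact absurd hc hn
  | iteFalse hc _ ih =>
    cases h' with
    | iteTrue hn _ => exact absurd hn hc
    | iteFalse _ a => obtain ⟨rfl, rfl⟩ := ih a; exact ⟨rfl, rfl⟩
  | loopDone hc =>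
    cases h' with
    | loopDone _ => exact ⟨rfl, rfl⟩
    | loopStep hn _ _ => exact absurd hn hc
  | loopStep hc _ _ ih1 ih2 =>
    cases h' with
    | loopDone hn => exact absurd hc hn
    | loopStep _ a b =>
      obtain ⟨rfl, rfl⟩ := ih1 a
      obtain ⟨rfl, rfl⟩ := ih2 b
      exact ⟨rfl, rfl⟩

/-- Rename all registers and tables by adding `k`. -/
def Instr.shift (k : ℕ) : Instr → Instr
  | idxConst a c => idxConst (a + k) c
  | idxAdd a b c => idxAdd (a + k) (b + k) (c + k)
  | idxSub a b c => idxSub (a + k) (b + k) (c + k)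
  | idxLoad a tab i j => idxLoad (a + k) (tab + k) (i + k) (j + k)
  | idxStore tab i j b => idxStore (tab + k) (i + k) (j + k) (b + k)
  | flip a => flip (a + k)
  | valCast x a => valCast (x + k) (a + k)
  | valAdd x y z => valAdd (x + k) (y + k) (z + k)
  | valSub x y z => valSub (x + k) (y + k) (z + k)
  | valMul x y z => valMul (x + k) (y + k) (z + k)
  | valDiv x y z => valDiv (x + k) (y + k) (z + k)
  | valSqrt x y => valSqrt (x + k) (y + k)
  | valLoad x tab i j => valLoad (x + k) (tab + k) (i + k) (j + k)
  | valStore tab i j y => valStore (tab + k) (i + k) (j + k) (y + k)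

def Cond.shift (k : ℕ) : Cond → Cond
  | idxLt a b => idxLt (a + k) (b + k)
  | valLt a b => valLt (a + k) (b + k)

def Prog.shift (k : ℕ) : Prog → Prog
  | skip => skip
  | op ins => op (ins.shift k)
  | seq P Q => seq (P.shift k) (Q.shift k)
  | ite c P Q => ite (c.shift k) (P.shift k) (Q.shift k)
  | loop c P => loop (c.shift k) (P.shift k)

/-- The memory that a shifted program sees. -/
def Store.unshift (k : ℕ) (σ : Store) : Store where
  idx a := σ.idx (a + k)
  val a := σ.val (a + k)
  idxTab a := σ.idxTab (a + k)
  valTab a := σ.valTab (a + k)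
  coins := σ.coins

/-- Agreement on all names below `k`. -/
structure Below (k : ℕ) (σ τ : Store) : Prop where
  idx : ∀ a < k, σ.idx a = τ.idx a
  val : ∀ a < k, σ.val a = τ.val a
  idxTab : ∀ a < k, σ.idxTab a = τ.idxTab a
  valTab : ∀ a < k, σ.valTab a = τ.valTab a

theorem Below.refl (k : ℕ) (σ : Store) : Below k σ σ := ⟨by simp, by simp, by simp, by simp⟩

theorem Below.trans {k : ℕ} {σ τ ρ : Store} (h : Below k σ τ) (h' : Below k τ ρ) : Below k σ ρ :=
  ⟨fun a ha => (h.idx a ha).trans (h'.idx a ha), fun a ha => (h.val a ha).trans (h'.val a ha),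
   fun a ha => (h.idxTab a ha).trans (h'.idxTab a ha),
   fun a ha => (h.valTab a ha).trans (h'.valTab a ha)⟩

theorem Below.symm {k : ℕ} {σ τ : Store} (h : Below k σ τ) : Below k τ σ :=
  ⟨fun a ha => (h.idx a ha).symm, fun a ha => (h.val a ha).symm,
   fun a ha => (h.idxTab a ha).symm, fun a ha => (h.valTab a ha).symm⟩

theorem Instr.shift_effect (k : ℕ) (ins : Instr) (σ : Store) :
    (((ins.shift k).effect σ).unshift k = ins.effect (σ.unshift k)) ∧
      Below k σ ((ins.shift k).effect σ) := by
  refine ⟨?_, ?_⟩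
  · cases ins <;>
      simp only [Instr.shift, Instr.effect, Store.unshift, Store.mk.injEq, true_and, and_true] <;>
      funext x <;>
      first
      | (simp only [Function.update_apply, Nat.add_right_cancel_iff]; try rfl)
      | (funext i j; simp only [setCell, Nat.add_right_cancel_iff])
  · cases ins <;> constructor <;> intro x hx <;>
      simp [Instr.shift, Instr.effect, Function.update_apply] <;>
      first
      | (intro h; omega)
      | (funext i j; simp only [setCell]; rw [if_neg (by omega)])

theorem Cond.shift_holds (k : ℕ) (c : Cond) (σ : Store) :
    (c.shift k).Holds σ ↔ c.Holds (σ.unshift k) := by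
  cases c <;> rfl

/-- The program for matrix multiplication is a black box that may overwrite any register or table.
After the shift it simulates its original run on the names from k on and cannot reach those below,
where the data structure lives. -/
theorem Exec.shift (k : ℕ) {P : Prog} {σ τ : Store} {t : ℕ} (h : Exec P σ τ t) (σ' : Store)
    (hσ : σ'.unshift k = σ) :
    ∃ τ', Exec (P.shift k) σ' τ' t ∧ τ'.unshift k = τ ∧ Below k σ' τ' := by
  induction h generalizing σ' with
  | skip σ => exact ⟨σ', .skip _, hσ, .refl _ _⟩
  | op ins σ =>
    obtain ⟨h1, h2⟩ := ins.shift_effect k σ'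
    exact ⟨_, .op _ _, by rw [h1, hσ], h2⟩
  | seq _ _ ih1 ih2 =>
    obtain ⟨τ1, e1, r1, b1⟩ := ih1 σ' hσ
    obtain ⟨τ2, e2, r2, b2⟩ := ih2 τ1 r1
    exact ⟨τ2, .seq e1 e2, r2, b1.trans b2⟩
  | iteTrue hc _ ih =>
    obtain ⟨τ1, e1, r1, b1⟩ := ih σ' hσ
    exact ⟨τ1, .iteTrue ((Cond.shift_holds k _ _).2 (hσ ▸ hc)) e1, r1, b1⟩
  | iteFalse hc _ ih =>
    obtain ⟨τ1, e1, r1, b1⟩ := ih σ' hσ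
    exact ⟨τ1, .iteFalse (fun hh => hc (hσ ▸ (Cond.shift_holds k _ _).1 hh)) e1, r1, b1⟩
  | loopDone hc =>
    exact ⟨σ', .loopDone (fun hh => hc (hσ ▸ (Cond.shift_holds k _ _).1 hh)), hσ, .refl _ _⟩
  | loopStep hc _ _ ih1 ih2 =>
    obtain ⟨τ1, e1, r1, b1⟩ := ih1 σ' hσ
    obtain ⟨τ2, e2, r2, b2⟩ := ih2 τ1 r1
    exact ⟨τ2, .loopStep ((Cond.shift_holds k _ _).2 (hσ ▸ hc)) e1 e2, r2, b1.trans b2⟩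

/-! ### Expressions -/

/-- Natural-number expressions. -/
inductive IE : Type
  | reg (a : ℕ)
  | lit (c : ℕ)
  | add (x y : IE)
  | sub (x y : IE)
  | ld (tab : ℕ) (x y : IE)

/-- Real expressions; `ite a b x y` is `x` if `a < b` and `y` otherwise. -/
inductive RE : Type
  | reg (a : ℕ)
  | nat (x : IE)
  | add (x y : RE)
  | sub (x y : RE)
  | mul (x y : RE)
  | div (x y : RE)
  | sqrt (x : RE)
  | ld (tab : ℕ) (x y : IE)
  | ite (a b : IE) (x y : RE)

def IE.eval (σ : Store) : IE → ℕ
  | reg a => σ.idx a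
  | lit c => c
  | add x y => x.eval σ + y.eval σ
  | sub x y => x.eval σ - y.eval σ
  | ld tab x y => σ.idxTab tab (x.eval σ) (y.eval σ)

def RE.eval (σ : Store) : RE → ℝ
  | reg a => σ.val a
  | nat x => (x.eval σ : ℝ)
  | add x y => x.eval σ + y.eval σ
  | sub x y => x.eval σ - y.eval σ
  | mul x y => x.eval σ * y.eval σ
  | div x y => x.eval σ / y.eval σ
  | sqrt x => Real.sqrt (x.eval σ)
  | ld tab x y => σ.valTab tab (x.eval σ) (y.eval σ)
  | ite a b x y => if a.eval σ < b.eval σ then x.eval σ else y.eval σ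

/-- Index registers that an expression may read at level `L`: those below `L` and, if `lv` is set,
the three loop registers of `fill`. -/
def okReg (lv : Bool) (L a : ℕ) : Bool :=
  decide (a < L) || (lv && decide (1000 ≤ a) && decide (a < 1003))

def IE.Ok (lv : Bool) (L : ℕ) : IE → Bool
  | reg a => okReg lv L a
  | lit _ => true
  | add x y => x.Ok lv L && y.Ok lv L
  | sub x y => x.Ok lv L && y.Ok lv L
  | ld tab x y => decide (tab < L) && x.Ok lv L && y.Ok lv L

def RE.Ok (lv : Bool) (L : ℕ) : RE → Bool
  | reg a => decide (a < L)
  | nat x => x.Ok lv L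
  | add x y => x.Ok lv L && y.Ok lv L
  | sub x y => x.Ok lv L && y.Ok lv L
  | mul x y => x.Ok lv L && y.Ok lv L
  | div x y => x.Ok lv L && y.Ok lv L
  | sqrt x => x.Ok lv L
  | ld tab x y => decide (tab < L) && x.Ok lv L && y.Ok lv L
  | ite a b x y => a.Ok lv L && b.Ok lv L && x.Ok lv L && y.Ok lv L

/-- Agreement on everything that an expression of level `L` may read. -/
structure Vis (lv : Bool) (L : ℕ) (σ τ : Store) : Prop where
  idx : ∀ a, okReg lv L a → σ.idx a = τ.idx a
  val : ∀ a < L, σ.val a = τ.val a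
  idxTab : ∀ a < L, σ.idxTab a = τ.idxTab a
  valTab : ∀ a < L, σ.valTab a = τ.valTab a

theorem IE.eval_congr {lv : Bool} {L : ℕ} {σ τ : Store} (h : Vis lv L σ τ) :
    ∀ e : IE, e.Ok lv L → e.eval σ = e.eval τ
  | reg a, he => h.idx a he
  | lit _, _ => rfl
  | add x y, he => by
    simp only [Ok, Bool.and_eq_true] at he
    simp only [eval, eval_congr h x he.1, eval_congr h y he.2]
  | sub x y, he => by
    simp only [Ok, Bool.and_eq_true] at he
    simp only [eval, eval_congr h x he.1, eval_congr h y he.2]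
  | ld tab x y, he => by
    simp only [Ok, Bool.and_eq_true, decide_eq_true_eq] at he
    simp only [eval, eval_congr h x he.1.2, eval_congr h y he.2, h.idxTab tab he.1.1]

theorem RE.eval_congr {lv : Bool} {L : ℕ} {σ τ : Store} (h : Vis lv L σ τ) :
    ∀ e : RE, e.Ok lv L → e.eval σ = e.eval τ
  | reg a, he => h.val a (by simpa [Ok] using he)
  | nat x, he => by simp only [eval, IE.eval_congr h x he]
  | add x y, he => by
    simp only [Ok, Bool.and_eq_true] at he
    simp only [eval, eval_congr h x he.1, eval_congr h y he.2]
  | sub x y, he => by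
    simp only [Ok, Bool.and_eq_true] at he
    simp only [eval, eval_congr h x he.1, eval_congr h y he.2]
  | mul x y, he => by
    simp only [Ok, Bool.and_eq_true] at he
    simp only [eval, eval_congr h x he.1, eval_congr h y he.2]
  | div x y, he => by
    simp only [Ok, Bool.and_eq_true] at he
    simp only [eval, eval_congr h x he.1, eval_congr h y he.2]
  | sqrt x, he => by simp only [eval, eval_congr h x he]
  | ld tab x y, he => by
    simp only [Ok, Bool.and_eq_true, decide_eq_true_eq] at he
    simp only [eval, IE.eval_congr h x he.1.2, IE.eval_congr h y he.2, h.valTab tab he.1.1]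
  | ite a b x y, he => by
    simp only [Ok, Bool.and_eq_true] at he
    simp only [eval, IE.eval_congr h a he.1.1.1, IE.eval_congr h b he.1.1.2,
      eval_congr h x he.1.2, eval_congr h y he.2]

/-- Code that evaluates an expression into index register `t`, using the registers from `t` on. -/
def IE.comp : IE → ℕ → Prog
  | reg a, t => .seq (.op (.idxConst t 0)) (.op (.idxAdd t a t))
  | lit c, t => .op (.idxConst t c)
  | add x y, t => .seq (x.comp t) (.seq (y.comp (t + 1)) (.op (.idxAdd t t (t + 1))))
  | sub x y, t => .seq (x.comp t) (.seq (y.comp (t + 1)) (.op (.idxSub t t (t + 1))))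
  | ld tab x y, t => .seq (x.comp t) (.seq (y.comp (t + 1)) (.op (.idxLoad t tab t (t + 1))))

def RE.comp : RE → ℕ → Prog
  | reg a, t => .seq (.op (.idxConst t 0)) (.seq (.op (.valCast t t)) (.op (.valAdd t a t)))
  | nat x, t => .seq (x.comp t) (.op (.valCast t t))
  | add x y, t => .seq (x.comp t) (.seq (y.comp (t + 1)) (.op (.valAdd t t (t + 1))))
  | sub x y, t => .seq (x.comp t) (.seq (y.comp (t + 1)) (.op (.valSub t t (t + 1))))
  | mul x y, t => .seq (x.comp t) (.seq (y.comp (t + 1)) (.op (.valMul t t (t + 1))))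
  | div x y, t => .seq (x.comp t) (.seq (y.comp (t + 1)) (.op (.valDiv t t (t + 1))))
  | sqrt x, t => .seq (x.comp t) (.op (.valSqrt t t))
  | ld tab x y, t => .seq (x.comp t) (.seq (y.comp (t + 1)) (.op (.valLoad t tab t (t + 1))))
  | ite a b x y, t =>
    .seq (a.comp t) (.seq (b.comp (t + 1)) (.ite (.idxLt t (t + 1)) (x.comp t) (y.comp t)))

def IE.cost : IE → ℕ
  | reg _ => 2
  | lit _ => 1
  | add x y => x.cost + y.cost + 1
  | sub x y => x.cost + y.cost + 1
  | ld _ x y => x.cost + y.cost + 1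

def RE.cost : RE → ℕ
  | reg _ => 3
  | nat x => x.cost + 1
  | add x y => x.cost + y.cost + 1
  | sub x y => x.cost + y.cost + 1
  | mul x y => x.cost + y.cost + 1
  | div x y => x.cost + y.cost + 1
  | sqrt x => x.cost + 1
  | ld _ x y => x.cost + y.cost + 1
  | ite a b x y => a.cost + b.cost + x.cost + y.cost + 1

/-- Agreement on all tables, all coins, and the registers below `t`. -/
structure Same (t : ℕ) (σ τ : Store) : Prop where
  idx : ∀ a < t, σ.idx a = τ.idx a
  val : ∀ a < t, σ.val a = τ.val a
  idxTab : σ.idxTab = τ.idxTab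
  valTab : σ.valTab = τ.valTab
  coins : σ.coins = τ.coins

theorem Same.symm {t : ℕ} {σ τ : Store} (h : Same t σ τ) : Same t τ σ :=
  ⟨fun a ha => (h.idx a ha).symm, fun a ha => (h.val a ha).symm, h.idxTab.symm, h.valTab.symm,
    h.coins.symm⟩

theorem Same.trans {t : ℕ} {σ τ ρ : Store} (h : Same t σ τ) (h' : Same t τ ρ) : Same t σ ρ :=
  ⟨fun a ha => (h.idx a ha).trans (h'.idx a ha), fun a ha => (h.val a ha).trans (h'.val a ha),
    h.idxTab.trans h'.idxTab, h.valTab.trans h'.valTab, h.coins.trans h'.coins⟩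

theorem Same.mono {t t' : ℕ} {σ τ : Store} (h : Same t σ τ) (ht : t' ≤ t) : Same t' σ τ :=
  ⟨fun a ha => h.idx a (ha.trans_le ht), fun a ha => h.val a (ha.trans_le ht), h.idxTab,
    h.valTab, h.coins⟩

theorem okReg_lt {lv : Bool} {L a : ℕ} (hL : L ≤ 1010) (h : okReg lv L a) : a < 1010 := by
  simp [okReg] at h; omega

theorem Same.vis {lv : Bool} {t L : ℕ} {σ τ : Store} (h : Same t σ τ) (ht : 1010 ≤ t) (hL : L ≤ 1010) :
    Vis lv L σ τ :=
  ⟨fun a ha => h.idx a ((okReg_lt hL ha).trans_le ht),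
   fun a ha => h.val a (by omega), fun a _ => by rw [h.idxTab], fun a _ => by rw [h.valTab]⟩

theorem same_update_idx {t a : ℕ} (ha : t ≤ a) (σ : Store) (v : ℕ) :
    Same t σ { σ with idx := Function.update σ.idx a v } :=
  ⟨fun b hb => by simp [Function.update_of_ne (show b ≠ a by omega)], fun _ _ => rfl, rfl, rfl,
    rfl⟩

theorem same_update_val {t a : ℕ} (ha : t ≤ a) (σ : Store) (v : ℝ) :
    Same t σ { σ with val := Function.update σ.val a v } :=
  ⟨fun _ _ => rfl, fun b hb => by simp [Function.update_of_ne (show b ≠ a by omega)], rfl, rfl,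
    rfl⟩

/-- Temporaries are used like a stack: the second operand is evaluated from `t + 1` on and leaves
the first result in `t` intact. All temporaries lie at or above 1010, where no admissible expression
reads, so evaluating the first operand does not change the value of the second. -/
theorem IE.comp_exec {lv : Bool} {L : ℕ} (hL : L ≤ 1010) (e : IE) : ∀ (_ : e.Ok lv L) (t : ℕ) (_ : 1010 ≤ t)
    (σ : Store), ∃ τ c, Exec (e.comp t) σ τ c ∧ c ≤ e.cost ∧ Same t σ τ ∧ τ.idx t = e.eval σ ∧
      τ.val = σ.val := by
  induction e with
  | reg a =>
    intro he t ht σ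
    have : a ≠ t := by have := okReg_lt hL he; omega
    refine ⟨_, _, .seq (.op _ _) (.op _ _), le_rfl, ?_, ?_, rfl⟩
    · exact (same_update_idx le_rfl _ _).trans (same_update_idx le_rfl _ _)
    · simp [Instr.effect, IE.eval, Function.update_of_ne this]
  | lit c => exact fun _ t _ σ => ⟨_, _, .op _ _, le_rfl, same_update_idx le_rfl _ _,
      by simp [Instr.effect, IE.eval], rfl⟩
  | add x y ihx ihy =>
    intro he t ht σ
    simp only [Ok, Bool.and_eq_true] at he
    obtain ⟨τ1, c1, e1, l1, s1, v1, w1⟩ := ihx he.1 t ht σ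
    obtain ⟨τ2, c2, e2, l2, s2, v2, w2⟩ := ihy he.2 (t + 1) (by omega) τ1
    refine ⟨_, _, Exec.seq e1 (Exec.seq e2 (.op (.idxAdd t t (t + 1)) _)),
      by simp only [IE.cost]; omega,
      (s1.trans (s2.mono (by omega))).trans (same_update_idx le_rfl _ _), ?_, ?_⟩
    · simp [Instr.effect, IE.eval, v2, ← s2.idx t (by omega), v1,
        eval_congr (s1.vis ht hL) y he.2]
    · simp [Instr.effect, w2, w1]
  | sub x y ihx ihy =>
    intro he t ht σ
    simp only [Ok, Bool.and_eq_true] at he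
    obtain ⟨τ1, c1, e1, l1, s1, v1, w1⟩ := ihx he.1 t ht σ
    obtain ⟨τ2, c2, e2, l2, s2, v2, w2⟩ := ihy he.2 (t + 1) (by omega) τ1
    refine ⟨_, _, Exec.seq e1 (Exec.seq e2 (.op (.idxSub t t (t + 1)) _)),
      by simp only [IE.cost]; omega,
      (s1.trans (s2.mono (by omega))).trans (same_update_idx le_rfl _ _), ?_, ?_⟩
    · simp [Instr.effect, IE.eval, v2, ← s2.idx t (by omega), v1,
        eval_congr (s1.vis ht hL) y he.2]
    · simp [Instr.effect, w2, w1]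
  | ld tab x y ihx ihy =>
    intro he t ht σ
    simp only [Ok, Bool.and_eq_true] at he
    obtain ⟨τ1, c1, e1, l1, s1, v1, w1⟩ := ihx he.1.2 t ht σ
    obtain ⟨τ2, c2, e2, l2, s2, v2, w2⟩ := ihy he.2 (t + 1) (by omega) τ1
    refine ⟨_, _, Exec.seq e1 (Exec.seq e2 (.op (.idxLoad t tab t (t + 1)) _)),
      by simp only [IE.cost]; omega,
      (s1.trans (s2.mono (by omega))).trans (same_update_idx le_rfl _ _), ?_, ?_⟩
    · simp [Instr.effect, IE.eval, v2, ← s2.idx t (by omega), v1, ← s2.idxTab, ← s1.idxTab,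
        eval_congr (s1.vis ht hL) y he.2]
    · simp [Instr.effect, w2, w1]

theorem RE.comp_exec {lv : Bool} {L : ℕ} (hL : L ≤ 1010) (e : RE) : ∀ (_ : e.Ok lv L) (t : ℕ) (_ : 1010 ≤ t)
    (σ : Store), ∃ τ c, Exec (e.comp t) σ τ c ∧ c ≤ e.cost ∧ Same t σ τ ∧
      τ.val t = e.eval σ := by
  induction e with
  | reg a =>
    intro he t ht σ
    have : a ≠ t := by simp [Ok] at he; omega
    refine ⟨_, _, .seq (.op _ _) (.seq (.op _ _) (.op _ _)), le_rfl, ?_, ?_⟩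
    · exact ((same_update_idx le_rfl _ _).trans (same_update_val le_rfl _ _)).trans
        (same_update_val le_rfl _ _)
    · simp [Instr.effect, RE.eval, Function.update_of_ne this]
  | nat x =>
    intro he t ht σ
    obtain ⟨τ1, c1, e1, l1, s1, v1, w1⟩ := IE.comp_exec hL x he t ht σ
    exact ⟨_, _, .seq e1 (.op _ _), by simp only [RE.cost]; omega, s1.trans (same_update_val le_rfl _ _),
      by simp [Instr.effect, RE.eval, v1]⟩
  | add x y ihx ihy =>
    intro he t ht σ
    simp only [Ok, Bool.and_eq_true] at he
    obtain ⟨τ1, c1, e1, l1, s1, v1⟩ := ihx he.1 t ht σ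
    obtain ⟨τ2, c2, e2, l2, s2, v2⟩ := ihy he.2 (t + 1) (by omega) τ1
    refine ⟨_, _, Exec.seq e1 (Exec.seq e2 (.op (.valAdd t t (t + 1)) _)),
      by simp only [RE.cost]; omega,
      (s1.trans (s2.mono (by omega))).trans (same_update_val le_rfl _ _), ?_⟩
    simp [Instr.effect, RE.eval, v2, ← s2.val t (by omega), v1, eval_congr (s1.vis ht hL) y he.2]
  | sub x y ihx ihy =>
    intro he t ht σ
    simp only [Ok, Bool.and_eq_true] at he
    obtain ⟨τ1, c1, e1, l1, s1, v1⟩ := ihx he.1 t ht σ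
    obtain ⟨τ2, c2, e2, l2, s2, v2⟩ := ihy he.2 (t + 1) (by omega) τ1
    refine ⟨_, _, Exec.seq e1 (Exec.seq e2 (.op (.valSub t t (t + 1)) _)),
      by simp only [RE.cost]; omega,
      (s1.trans (s2.mono (by omega))).trans (same_update_val le_rfl _ _), ?_⟩
    simp [Instr.effect, RE.eval, v2, ← s2.val t (by omega), v1, eval_congr (s1.vis ht hL) y he.2]
  | mul x y ihx ihy =>
    intro he t ht σ
    simp only [Ok, Bool.and_eq_true] at he
    obtain ⟨τ1, c1, e1, l1, s1, v1⟩ := ihx he.1 t ht σ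
    obtain ⟨τ2, c2, e2, l2, s2, v2⟩ := ihy he.2 (t + 1) (by omega) τ1
    refine ⟨_, _, Exec.seq e1 (Exec.seq e2 (.op (.valMul t t (t + 1)) _)),
      by simp only [RE.cost]; omega,
      (s1.trans (s2.mono (by omega))).trans (same_update_val le_rfl _ _), ?_⟩
    simp [Instr.effect, RE.eval, v2, ← s2.val t (by omega), v1, eval_congr (s1.vis ht hL) y he.2]
  | div x y ihx ihy =>
    intro he t ht σ
    simp only [Ok, Bool.and_eq_true] at he
    obtain ⟨τ1, c1, e1, l1, s1, v1⟩ := ihx he.1 t ht σ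
    obtain ⟨τ2, c2, e2, l2, s2, v2⟩ := ihy he.2 (t + 1) (by omega) τ1
    refine ⟨_, _, Exec.seq e1 (Exec.seq e2 (.op (.valDiv t t (t + 1)) _)),
      by simp only [RE.cost]; omega,
      (s1.trans (s2.mono (by omega))).trans (same_update_val le_rfl _ _), ?_⟩
    simp [Instr.effect, RE.eval, v2, ← s2.val t (by omega), v1, eval_congr (s1.vis ht hL) y he.2]
  | sqrt x ih =>
    intro he t ht σ
    obtain ⟨τ1, c1, e1, l1, s1, v1⟩ := ih he t ht σ
    exact ⟨_, _, .seq e1 (.op (.valSqrt t t) _), by simp only [RE.cost]; omega,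
      s1.trans (same_update_val le_rfl _ _), by simp [Instr.effect, RE.eval, v1]⟩
  | ld tab x y =>
    intro he t ht σ
    simp only [Ok, Bool.and_eq_true] at he
    obtain ⟨τ1, c1, e1, l1, s1, v1, w1⟩ := IE.comp_exec hL x he.1.2 t ht σ
    obtain ⟨τ2, c2, e2, l2, s2, v2, w2⟩ := IE.comp_exec hL y he.2 (t + 1) (by omega) τ1
    refine ⟨_, _, Exec.seq e1 (Exec.seq e2 (.op (.valLoad t tab t (t + 1)) _)),
      by simp only [RE.cost]; omega,
      (s1.trans (s2.mono (by omega))).trans (same_update_val le_rfl _ _), ?_⟩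
    simp [Instr.effect, RE.eval, v2, ← s2.idx t (by omega), v1, ← s2.valTab, ← s1.valTab,
      IE.eval_congr (s1.vis ht hL) y he.2]
  | ite a b x y ihx ihy =>
    intro he t ht σ
    simp only [Ok, Bool.and_eq_true] at he
    obtain ⟨τ1, c1, e1, l1, s1, v1, w1⟩ := IE.comp_exec hL a he.1.1.1 t ht σ
    obtain ⟨τ2, c2, e2, l2, s2, v2, w2⟩ := IE.comp_exec hL b he.1.1.2 (t + 1) (by omega) τ1
    have s12 := s1.trans (s2.mono (Nat.le_succ t))
    have hab : τ2.idx t < τ2.idx (t + 1) ↔ a.eval σ < b.eval σ := by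
      rw [v2, ← s2.idx t (by omega), v1, IE.eval_congr (s1.vis ht hL) b he.1.1.2]
    by_cases h : a.eval σ < b.eval σ
    · obtain ⟨τ3, c3, e3, l3, s3, v3⟩ := ihx he.1.2 t ht τ2
      refine ⟨τ3, _, .seq e1 (.seq e2 (.iteTrue (hab.2 h) e3)), by simp only [RE.cost]; omega,
        s12.trans s3, ?_⟩
      simp only [RE.eval, if_pos h, v3, eval_congr (s12.vis ht hL) x he.1.2]
    · obtain ⟨τ3, c3, e3, l3, s3, v3⟩ := ihy he.2 t ht τ2
      refine ⟨τ3, _, .seq e1 (.seq e2 (.iteFalse (fun hh => h (hab.1 hh)) e3)),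
        by simp only [RE.cost]; omega, s12.trans s3, ?_⟩
      simp only [RE.eval, if_neg h, v3, eval_congr (s12.vis ht hL) y he.2]

end RealRAM

namespace RealRAM

/-! ### Correctness triples -/

/-- Agreement on all names below `L` and, if `b` is set, on the coins. -/
structure Sim (b : Bool) (L : ℕ) (σ s : Store) : Prop extends Below L σ s where
  coins : b = true → σ.coins = s.coins

/-- From every memory that agrees with `s`, the program `P` halts within `c` steps in a memory that
agrees with `s'`. -/
def Tri (b : Bool) (L : ℕ) (P : Prog) (s : Store) (c : ℝ) (s' : Store) : Prop :=
  ∀ σ, Sim b L σ s → ∃ τ t, Exec P σ τ t ∧ (t : ℝ) ≤ c ∧ Sim b L τ s'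

namespace Store

def setI (s : Store) (a v : ℕ) : Store := { s with idx := Function.update s.idx a v }
def setR (s : Store) (a : ℕ) (v : ℝ) : Store := { s with val := Function.update s.val a v }
def setIT (s : Store) (a : ℕ) (f : ℕ → ℕ → ℕ) : Store :=
  { s with idxTab := Function.update s.idxTab a f }
def setVT (s : Store) (a : ℕ) (f : ℕ → ℕ → ℝ) : Store :=
  { s with valTab := Function.update s.valTab a f }

variable (s : Store) (a b v : ℕ) (x : ℝ) (f : ℕ → ℕ → ℕ) (g : ℕ → ℕ → ℝ)

@[simp] theorem setI_idx : (s.setI a v).idx b = if b = a then v else s.idx b := by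
  simp [setI, Function.update_apply]
@[simp] theorem setI_val : (s.setI a v).val = s.val := rfl
@[simp] theorem setI_idxTab : (s.setI a v).idxTab = s.idxTab := rfl
@[simp] theorem setI_valTab : (s.setI a v).valTab = s.valTab := rfl
@[simp] theorem setI_coins : (s.setI a v).coins = s.coins := rfl
@[simp] theorem setR_idx : (s.setR a x).idx = s.idx := rfl
@[simp] theorem setR_val : (s.setR a x).val b = if b = a then x else s.val b := by
  simp [setR, Function.update_apply]
@[simp] theorem setR_idxTab : (s.setR a x).idxTab = s.idxTab := rfl
@[simp] theorem setR_valTab : (s.setR a x).valTab = s.valTab := rfl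
@[simp] theorem setR_coins : (s.setR a x).coins = s.coins := rfl
@[simp] theorem setIT_idx : (s.setIT a f).idx = s.idx := rfl
@[simp] theorem setIT_val : (s.setIT a f).val = s.val := rfl
@[simp] theorem setIT_idxTab : (s.setIT a f).idxTab b = if b = a then f else s.idxTab b := by
  simp [setIT, Function.update_apply]
@[simp] theorem setIT_valTab : (s.setIT a f).valTab = s.valTab := rfl
@[simp] theorem setIT_coins : (s.setIT a f).coins = s.coins := rfl
@[simp] theorem setVT_idx : (s.setVT a g).idx = s.idx := rfl
@[simp] theorem setVT_val : (s.setVT a g).val = s.val := rfl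
@[simp] theorem setVT_idxTab : (s.setVT a g).idxTab = s.idxTab := rfl
@[simp] theorem setVT_valTab : (s.setVT a g).valTab b = if b = a then g else s.valTab b := by
  simp [setVT, Function.update_apply]
@[simp] theorem setVT_coins : (s.setVT a g).coins = s.coins := rfl

/-- Set the loop registers of `fill`. -/
def setLoop (s : Store) (i j k : ℕ) : Store := ((s.setI 1000 i).setI 1001 j).setI 1002 k

@[simp] theorem setLoop_val (i j k : ℕ) : (s.setLoop i j k).val = s.val := rfl
@[simp] theorem setLoop_idxTab (i j k : ℕ) : (s.setLoop i j k).idxTab = s.idxTab := rfl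
@[simp] theorem setLoop_valTab (i j k : ℕ) : (s.setLoop i j k).valTab = s.valTab := rfl
@[simp] theorem setLoop_idx (i j k : ℕ) : (s.setLoop i j k).idx b =
    if b = 1002 then k else if b = 1001 then j else if b = 1000 then i else s.idx b := by
  simp [setLoop]

end Store

variable {b : Bool} {L : ℕ}

theorem Sim.refl (b : Bool) (L : ℕ) (σ : Store) : Sim b L σ σ := ⟨.refl _ _, fun _ => rfl⟩

theorem Sim.trans {σ τ ρ : Store} (h : Sim b L σ τ) (h' : Sim b L τ ρ) : Sim b L σ ρ :=
  ⟨h.toBelow.trans h'.toBelow, fun hb => (h.coins hb).trans (h'.coins hb)⟩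

theorem Below.mono {L' : ℕ} {σ τ : Store} (h : Below L' σ τ) (hL : L ≤ L') : Below L σ τ :=
  ⟨fun a ha => h.idx a (by omega), fun a ha => h.val a (by omega),
   fun a ha => h.idxTab a (by omega), fun a ha => h.valTab a (by omega)⟩

theorem Sim.mono {L' : ℕ} {σ τ : Store} (h : Sim b L' σ τ) (hL : L ≤ L') : Sim b L σ τ :=
  ⟨h.toBelow.mono hL, h.coins⟩

theorem Sim.forget {σ τ : Store} (h : Sim b L σ τ) : Sim false L σ τ :=
  ⟨h.toBelow, by simp⟩

theorem Same.sim {t : ℕ} {σ τ : Store} (h : Same t σ τ) (hL : L ≤ t) : Sim b L σ τ :=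
  ⟨⟨fun a ha => h.idx a (by omega), fun a ha => h.val a (by omega), fun a _ => by rw [h.idxTab],
    fun a _ => by rw [h.valTab]⟩, fun _ => h.coins⟩

theorem Sim.vis {σ s : Store} (h : Sim b L σ s) : Vis false L σ s :=
  ⟨fun a ha => h.idx a (by simpa [okReg] using ha), h.val, h.idxTab, h.valTab⟩

theorem Sim.setI {σ s : Store} (h : Sim b L σ s) (a v : ℕ) : Sim b L (σ.setI a v) (s.setI a v) :=
  ⟨⟨fun c hc => by simp [h.idx c hc], fun c hc => by simp [h.val c hc],
    fun c hc => by simp [h.idxTab c hc], fun c hc => by simp [h.valTab c hc]⟩, h.coins⟩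

theorem Sim.setR {σ s : Store} (h : Sim b L σ s) (a : ℕ) (v : ℝ) :
    Sim b L (σ.setR a v) (s.setR a v) :=
  ⟨⟨fun c hc => by simp [h.idx c hc], fun c hc => by simp [h.val c hc],
    fun c hc => by simp [h.idxTab c hc], fun c hc => by simp [h.valTab c hc]⟩, h.coins⟩

theorem Sim.setIT {σ s : Store} (h : Sim b L σ s) (a : ℕ) (f : ℕ → ℕ → ℕ) :
    Sim b L (σ.setIT a f) (s.setIT a f) :=
  ⟨⟨fun c hc => by simp [h.idx c hc], fun c hc => by simp [h.val c hc],
    fun c hc => by simp [h.idxTab c hc], fun c hc => by simp [h.valTab c hc]⟩, h.coins⟩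

theorem Sim.setVT {σ s : Store} (h : Sim b L σ s) (a : ℕ) (f : ℕ → ℕ → ℝ) :
    Sim b L (σ.setVT a f) (s.setVT a f) :=
  ⟨⟨fun c hc => by simp [h.idx c hc], fun c hc => by simp [h.val c hc],
    fun c hc => by simp [h.idxTab c hc], fun c hc => by simp [h.valTab c hc]⟩, h.coins⟩

theorem sim_setI {a : ℕ} (ha : L ≤ a) (s : Store) (v : ℕ) : Sim b L (s.setI a v) s :=
  ⟨⟨fun c hc => by simp [show c ≠ a by omega], fun _ _ => rfl, fun _ _ => rfl, fun _ _ => rfl⟩,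
    fun _ => rfl⟩

theorem sim_setR {a : ℕ} (ha : L ≤ a) (s : Store) (v : ℝ) : Sim b L (s.setR a v) s :=
  ⟨⟨fun _ _ => rfl, fun c hc => by simp [show c ≠ a by omega], fun _ _ => rfl, fun _ _ => rfl⟩,
    fun _ => rfl⟩

theorem sim_setVT {a : ℕ} (ha : L ≤ a) (s : Store) (v : ℕ → ℕ → ℝ) : Sim b L (s.setVT a v) s :=
  ⟨⟨fun _ _ => rfl, fun _ _ => rfl, fun _ _ => rfl, fun c hc => by simp [show c ≠ a by omega]⟩,
    fun _ => rfl⟩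

theorem sim_setIT {a : ℕ} (ha : L ≤ a) (s : Store) (v : ℕ → ℕ → ℕ) : Sim b L (s.setIT a v) s :=
  ⟨⟨fun _ _ => rfl, fun _ _ => rfl, fun c hc => by simp [show c ≠ a by omega], fun _ _ => rfl⟩,
    fun _ => rfl⟩

theorem Sim.holds {σ s : Store} (h : Sim b L σ s) {c : Cond}
    (hc : match c with | .idxLt x y => x < L ∧ y < L | .valLt x y => x < L ∧ y < L) :
    c.Holds σ ↔ c.Holds s := by
  cases c with
  | idxLt x y => simp only [Cond.Holds, h.idx x hc.1, h.idx y hc.2]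
  | valLt x y => simp only [Cond.Holds, h.val x hc.1, h.val y hc.2]

theorem Tri.seq {P Q : Prog} {s s1 s2 : Store} {c1 c2 : ℝ} (h1 : Tri b L P s c1 s1)
    (h2 : Tri b L Q s1 c2 s2) : Tri b L (.seq P Q) s (c1 + c2) s2 := by
  intro σ hσ
  obtain ⟨τ1, t1, e1, l1, r1⟩ := h1 σ hσ
  obtain ⟨τ2, t2, e2, l2, r2⟩ := h2 τ1 r1
  exact ⟨τ2, _, .seq e1 e2, by push_cast; linarith, r2⟩

theorem Tri.mono {P : Prog} {s s1 : Store} {c1 c2 : ℝ} (h1 : Tri b L P s c1 s1) (h : c1 ≤ c2) :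
    Tri b L P s c2 s1 := by
  intro σ hσ
  obtain ⟨τ1, t1, e1, l1, r1⟩ := h1 σ hσ
  exact ⟨τ1, t1, e1, l1.trans h, r1⟩

theorem Tri.post {P : Prog} {s s1 s2 : Store} {c : ℝ} (h1 : Tri b L P s c s1)
    (h : Sim b L s1 s2) : Tri b L P s c s2 := by
  intro σ hσ
  obtain ⟨τ1, t1, e1, l1, r1⟩ := h1 σ hσ
  exact ⟨τ1, t1, e1, l1, r1.trans h⟩

/-- To prove a triple at a low level it suffices to prove it at a higher level, for all values of
the names in between. -/
theorem Tri.lower {L' : ℕ} (hL : L ≤ L') {P : Prog} {s s' : Store} {c : ℝ}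
    (h : ∀ σ, Sim b L σ s → ∃ σ', Tri b L' P σ c σ' ∧ Sim b L σ' s') : Tri b L P s c s' := by
  intro σ hσ
  obtain ⟨σ', h1, h2⟩ := h σ hσ
  obtain ⟨τ1, t1, e1, l1, r1⟩ := h1 σ (.refl _ _ _)
  exact ⟨τ1, t1, e1, l1, (r1.mono hL).trans h2⟩

/-- The link between the phase that draws the signs, where the coins must be tracked, and the later
phases, where the multiplication program may consume coins in an unknown way. -/
theorem Tri.forget {P : Prog} {s s' : Store} {c : ℝ} (h : Tri true L P s c s')
    : ∀ σ, Sim true L σ s → ∃ τ t, Exec P σ τ t ∧ (t : ℝ) ≤ c ∧ Sim false L τ s' := by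
  intro σ hσ
  obtain ⟨τ1, t1, e1, l1, r1⟩ := h σ hσ
  exact ⟨τ1, t1, e1, l1, r1.forget⟩

theorem Tri.ite_true {P Q : Prog} {cd : Cond} {s s1 : Store} {c : ℝ}
    (hc : match cd with | .idxLt x y => x < L ∧ y < L | .valLt x y => x < L ∧ y < L)
    (h : cd.Holds s) (h1 : Tri b L P s c s1) : Tri b L (.ite cd P Q) s (c + 1) s1 := by
  intro σ hσ
  obtain ⟨τ1, t1, e1, l1, r1⟩ := h1 σ hσ
  exact ⟨τ1, _, .iteTrue ((hσ.holds hc).2 h) e1, by push_cast; linarith, r1⟩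

theorem Tri.ite_false {P Q : Prog} {cd : Cond} {s s1 : Store} {c : ℝ}
    (hc : match cd with | .idxLt x y => x < L ∧ y < L | .valLt x y => x < L ∧ y < L)
    (h : ¬ cd.Holds s) (h1 : Tri b L Q s c s1) : Tri b L (.ite cd P Q) s (c + 1) s1 := by
  intro σ hσ
  obtain ⟨τ1, t1, e1, l1, r1⟩ := h1 σ hσ
  exact ⟨τ1, _, .iteFalse (fun hh => h ((hσ.holds hc).1 hh)) e1, by push_cast; linarith, r1⟩

theorem Tri.skip (s : Store) : Tri b L .skip s 1 s :=
  fun σ hσ => ⟨σ, 1, .skip σ, by simp, hσ⟩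

/-- A loop that is executed exactly `N` times. -/
theorem Tri.while {P : Prog} {cd : Cond}
    (hc : match cd with | .idxLt x y => x < L ∧ y < L | .valLt x y => x < L ∧ y < L)
    {N : ℕ} {c : ℕ → ℝ} (Q : ℕ → Store → Prop)
    (hstep : ∀ m < N, ∀ s, Q m s → cd.Holds s ∧ ∃ s', Tri b L P s (c m) s' ∧ Q (m + 1) s')
    (hend : ∀ s, Q N s → ¬ cd.Holds s) {s : Store} (h0 : Q 0 s) :
    ∃ s', Q N s' ∧ Tri b L (.loop cd P) s ((∑ m ∈ Finset.range N, (c m + 1)) + 1) s' := by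
  have key : ∀ j m s, m + j = N → Q m s → ∃ s', Q N s' ∧
      Tri b L (.loop cd P) s ((∑ i ∈ Finset.range j, (c (m + i) + 1)) + 1) s' := by
    intro j
    induction j with
    | zero =>
      intro m s hm hQ
      obtain rfl : m = N := by omega
      refine ⟨s, hQ, fun σ hσ => ⟨σ, 1, .loopDone (fun hh => hend s hQ ((hσ.holds hc).1 hh)),
        by simp, hσ⟩⟩
    | succ j ih =>
      intro m s hm hQ
      obtain ⟨hh, s1, h1, hQ1⟩ := hstep m (by omega) s hQ
      obtain ⟨s2, hQ2, h2⟩ := ih (m + 1) s1 (by omega) hQ1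
      refine ⟨s2, hQ2, fun σ hσ => ?_⟩
      obtain ⟨τ1, t1, e1, l1, r1⟩ := h1 σ hσ
      obtain ⟨τ2, t2, e2, l2, r2⟩ := h2 τ1 r1
      refine ⟨τ2, _, .loopStep ((hσ.holds hc).2 hh) e1 e2, ?_, r2⟩
      rw [Finset.sum_range_succ']
      have : ∀ i, m + 1 + i = m + (i + 1) := by intro i; omega
      simp only [this] at l2
      push_cast
      simp only [add_zero]
      linarith
  obtain ⟨s', hq, ht⟩ := key N 0 s (by omega) h0
  exact ⟨s', hq, by simpa using ht⟩

/-! ### Assignments -/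

/-- The machine has no move instruction; the value is copied by adding the zero placed in register
1011. -/
def assignI (a : ℕ) (e : IE) : Prog :=
  .seq (e.comp 1010) (.seq (.op (.idxConst 1011 0)) (.op (.idxAdd a 1010 1011)))

def assignR (a : ℕ) (e : RE) : Prog :=
  .seq (e.comp 1010) (.seq (.op (.idxConst 1011 0)) (.seq (.op (.valCast 1011 1011))
    (.op (.valAdd a 1010 1011))))

/-- `tab[i][j] := e` for a table of natural numbers. -/
def storeI (tab : ℕ) (i j e : IE) : Prog :=
  .seq (i.comp 1010) (.seq (j.comp 1011) (.seq (e.comp 1012) (.op (.idxStore tab 1010 1011 1012))))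

/-- `tab[i][j] := e` for a table of real numbers. -/
def storeR (tab : ℕ) (i j : IE) (e : RE) : Prog :=
  .seq (i.comp 1010) (.seq (j.comp 1011) (.seq (e.comp 1012) (.op (.valStore tab 1010 1011 1012))))

/-- Change one entry of a table. -/
def upd {V : Type} (f : ℕ → ℕ → V) (i j : ℕ) (v : V) : ℕ → ℕ → V :=
  fun i' j' => if i' = i ∧ j' = j then v else f i' j'

theorem Tri.assignI (hL : L ≤ 1010) (a : ℕ) (ha : a < 1010) (e : IE) (he : e.Ok false L)
    (s : Store) : Tri b L (assignI a e) s (e.cost + 2 : ℕ) (s.setI a (e.eval s)) := by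
  intro σ hσ
  obtain ⟨τ, c, e1, l1, s1, v1, w1⟩ := e.comp_exec hL he 1010 le_rfl σ
  refine ⟨_, _, .seq e1 (.seq (.op _ _) (.op _ _)), by exact_mod_cast by omega, ?_⟩
  have h1 : Sim b L τ s := (Same.sim s1.symm hL).trans hσ
  have h2 := ((sim_setI (b := b) (show L ≤ 1011 by omega) τ 0).trans h1).setI a (e.eval s)
  convert h2 using 1
  simp [Instr.effect, Store.setI, v1, IE.eval_congr hσ.vis e he]

theorem Tri.assignR (hL : L ≤ 1010) (a : ℕ) (ha : a < 1010) (e : RE) (he : e.Ok false L)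
    (s : Store) : Tri b L (assignR a e) s (e.cost + 3 : ℕ) (s.setR a (e.eval s)) := by
  intro σ hσ
  obtain ⟨τ, c, e1, l1, s1, v1⟩ := e.comp_exec hL he 1010 le_rfl σ
  refine ⟨_, _, .seq e1 (.seq (.op _ _) (.seq (.op _ _) (.op _ _))),
    by exact_mod_cast by omega, ?_⟩
  have h1 : Sim b L τ s := (Same.sim s1.symm hL).trans hσ
  have h2 := ((sim_setR (b := b) (show L ≤ 1011 by omega) _ 0).trans
    ((sim_setI (b := b) (show L ≤ 1011 by omega) τ 0).trans h1)).setR a (e.eval s)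
  convert h2 using 1
  simp [Instr.effect, Store.setI, Store.setR, v1, RE.eval_congr hσ.vis e he]

theorem Tri.storeI (hL : L ≤ 1010) (tab : ℕ) (i j e : IE) (hi : i.Ok false L)
    (hj : j.Ok false L) (he : e.Ok false L) (htab : tab < L) (s : Store) :
    Tri b L (storeI tab i j e) s (i.cost + j.cost + e.cost + 1 : ℕ)
      (s.setIT tab (upd (s.idxTab tab) (i.eval s) (j.eval s) (e.eval s))) := by
  intro σ hσ
  obtain ⟨τ1, c1, e1, l1, s1, v1, w1⟩ := i.comp_exec hL hi 1010 le_rfl σ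
  obtain ⟨τ2, c2, e2, l2, s2, v2, w2⟩ := j.comp_exec hL hj 1011 (by omega) τ1
  obtain ⟨τ3, c3, e3, l3, s3, v3, w3⟩ := e.comp_exec hL he 1012 (by omega) τ2
  refine ⟨_, _, .seq e1 (.seq e2 (.seq e3 (.op _ _))), by exact_mod_cast by omega, ?_⟩
  have h1 : Sim b L τ1 s := (Same.sim s1.symm hL).trans hσ
  have h2 : Sim b L τ2 s := (Same.sim s2.symm (by omega)).trans h1
  have h3 : Sim b L τ3 s := (Same.sim s3.symm (by omega)).trans h2
  convert h3.setIT tab (upd (s.idxTab tab) (i.eval s) (j.eval s) (e.eval s)) using 1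
  simp only [Instr.effect, Store.setIT, Store.mk.injEq, true_and, and_true]
  rw [v3, ← s3.idx 1010 (by omega), ← s3.idx 1011 (by omega), v2, ← s2.idx 1010 (by omega), v1,
    IE.eval_congr hσ.vis i hi, IE.eval_congr h1.vis j hj, IE.eval_congr h2.vis e he]
  funext a x y
  by_cases h : a = tab
  · subst h; simp [setCell, upd, h3.idxTab a htab]
  · simp [setCell, h, Function.update_of_ne]

theorem Tri.storeR (hL : L ≤ 1010) (tab : ℕ) (i j : IE) (e : RE) (hi : i.Ok false L)
    (hj : j.Ok false L) (he : e.Ok false L) (htab : tab < L) (s : Store) :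
    Tri b L (storeR tab i j e) s (i.cost + j.cost + e.cost + 1 : ℕ)
      (s.setVT tab (upd (s.valTab tab) (i.eval s) (j.eval s) (e.eval s))) := by
  intro σ hσ
  obtain ⟨τ1, c1, e1, l1, s1, v1, w1⟩ := i.comp_exec hL hi 1010 le_rfl σ
  obtain ⟨τ2, c2, e2, l2, s2, v2, w2⟩ := j.comp_exec hL hj 1011 (by omega) τ1
  obtain ⟨τ3, c3, e3, l3, s3, v3⟩ := e.comp_exec hL he 1012 (by omega) τ2
  refine ⟨_, _, .seq e1 (.seq e2 (.seq e3 (.op _ _))), by exact_mod_cast by omega, ?_⟩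
  have h1 : Sim b L τ1 s := (Same.sim s1.symm hL).trans hσ
  have h2 : Sim b L τ2 s := (Same.sim s2.symm (by omega)).trans h1
  have h3 : Sim b L τ3 s := (Same.sim s3.symm (by omega)).trans h2
  convert h3.setVT tab (upd (s.valTab tab) (i.eval s) (j.eval s) (e.eval s)) using 1
  simp only [Instr.effect, Store.setVT, Store.mk.injEq, true_and, and_true]
  rw [v3, ← s3.idx 1010 (by omega), ← s3.idx 1011 (by omega), v2, ← s2.idx 1010 (by omega), v1,
    IE.eval_congr hσ.vis i hi, IE.eval_congr h1.vis j hj, RE.eval_congr h2.vis e he]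
  funext a x y
  by_cases h : a = tab
  · subst h; simp [setCell, upd, h3.valTab a htab]
  · simp [setCell, h, Function.update_of_ne]

/-! ### Filling a rectangle of a table -/

/-- `for (a := 0; a < n; a := a + 1) body` -/
def forLoop (a n : ℕ) (body : Prog) : Prog :=
  .seq (assignI a (.lit 0)) (.loop (.idxLt a n)
    (.seq body (assignI a (.add (.reg a) (.lit 1)))))

theorem Tri.forLoop (hL : L ≤ 1010) {a n : ℕ} (ha : a < L) (hn : n < L) {P : Prog} {N : ℕ}
    {c : ℝ} (hc : 0 ≤ c) (Q : ℕ → Store → Prop)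
    (hQ : ∀ m s, Q m s → s.idx a = m ∧ s.idx n = N)
    (hstep : ∀ m < N, ∀ s, Q m s → ∃ s', Tri b L P s c s' ∧ s'.idx a = m ∧
      Q (m + 1) (s'.setI a (m + 1)))
    {s : Store} (h0 : Q 0 (s.setI a 0)) :
    ∃ s', Q N s' ∧ Tri b L (forLoop a n P) s ((N + 1) * (c + 10)) s' := by
  have ha' : a < 1010 := by omega
  obtain ⟨s', hq, ht⟩ := Tri.while (b := b) (L := L) (cd := .idxLt a n)
    (P := .seq P (RealRAM.assignI a (.add (.reg a) (.lit 1)))) ⟨ha, hn⟩ (N := N)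
    (c := fun _ => c + 6) Q
    (by
      intro m hm s hs
      refine ⟨by simp [Cond.Holds, hQ m s hs, hm], ?_⟩
      obtain ⟨s1, h1, hm1, hq1⟩ := hstep m hm s hs
      refine ⟨_, (h1.seq (Tri.assignI hL a ha' _ (by simp [IE.Ok, okReg, ha]) s1)).mono ?_, ?_⟩
      · norm_num [IE.cost]
      · simpa [IE.eval, hm1] using hq1)
    (by
      intro s hs
      simp [Cond.Holds, hQ N s hs]) h0
  refine ⟨s', hq, ((Tri.assignI hL a ha' _ (by simp [IE.Ok]) s).seq ht).mono ?_⟩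
  simp [IE.cost]
  nlinarith [(Nat.cast_nonneg N : (0:ℝ) ≤ N)]

/-- The three loop registers lie below 1010, so inside the loops of `fill` they may be read like
ordinary registers. -/
theorem IE.Ok.raise (hL : L ≤ 1000) : ∀ {e : IE} {lv : Bool}, e.Ok lv L → e.Ok false 1010
  | .reg a, lv, h => by simp [IE.Ok, okReg] at h ⊢; omega
  | .lit _, _, _ => rfl
  | .add x y, lv, h => by
    simp only [IE.Ok, Bool.and_eq_true] at h ⊢
    exact ⟨IE.Ok.raise hL h.1, IE.Ok.raise hL h.2⟩
  | .sub x y, lv, h => by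
    simp only [IE.Ok, Bool.and_eq_true] at h ⊢
    exact ⟨IE.Ok.raise hL h.1, IE.Ok.raise hL h.2⟩
  | .ld tab x y, lv, h => by
    simp only [IE.Ok, Bool.and_eq_true, decide_eq_true_eq] at h ⊢
    exact ⟨⟨by omega, IE.Ok.raise hL h.1.2⟩, IE.Ok.raise hL h.2⟩

theorem RE.Ok.raise (hL : L ≤ 1000) : ∀ {e : RE} {lv : Bool}, e.Ok lv L → e.Ok false 1010
  | .reg a, lv, h => by simp [RE.Ok] at h ⊢; omega
  | .nat x, lv, h => IE.Ok.raise (e := x) hL h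
  | .add x y, lv, h => by
    simp only [RE.Ok, Bool.and_eq_true] at h ⊢
    exact ⟨RE.Ok.raise hL h.1, RE.Ok.raise hL h.2⟩
  | .sub x y, lv, h => by
    simp only [RE.Ok, Bool.and_eq_true] at h ⊢
    exact ⟨RE.Ok.raise hL h.1, RE.Ok.raise hL h.2⟩
  | .mul x y, lv, h => by
    simp only [RE.Ok, Bool.and_eq_true] at h ⊢
    exact ⟨RE.Ok.raise hL h.1, RE.Ok.raise hL h.2⟩
  | .div x y, lv, h => by
    simp only [RE.Ok, Bool.and_eq_true] at h ⊢
    exact ⟨RE.Ok.raise hL h.1, RE.Ok.raise hL h.2⟩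
  | .sqrt x, lv, h => RE.Ok.raise (e := x) hL h
  | .ld tab x y, lv, h => by
    simp only [RE.Ok, Bool.and_eq_true, decide_eq_true_eq] at h ⊢
    exact ⟨⟨by omega, IE.Ok.raise hL h.1.2⟩, IE.Ok.raise hL h.2⟩
  | .ite u v x y, lv, h => by
    simp only [RE.Ok, Bool.and_eq_true] at h ⊢
    exact ⟨⟨⟨IE.Ok.raise hL h.1.1.1, IE.Ok.raise hL h.1.1.2⟩, RE.Ok.raise hL h.1.2⟩,
      RE.Ok.raise hL h.2⟩

/-- `tab[oi + I][oj + J] := ∑ K < n, e` for all `I < p` and `J < q`; the loop variables `I, J, K`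
are the index registers `1000, 1001, 1002`. -/
def fill (tab : ℕ) (oi oj p q n : IE) (e : RE) : Prog :=
  .seq (assignI 1003 oi) <| .seq (assignI 1004 oj) <| .seq (assignI 1005 p) <|
  .seq (assignI 1006 q) <| .seq (assignI 1007 n) <|
  forLoop 1000 1005 <| forLoop 1001 1006 <|
    .seq (assignR 1000 (.nat (.lit 0))) <|
    .seq (forLoop 1002 1007 (assignR 1000 (.add (.reg 1000) e)))
      (storeR tab (.add (.reg 1003) (.reg 1000)) (.add (.reg 1004) (.reg 1001)) (.reg 1000))

/-- The table `old`, overwritten by `F` on the `p × q` rectangle at position `(oi, oj)`. -/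
def fillFun (old : ℕ → ℕ → ℝ) (oi oj p q : ℕ) (F : ℕ → ℕ → ℝ) : ℕ → ℕ → ℝ :=
  fun a c => if (oi ≤ a ∧ a < oi + p) ∧ (oj ≤ c ∧ c < oj + q) then F (a - oi) (c - oj) else old a c

/-- The constant in the running time of `fill`. -/
def fillK (oi oj p q n : IE) (e : RE) : ℝ :=
  (oi.cost + oj.cost + p.cost + q.cost + n.cost + e.cost + 100 : ℕ)

/-- When an entry is computed, other entries of the target table may already be overwritten.
Therefore `hf` asks for the value of `e` under every content `g` of this table that is still
original at the entry itself. This admits updates in place, where an entry depends on its own old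
value. -/
theorem Tri.fill_top (tab : ℕ) (htab : tab < 1000) (hL : L ≤ 1000) (oi oj p q n : IE) (e : RE)
    (hoi : oi.Ok false L) (hoj : oj.Ok false L) (hp : p.Ok false L) (hq : q.Ok false L)
    (hn : n.Ok false L) (he : e.Ok true L) (σ : Store) (f : ℕ → ℕ → ℕ → ℝ)
    (hf : ∀ i < p.eval σ, ∀ j < q.eval σ, ∀ k < n.eval σ, ∀ g : ℕ → ℕ → ℝ,
      g (oi.eval σ + i) (oj.eval σ + j) = σ.valTab tab (oi.eval σ + i) (oj.eval σ + j) →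
      e.eval ((σ.setVT tab g).setLoop i j k) = f i j k) :
    ∃ σ', Tri b 1010 (fill tab oi oj p q n e) σ
      (10 * fillK oi oj p q n e * ((p.eval σ + 1) * (q.eval σ + 1) * (n.eval σ + 1))) σ' ∧
      Sim true 1000 σ' (σ.setVT tab (fillFun (σ.valTab tab) (oi.eval σ) (oj.eval σ) (p.eval σ)
        (q.eval σ) fun i j => ∑ k ∈ Finset.range (n.eval σ), f i j k)) := by
  set voi := oi.eval σ with hvoi
  set voj := oj.eval σ with hvoj
  set vp := p.eval σ with hvp
  set vq := q.eval σ with hvq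
  set vn := n.eval σ with hvn
  set F : ℕ → ℕ → ℝ := fun i j => ∑ k ∈ Finset.range vn, f i j k with hF
  let C : Store → (ℕ → ℕ → ℝ) → Prop := fun s g => Sim true 1000 s (σ.setVT tab g) ∧
    s.idx 1003 = voi ∧ s.idx 1004 = voj ∧ s.idx 1005 = vp ∧ s.idx 1006 = vq ∧ s.idx 1007 = vn
  have hCI : ∀ s g r v, C s g → 1000 ≤ r → r < 1003 → C (s.setI r v) g := by
    intro s g r v ⟨h1, h2, h3, h4, h5, h6⟩ hr hr'
    refine ⟨(sim_setI hr s v).trans h1, ?_, ?_, ?_, ?_, ?_⟩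
    · simp [h2, show 1003 ≠ r by omega]
    · simp [h3, show 1004 ≠ r by omega]
    · simp [h4, show 1005 ≠ r by omega]
    · simp [h5, show 1006 ≠ r by omega]
    · simp [h6, show 1007 ≠ r by omega]
  have hCR : ∀ s g r v, C s g → 1000 ≤ r → C (s.setR r v) g := by
    intro s g r v ⟨h1, h2⟩ hr
    exact ⟨(sim_setR hr s v).trans h1, h2⟩
  -- `g1 m` is the table with the first `m` rows of the rectangle finished; `g2 m j` has in addition
  -- the first `j` entries of row `m`.
  let g1 : ℕ → ℕ → ℕ → ℝ := fun m => fillFun (σ.valTab tab) voi voj m vq F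
  let g2 : ℕ → ℕ → ℕ → ℕ → ℝ := fun m j a c =>
    if a = voi + m ∧ voj ≤ c ∧ c < voj + j then F m (c - voj) else g1 m a c
  have inner : ∀ m < vp, ∀ j < vq, ∀ s, (s.idx 1000 = m ∧ s.idx 1001 = j ∧ s.val 1000 = 0 ∧
      C s (g2 m j)) → ∃ s', Tri b 1010 (RealRAM.forLoop 1002 1007
        (RealRAM.assignR 1000 (.add (.reg 1000) e))) s
        ((vn + 1) * ((e.cost + 7 : ℕ) + 10)) s' ∧
        s'.idx 1000 = m ∧ s'.idx 1001 = j ∧ s'.val 1000 = F m j ∧ C s' (g2 m j) := by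
    intro m hm j hj s hs
    obtain ⟨s', h1, h2⟩ := Tri.forLoop (b := b) (L := 1010) le_rfl (a := 1002) (n := 1007)
      (by norm_num) (by norm_num) (P := RealRAM.assignR 1000 (.add (.reg 1000) e)) (N := vn)
      (c := ((e.cost + 7 : ℕ) : ℝ)) (Nat.cast_nonneg _)
      (fun k s => s.idx 1002 = k ∧ s.idx 1000 = m ∧ s.idx 1001 = j ∧
        s.val 1000 = ∑ k' ∈ Finset.range k, f m j k' ∧ C s (g2 m j))
      (fun k s h => ⟨h.1, h.2.2.2.2.2.2.2.2.2⟩)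
      (by
        rintro k hk s ⟨hk', hm', hj', hv, hC⟩
        refine ⟨_, (Tri.assignR (b := b) (L := 1010) le_rfl 1000 (by norm_num) _
          (by simpa [RE.Ok] using RE.Ok.raise hL he) s).mono ?_, by simpa using hk', ?_⟩
        · exact_mod_cast by simp [RE.cost]; omega
        have hev : e.eval s = f m j k := by
          rw [← hf m hm j hj k hk (g2 m j) (by simp [g2, g1, fillFun])]
          refine RE.eval_congr (lv := true) (L := L) ⟨?_, ?_, ?_, ?_⟩ e he
          · intro a ha
            simp only [Store.setLoop_idx]
            split_ifs with h1 h2 h3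
            · rw [h1, hk']
            · rw [h2, hj']
            · rw [h3, hm']
            · exact hC.1.idx a (by simp [okReg] at ha; omega)
          · exact fun a ha => hC.1.val a (by omega)
          · exact fun a ha => hC.1.idxTab a (by omega)
          · exact fun a ha => hC.1.valTab a (by omega)
        refine ⟨by simp, by simpa using hm', by simpa using hj', ?_, ?_⟩
        · simp [RE.eval, hv, Finset.sum_range_succ, hev]
        · exact hCI _ _ _ _ (hCR _ _ _ _ hC le_rfl) (by norm_num) (by norm_num))
      (s := s) ⟨by simp, by simpa using hs.1, by simpa using hs.2.1, by simpa using hs.2.2.1,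
        hCI _ _ _ _ hs.2.2.2 (by norm_num) (by norm_num)⟩
    exact ⟨s', h2, h1.2.1, h1.2.2.1, h1.2.2.2.1, h1.2.2.2.2⟩
  set B3 : ℝ := (vn + 1) * ((e.cost + 7 : ℕ) + 10) with hB3
  have hB3' : 0 ≤ B3 := by positivity
  have middle : ∀ m < vp, ∀ s, (s.idx 1000 = m ∧ C s (g1 m)) → ∃ s', Tri b 1010
      (RealRAM.forLoop 1001 1006 (.seq (RealRAM.assignR 1000 (.nat (.lit 0))) <|
        .seq (RealRAM.forLoop 1002 1007 (RealRAM.assignR 1000 (.add (.reg 1000) e)))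
        (RealRAM.storeR tab (.add (.reg 1003) (.reg 1000)) (.add (.reg 1004) (.reg 1001))
          (.reg 1000)))) s ((vq + 1) * (B3 + 20 + 10)) s' ∧ s'.idx 1000 = m ∧ C s' (g2 m vq) := by
    intro m hm s hs
    obtain ⟨s', h1, h2⟩ := Tri.forLoop (b := b) (L := 1010) le_rfl (a := 1001) (n := 1006)
      (by norm_num) (by norm_num) (P := .seq (RealRAM.assignR 1000 (.nat (.lit 0))) <|
        .seq (RealRAM.forLoop 1002 1007 (RealRAM.assignR 1000 (.add (.reg 1000) e)))
        (RealRAM.storeR tab (.add (.reg 1003) (.reg 1000)) (.add (.reg 1004) (.reg 1001))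
          (.reg 1000))) (N := vq) (c := B3 + 20) (by positivity)
      (fun j s => s.idx 1001 = j ∧ s.idx 1000 = m ∧ C s (g2 m j))
      (fun k s h => ⟨h.1, h.2.2.2.2.2.2.1⟩)
      (by
        rintro j hj s ⟨hj', hm', hC⟩
        obtain ⟨s1, t1, i1, i2, i3, i4⟩ := inner m hm j hj (s.setR 1000 0)
          ⟨hm', hj', by simp, hCR _ _ _ _ hC le_rfl⟩
        have t0 := Tri.assignR (b := b) (L := 1010) le_rfl 1000 (by norm_num) (.nat (.lit 0))
          rfl s
        simp only [RE.eval, IE.eval, Nat.cast_zero] at t0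
        have t2 := Tri.storeR (b := b) (L := 1010) le_rfl tab (.add (.reg 1003) (.reg 1000))
          (.add (.reg 1004) (.reg 1001)) (.reg 1000) rfl rfl rfl (by omega) s1
        refine ⟨_, (t0.seq (t1.seq t2)).mono ?_, by simpa using i2, by simp, by simpa using i1, ?_⟩
        · simp [RE.cost, IE.cost]
          linarith
        · refine hCI _ _ _ _ ⟨?_, ?_⟩ (by norm_num) (by norm_num)
          · have := i4.1.setVT tab (g2 m (j + 1))
            have e1 : (σ.setVT tab (g2 m j)).setVT tab (g2 m (j + 1)) =
                σ.setVT tab (g2 m (j + 1)) := by simp [Store.setVT]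
            rw [e1] at this
            convert this using 2
            simp only [IE.eval, RE.eval, i1, i2, i3, i4.2.1, i4.2.2.1]
            rw [i4.1.valTab tab htab]
            funext a c
            simp only [upd, Store.setVT_valTab, if_true, g2]
            by_cases h1 : a = voi + m
            · by_cases h2 : c = voj + j
              · rw [if_pos ⟨h1, h2⟩, if_pos (by omega), h2, Nat.add_sub_cancel_left]
              · rw [if_neg (by omega)]
                by_cases h3 : voj ≤ c ∧ c < voj + j
                · rw [if_pos (by omega), if_pos (by omega)]
                · rw [if_neg (by omega), if_neg (by omega)]
            · rw [if_neg (by omega), if_neg (by omega), if_neg (by omega)]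
          · exact i4.2)
      (s := s) ⟨by simp, by simpa using hs.1, hCI _ _ _ _ (by
        have : g2 m 0 = g1 m := by
          funext a c
          simp only [g2]
          rw [if_neg (by omega)]
        rw [this]; exact hs.2) (by norm_num) (by norm_num)⟩
    exact ⟨s', h2, h1.2.1, h1.2.2⟩
  set B2 : ℝ := (vq + 1) * (B3 + 20 + 10) with hB2
  have hB2' : 0 ≤ B2 := by positivity
  have hset : ∀ (r : ℕ) (x : IE), x.Ok false L → r < 1010 → ∀ s, Tri b 1010
      (RealRAM.assignI r x) s (x.cost + 2 : ℕ) (s.setI r (x.eval s)) := fun r x hx hr s =>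
    Tri.assignI le_rfl r hr x (IE.Ok.raise hL hx) s
  have hev : ∀ (x : IE), x.Ok false L → ∀ r v s, 1000 ≤ r → x.eval (s.setI r v) = x.eval s := by
    intro x hx r v s hr
    exact IE.eval_congr ((sim_setI (b := true) (show L ≤ r by omega) s v).vis) x hx
  have t1 := hset 1003 oi hoi (by norm_num) σ
  have t2 := hset 1004 oj hoj (by norm_num) (σ.setI 1003 voi)
  have t3 := hset 1005 p hp (by norm_num) ((σ.setI 1003 voi).setI 1004 voj)
  have t4 := hset 1006 q hq (by norm_num) (((σ.setI 1003 voi).setI 1004 voj).setI 1005 vp)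
  have t5 := hset 1007 n hn (by norm_num)
    ((((σ.setI 1003 voi).setI 1004 voj).setI 1005 vp).setI 1006 vq)
  simp only [hev oj hoj, hev p hp, hev q hq, hev n hn, Nat.reduceLeDiff] at t2 t3 t4 t5
  have hC0 : C (((((σ.setI 1003 voi).setI 1004 voj).setI 1005 vp).setI 1006 vq).setI 1007 vn)
      (σ.valTab tab) := by
    refine ⟨?_, by simp, by simp, by simp, by simp, by simp⟩
    have : σ.setVT tab (σ.valTab tab) = σ := by simp [Store.setVT]
    rw [this]
    exact (sim_setI (by norm_num) _ _).trans <| (sim_setI (by norm_num) _ _).trans <|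
      (sim_setI (by norm_num) _ _).trans <| (sim_setI (by norm_num) _ _).trans <|
      sim_setI (by norm_num) _ _
  obtain ⟨s', h1, h2⟩ := Tri.forLoop (b := b) (L := 1010) le_rfl (a := 1000) (n := 1005)
      (by norm_num) (by norm_num) (P := RealRAM.forLoop 1001 1006
        (.seq (RealRAM.assignR 1000 (.nat (.lit 0))) <|
        .seq (RealRAM.forLoop 1002 1007 (RealRAM.assignR 1000 (.add (.reg 1000) e)))
        (RealRAM.storeR tab (.add (.reg 1003) (.reg 1000)) (.add (.reg 1004) (.reg 1001))
          (.reg 1000)))) (N := vp) (c := B2) (by positivity)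
      (fun m s => s.idx 1000 = m ∧ C s (g1 m))
      (fun k s h => ⟨h.1, h.2.2.2.2.1⟩)
      (by
        rintro m hm s ⟨hm', hC⟩
        obtain ⟨s1, t1, i1, i2⟩ := middle m hm s ⟨hm', hC⟩
        refine ⟨s1, t1, i1, by simp, hCI _ _ _ _ ?_ (by norm_num) (by norm_num)⟩
        have : g2 m vq = g1 (m + 1) := by
          funext a c
          simp only [g2, g1, fillFun]
          by_cases h1 : a = voi + m
          · subst h1
            by_cases h2 : voj ≤ c ∧ c < voj + vq
            · rw [if_pos ⟨rfl, h2⟩, if_pos (by omega), Nat.add_sub_cancel_left]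
            · rw [if_neg (by omega), if_neg (by omega), if_neg (by omega)]
          · rw [if_neg (by omega)]
            by_cases h3 : (voi ≤ a ∧ a < voi + m) ∧ (voj ≤ c ∧ c < voj + vq)
            · rw [if_pos h3, if_pos (by omega)]
            · rw [if_neg h3, if_neg (by omega)]
        rw [← this]; exact i2)
      (s := ((((σ.setI 1003 voi).setI 1004 voj).setI 1005 vp).setI 1006 vq).setI 1007 vn)
      ⟨by simp, hCI _ _ _ _ (by
        have : g1 0 = σ.valTab tab := by
          funext a c
          simp only [g1, fillFun]
          rw [if_neg (by omega)]
        rw [this]; exact hC0) (by norm_num) (by norm_num)⟩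
  refine ⟨s', (t1.seq (t2.seq (t3.seq (t4.seq (t5.seq h2))))).mono ?_, h1.2.1⟩
  set K : ℝ := fillK oi oj p q n e with hK
  have hKe : K = oi.cost + oj.cost + p.cost + q.cost + n.cost + e.cost + 100 := by
    simp [hK, fillK]
  have hp0 : (0:ℝ) ≤ vp := Nat.cast_nonneg _
  have hq0 : (0:ℝ) ≤ vq := Nat.cast_nonneg _
  have hn0 : (0:ℝ) ≤ vn := Nat.cast_nonneg _
  have a1 : (0:ℝ) ≤ oi.cost := Nat.cast_nonneg _
  have a2 : (0:ℝ) ≤ oj.cost := Nat.cast_nonneg _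
  have a3 : (0:ℝ) ≤ p.cost := Nat.cast_nonneg _
  have a4 : (0:ℝ) ≤ q.cost := Nat.cast_nonneg _
  have a5 : (0:ℝ) ≤ n.cost := Nat.cast_nonneg _
  have a6 : (0:ℝ) ≤ e.cost := Nat.cast_nonneg _
  have hB3K : B3 + 30 ≤ 2 * K * (vn + 1) := by
    rw [hB3, hKe]; push_cast; nlinarith [mul_nonneg hn0 a6, mul_nonneg hn0 a5, mul_nonneg hn0 a4,
      mul_nonneg hn0 a3, mul_nonneg hn0 a2, mul_nonneg hn0 a1]
  have hK0 : 100 ≤ K := by rw [hKe]; linarith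
  have h1n : 1 ≤ (vq + 1) * (vn + 1 : ℝ) := by nlinarith
  have hB2K : B2 + 10 ≤ 3 * K * ((vq + 1) * (vn + 1)) := by
    have : B2 ≤ (vq + 1) * (2 * K * (vn + 1)) := by
      rw [hB2]; gcongr; linarith
    nlinarith
  have h1p : 1 ≤ (vp + 1) * ((vq + 1) * (vn + 1 : ℝ)) := by nlinarith
  have hfin : (vp + 1) * (B2 + 10) ≤ 3 * K * ((vp + 1) * ((vq + 1) * (vn + 1 : ℝ))) := by
    calc (vp + 1) * (B2 + 10) ≤ (vp + 1) * (3 * K * ((vq + 1) * (vn + 1))) := by gcongr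
      _ = _ := by ring
  have hpre : ((oi.cost + 2 : ℕ) : ℝ) + ((oj.cost + 2 : ℕ) + ((p.cost + 2 : ℕ) + ((q.cost + 2 : ℕ) +
      ((n.cost + 2 : ℕ) + 0)))) ≤ K := by
    rw [hKe]; push_cast; linarith
  have : K ≤ K * ((vp + 1) * ((vq + 1) * (vn + 1 : ℝ))) := le_mul_of_one_le_right (by linarith) h1p
  have h0 : 0 ≤ K * ((vp + 1) * ((vq + 1) * (vn + 1 : ℝ))) := by positivity
  calc _ ≤ K + 3 * K * ((vp + 1) * ((vq + 1) * (vn + 1 : ℝ))) := by linarith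
    _ ≤ 10 * (K * ((vp + 1) * ((vq + 1) * (vn + 1 : ℝ)))) := by linarith
    _ = _ := by ring

theorem Tri.fill (tab : ℕ) (htab : tab < 1000) (hL : L ≤ 1000) (oi oj p q n : IE) (e : RE)
    (hoi : oi.Ok false L) (hoj : oj.Ok false L) (hp : p.Ok false L) (hq : q.Ok false L)
    (hn : n.Ok false L) (he : e.Ok true L) (s : Store) (f : ℕ → ℕ → ℕ → ℝ)
    (hf : ∀ i < p.eval s, ∀ j < q.eval s, ∀ k < n.eval s, ∀ g : ℕ → ℕ → ℝ,
      g (oi.eval s + i) (oj.eval s + j) = s.valTab tab (oi.eval s + i) (oj.eval s + j) →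
      e.eval ((s.setVT tab g).setLoop i j k) = f i j k) (htab' : tab < L) :
    Tri b L (fill tab oi oj p q n e) s
      (10 * fillK oi oj p q n e * ((p.eval s + 1) * (q.eval s + 1) * (n.eval s + 1)))
      (s.setVT tab (fillFun (s.valTab tab) (oi.eval s) (oj.eval s) (p.eval s)
        (q.eval s) fun i j => ∑ k ∈ Finset.range (n.eval s), f i j k)) := by
  refine Tri.lower (L' := 1010) (by omega) fun σ hσ => ?_
  have e1 := IE.eval_congr hσ.vis oi hoi
  have e2 := IE.eval_congr hσ.vis oj hoj
  have e3 := IE.eval_congr hσ.vis p hp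
  have e4 := IE.eval_congr hσ.vis q hq
  have e5 := IE.eval_congr hσ.vis n hn
  obtain ⟨σ', h1, h2⟩ := Tri.fill_top (b := b) tab htab hL oi oj p q n e hoi hoj hp hq hn he σ f
    (by
      intro i hi j hj k hk g hg
      rw [e1, e2, hσ.valTab tab htab'] at hg
      rw [e3] at hi
      rw [e4] at hj
      rw [e5] at hk
      rw [← hf i hi j hj k hk g hg]
      refine RE.eval_congr (lv := true) (L := L) ⟨?_, ?_, ?_, ?_⟩ e he
      · intro a ha
        simp only [Store.setLoop_idx, Store.setVT_idx]
        split_ifs with h1 h2 h3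
        · rfl
        · rfl
        · rfl
        · exact hσ.idx a (by simp [okReg] at ha; omega)
      · exact fun a ha => hσ.val a ha
      · exact fun a ha => hσ.idxTab a ha
      · exact fun a ha => (hσ.setVT tab g).valTab a ha)
  rw [e3, e4, e5] at h1
  refine ⟨σ', h1, ?_⟩
  rw [e1, e2, e3, e4, e5, hσ.valTab tab htab'] at h2
  have h3 : Sim b L σ' (σ.setVT tab _) := ⟨(h2.toBelow).mono hL, fun _ => h2.coins rfl⟩
  exact h3.trans (hσ.setVT tab _)

end RealRAM

namespace RealRAM

variable {b : Bool} {L : ℕ}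

/-! ### Multiplication of rectangular matrices by blocks -/

/-- `P` multiplies the `m × m` matrices in tables `200` and `201` into table `202`, where `m` is
index register `200`, and changes no name below `200`. -/
def IsMulProg (ω C : ℝ) (P : Prog) : Prop :=
  ∀ m : ℕ, 1 ≤ m → ∀ σ : Store, σ.idx 200 = m → ∃ τ t, Exec P σ τ t ∧
    (t : ℝ) ≤ C * (m : ℝ) ^ ω ∧ Below 200 σ τ ∧
    ∀ i < m, ∀ j < m, τ.valTab 202 i j =
      ∑ k ∈ Finset.range m, σ.valTab 200 i k * σ.valTab 201 k j

/-- The shift by 200 moves the given program out of the way of all other data. The constant is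
raised to at least 0 so that later estimates can be monotone in it. -/
theorem IsMatMulExponent.exists_mulProg {ω : ℝ} (h : IsMatMulExponent ω) :
    ∃ P C, 0 ≤ C ∧ IsMulProg ω C P := by
  obtain ⟨P, C, hP⟩ := h
  refine ⟨P.shift 200, max C 0, le_max_right _ _, fun m hm σ hσ => ?_⟩
  obtain ⟨τ, t, e, ht, hτ⟩ := hP m (Matrix.of fun i j => σ.valTab 200 i j)
    (Matrix.of fun i j => σ.valTab 201 i j) (σ.unshift 200) hm (by simpa [Store.unshift] using hσ)
    (by simp [Store.unshift]) (by simp [Store.unshift])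
  obtain ⟨τ', e', rfl, hB⟩ := e.shift 200 σ rfl
  refine ⟨τ', t, e', ht.trans ?_, hB, fun i hi j hj => ?_⟩
  · gcongr
    exact le_max_left _ _
  · have := hτ ⟨i, hi⟩ ⟨j, hj⟩
    simpa [Store.unshift, Matrix.mul_apply, Finset.sum_range] using this

namespace Store

theorem setI_setI (s : Store) (a v w : ℕ) : (s.setI a v).setI a w = s.setI a w := by
  simp [setI]
theorem setVT_setI (s : Store) (a c v : ℕ) (f : ℕ → ℕ → ℝ) :
    (s.setVT a f).setI c v = (s.setI c v).setVT a f := rfl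
theorem setVT_setVT_setI (s : Store) (a c v w : ℕ) (f : ℕ → ℕ → ℝ) {g h : ℕ → ℕ → ℝ} (e : g = h) :
    (((s.setI a v).setVT c f).setVT c g).setI a w = (s.setI a w).setVT c h := by
  subst e; simp [setVT, setI]
theorem setVT_self (s : Store) (a : ℕ) : s.setVT a (s.valTab a) = s := by simp [setVT]
theorem setI_self (s : Store) (a : ℕ) : s.setI a (s.idx a) = s := by simp [setI]
theorem setI_comm (s : Store) {a c : ℕ} (h : a ≠ c) (v w : ℕ) :
    (s.setI a v).setI c w = (s.setI c w).setI a v := by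
  simp [setI, Function.update_comm h]

end Store

def IE.I : IE := .reg 1000
def IE.J : IE := .reg 1001
def IE.K : IE := .reg 1002

/-- Entry of the `p × q` matrix in a table, and `0` outside. -/
def pad (f : ℕ → ℕ → ℝ) (p q i j : ℕ) : ℝ := if i < p then if j < q then f i j else 0 else 0

/-- Add the product of the blocks of `a` and `b` at positions `(I, K)` and `(K, J)` to the block of
`c` at `(I, J)`, where `I, J, K` are index registers `100, 101, 102`. -/
def mulBlock (P : Prog) (a b c p q r bs : ℕ) : Prog :=
  .seq (fill 200 (.lit 0) (.lit 0) (.reg bs) (.reg bs) (.lit 1)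
    (.ite (.add (.reg 100) .I) (.reg p) (.ite (.add (.reg 102) .J) (.reg q)
      (.ld a (.add (.reg 100) .I) (.add (.reg 102) .J)) (.nat (.lit 0))) (.nat (.lit 0)))) <|
  .seq (fill 201 (.lit 0) (.lit 0) (.reg bs) (.reg bs) (.lit 1)
    (.ite (.add (.reg 102) .I) (.reg q) (.ite (.add (.reg 101) .J) (.reg r)
      (.ld b (.add (.reg 102) .I) (.add (.reg 101) .J)) (.nat (.lit 0))) (.nat (.lit 0)))) <|
  .seq (assignI 200 (.reg bs)) <|
  .seq P <|
  fill c (.reg 100) (.reg 101) (.reg bs) (.reg bs) (.lit 1)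
    (.add (.ld c (.add (.reg 100) .I) (.add (.reg 101) .J)) (.ld 202 .I .J))

/-- Blocks at the border may stick out of the matrices. The operands are padded with zeros, so the
surplus entries of `c` only have 0 added to them. The triple does not track coins, since nothing is
known about the coins that `P` uses. -/
theorem Tri.mulBlock {ω C : ℝ} (hω : 2 ≤ ω) {P : Prog} (hP : IsMulProg ω C P)
    {a b c p q r bs : ℕ} (ha : a < 100) (hb : b < 100) (hc : c < 100) (hp : p < 100) (hq : q < 100)
    (hr : r < 100) (hbs : bs < 100) (s : Store) (hB : 1 ≤ s.idx bs) :
    Tri false 120 (mulBlock P a b c p q r bs) s ((C + 100000) * (s.idx bs : ℝ) ^ ω)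
      (s.setVT c fun i j => s.valTab c i j +
        if (s.idx 100 ≤ i ∧ i < s.idx 100 + s.idx bs) ∧ (s.idx 101 ≤ j ∧ j < s.idx 101 + s.idx bs)
        then ∑ k ∈ Finset.range (s.idx bs), pad (s.valTab a) (s.idx p) (s.idx q) i (s.idx 102 + k) *
          pad (s.valTab b) (s.idx q) (s.idx r) (s.idx 102 + k) j else 0) := by
  intro σ hσ
  set B := s.idx bs with hBdef
  have ibs : σ.idx bs = B := hσ.idx bs (by omega)
  have ip : σ.idx p = s.idx p := hσ.idx p (by omega)
  have iq : σ.idx q = s.idx q := hσ.idx q (by omega)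
  have ir : σ.idx r = s.idx r := hσ.idx r (by omega)
  have i100 : σ.idx 100 = s.idx 100 := hσ.idx 100 (by omega)
  have i101 : σ.idx 101 = s.idx 101 := hσ.idx 101 (by omega)
  have i102 : σ.idx 102 = s.idx 102 := hσ.idx 102 (by omega)
  have ta : σ.valTab a = s.valTab a := hσ.valTab a (by omega)
  have tb : σ.valTab b = s.valTab b := hσ.valTab b (by omega)
  have tc : σ.valTab c = s.valTab c := hσ.valTab c (by omega)
  obtain ⟨τ1, t1, e1, l1, r1⟩ := Tri.fill (b := false) (L := 203) 200 (by norm_num) (by norm_num)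
    (.lit 0) (.lit 0) (.reg bs) (.reg bs) (.lit 1)
    (.ite (.add (.reg 100) .I) (.reg p) (.ite (.add (.reg 102) .J) (.reg q)
      (.ld a (.add (.reg 100) .I) (.add (.reg 102) .J)) (.nat (.lit 0))) (.nat (.lit 0)))
    rfl rfl (by simp [IE.Ok, okReg]; omega) (by simp [IE.Ok, okReg]; omega) rfl
    (by simp [RE.Ok, IE.Ok, okReg, IE.I, IE.J]; omega) σ
    (fun i j _ => pad (s.valTab a) (s.idx p) (s.idx q) (s.idx 100 + i) (s.idx 102 + j))
    (by
      intro i _ j _ k _ g _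
      simp [RE.eval, IE.eval, IE.I, IE.J, pad, show p ≠ 1002 by omega, show p ≠ 1001 by omega,
        show p ≠ 1000 by omega, show q ≠ 1002 by omega, show q ≠ 1001 by omega,
        show q ≠ 1000 by omega, show a ≠ 200 by omega, ip, iq, i100, i102, ta]) (by norm_num)
    σ (.refl _ _ _)
  obtain ⟨τ2, t2, e2, l2, r2⟩ := Tri.fill (b := false) (L := 203) 201 (by norm_num) (by norm_num)
    (.lit 0) (.lit 0) (.reg bs) (.reg bs) (.lit 1)
    (.ite (.add (.reg 102) .I) (.reg q) (.ite (.add (.reg 101) .J) (.reg r)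
      (.ld b (.add (.reg 102) .I) (.add (.reg 101) .J)) (.nat (.lit 0))) (.nat (.lit 0)))
    rfl rfl (by simp [IE.Ok, okReg]; omega) (by simp [IE.Ok, okReg]; omega) rfl
    (by simp [RE.Ok, IE.Ok, okReg, IE.I, IE.J]; omega) _
    (fun i j _ => pad (s.valTab b) (s.idx q) (s.idx r) (s.idx 102 + i) (s.idx 101 + j))
    (by
      intro i _ j _ k _ g _
      simp [RE.eval, IE.eval, IE.I, IE.J, pad, show r ≠ 1002 by omega, show r ≠ 1001 by omega,
        show r ≠ 1000 by omega, show q ≠ 1002 by omega, show q ≠ 1001 by omega,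
        show q ≠ 1000 by omega, show b ≠ 200 by omega, show b ≠ 201 by omega, ir, iq, i101, i102,
        tb]) (by norm_num)
    τ1 r1
  obtain ⟨τ3, t3, e3, l3, r3⟩ := Tri.assignI (b := false) (L := 203) (by norm_num) 200
    (by norm_num) (.reg bs) (by simp [IE.Ok, okReg]; omega) _ τ2 r2
  have h3 : τ3.idx 200 = B := by
    rw [r3.idx 200 (by omega)]; simp [IE.eval, ibs]
  obtain ⟨τ4, t4, e4, l4, B4, v4⟩ := hP B hB τ3 h3
  have z4 : ∀ i < B, ∀ j < B, τ4.valTab 202 i j = ∑ k ∈ Finset.range B,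
      pad (s.valTab a) (s.idx p) (s.idx q) (s.idx 100 + i) (s.idx 102 + k) *
        pad (s.valTab b) (s.idx q) (s.idx r) (s.idx 102 + k) (s.idx 101 + j) := by
    intro i hi j hj
    rw [v4 i hi j hj]
    refine Finset.sum_congr rfl fun k hk => ?_
    have hk' := Finset.mem_range.1 hk
    rw [r3.valTab 200 (by omega), r3.valTab 201 (by omega)]
    simp [fillFun, IE.eval, ibs, hi, hj, hk']
  have B4' : Below 120 τ4 σ := by
    refine (B4.mono (by norm_num)).symm.trans ?_
    have h := r3.toBelow.mono (show 120 ≤ 203 by norm_num)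
    refine h.trans ?_
    refine Below.trans (sim_setI (b := false) (by norm_num) _ _).toBelow ?_
    refine Below.trans (sim_setVT (b := false) (by norm_num) _ _).toBelow ?_
    exact (sim_setVT (b := false) (by norm_num) _ _).toBelow
  have S4 : Sim false 120 τ4 s := ⟨B4'.trans hσ.toBelow, by simp⟩
  obtain ⟨τ5, t5, e5, l5, r5⟩ := Tri.fill (b := false) (L := 203) c (by omega) (by norm_num)
    (.reg 100) (.reg 101) (.reg bs) (.reg bs) (.lit 1)
    (.add (.ld c (.add (.reg 100) .I) (.add (.reg 101) .J)) (.ld 202 .I .J))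
    rfl rfl (by simp [IE.Ok, okReg]; omega) (by simp [IE.Ok, okReg]; omega) rfl
    (by simp [RE.Ok, IE.Ok, okReg, IE.I, IE.J]; omega) τ4
    (fun i j _ => s.valTab c (s.idx 100 + i) (s.idx 101 + j) + τ4.valTab 202 i j)
    (by
      intro i _ j _ k _ g hg
      simp only [IE.eval] at hg
      rw [S4.idx 100 (by omega), S4.idx 101 (by omega), S4.valTab c (by omega)] at hg
      simp [RE.eval, IE.eval, IE.I, IE.J, S4.idx 100, S4.idx 101, hg,
        show 202 ≠ c by omega]) (by omega)
    τ4 (.refl _ _ _)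
  refine ⟨τ5, _, .seq e1 (.seq e2 (.seq e3 (.seq e4 e5))), ?_, ?_⟩
  · have hB1 : (1 : ℝ) ≤ B := by exact_mod_cast hB
    have hBω : (B : ℝ) ^ 2 ≤ (B : ℝ) ^ ω := by
      rw [← Real.rpow_natCast]
      exact Real.rpow_le_rpow_of_exponent_le hB1 (by simpa using hω)
    simp [fillK, IE.cost, RE.cost, IE.eval, IE.I, IE.J, ibs] at l1 l2 l3 l5
    rw [S4.idx bs (by omega), ← hBdef] at l5
    push_cast
    have l3' : (t3 : ℝ) ≤ 4 := by exact_mod_cast l3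
    have hb2 : (1 : ℝ) ≤ (B : ℝ) ^ 2 := by nlinarith
    have h2 : ((B : ℝ) + 1) * (B + 1) * (1 + 1) ≤ 8 * B ^ 2 := by nlinarith
    nlinarith
  · have hr5 : Sim false 120 τ5 _ := r5.mono (by norm_num)
    refine hr5.trans ?_
    have key : fillFun (τ4.valTab c) (IE.eval τ4 (.reg 100)) (IE.eval τ4 (.reg 101))
        (IE.eval τ4 (.reg bs)) (IE.eval τ4 (.reg bs)) (fun i j => ∑ k ∈ Finset.range
          (IE.eval τ4 (.lit 1)), (s.valTab c (s.idx 100 + i) (s.idx 101 + j) + τ4.valTab 202 i j)) =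
        fun i j => s.valTab c i j +
        if (s.idx 100 ≤ i ∧ i < s.idx 100 + B) ∧ (s.idx 101 ≤ j ∧ j < s.idx 101 + B)
        then ∑ k ∈ Finset.range B, pad (s.valTab a) (s.idx p) (s.idx q) i (s.idx 102 + k) *
          pad (s.valTab b) (s.idx q) (s.idx r) (s.idx 102 + k) j else 0 := by
      funext i j
      simp only [IE.eval, fillFun, Finset.sum_range_one]
      rw [S4.idx 100 (by omega), S4.idx 101 (by omega), S4.idx bs (by omega),
        S4.valTab c (by omega)]
      split_ifs with h
      · rw [z4 _ (by omega) _ (by omega), Nat.add_sub_cancel' h.1.1, Nat.add_sub_cancel' h.2.1]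
      · simp
    rw [key]
    exact S4.setVT c _

/-- `c := a * b`, where `a` is `p × q` and `b` is `q × r`, by blocks of size `bs`. -/
def matMul (P : Prog) (a b c p q r bs : ℕ) : Prog :=
  .seq (fill c (.lit 0) (.lit 0) (.reg p) (.reg r) (.lit 1) (.nat (.lit 0))) <|
  .seq (assignI 100 (.lit 0)) <| .loop (.idxLt 100 p) <| .seq
    (.seq (assignI 101 (.lit 0)) <| .loop (.idxLt 101 r) <| .seq
      (.seq (assignI 102 (.lit 0)) <| .loop (.idxLt 102 q) <| .seq
        (mulBlock P a b c p q r bs)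
        (assignI 102 (.add (.reg 102) (.reg bs))))
      (assignI 101 (.add (.reg 101) (.reg bs))))
    (assignI 100 (.add (.reg 100) (.reg bs)))

/-- The number of blocks of size `B` that cover `{0, …, p - 1}`. -/
def blocks (p B : ℕ) : ℕ := (p + B - 1) / B

theorem lt_of_lt_blocks {p B m : ℕ} (hB : 1 ≤ B) (h : m < blocks p B) : m * B < p := by
  have := (Nat.le_div_iff_mul_le (by omega)).1 (Nat.succ_le_of_lt h)
  have h2 : (m + 1) * B = m * B + B := by ring
  simp only [Nat.succ_eq_add_one] at this
  omega

theorem le_blocks_mul {p B : ℕ} (hB : 1 ≤ B) : p ≤ blocks p B * B := by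
  have h := Nat.div_add_mod (p + B - 1) B
  have h2 := Nat.mod_lt (p + B - 1) (show 0 < B by omega)
  unfold blocks
  rw [mul_comm]
  omega

theorem blocks_le {p B : ℕ} (hB : 1 ≤ B) : (blocks p B : ℝ) ≤ p / B + 1 := by
  have hB' : (0:ℝ) < B := by exact_mod_cast hB
  have h : ((blocks p B * B : ℕ) : ℝ) ≤ (p + B : ℕ) := by
    exact_mod_cast (Nat.div_mul_le_self (p + B - 1) B).trans (by omega)
  push_cast at h
  rw [← sub_nonneg]
  have : (p / B + 1 - blocks p B : ℝ) = ((p + B) - blocks p B * B) / B := by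
    field_simp
  rw [this]
  exact div_nonneg (by linarith) hB'.le

set_option maxHeartbeats 1600000 in
-- A side of length p is covered by at most p/B + 1 blocks, and each of the resulting block products
-- costs B^ω. The target is cleared first and accumulates the block products, so it must differ from
-- both factors.
theorem Tri.matMul {ω C : ℝ} (hω : 2 ≤ ω) (hC : 0 ≤ C) {P : Prog} (hP : IsMulProg ω C P)
    (hL : L ≤ 100) {a b c p q r bs : ℕ} (ha : a < L) (hb : b < L) (hc : c < L) (hp : p < L)
    (hq : q < L) (hr : r < L) (hbs : bs < L) (hac : a ≠ c) (hbc : b ≠ c)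
    (s : Store) (hB : 1 ≤ s.idx bs) :
    Tri false L (matMul P a b c p q r bs) s (20 * (C + 100000) *
        ((s.idx p / s.idx bs + 1) * (s.idx q / s.idx bs + 1) * (s.idx r / s.idx bs + 1) *
          (s.idx bs : ℝ) ^ ω))
      (s.setVT c (fillFun (s.valTab c) 0 0 (s.idx p) (s.idx r) fun i j =>
        ∑ k ∈ Finset.range (s.idx q), s.valTab a i k * s.valTab b k j)) := by
  refine Tri.lower (L' := 120) (by omega) fun σ hσ => ?_
  have ibs : σ.idx bs = s.idx bs := hσ.idx bs (by omega)
  have ip : σ.idx p = s.idx p := hσ.idx p (by omega)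
  have iq : σ.idx q = s.idx q := hσ.idx q (by omega)
  have ir : σ.idx r = s.idx r := hσ.idx r (by omega)
  have ta : σ.valTab a = s.valTab a := hσ.valTab a (by omega)
  have tb : σ.valTab b = s.valTab b := hσ.valTab b (by omega)
  have tc : σ.valTab c = s.valTab c := hσ.valTab c (by omega)
  set B := s.idx bs with hBdef
  set vp := s.idx p
  set vq := s.idx q
  set vr := s.idx r
  set X : ℝ := (C + 100000) * (B : ℝ) ^ ω with hX
  have hB1 : (1 : ℝ) ≤ B := by exact_mod_cast hB
  have hBω : (B : ℝ) ^ 2 ≤ (B : ℝ) ^ ω := by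
    rw [← Real.rpow_natCast]
    exact Real.rpow_le_rpow_of_exponent_le hB1 (by simpa using hω)
  have hX0 : 100000 * (B:ℝ) ^ 2 ≤ X := by nlinarith
  have hX1 : 100000 ≤ X := by nlinarith
  set full : ℕ → ℕ → ℝ := fun i j => ∑ k ∈ Finset.range vq,
    pad (s.valTab a) vp vq i k * pad (s.valTab b) vq vr k j with hfull
  have pred : ∀ {n v : ℕ}, n < 100 → 100 ≤ v → n ≠ v := by omega
  have nbs : bs < 100 := by omega
  have np : p < 100 := by omega
  have nq : q < 100 := by omega
  have nr : r < 100 := by omega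
  have loopK : ∀ s1 : Store, s1.idx bs = B → s1.idx p = vp → s1.idx q = vq → s1.idx r = vr →
      s1.valTab a = s.valTab a → s1.valTab b = s.valTab b →
      ∃ v, Tri false 120 (.seq (RealRAM.assignI 102 (.lit 0)) <| .loop (.idxLt 102 q) <| .seq
        (RealRAM.mulBlock P a b c p q r bs)
        (RealRAM.assignI 102 (.add (.reg 102) (.reg bs)))) s1 ((vq / B + 2) * (X + 10))
        ((s1.setI 102 v).setVT c fun i j => s1.valTab c i j +
          if (s1.idx 100 ≤ i ∧ i < s1.idx 100 + B) ∧ (s1.idx 101 ≤ j ∧ j < s1.idx 101 + B)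
          then full i j else 0) := by
    intro s1 h1 h2 h3 h4 h5 h6
    let g : ℕ → ℕ → ℕ → ℝ := fun m i j => s1.valTab c i j +
          if (s1.idx 100 ≤ i ∧ i < s1.idx 100 + B) ∧ (s1.idx 101 ≤ j ∧ j < s1.idx 101 + B)
          then ∑ k ∈ Finset.range (m * B), pad (s.valTab a) vp vq i k * pad (s.valTab b) vq vr k j
          else 0
    obtain ⟨s2, hs2, ht⟩ := Tri.while (b := false) (L := 120) (cd := .idxLt 102 q)
      (P := .seq (RealRAM.mulBlock P a b c p q r bs)
        (RealRAM.assignI 102 (.add (.reg 102) (.reg bs)))) (by constructor <;> omega)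
      (N := blocks vq B) (c := fun _ => X + 7)
      (fun m s' => s' = (s1.setI 102 (m * B)).setVT c (g m))
      (by
        rintro m hm s' rfl
        refine ⟨?_, ?_⟩
        · have := lt_of_lt_blocks hB hm
          simpa [Cond.Holds, pred nq, h3] using this
        · have t1 := Tri.mulBlock hω hP (a := a) (b := b) (c := c) (p := p) (q := q) (r := r)
            (bs := bs) (by omega) (by omega) (by omega) np nq nr nbs
            ((s1.setI 102 (m * B)).setVT c (g m))
            (by simpa [pred nbs, h1] using hB)
          refine ⟨_, (t1.seq (Tri.assignI (by norm_num) 102 (by norm_num) _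
            (by simp [IE.Ok, okReg]; omega) _)).mono ?_, ?_⟩
          · simp [IE.cost, pred nbs, h1]
            linarith
          · simp only [IE.eval, Store.setVT_idx, Store.setI_idx, pred nbs, if_false,
              if_true, h1, Nat.reduceLeDiff]
            rw [show m * B + B = (m + 1) * B by ring]
            refine Store.setVT_setVT_setI _ _ _ _ _ _ ?_
            funext i j
            simp only [Store.setVT_valTab, Store.setI_valTab, hac, hbc, pred np, pred nq, pred nr,
              if_false, if_true, h2, h3, h4, h5, h6, show (100:ℕ) ≠ 102 by norm_num,
              show (101:ℕ) ≠ 102 by norm_num, g, Nat.reduceLeDiff]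
            rw [add_assoc]
            congr 1
            split_ifs with hh
            · rw [show (m + 1) * B = m * B + B by ring, Finset.sum_range_add]
            · simp)
      (by
        rintro s' rfl
        have := le_blocks_mul (p := vq) hB
        simpa [Cond.Holds, pred nq, h3] using this)
      (s := s1.setI 102 0)
      (by
        have : g 0 = s1.valTab c := by
          funext i j
          simp [g]
        rw [this, zero_mul]
        exact (Store.setVT_self (s1.setI 102 0) c).symm)
    subst hs2
    refine ⟨blocks vq B * B, (((Tri.assignI (b := false) (L := 120) (by norm_num) 102
      (by norm_num) (.lit 0) rfl s1).seq ht).mono ?_).post ?_⟩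
    · have := blocks_le (p := vq) hB
      simp [IE.cost]
      nlinarith
    · have : g (blocks vq B) = fun i j => s1.valTab c i j +
          if (s1.idx 100 ≤ i ∧ i < s1.idx 100 + B) ∧ (s1.idx 101 ≤ j ∧ j < s1.idx 101 + B)
          then full i j else 0 := by
        funext i j
        simp only [g]
        congr 1
        split_ifs with h
        -- The blocks may cover more than `vq` summation indices; the surplus ones contribute 0
        -- because of the padding.
        · obtain ⟨e, he⟩ := Nat.exists_eq_add_of_le (le_blocks_mul (p := vq) hB)
          rw [he, Finset.sum_range_add, Finset.sum_eq_zero (s := Finset.range e), add_zero]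
          intro k _
          simp [pad]
        · rfl
      rw [this]
      exact .refl _ _ _
  set X1 : ℝ := (vq / B + 2) * (X + 10) with hX1'
  have hq0 : (0:ℝ) ≤ vq / B := by positivity
  have hp0 : (0:ℝ) ≤ vp / B := by positivity
  have hr0 : (0:ℝ) ≤ vr / B := by positivity
  have hX1X : 100000 ≤ X1 := by nlinarith
  have loopJ : ∀ s1 : Store, s1.idx bs = B → s1.idx p = vp → s1.idx q = vq → s1.idx r = vr →
      s1.valTab a = s.valTab a → s1.valTab b = s.valTab b →
      ∃ v w, Tri false 120 (.seq (RealRAM.assignI 101 (.lit 0)) <| .loop (.idxLt 101 r) <| .seq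
      (.seq (RealRAM.assignI 102 (.lit 0)) <| .loop (.idxLt 102 q) <| .seq
        (RealRAM.mulBlock P a b c p q r bs)
        (RealRAM.assignI 102 (.add (.reg 102) (.reg bs))))
      (RealRAM.assignI 101 (.add (.reg 101) (.reg bs)))) s1 ((vr / B + 2) * (X1 + 10))
        (((s1.setI 102 w).setI 101 v).setVT c fun i j => s1.valTab c i j +
          if (s1.idx 100 ≤ i ∧ i < s1.idx 100 + B) then full i j else 0) := by
    intro s1 h1 h2 h3 h4 h5 h6
    let g : ℕ → ℕ → ℕ → ℝ := fun m i j => s1.valTab c i j +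
          if (s1.idx 100 ≤ i ∧ i < s1.idx 100 + B) ∧ j < m * B then full i j else 0
    obtain ⟨s2, ⟨w, hs2⟩, ht⟩ := Tri.while (b := false) (L := 120) (cd := .idxLt 101 r)
      (P := .seq (.seq (RealRAM.assignI 102 (.lit 0)) <| .loop (.idxLt 102 q) <| .seq
        (RealRAM.mulBlock P a b c p q r bs)
        (RealRAM.assignI 102 (.add (.reg 102) (.reg bs))))
        (RealRAM.assignI 101 (.add (.reg 101) (.reg bs)))) (by constructor <;> omega)
      (N := blocks vr B) (c := fun _ => X1 + 7)
      (fun m s' => ∃ w, s' = ((s1.setI 102 w).setI 101 (m * B)).setVT c (g m))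
      (by
        rintro m hm s' ⟨w, rfl⟩
        refine ⟨?_, ?_⟩
        · have := lt_of_lt_blocks hB hm
          simpa [Cond.Holds, pred nr, h4] using this
        · obtain ⟨v, t1⟩ := loopK (((s1.setI 102 w).setI 101 (m * B)).setVT c (g m))
            (by simpa [pred nbs] using h1) (by simpa [pred np] using h2)
            (by simpa [pred nq] using h3) (by simpa [pred nr] using h4)
            (by simpa [hac] using h5) (by simpa [hbc] using h6)
          refine ⟨_, (t1.seq (Tri.assignI (by norm_num) 101 (by norm_num) _
            (by simp [IE.Ok, okReg]; omega) _)).mono ?_, v, ?_⟩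
          · simp [IE.cost]
          · simp only [IE.eval, Store.setVT_idx, Store.setI_idx, pred nbs, if_false, Nat.reduceEqDiff,
              if_true, h1, Nat.reduceLeDiff]
            rw [show m * B + B = (m + 1) * B by ring]
            have e : (((s1.setI 102 w).setI 101 (m * B)).setVT c (g m)).setI 102 v =
                ((s1.setI 102 v).setI 101 (m * B)).setVT c (g m) := by
              rw [Store.setVT_setI, Store.setI_comm _ (by norm_num), Store.setI_setI]
            rw [e]
            refine Store.setVT_setVT_setI _ _ _ _ _ _ ?_
            funext i j
            simp only [Store.setVT_valTab, if_true, g]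
            rw [add_assoc]
            congr 1
            have : (m + 1) * B = m * B + B := by ring
            by_cases hi : s1.idx 100 ≤ i ∧ i < s1.idx 100 + B
            · by_cases hj : j < m * B
              · rw [if_pos ⟨hi, hj⟩, if_neg (by omega), if_pos ⟨hi, by omega⟩, add_zero]
              · by_cases hj2 : j < (m + 1) * B
                · rw [if_neg (by omega), if_pos ⟨hi, by omega⟩, if_pos ⟨hi, hj2⟩, zero_add]
                · rw [if_neg (by omega), if_neg (by omega), if_neg (by omega), zero_add]
            · rw [if_neg (by omega), if_neg (by omega), if_neg (by omega), zero_add])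
      (by
        rintro s' ⟨w, rfl⟩
        have := le_blocks_mul (p := vr) hB
        simpa [Cond.Holds, pred nr, h4] using this)
      (s := s1.setI 101 0)
      (by
        refine ⟨s1.idx 102, ?_⟩
        have : g 0 = s1.valTab c := by
          funext i j
          simp [g]
        rw [this, zero_mul, Store.setI_self]
        exact (Store.setVT_self (s1.setI 101 0) c).symm)
    subst hs2
    refine ⟨blocks vr B * B, w, (((Tri.assignI (b := false) (L := 120) (by norm_num) 101
      (by norm_num) (.lit 0) rfl s1).seq ht).mono ?_).post ?_⟩
    · have := blocks_le (p := vr) hB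
      simp [IE.cost]
      nlinarith
    · have : g (blocks vr B) = fun i j => s1.valTab c i j +
          if (s1.idx 100 ≤ i ∧ i < s1.idx 100 + B) then full i j else 0 := by
        funext i j
        simp only [g]
        congr 1
        by_cases hj : j < blocks vr B * B
        · simp [hj]
        · have hj' : ¬ j < vr := by
            have := le_blocks_mul (p := vr) hB
            omega
          have : full i j = 0 := Finset.sum_eq_zero fun k _ => by simp [pad, hj']
          simp [this]
      rw [this]
      exact .refl _ _ _
  set X2 : ℝ := (vr / B + 2) * (X1 + 10) with hX2'
  have hX2X : 100000 ≤ X2 := by nlinarith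
  have t0 := Tri.fill (b := false) (L := 120) c (by omega) (by norm_num)
    (.lit 0) (.lit 0) (.reg p) (.reg r) (.lit 1) (.nat (.lit 0)) rfl rfl
    (by simp [IE.Ok, okReg]; omega) (by simp [IE.Ok, okReg]; omega) rfl rfl σ (fun _ _ _ => 0)
    (by simp [RE.eval, IE.eval]) (by omega)
  simp only [IE.eval, ip, ir, Finset.sum_const_zero] at t0
  set z : ℕ → ℕ → ℝ := fillFun (σ.valTab c) 0 0 vp vr fun _ _ => 0 with hz
  let g : ℕ → ℕ → ℕ → ℝ := fun m i j => z i j + if i < m * B then full i j else 0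
  obtain ⟨s2, ⟨v, w, hs2⟩, ht⟩ := Tri.while (b := false) (L := 120) (cd := .idxLt 100 p)
      (P := .seq (.seq (RealRAM.assignI 101 (.lit 0)) <| .loop (.idxLt 101 r) <| .seq
      (.seq (RealRAM.assignI 102 (.lit 0)) <| .loop (.idxLt 102 q) <| .seq
        (RealRAM.mulBlock P a b c p q r bs)
        (RealRAM.assignI 102 (.add (.reg 102) (.reg bs))))
      (RealRAM.assignI 101 (.add (.reg 101) (.reg bs))))
        (RealRAM.assignI 100 (.add (.reg 100) (.reg bs)))) (by constructor <;> omega)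
      (N := blocks vp B) (c := fun _ => X2 + 7)
      (fun m s' => ∃ v w, s' = (((σ.setI 102 w).setI 101 v).setI 100 (m * B)).setVT c (g m))
      (by
        rintro m hm s' ⟨v, w, rfl⟩
        refine ⟨?_, ?_⟩
        · have := lt_of_lt_blocks hB hm
          simpa [Cond.Holds, pred np, ip] using this
        · obtain ⟨v', w', t1⟩ := loopJ
            ((((σ.setI 102 w).setI 101 v).setI 100 (m * B)).setVT c (g m))
            (by simpa [pred nbs] using ibs) (by simpa [pred np] using ip)
            (by simpa [pred nq] using iq) (by simpa [pred nr] using ir)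
            (by simpa [hac] using ta) (by simpa [hbc] using tb)
          refine ⟨_, (t1.seq (Tri.assignI (by norm_num) 100 (by norm_num) _
            (by simp [IE.Ok, okReg]; omega) _)).mono ?_, v', w', ?_⟩
          · simp [IE.cost]
          · simp only [IE.eval, Store.setVT_idx, Store.setI_idx, pred nbs, if_false, Nat.reduceEqDiff,
              if_true, ibs, Nat.reduceLeDiff]
            rw [show m * B + B = (m + 1) * B by ring]
            have e : (((((σ.setI 102 w).setI 101 v).setI 100 (m * B)).setVT c (g m)).setI 102
                w').setI 101 v' =
                (((σ.setI 102 w').setI 101 v').setI 100 (m * B)).setVT c (g m) := by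
              simp only [Store.setVT_setI]
              congr 1
              rw [Store.setI_comm _ (show 100 ≠ 102 by norm_num),
                Store.setI_comm _ (show 101 ≠ 102 by norm_num), Store.setI_setI,
                Store.setI_comm _ (show 100 ≠ 101 by norm_num), Store.setI_setI]
            rw [e]
            refine Store.setVT_setVT_setI _ _ _ _ _ _ ?_
            funext i j
            simp only [Store.setVT_valTab, if_true, g]
            rw [add_assoc]
            congr 1
            have : (m + 1) * B = m * B + B := by ring
            by_cases hj : i < m * B
            · rw [if_pos hj, if_neg (by omega), if_pos (by omega), add_zero]
            · by_cases hj2 : i < (m + 1) * B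
              · rw [if_neg (by omega), if_pos (by omega), if_pos hj2, zero_add]
              · rw [if_neg (by omega), if_neg (by omega), if_neg (by omega), zero_add])
      (by
        rintro s' ⟨v, w, rfl⟩
        have := le_blocks_mul (p := vp) hB
        simpa [Cond.Holds, pred np, ip] using this)
      (s := (σ.setVT c z).setI 100 0)
      (by
        refine ⟨σ.idx 101, σ.idx 102, ?_⟩
        have : g 0 = z := by
          funext i j
          simp [g]
        rw [this, zero_mul, Store.setI_self, Store.setI_self]
        rfl)
  subst hs2
  refine ⟨_, (t0.seq ((Tri.assignI (b := false) (L := 120) (by norm_num) 100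
      (by norm_num) (.lit 0) rfl _).seq ht)).mono ?_, ?_⟩
  · have hb := blocks_le (p := vp) hB
    simp [IE.cost, fillK, RE.cost]
    have e1 : (vp + 1 : ℝ) ≤ (vp / B + 1) * B := by
      rw [add_mul, div_mul_cancel₀ _ (by positivity)]; linarith
    have e2 : (vr + 1 : ℝ) ≤ (vr / B + 1) * B := by
      rw [add_mul, div_mul_cancel₀ _ (by positivity)]; linarith
    have e3 : (vp + 1 : ℝ) * (vr + 1) ≤ ((vp / B + 1) * B) * ((vr / B + 1) * B) := by gcongr
    set x := (vp / B : ℝ)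
    set y := (vq / B : ℝ)
    set u := (vr / B : ℝ)
    have e4 : (x + 1) * (u + 1) * (B:ℝ) ^ 2 * 100000 ≤ (x + 1) * (u + 1) * X := by
      rw [mul_assoc]; gcongr; linarith
    have e5 : X1 + 10 ≤ 2.1 * (y + 1) * X := by rw [hX1']; nlinarith [mul_nonneg hq0 (by linarith : 0 ≤ X)]
    have e6 : X2 + 10 ≤ 4.3 * (u + 1) * ((y + 1) * X) := by
      have : X2 ≤ (u + 2) * (2.1 * (y + 1) * X) := by rw [hX2']; gcongr
      have h7 : 100000 ≤ (y + 1) * X := by nlinarith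
      nlinarith [mul_nonneg hr0 (by linarith : 0 ≤ (y + 1) * X)]
    have e7 : (x + 2) * (X2 + 10) ≤ 8.6 * ((x + 1) * ((u + 1) * ((y + 1) * X))) := by
      calc (x + 2) * (X2 + 10) ≤ (2 * (x + 1)) * (4.3 * (u + 1) * ((y + 1) * X)) := by
            gcongr; linarith
        _ = _ := by ring
    have e8 : (x + 1) * (u + 1) * X ≤ (x + 1) * ((u + 1) * ((y + 1) * X)) := by
      rw [mul_assoc]; gcongr; nlinarith
    have e9 : (blocks vp B : ℝ) * (X2 + 7 + 1) ≤ (x + 1) * (X2 + 10) :=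
      mul_le_mul hb (by linarith) (by linarith) (by linarith)
    have e10 : 20 * (C + 100000) * ((x + 1) * (y + 1) * (u + 1) * (B : ℝ) ^ ω) =
        20 * ((x + 1) * ((u + 1) * ((y + 1) * X))) := by rw [hX]; ring
    rw [e10]
    nlinarith
  · have hfin : g (blocks vp B) = fillFun (s.valTab c) 0 0 vp vr fun i j =>
        ∑ k ∈ Finset.range vq, s.valTab a i k * s.valTab b k j := by
      funext i j
      simp only [g, hz, fillFun, tc]
      by_cases hi : i < vp
      · have hi' : i < blocks vp B * B := hi.trans_le (le_blocks_mul hB)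
        by_cases hj : j < vr
        · simp only [hi, hj, hi', zero_le, zero_add, and_self, if_true, Nat.sub_zero]
          refine Finset.sum_congr rfl fun k hk => ?_
          simp [pad, hi, hj, Finset.mem_range.1 hk]
        · have : full i j = 0 := Finset.sum_eq_zero fun k _ => by simp [pad, hj]
          simp [hj, this]
      · have : full i j = 0 := Finset.sum_eq_zero fun k _ => by simp [pad, hi]
        simp [hi, this]
    rw [hfin]
    refine Sim.trans ?_ (hσ.setVT c _)
    refine Sim.setVT ?_ c _
    exact (sim_setI (by omega) _ _).trans <| (sim_setI (by omega) _ _).trans <|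
      sim_setI (by omega) _ _

end RealRAM

namespace RealRAM

/-! ### Inversion by orthogonalization -/

/-- Column `k` of the matrix that results from `X` by column operations that make column `k`
orthogonal to the previous ones. -/
def elim (X : ℕ → ℕ → ℝ) (k a : ℕ) : ℝ :=
  X a k - ∑ j : Fin k, elim X j a * (elim X j k / elim X j j)
termination_by k
decreasing_by all_goals exact j.2

/-- Column `j` of `X` after the operations with the first `c` columns. -/
def elimPart (X : ℕ → ℕ → ℝ) (c a j : ℕ) : ℝ :=
  X a j - ∑ k ∈ Finset.range c, elim X k a * (elim X k j / elim X k k)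

theorem elimPart_self (X : ℕ → ℕ → ℝ) (k a : ℕ) : elimPart X k a k = elim X k a := by
  rw [elimPart, elim, Finset.sum_range]

/-- The matrix `f` of size `N` on top of the identity matrix. -/
def stack (N : ℕ) (f : ℕ → ℕ → ℝ) (a j : ℕ) : ℝ :=
  if a < N then f a j else if a - N = j then 1 else 0

section Algebra

variable {N : ℕ} {f : ℕ → ℕ → ℝ}

/-- The lower half starts as the identity, and column k only receives multiples of earlier columns,
so the lower half stays unit upper triangular. -/
theorem elim_bot (k l : ℕ) : (k < l → elim (stack N f) k (N + l) = 0) ∧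
    (k = l → elim (stack N f) k (N + l) = 1) := by
  induction k using Nat.strong_induction_on generalizing l with
  | _ k ih =>
    constructor
    · intro h
      rw [elim, Finset.sum_eq_zero, sub_zero]
      · simp [stack]; omega
      · intro j _
        rw [(ih j j.2 l).1 (by omega), zero_mul]
    · rintro rfl
      rw [elim, Finset.sum_eq_zero, sub_zero]
      · simp [stack]
      · intro j _
        rw [(ih j j.2 k).1 j.2, zero_mul]

/-- Column operations act on both halves alike, so the upper half remains the given matrix times the
lower half. -/
theorem elim_top (k i : ℕ) (hk : k < N) (hi : i < N) :
    elim (stack N f) k i = ∑ l ∈ Finset.range N, f i l * elim (stack N f) k (N + l) := by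
  induction k using Nat.strong_induction_on with
  | _ k ih =>
    rw [elim]
    have h2 : ∀ l, elim (stack N f) k (N + l) = (if l = k then 1 else 0) -
        ∑ j : Fin k, elim (stack N f) j (N + l) *
          (elim (stack N f) j k / elim (stack N f) j j) := by
      intro l
      rw [elim]
      simp [stack]
    simp only [h2, mul_sub, Finset.sum_sub_distrib]
    congr 1
    · simp [stack, hi, hk]
    · simp only [Finset.mul_sum]
      rw [Finset.sum_comm]
      refine Finset.sum_congr rfl fun j _ => ?_
      rw [ih j j.2 (by omega), Finset.sum_mul]
      refine Finset.sum_congr rfl fun l _ => by ring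

variable (hf : (Matrix.of fun i j : Fin N => f i j).PosDef)
include hf

theorem posDef_table_symm {i j : ℕ} (hi : i < N) (hj : j < N) : f i j = f j i := by
  have := hf.1.apply ⟨i, hi⟩ ⟨j, hj⟩
  simpa using this.symm

/-- Entry i < k of column k: by induction the summands with j > i vanish, and the one with j = i is
entry k of column i. By the symmetry of the matrix, expanding this entry cancels everything else.
Hence the upper half is lower triangular, and its pivots are values of the quadratic form. -/
theorem elim_diag (k : ℕ) (hk : k < N) :
    0 < elim (stack N f) k k ∧ ∀ i < k, elim (stack N f) k i = 0 := by
  induction k using Nat.strong_induction_on with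
  | _ k ih =>
    have hz : ∀ i < k, elim (stack N f) k i = 0 := by
      intro i hi
      have e1 : elim (stack N f) i k = f k i - ∑ j ∈ Finset.range i, elim (stack N f) j k *
          (elim (stack N f) j i / elim (stack N f) j j) := by
        rw [← elimPart_self, elimPart]; simp [stack, hk]
      have e2 : elim (stack N f) k i = f i k - ∑ j ∈ Finset.range k, elim (stack N f) j i *
          (elim (stack N f) j k / elim (stack N f) j j) := by
        rw [← elimPart_self, elimPart]; simp [stack, hi.trans hk]
      obtain ⟨e, rfl⟩ := Nat.exists_eq_add_of_le (Nat.succ_le_of_lt hi)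
      rw [Finset.sum_range_add, Finset.sum_range_succ, Finset.sum_eq_zero (s := Finset.range e),
        add_zero] at e2
      · have hpos := (ih i hi (hi.trans hk)).1
        rw [e2, posDef_table_symm hf (hi.trans hk) hk, mul_div_cancel₀ _ hpos.ne', e1]
        have : ∀ j, elim (stack N f) j i * (elim (stack N f) j (i.succ + e) / elim (stack N f) j j)
          = elim (stack N f) j (i.succ + e) * (elim (stack N f) j i / elim (stack N f) j j) := by
          intro j; ring
        simp only [this]
        ring
      · intro j hj
        have := Finset.mem_range.1 hj
        rw [(ih (i.succ + j) (by omega) (by omega)).2 i (by omega), zero_mul]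
    refine ⟨?_, hz⟩
    -- For the lower half x of column k, Mx vanishes above position k and x vanishes below it, so
    -- xᵀMx is just the pivot. Positivity follows since x has the entry 1 at k.
    let x : Fin N → ℝ := fun l => elim (stack N f) k (N + l)
    have hx : x ≠ 0 := by
      intro h
      have := congrFun h ⟨k, hk⟩
      simp [x, (elim_bot (N := N) (f := f) k k).2 rfl] at this
    have h1 := hf.dotProduct_mulVec_pos hx
    have h2 : (Matrix.of fun i j : Fin N => f i j).mulVec x = fun i : Fin N =>
        elim (stack N f) k i := by
      funext i
      rw [elim_top k i hk i.2, Finset.sum_range]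
      rfl
    rw [h2] at h1
    simp only [dotProduct, star_trivial, x, Pi.star_apply] at h1
    rw [Finset.sum_eq_single (⟨k, hk⟩ : Fin N)] at h1
    · simpa [(elim_bot (N := N) (f := f) k k).2 rfl] using h1
    · intro i _ hik
      rcases lt_trichotomy (i : ℕ) k with h | h | h
      · rw [hz i h, mul_zero]
      · exact absurd (Fin.ext h) hik
      · rw [(elim_bot (N := N) (f := f) k i).1 h, zero_mul]
    · simp

/-- The inverse of a positive definite matrix from its orthogonalization. -/
theorem elim_inverse : (Matrix.of fun i j : Fin N => f i j)⁻¹ = Matrix.of fun i j : Fin N =>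
    ∑ k ∈ Finset.range N, elim (stack N f) k (N + i) *
      (elim (stack N f) k (N + j) / elim (stack N f) k k) := by
  set M := Matrix.of fun i j : Fin N => f i j with hM
  let R : Matrix (Fin N) (Fin N) ℝ := Matrix.of fun i k => elim (stack N f) k (N + i)
  let D : Matrix (Fin N) (Fin N) ℝ := Matrix.diagonal fun k => elim (stack N f) k k
  let D' : Matrix (Fin N) (Fin N) ℝ := Matrix.diagonal fun k => (elim (stack N f) k k)⁻¹
  have hDD : D' * D = 1 := by
    simp only [D, D', Matrix.diagonal_mul_diagonal]
    rw [← Matrix.diagonal_one]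
    congr 1
    funext k
    exact inv_mul_cancel₀ (elim_diag hf k k.2).1.ne'
  have hS : M * R = Matrix.of fun (i k : Fin N) => elim (stack N f) k i := by
    ext i k
    simp only [Matrix.mul_apply, Matrix.of_apply, hM, R]
    rw [elim_top k i k.2 i.2, Finset.sum_range]
  -- R is upper triangular and MR is lower triangular, so RᵀMR vanishes above the diagonal; being
  -- symmetric, it is diagonal. Then the inverse of M is R D⁻¹ Rᵀ.
  have hup : ∀ k l : Fin N, k < l → (R.transpose * (M * R)) k l = 0 := by
    intro k l hkl
    rw [hS, Matrix.mul_apply]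
    refine Finset.sum_eq_zero fun i _ => ?_
    simp only [Matrix.transpose_apply, Matrix.of_apply, R]
    rcases lt_or_ge (k : ℕ) i with h | h
    · rw [(elim_bot (N := N) (f := f) k i).1 h, zero_mul]
    · rw [(elim_diag hf l l.2).2 i (lt_of_le_of_lt h hkl), mul_zero]
  have hsym : (R.transpose * (M * R)).transpose = R.transpose * (M * R) := by
    have : M.transpose = M := by
      ext i j
      simp only [Matrix.transpose_apply, hM, Matrix.of_apply]
      exact posDef_table_symm hf j.2 i.2
    rw [Matrix.transpose_mul, Matrix.transpose_mul, this, Matrix.transpose_transpose,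
      Matrix.mul_assoc]
  have hD : R.transpose * (M * R) = D := by
    ext k l
    rcases lt_trichotomy k l with h | h | h
    · rw [hup k l h]; simp [D, h.ne]
    · subst h
      rw [hS, Matrix.mul_apply, Finset.sum_eq_single k]
      · simp [R, D, (elim_bot (N := N) (f := f) k k).2 rfl]
      · intro i _ hik
        simp only [Matrix.transpose_apply, Matrix.of_apply, R]
        rcases lt_or_gt_of_ne (fun h => hik (Fin.ext h) : (i : ℕ) ≠ k) with h | h
        · rw [(elim_diag hf k k.2).2 i h, mul_zero]
        · rw [(elim_bot (N := N) (f := f) k i).1 h, zero_mul]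
      · simp
    · rw [← hsym, Matrix.transpose_apply, hup l k h]; simp [D, h.ne']
  have h1 : (D' * R.transpose * M) * R = 1 := by
    rw [Matrix.mul_assoc, Matrix.mul_assoc, hD, hDD]
  have h2 : (R * D' * R.transpose) * M = 1 := by
    have := mul_eq_one_comm.1 h1
    rw [← this]; simp only [Matrix.mul_assoc]
  rw [Matrix.inv_eq_left_inv h2]
  ext i j
  rw [Matrix.mul_apply]
  simp only [Matrix.of_apply, Finset.sum_range, R, D', Matrix.mul_diagonal,
    Matrix.transpose_apply]
  refine Finset.sum_congr rfl fun k _ => by ring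

end Algebra

/-! ### The order of the updates -/

/-- The largest power of two that divides `n`. -/
def lowb (n : ℕ) : ℕ := 2 ^ padicValNat 2 n

theorem lowb_pos (n : ℕ) : 0 < lowb n := by unfold lowb; positivity

theorem lowb_dvd (n : ℕ) : lowb n ∣ n := pow_padicValNat_dvd

theorem lowb_le {n : ℕ} (hn : n ≠ 0) : lowb n ≤ n := Nat.le_of_dvd (by omega) (lowb_dvd n)

theorem lowb_two_mul {n : ℕ} (hn : n ≠ 0) : lowb (n + n) = lowb n + lowb n := by
  unfold lowb
  rw [← two_mul, padicValNat.mul (by norm_num) hn, padicValNat_self, pow_add]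
  ring

theorem lowb_odd (n : ℕ) : lowb (n + n + 1) = 1 := by
  unfold lowb
  rw [padicValNat.eq_zero_of_not_dvd (by omega), pow_zero]

/-- The number of columns that have been applied to column `j` before step `i`. -/
def applied : ℕ → ℕ → ℕ
  | 0, _ => 0
  | i + 1, j => if i + 1 ≤ j ∧ j < i + 1 + lowb (i + 1) then i + 1 else applied i j

/-- The step with i + 1 = j always includes column j itself. So a column has received all its
predecessors before it is used as a pivot column. -/
theorem applied_of_le {i j : ℕ} (h : j ≤ i) : applied i j = j := by
  induction i with
  | zero => obtain rfl : j = 0 := by omega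
            rfl
  | succ i ih =>
    rw [applied]
    by_cases hj : j = i + 1
    · rw [if_pos ⟨hj.ge, by have := lowb_pos (i + 1); omega⟩, hj]
    · rw [if_neg (by omega), ih (by omega)]

/-- All columns treated in one step are at the same stage, exactly `lowb (i + 1)` columns behind, so
a single block product brings all of them up to date. Write i + 1 = 2^v q with q odd. The step at e0
= 2^v (q - 1) reaches at least 2^(v+1) columns and so includes j, while the steps strictly between
stop before column i + 1. -/
theorem applied_before {i j : ℕ} (h1 : i + 1 ≤ j) (h2 : j < i + 1 + lowb (i + 1)) :
    applied i j = i + 1 - lowb (i + 1) := by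
  obtain ⟨v, hv⟩ : ∃ v, v = padicValNat 2 (i + 1) := ⟨_, rfl⟩
  have hl : lowb (i + 1) = 2 ^ v := by rw [hv]; rfl
  have hle := lowb_le (show i + 1 ≠ 0 by omega)
  have hnd : ¬ 2 ^ (v + 1) ∣ i + 1 := by
    rw [hv]; exact pow_succ_padicValNat_not_dvd (by omega)
  obtain ⟨q, hq⟩ := lowb_dvd (i + 1)
  rw [hl] at hq h2 hle ⊢
  have hodd : ¬ 2 ∣ q := by
    rintro ⟨r, rfl⟩
    exact hnd ⟨r, by rw [hq]; ring⟩
  set e0 := i + 1 - 2 ^ v with he0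
  -- Since q - 1 is even, 2^(v+1) divides e0, so the window that starts at e0 contains j. For e0 = 0
  -- nothing has been applied yet.
  have hbase : applied e0 j = e0 := by
    by_cases h0 : e0 = 0
    · rw [h0]; rfl
    · obtain ⟨m, hm⟩ := Nat.exists_eq_succ_of_ne_zero h0
      rw [hm, applied, ← Nat.succ_eq_add_one, ← hm, if_pos]
      refine ⟨by omega, ?_⟩
      have hd : 2 ^ (v + 1) ∣ e0 := by
        obtain ⟨r, hr⟩ : 2 ∣ q - 1 := by omega
        refine ⟨r, ?_⟩
        have : e0 = 2 ^ v * (q - 1) := by rw [Nat.mul_sub, ← hq, mul_one]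
        rw [this, hr]; ring
      have : 2 ^ (v + 1) ≤ lowb e0 := by
        unfold lowb
        exact Nat.pow_le_pow_right (by norm_num) ((padicValNat_dvd_iff_le h0).1 hd)
      rw [pow_succ] at this
      omega
  -- A number strictly between e0 and i + 1 is not divisible by 2^v. Its largest power of two
  -- divides its distance to i + 1, so its window ends at i + 1 at the latest.
  have key : ∀ t, e0 + t ≤ i → applied (e0 + t) j = e0 := by
    intro t
    induction t with
    | zero => intro _; exact hbase
    | succ t ih =>
      intro ht
      rw [← add_assoc, applied, if_neg, ih (by omega)]
      rintro ⟨_, h4⟩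
      have hlt : padicValNat 2 (e0 + t + 1) < v := by
        by_contra hge
        push Not at hge
        have h5 : 2 ^ v ∣ e0 + t + 1 := (padicValNat_dvd_iff_le (by omega)).2 hge
        have h6 : 2 ^ v ∣ i + 1 - (e0 + t + 1) := Nat.dvd_sub ⟨q, hq⟩ h5
        have := Nat.le_of_dvd (by omega) h6
        omega
      have h7 : lowb (e0 + t + 1) ∣ i + 1 - (e0 + t + 1) :=
        Nat.dvd_sub ((pow_dvd_pow 2 hlt.le).trans ⟨q, hq⟩) (lowb_dvd _)
      have := Nat.le_of_dvd (by omega) h7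
      omega
  have := key (2 ^ v - 1) (by have : 0 < 2 ^ v := by positivity
                              omega)
  rwa [show e0 + (2 ^ v - 1) = i by have : 0 < 2 ^ v := by positivity
                                    omega] at this

/-- For each v, the multiples of 2^v among 1, …, N contribute at most (N / 2^v) · 2^v ≤ N, and only
log₂ N + 1 exponents occur. -/
theorem sum_lowb_le (N : ℕ) :
    ∑ i ∈ Finset.range N, lowb (i + 1) ≤ N * (Nat.log 2 N + 1) := by
  have h1 : ∀ i ∈ Finset.range N, lowb (i + 1) ≤
      ∑ v ∈ Finset.range (Nat.log 2 N + 1), if 2 ^ v ∣ i + 1 then 2 ^ v else 0 := by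
    intro i hi
    have hi' := Finset.mem_range.1 hi
    have hmem : padicValNat 2 (i + 1) ∈ Finset.range (Nat.log 2 N + 1) := by
      rw [Finset.mem_range]
      have : 2 ^ padicValNat 2 (i + 1) ≤ N := (lowb_le (by omega)).trans (by omega)
      have := Nat.le_log_of_pow_le (by norm_num) this
      omega
    refine le_trans ?_ (Finset.single_le_sum (fun _ _ => Nat.zero_le _) hmem)
    exact (if_pos (lowb_dvd (i + 1))).ge
  refine (Finset.sum_le_sum h1).trans ?_
  rw [Finset.sum_comm]
  calc _ ≤ ∑ v ∈ Finset.range (Nat.log 2 N + 1), N := by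
        refine Finset.sum_le_sum fun v _ => ?_
        rw [← Finset.sum_filter, Finset.sum_const, smul_eq_mul]
        have : ((Finset.range N).filter fun i => 2 ^ v ∣ i + 1).card = N / 2 ^ v :=
          Nat.card_multiples N (2 ^ v)
        rw [this]
        exact Nat.div_mul_le_self _ _
    _ = _ := by simp [mul_comm]

end RealRAM

/-! ### Inversion of positive definite matrices in matrix multiplication time -/

namespace RealRAM

variable {b : Bool} {L : ℕ}

/-- The cost may vary with the round, as the amortized analysis of the inversion needs. -/
theorem Tri.forLoop' (hL : L ≤ 1010) {a n : ℕ} (ha : a < L) (hn : n < L) {P : Prog} {N : ℕ}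
    {c : ℕ → ℝ} (Q : ℕ → Store → Prop)
    (hQ : ∀ m s, Q m s → s.idx a = m ∧ s.idx n = N)
    (hstep : ∀ m < N, ∀ s, Q m s → ∃ s', Tri b L P s (c m) s' ∧ s'.idx a = m ∧
      Q (m + 1) (s'.setI a (m + 1)))
    {s : Store} (h0 : Q 0 (s.setI a 0)) :
    ∃ s', Q N s' ∧ Tri b L (RealRAM.forLoop a n P) s ((∑ m ∈ Finset.range N, (c m + 7)) + 5) s' := by
  have ha' : a < 1010 := by omega
  obtain ⟨s', hq, ht⟩ := Tri.while (b := b) (L := L) (cd := .idxLt a n)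
    (P := .seq P (RealRAM.assignI a (.add (.reg a) (.lit 1)))) ⟨ha, hn⟩ (N := N)
    (c := fun m => c m + 6) Q
    (by
      intro m hm s hs
      refine ⟨by simp [Cond.Holds, hQ m s hs, hm], ?_⟩
      obtain ⟨s1, h1, hm1, hq1⟩ := hstep m hm s hs
      refine ⟨_, (h1.seq (Tri.assignI hL a ha' _ (by simp [IE.Ok, okReg, ha]) s1)).mono ?_, ?_⟩
      · norm_num [IE.cost]
      · simpa [IE.eval, hm1] using hq1)
    (by
      intro s hs
      simp [Cond.Holds, hQ N s hs]) h0
  refine ⟨s', hq, ((Tri.assignI hL a ha' _ (by simp [IE.Ok]) s).seq ht).mono ?_⟩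
  simp [IE.cost]
  have : ∀ m, c m + 6 + 1 = c m + 7 := by intro m; ring
  simp only [this]
  linarith

/-- One round of column operations: the columns `i + 1 - lb, …, i` are applied to the following
`lb` columns, where `lb` is the largest power of two dividing `i + 1`. -/
def elimStep (P : Prog) (n : ℕ) : Prog :=
  .seq (assignI 61 (.ld 60 (.add (.reg 60) (.lit 1)) (.lit 0))) <|
  .seq (assignI 62 (.sub (.add (.reg 60) (.lit 1)) (.reg 61))) <|
  .seq (assignI 63 (.sub (.reg 61) (.sub (.reg 61) (.sub (.reg n) (.add (.reg 60) (.lit 1)))))) <|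
  .seq (fill 61 (.lit 0) (.lit 0) (.reg 64) (.reg 61) (.lit 1)
    (.ld 60 .I (.add (.reg 62) .J))) <|
  .seq (fill 62 (.lit 0) (.lit 0) (.reg 61) (.reg 63) (.lit 1)
    (.div (.ld 60 (.add (.add (.reg 60) (.lit 1)) .J) (.add (.reg 62) .I))
      (.ld 60 (.add (.reg 62) .I) (.add (.reg 62) .I)))) <|
  .seq (matMul P 61 62 63 64 61 63 61) <|
  fill 60 (.lit 0) (.add (.reg 60) (.lit 1)) (.reg 64) (.reg 63) (.lit 1)
    (.sub (.ld 60 .I (.add (.add (.reg 60) (.lit 1)) .J)) (.ld 63 .I .J))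

/-- Invert the positive definite `n × n` matrix in table `a` into table `c`. -/
def invert (P : Prog) (n a c : ℕ) : Prog :=
  .seq (forLoop 60 n (.seq
    (storeI 60 (.add (.reg 60) (.reg 60)) (.lit 0)
      (.add (.ld 60 (.reg 60) (.lit 0)) (.ld 60 (.reg 60) (.lit 0))))
    (storeI 60 (.add (.add (.reg 60) (.reg 60)) (.lit 1)) (.lit 0) (.lit 1)))) <|
  .seq (assignI 64 (.add (.reg n) (.reg n))) <|
  .seq (fill 60 (.lit 0) (.lit 0) (.reg 64) (.reg n) (.lit 1)
    (.ite .I (.reg n) (.ld a .I .J) (.ite (.sub .I (.reg n)) .J (.nat (.lit 0))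
      (.ite .J (.sub .I (.reg n)) (.nat (.lit 0)) (.nat (.lit 1)))))) <|
  .seq (forLoop 60 n (elimStep P n)) <|
  .seq (fill 61 (.lit 0) (.lit 0) (.reg n) (.reg n) (.lit 1) (.ld 60 (.add (.reg n) .I) .J)) <|
  .seq (fill 62 (.lit 0) (.lit 0) (.reg n) (.reg n) (.lit 1)
    (.div (.ld 60 (.add (.reg n) .J) .I) (.ld 60 .I .I))) <|
  matMul P 61 62 c n n n n

theorem Sim.setI_left {σ s : Store} (h : Sim b L σ s) {a : ℕ} (ha : L ≤ a) (v : ℕ) :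
    Sim b L (σ.setI a v) s := (sim_setI ha σ v).trans h
theorem Sim.setVT_left {σ s : Store} (h : Sim b L σ s) {a : ℕ} (ha : L ≤ a) (v : ℕ → ℕ → ℝ) :
    Sim b L (σ.setVT a v) s := (sim_setVT ha σ v).trans h
theorem Sim.setIT_left {σ s : Store} (h : Sim b L σ s) {a : ℕ} (ha : L ≤ a) (v : ℕ → ℕ → ℕ) :
    Sim b L (σ.setIT a v) s := (sim_setIT ha σ v).trans h

set_option maxHeartbeats 1000000 in
-- With B = `lowb (i + 1)` the main work is a product of a 2N × B matrix and one with at most B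
-- columns. In blocks of size B it costs about (N/B) · B^ω, which is at most N^(ω-1) B because B ≤ N
-- and ω ≥ 2.
theorem Tri.elimStep {ω C : ℝ} (hω : 2 ≤ ω) (hC : 0 ≤ C) {P : Prog} (hP : IsMulProg ω C P)
    {n N : ℕ} (hn : n < 60) (s : Store) (X : ℕ → ℕ → ℝ) (i : ℕ) (hi : i < N)
    (h60 : s.idx 60 = i) (h64 : s.idx 64 = N + N) (hN : s.idx n = N)
    (hlb : s.idxTab 60 (i + 1) 0 = lowb (i + 1))
    (hX : ∀ a < N + N, ∀ j < N, s.valTab 60 a j = elimPart X (applied i j) a j) :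
    ∃ s', Tri false 100 (elimStep P n) s (3000 * (C + 100000) * ((N : ℝ) ^ (ω - 1) *
        lowb (i + 1))) s' ∧ Sim false 60 s' s ∧ s'.idxTab 60 = s.idxTab 60 ∧ s'.idx 60 = i ∧
      s'.idx 64 = N + N ∧
      ∀ a < N + N, ∀ j < N, s'.valTab 60 a j = elimPart X (applied (i + 1) j) a j := by
  set B := lowb (i + 1) with hB
  have hB1 : 1 ≤ B := lowb_pos _
  have hBi : B ≤ i + 1 := lowb_le (by omega)
  set lo := i + 1 - B with hlo
  -- By truncated subtraction this is the minimum of B and N - (i + 1): the number of columns in the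
  -- window that exist.
  set cnt := B - (B - (N - (i + 1))) with hcnt
  have pred : ∀ {v : ℕ}, 60 ≤ v → n ≠ v := by omega
  have t1 := Tri.assignI (b := false) (L := 100) (by norm_num) 61 (by norm_num)
    (.ld 60 (.add (.reg 60) (.lit 1)) (.lit 0)) rfl s
  simp only [IE.eval, h60, hlb] at t1
  set s1 := s.setI 61 B with hs1
  have t2 := Tri.assignI (b := false) (L := 100) (by norm_num) 62 (by norm_num)
    (.sub (.add (.reg 60) (.lit 1)) (.reg 61)) rfl s1
  have e2 : IE.eval s1 (.sub (.add (.reg 60) (.lit 1)) (.reg 61)) = lo := by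
    simp [IE.eval, hs1, h60, hlo]
  rw [e2] at t2
  set s2 := s1.setI 62 lo with hs2
  have t3 := Tri.assignI (b := false) (L := 100) (by norm_num) 63 (by norm_num)
    (.sub (.reg 61) (.sub (.reg 61) (.sub (.reg n) (.add (.reg 60) (.lit 1)))))
    (by simp [IE.Ok, okReg]; omega) s2
  have e3 : IE.eval s2 (.sub (.reg 61) (.sub (.reg 61) (.sub (.reg n)
      (.add (.reg 60) (.lit 1))))) = cnt := by
    simp [IE.eval, hs2, hs1, h60, hcnt, hN, pred]
  rw [e3] at t3
  set s3 := s2.setI 63 cnt with hs3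
  have t4 := Tri.fill (b := false) (L := 100) 61 (by norm_num) (by norm_num) (.lit 0) (.lit 0)
    (.reg 64) (.reg 61) (.lit 1) (.ld 60 .I (.add (.reg 62) .J)) rfl rfl rfl rfl rfl rfl s3
    (fun a k _ => s.valTab 60 a (lo + k))
    (by
      intro a _ k _ _ _ g _
      simp [RE.eval, IE.eval, IE.I, IE.J, hs3, hs2, hs1]) (by norm_num)
  simp only [IE.eval, Finset.sum_range_one] at t4
  have r64 : s3.idx 64 = N + N := by simp [hs3, hs2, hs1, h64]
  have r61 : s3.idx 61 = B := by simp [hs3, hs2, hs1]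
  have r63 : s3.idx 63 = cnt := by simp [hs3, hs2, hs1]
  rw [r64, r61] at t4
  set f4 := fillFun (s3.valTab 61) 0 0 (N + N) B fun a k => s.valTab 60 a (lo + k) with hf4
  set s4 := s3.setVT 61 f4 with hs4
  have t5 := Tri.fill (b := false) (L := 100) 62 (by norm_num) (by norm_num) (.lit 0) (.lit 0)
    (.reg 61) (.reg 63) (.lit 1)
    (.div (.ld 60 (.add (.add (.reg 60) (.lit 1)) .J) (.add (.reg 62) .I))
      (.ld 60 (.add (.reg 62) .I) (.add (.reg 62) .I))) rfl rfl rfl rfl rfl rfl s4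
    (fun k j _ => s.valTab 60 (i + 1 + j) (lo + k) / s.valTab 60 (lo + k) (lo + k))
    (by
      intro a _ k _ _ _ g _
      simp [RE.eval, IE.eval, IE.I, IE.J, hs4, hs3, hs2, hs1, h60]) (by norm_num)
  simp only [IE.eval, Finset.sum_range_one] at t5
  have q61 : s4.idx 61 = B := r61
  have q63 : s4.idx 63 = cnt := r63
  rw [q61, q63] at t5
  set f5 := fillFun (s4.valTab 62) 0 0 B cnt fun k j =>
    s.valTab 60 (i + 1 + j) (lo + k) / s.valTab 60 (lo + k) (lo + k) with hf5
  set s5 := s4.setVT 62 f5 with hs5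
  have t6 := Tri.matMul (L := 100) hω hC hP le_rfl (a := 61) (b := 62) (c := 63) (p := 64)
    (q := 61) (r := 63) (bs := 61) (by norm_num) (by norm_num) (by norm_num) (by norm_num)
    (by norm_num) (by norm_num) (by norm_num) (by norm_num) (by norm_num) s5
    (by rw [show s5.idx 61 = B from r61]; exact hB1)
  rw [show s5.idx 61 = B from r61, show s5.idx 63 = cnt from r63,
    show s5.idx 64 = N + N from r64] at t6
  set f6 := fillFun (s5.valTab 63) 0 0 (N + N) cnt fun a j =>
    ∑ k ∈ Finset.range B, s5.valTab 61 a k * s5.valTab 62 k j with hf6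
  set s6 := s5.setVT 63 f6 with hs6
  have t7 := Tri.fill (b := false) (L := 100) 60 (by norm_num) (by norm_num) (.lit 0)
    (.add (.reg 60) (.lit 1)) (.reg 64) (.reg 63) (.lit 1)
    (.sub (.ld 60 .I (.add (.add (.reg 60) (.lit 1)) .J)) (.ld 63 .I .J)) rfl rfl rfl rfl rfl rfl s6
    (fun a j _ => s.valTab 60 a (i + 1 + j) - f6 a j)
    (by
      intro a _ j _ _ _ g hg
      have e60 : s6.idx 60 = i := by
        simp [hs6, hs5, hs4, hs3, hs2, hs1, h60]
      simp only [IE.eval, e60, zero_add] at hg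
      have e7 : s6.valTab 60 = s.valTab 60 := by simp [hs6, hs5, hs4, hs3, hs2, hs1]
      have e8 : s6.valTab 63 = f6 := by simp [hs6]
      rw [e7] at hg
      simp [RE.eval, IE.eval, IE.I, IE.J, e60, hg, e8]) (by norm_num)
  simp only [IE.eval, Finset.sum_range_one] at t7
  have e60 : s6.idx 60 = i := by simp [hs6, hs5, hs4, hs3, hs2, hs1, h60]
  rw [show s6.idx 64 = N + N from r64, show s6.idx 63 = cnt from r63, e60] at t7
  refine ⟨_, (t1.seq (t2.seq (t3.seq (t4.seq (t5.seq (t6.seq t7)))))).mono ?_, ?_, ?_, ?_, ?_, ?_⟩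
  · simp only [fillK, IE.cost, RE.cost, IE.I, IE.J]
    norm_num
    have hN1 : (1 : ℝ) ≤ N := by exact_mod_cast (by omega : 1 ≤ N)
    have hBr : (1 : ℝ) ≤ B := by exact_mod_cast hB1
    have hBN : (B : ℝ) ≤ N := by exact_mod_cast (by omega : B ≤ N)
    have hcB : (cnt : ℝ) ≤ B := by exact_mod_cast (by omega : cnt ≤ B)
    have hc0 : (0 : ℝ) ≤ cnt := Nat.cast_nonneg _
    set Y : ℝ := (N : ℝ) ^ (ω - 1) * B with hY
    have hNY : (N : ℝ) * B ≤ Y := by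
      rw [hY]
      gcongr
      calc (N : ℝ) = (N : ℝ) ^ (1 : ℝ) := (Real.rpow_one _).symm
        _ ≤ _ := Real.rpow_le_rpow_of_exponent_le hN1 (by linarith)
    have hBY : (B : ℝ) ^ ω ≤ Y / N * B := by
      have e1 : (B : ℝ) ^ ω = (B : ℝ) ^ (ω - 2) * B ^ 2 := by
        rw [← Real.rpow_natCast, ← Real.rpow_add (by linarith)]; norm_num
      have e2 : Y / N = (N : ℝ) ^ (ω - 2) * B := by
        have : (N : ℝ) ^ (ω - 1) = (N : ℝ) ^ (ω - 2) * N := by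
          rw [← Real.rpow_add_one (by linarith)]; congr 1; ring
        rw [hY, this]; field_simp
      rw [e1, e2, mul_assoc, ← sq]
      gcongr
    have hMM : ((N : ℝ) + N) / B + 1 ≤ 3 * N / B := by
      rw [div_add_one (by linarith), div_le_div_iff_of_pos_right (by linarith)]; linarith
    have hcc : (cnt : ℝ) / B + 1 ≤ 2 := by
      have : (cnt : ℝ) / B ≤ 1 := div_le_one_of_le₀ hcB (by linarith)
      linarith
    have hBB : (B : ℝ) / B + 1 = 2 := by rw [div_self (by linarith)]; norm_num
    have h1 : (((N : ℝ) + N) / B + 1) * (B / B + 1) * (cnt / B + 1) * (B : ℝ) ^ ω ≤ 12 * Y := by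
      calc _ ≤ (3 * N / B) * 2 * 2 * (Y / N * B) := by
            rw [hBB]
            have : (0:ℝ) ≤ cnt / B + 1 := by positivity
            gcongr
        _ = 12 * Y := by field_simp; ring
    have h2 : ((N : ℝ) + N + 1) * (B + 1) ≤ 6 * Y := by nlinarith
    have h3 : ((B : ℝ) + 1) * (cnt + 1) ≤ 4 * Y := by nlinarith
    have h4 : ((N : ℝ) + N + 1) * (cnt + 1) ≤ 6 * Y := by nlinarith
    have h5 : 20 * (C + 100000) * ((((N : ℝ) + N) / B + 1) * (B / B + 1) * (cnt / B + 1) *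
        (B : ℝ) ^ ω) ≤ 20 * (C + 100000) * (12 * Y) := by gcongr
    have hY1 : 1 ≤ Y := by nlinarith
    have h6 : 0 ≤ C * Y := by positivity
    linarith
  · exact Sim.setVT_left (Sim.setVT_left (Sim.setVT_left (Sim.setVT_left (Sim.setI_left
      (Sim.setI_left (Sim.setI_left (.refl _ _ _) (by norm_num) _) (by norm_num) _) (by norm_num) _)
      (by norm_num) _) (by norm_num) _) (by norm_num) _) (by norm_num) _
  · rfl
  · exact e60
  · exact r64
  · intro a ha j hj
    have e7 : s6.valTab 60 = s.valTab 60 := by simp [hs6, hs5, hs4, hs3, hs2, hs1]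
    simp only [Store.setVT_valTab, if_true, fillFun, e7, zero_le, true_and, zero_add, applied,
      Nat.sub_zero]
    by_cases hj1 : i + 1 ≤ j ∧ j < i + 1 + B
    · have hc : j < i + 1 + cnt := by omega
      rw [if_pos ⟨ha, hj1.1, hc⟩, if_pos hj1, hX a ha _ (by omega), Nat.add_sub_cancel' hj1.1,
        applied_before hj1.1 hj1.2, ← hB, ← hlo]
      have e8 : f6 a (j - (i + 1)) = ∑ k ∈ Finset.range B, elim X (lo + k) a *
          (elim X (lo + k) j / elim X (lo + k) (lo + k)) := by
        rw [hf6, fillFun, if_pos (by omega)]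
        refine Finset.sum_congr rfl fun k hk => ?_
        have hk' := Finset.mem_range.1 hk
        have e9 : s5.valTab 61 = f4 := by simp [hs5, hs4]
        have e10 : s5.valTab 62 = f5 := by simp [hs5]
        rw [e9, e10, hf4, hf5, fillFun, fillFun, if_pos (by omega), if_pos (by omega)]
        simp only [Nat.sub_zero]
        rw [hX _ ha _ (by omega), hX _ (by omega) _ (by omega), hX _ (by omega) _ (by omega),
          applied_of_le (by omega), elimPart_self, elimPart_self, elimPart_self,
          Nat.add_sub_cancel' hj1.1]
      rw [e8, elimPart, elimPart, show i + 1 = lo + B by omega, Finset.sum_range_add]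
      ring
    · rw [if_neg (by omega), if_neg hj1, hX a ha j hj]

/-- Step i costs N^(ω-1) times `lowb (i + 1)`, and these sum to N^ω (log₂ N + 1) by `sum_lowb_le`.
One further product forms R (D⁻¹ Rᵀ) as in `elim_inverse`. -/
theorem Tri.invert {ω C : ℝ} (hω : 2 ≤ ω) (hC : 0 ≤ C) {P : Prog} (hP : IsMulProg ω C P)
    (hL : L ≤ 60) {n a c N : ℕ} (hn : n < L) (ha : a < L) (hc : c < L) (s : Store)
    (hN : s.idx n = N) (hN1 : 1 ≤ N)
    (hpos : (Matrix.of fun i j : Fin N => s.valTab a i j).PosDef) :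
    ∃ f, (∀ i j : Fin N, f i j = (Matrix.of fun i j : Fin N => s.valTab a i j)⁻¹ i j) ∧
      Tri false L (invert P n a c) s (20000 * (C + 100000) * ((N : ℝ) ^ ω * (Nat.log 2 N + 1)))
        (s.setVT c f) := by
  set M := Matrix.of fun i j : Fin N => s.valTab a i j with hM
  refine ⟨fillFun (s.valTab c) 0 0 N N fun i j => if h : i < N ∧ j < N then
    M⁻¹ ⟨i, h.1⟩ ⟨j, h.2⟩ else 0, fun i j => by simp [fillFun], ?_⟩
  refine Tri.lower (L' := 100) (by omega) fun σ hσ => ?_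
  have pred : ∀ {v : ℕ}, 60 ≤ v → n ≠ v := by omega
  have preda : ∀ {v : ℕ}, 60 ≤ v → a ≠ v := by omega
  have predc : ∀ {v : ℕ}, 60 ≤ v → c ≠ v := by omega
  have iN : σ.idx n = N := (hσ.idx n hn).trans hN
  -- the table of the powers of two
  obtain ⟨s1, ⟨h1a, h1b, h1c⟩, t1⟩ := Tri.forLoop (b := false) (L := 100) (by norm_num) (a := 60)
    (n := n) (by norm_num) (by omega) (P := .seq
    (RealRAM.storeI 60 (.add (.reg 60) (.reg 60)) (.lit 0)
      (.add (.ld 60 (.reg 60) (.lit 0)) (.ld 60 (.reg 60) (.lit 0))))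
    (RealRAM.storeI 60 (.add (.add (.reg 60) (.reg 60)) (.lit 1)) (.lit 0) (.lit 1))) (N := N)
    (c := 40) (by norm_num)
    (fun m s' => s'.idx 60 = m ∧ Sim false 60 s' σ ∧
      ∀ j, 1 ≤ j → j < m + m → s'.idxTab 60 j 0 = lowb j)
    (fun m s' h => ⟨h.1, (h.2.1.idx n (by omega)).trans iN⟩)
    (by
      rintro m hm s' ⟨h1, h2, h3⟩
      have u1 := Tri.storeI (b := false) (L := 100) (by norm_num) 60
        (.add (.reg 60) (.reg 60)) (.lit 0)
        (.add (.ld 60 (.reg 60) (.lit 0)) (.ld 60 (.reg 60) (.lit 0))) rfl rfl rfl (by norm_num) s'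
      have u2 := Tri.storeI (b := false) (L := 100) (by norm_num) 60
        (.add (.add (.reg 60) (.reg 60)) (.lit 1)) (.lit 0) (.lit 1) rfl rfl rfl (by norm_num)
        (s'.setIT 60 (upd (s'.idxTab 60) (m + m) 0 (s'.idxTab 60 m 0 + s'.idxTab 60 m 0)))
      simp only [IE.eval, h1] at u1
      simp only [IE.eval, h1, Store.setIT_idx] at u2
      refine ⟨_, (u1.seq u2).mono (by norm_num [IE.cost]), h1, by simp, ?_, ?_⟩
      · exact Sim.setI_left (Sim.setIT_left (Sim.setIT_left h2 le_rfl _) le_rfl _) le_rfl _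
      · intro j hj1 hj2
        simp only [Store.setI_idxTab, Store.setIT_idxTab, if_true, upd, and_true]
        by_cases e1 : j = m + m + 1
        · rw [if_pos e1, e1, lowb_odd]
        · rw [if_neg e1]
          by_cases e2 : j = m + m
          · rw [if_pos e2, e2, h3 m (by omega) (by omega), lowb_two_mul (by omega)]
          · rw [if_neg e2, h3 j hj1 (by omega)])
    (s := σ) ⟨by simp, Sim.setI_left (.refl _ _ _) le_rfl _, by intro j h1 h2; omega⟩
  have t2 := Tri.assignI (b := false) (L := 100) (by norm_num) 64 (by norm_num)
    (.add (.reg n) (.reg n)) (by simp [IE.Ok, okReg]; omega) s1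
  have n1 : s1.idx n = N := (h1b.idx n (by omega)).trans iN
  simp only [IE.eval, n1] at t2
  set s2 := s1.setI 64 (N + N) with hs2
  have n2 : s2.idx n = N := by simp [hs2, pred, n1]
  have t3 := Tri.fill (b := false) (L := 100) 60 (by norm_num) (by norm_num) (.lit 0) (.lit 0)
    (.reg 64) (.reg n) (.lit 1) (.ite .I (.reg n) (.ld a .I .J) (.ite (.sub .I (.reg n)) .J
      (.nat (.lit 0)) (.ite .J (.sub .I (.reg n)) (.nat (.lit 0)) (.nat (.lit 1))))) rfl rfl rfl
    (by simp [IE.Ok, okReg]; omega) rfl (by simp [RE.Ok, IE.Ok, IE.I, IE.J, okReg]; omega) s2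
    (fun i j _ => stack N (s.valTab a) i j)
    (by
      intro i _ j _ _ _ g _
      have e1 : s1.valTab a = s.valTab a := (h1b.valTab a (by omega)).trans (hσ.valTab a ha)
      simp [RE.eval, IE.eval, IE.I, IE.J, pred, preda, hs2, e1, n1, stack]
      rcases lt_or_ge i N with h | h
      · simp [h]
      · rcases lt_trichotomy (i - N) j with h2 | h2 | h2
        · simp [h.not_gt, h2, h2.ne]
        · simp [h2]
        · simp [h.not_gt, h2, h2.ne', h2.not_gt]) (by norm_num)
  have r2 : s2.idx 64 = N + N := by simp [hs2]
  simp only [IE.eval, n2, r2, Finset.sum_range_one] at t3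
  set f3 := fillFun (s2.valTab 60) 0 0 (N + N) N fun i j => stack N (s.valTab a) i j with hf3
  set s3 := s2.setVT 60 f3 with hs3
  have S3 : Sim false 60 s3 σ := Sim.setVT_left (Sim.setI_left h1b (by norm_num) _) le_rfl _
  obtain ⟨s4, ⟨h4a, h4b, h4c, h4d, h4e⟩, t4⟩ := Tri.forLoop' (b := false) (L := 100) (by norm_num)
    (a := 60) (n := n) (by norm_num) (by omega) (P := RealRAM.elimStep P n) (N := N)
    (c := fun i => 3000 * (C + 100000) * ((N : ℝ) ^ (ω - 1) * lowb (i + 1)))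
    (fun m s' => s'.idx 60 = m ∧ s'.idx 64 = N + N ∧ Sim false 60 s' σ ∧
      (∀ j, 1 ≤ j → j < N + N → s'.idxTab 60 j 0 = lowb j) ∧
      ∀ a' < N + N, ∀ j < N, s'.valTab 60 a' j =
        elimPart (stack N (s.valTab a)) (applied m j) a' j)
    (fun m s' h => ⟨h.1, (h.2.2.1.idx n (by omega)).trans iN⟩)
    (by
      rintro m hm s' ⟨h1, h2, h3, h4, h5⟩
      obtain ⟨s'', u, v1, v2, v3, v4, v5⟩ := Tri.elimStep hω hC hP (n := n) (by omega) s'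
        (stack N (s.valTab a)) m hm h1 h2 ((h3.idx n (by omega)).trans iN)
        (h4 (m + 1) (by omega) (by omega)) h5
      refine ⟨s'', u, v3, by simp, by simpa using v4, Sim.setI_left (v1.trans h3) le_rfl _, ?_, ?_⟩
      · simpa [v2] using h4
      · simpa using v5)
    (s := s3) ⟨by simp, r2, Sim.setI_left S3 le_rfl _, fun j h1 h2 => h1c j h1 h2, by
      intro a' ha' j hj
      simp [hs3, hf3, fillFun, ha', hj, applied, elimPart]⟩
  have n4 : s4.idx n = N := (h4c.idx n (by omega)).trans iN
  have t5 := Tri.fill (b := false) (L := 100) 61 (by norm_num) (by norm_num) (.lit 0) (.lit 0)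
    (.reg n) (.reg n) (.lit 1) (.ld 60 (.add (.reg n) .I) .J) rfl rfl
    (by simp [IE.Ok, okReg]; omega) (by simp [IE.Ok, okReg]; omega) rfl
    (by simp [RE.Ok, IE.Ok, IE.I, IE.J, okReg]; omega) s4
    (fun i j _ => elim (stack N (s.valTab a)) j (N + i))
    (by
      intro i hi j hj _ _ g _
      simp only [IE.eval, n4] at hi hj
      simp [RE.eval, IE.eval, IE.I, IE.J, pred, n4]
      rw [h4e _ (by omega) _ hj, applied_of_le (by omega), elimPart_self]) (by norm_num)
  simp only [IE.eval, n4, Finset.sum_range_one] at t5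
  set f5 := fillFun (s4.valTab 61) 0 0 N N fun i j => elim (stack N (s.valTab a)) j (N + i) with hf5
  set s5 := s4.setVT 61 f5 with hs5
  have n5 : s5.idx n = N := n4
  have t6 := Tri.fill (b := false) (L := 100) 62 (by norm_num) (by norm_num) (.lit 0) (.lit 0)
    (.reg n) (.reg n) (.lit 1) (.div (.ld 60 (.add (.reg n) .J) .I) (.ld 60 .I .I)) rfl rfl
    (by simp [IE.Ok, okReg]; omega) (by simp [IE.Ok, okReg]; omega) rfl
    (by simp [RE.Ok, IE.Ok, IE.I, IE.J, okReg]; omega) s5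
    (fun i j _ => elim (stack N (s.valTab a)) i (N + j) / elim (stack N (s.valTab a)) i i)
    (by
      intro i hi j hj _ _ g _
      simp only [IE.eval, n5] at hi hj
      simp [RE.eval, IE.eval, IE.I, IE.J, pred, hs5, n4]
      rw [h4e _ (by omega) _ hi, applied_of_le (by omega), elimPart_self, h4e _ (by omega) _ hi,
        applied_of_le (by omega), elimPart_self]) (by norm_num)
  simp only [IE.eval, n5, Finset.sum_range_one] at t6
  set f6 := fillFun (s5.valTab 62) 0 0 N N fun i j =>
    elim (stack N (s.valTab a)) i (N + j) / elim (stack N (s.valTab a)) i i with hf6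
  set s6 := s5.setVT 62 f6 with hs6
  have n6 : s6.idx n = N := n4
  have t7 := Tri.matMul (L := 100) hω hC hP le_rfl (a := 61) (b := 62) (c := c) (p := n)
    (q := n) (r := n) (bs := n) (by norm_num) (by norm_num) (by omega) (by omega)
    (by omega) (by omega) (by omega) (by omega) (by omega) s6 (by rw [n6]; exact hN1)
  rw [n6] at t7
  refine ⟨_, (t1.seq (t2.seq (t3.seq (t4.seq (t5.seq (t6.seq t7)))))).mono ?_, ?_⟩
  · have hNr : (1 : ℝ) ≤ N := by exact_mod_cast hN1
    set l : ℝ := (Nat.log 2 N : ℝ) + 1 with hl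
    have hl1 : 1 ≤ l := by rw [hl]; linarith [(Nat.cast_nonneg (Nat.log 2 N) : (0:ℝ) ≤ _)]
    set Y : ℝ := (N : ℝ) ^ ω with hY
    have hNY : (N : ℝ) ^ 2 ≤ Y := by
      rw [hY, ← Real.rpow_natCast]
      exact Real.rpow_le_rpow_of_exponent_le hNr (by simpa using hω)
    have hsum : (∑ m ∈ Finset.range N, (3000 * (C + 100000) *
        ((N : ℝ) ^ (ω - 1) * lowb (m + 1)) + 7)) ≤ 3000 * (C + 100000) * (Y * l) + 7 * N := by
      rw [Finset.sum_add_distrib, ← Finset.mul_sum, ← Finset.mul_sum]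
      have h1 : (∑ m ∈ Finset.range N, (lowb (m + 1) : ℝ)) ≤ N * l := by
        rw [hl]; exact_mod_cast sum_lowb_le N
      have h2 : Y = (N : ℝ) ^ (ω - 1) * N := by
        rw [hY, ← Real.rpow_add_one (by linarith)]; congr 1; ring
      rw [h2, mul_assoc ((N : ℝ) ^ (ω - 1))]
      have h3 : (∑ m ∈ Finset.range N, (7 : ℝ)) = 7 * N := by simp [mul_comm]
      rw [h3]
      gcongr
    simp only [fillK, IE.cost, RE.cost, IE.I, IE.J]
    rw [div_self (by linarith : (N : ℝ) ≠ 0)]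
    norm_num
    have hYl : Y ≤ Y * l := le_mul_of_one_le_right (by positivity) hl1
    have hCY : 0 ≤ C * (Y * l) := by positivity
    have hCY' : C * Y ≤ C * (Y * l) := by gcongr
    have hNN : (N : ℝ) ≤ Y * l := by nlinarith
    have h9 : ((N : ℝ) + 1) * (N + 1) ≤ 4 * (Y * l) := by nlinarith
    have h10 : ((N : ℝ) + N + 1) * (N + 1) ≤ 6 * (Y * l) := by nlinarith
    have h11 : 1 ≤ Y * l := by nlinarith
    linarith
  · have hinv := elim_inverse (N := N) (f := s.valTab a) hpos
    have hfin : fillFun (s6.valTab c) 0 0 N N (fun i j => ∑ k ∈ Finset.range N,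
        s6.valTab 61 i k * s6.valTab 62 k j) = fillFun (s.valTab c) 0 0 N N fun i j =>
        if h : i < N ∧ j < N then M⁻¹ ⟨i, h.1⟩ ⟨j, h.2⟩ else 0 := by
      have ec : s6.valTab c = s.valTab c := by
        simp only [hs6, hs5, Store.setVT_valTab, predc (show 60 ≤ 62 by norm_num),
          predc (show 60 ≤ 61 by norm_num), if_false]
        exact (h4c.valTab c (by omega)).trans (hσ.valTab c hc)
      funext i j
      rw [ec]
      simp only [fillFun, zero_le, true_and, zero_add, Nat.sub_zero]
      by_cases h : i < N ∧ j < N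
      · rw [if_pos h, if_pos h, dif_pos h, hM, hinv]
        simp only [Matrix.of_apply]
        refine Finset.sum_congr rfl fun k hk => ?_
        have hk' := Finset.mem_range.1 hk
        simp [hs6, hs5, hf5, hf6, fillFun, h.1, h.2, hk']
      · rw [if_neg h, if_neg h]
    rw [hfin]
    refine Sim.trans ?_ (hσ.setVT c _)
    refine Sim.setVT ?_ c _
    refine (Sim.mono ?_ (show L ≤ 60 from hL))
    exact Sim.setVT_left (Sim.setVT_left h4c (by norm_num) _) (by norm_num) _

end RealRAM

namespace InverseMaintenance

/-! ### Random signs -/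

def sgn (b : Bool) : ℝ := if b then 1 else -1

def signSum {N : ℕ} (x : Fin N → ℝ) (e : Fin N → Bool) : ℝ := ∑ j, sgn (e j) * x j

theorem sum_bool_cons {N : ℕ} (f : (Fin (N + 1) → Bool) → ℝ) :
    ∑ e, f e = ∑ e : Fin N → Bool, (f (Fin.cons true e) + f (Fin.cons false e)) := by
  rw [← (Fin.consEquiv fun _ => Bool).sum_comp, Fintype.sum_prod_type_right]
  refine Finset.sum_congr rfl fun e _ => ?_
  rw [Fintype.sum_bool]
  rfl

theorem signSum_cons {N : ℕ} (x : Fin (N + 1) → ℝ) (b : Bool) (e : Fin N → Bool) :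
    signSum x (Fin.cons b e) = sgn b * x 0 + signSum (Fin.tail x) e := by
  simp [signSum, Fin.sum_univ_succ, Fin.tail]

theorem sum_signSum_sq {N : ℕ} (x : Fin N → ℝ) :
    ∑ e, signSum x e ^ 2 = 2 ^ N * ∑ j, x j ^ 2 := by
  induction N with
  | zero => simp [signSum]
  | succ N ih =>
    rw [sum_bool_cons, Fin.sum_univ_succ]
    have h : ∀ e : Fin N → Bool, signSum x (Fin.cons true e) ^ 2 +
        signSum x (Fin.cons false e) ^ 2 = 2 * signSum (Fin.tail x) e ^ 2 + 2 * x 0 ^ 2 := by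
      intro e
      simp only [signSum_cons, sgn]
      norm_num
      ring
    simp only [h, Finset.sum_add_distrib, ← Finset.mul_sum, ih]
    simp [Fin.tail]
    ring

/-- Averaging over the first sign removes the odd powers of its term, and the resulting recursion
stays below 3 (Σ xⱼ²)². -/
theorem sum_signSum_pow_four {N : ℕ} (x : Fin N → ℝ) :
    ∑ e, signSum x e ^ 4 ≤ 2 ^ N * (3 * (∑ j, x j ^ 2) ^ 2) := by
  induction N with
  | zero => simp [signSum]
  | succ N ih =>
    rw [sum_bool_cons, Fin.sum_univ_succ]
    have h : ∀ e : Fin N → Bool, signSum x (Fin.cons true e) ^ 4 +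
        signSum x (Fin.cons false e) ^ 4 = 2 * signSum (Fin.tail x) e ^ 4 +
          12 * x 0 ^ 2 * signSum (Fin.tail x) e ^ 2 + 2 * x 0 ^ 4 := by
      intro e
      simp only [signSum_cons, sgn]
      norm_num
      ring
    simp only [h, Finset.sum_add_distrib, ← Finset.mul_sum, sum_signSum_sq]
    have := ih (Fin.tail x)
    have e0 : ∑ j, Fin.tail x j ^ 2 = ∑ j : Fin N, x j.succ ^ 2 := rfl
    rw [e0] at this ⊢
    set S := ∑ j : Fin N, x j.succ ^ 2
    simp
    have hp : (0:ℝ) < 2 ^ N := by positivity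
    have h4 : 0 ≤ (2:ℝ) ^ N * x 0 ^ 4 := by positivity
    rw [show (2:ℝ) ^ (N + 1) = 2 ^ N * 2 from pow_succ _ _]
    nlinarith

/-- A sub-gaussian bound for the square of a sum of random signs. -/
theorem sum_exp_signSum {N : ℕ} (x : Fin N → ℝ) : ∀ (l : ℝ), 0 ≤ l →
    2 * l * ∑ j, x j ^ 2 < 1 → ∑ e, Real.exp (l * signSum x e ^ 2) ≤
      2 ^ N * Real.exp (l * (∑ j, x j ^ 2) / (1 - 2 * l * ∑ j, x j ^ 2)) := by
  induction N with
  | zero => intro l hl h; simp [signSum]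
  | succ N ih =>
    intro l hl h
    rw [sum_bool_cons]
    rw [Fin.sum_univ_succ] at h ⊢
    set S := ∑ j : Fin N, x j.succ ^ 2 with hS
    set u := x 0 ^ 2 with hu
    have hS0 : 0 ≤ S := Finset.sum_nonneg fun _ _ => sq_nonneg _
    have hu0 : 0 ≤ u := sq_nonneg _
    -- Averaging exp(l (y ± x₀)²) over the sign gives exp(l u + l y²) cosh(2 l x₀ y), and cosh t ≤
    -- exp(t²/2) turns this into exp(l u + l' y²). The induction hypothesis is then applied with l'.
    set l' := l * (1 + 2 * l * u) with hl'
    have hl'0 : 0 ≤ l' := by positivity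
    have hlu : 0 ≤ l * u := by positivity
    have hlS : 0 ≤ l * S := by positivity
    have hstep : ∀ e : Fin N → Bool, Real.exp (l * signSum x (Fin.cons true e) ^ 2) +
        Real.exp (l * signSum x (Fin.cons false e) ^ 2) ≤
        2 * Real.exp (l * u) * Real.exp (l' * signSum (Fin.tail x) e ^ 2) := by
      intro e
      set y := signSum (Fin.tail x) e
      have e1 : l * signSum x (Fin.cons true e) ^ 2 = (l * u + l * y ^ 2) + 2 * l * x 0 * y := by
        simp only [signSum_cons, sgn, hu]; norm_num; ring
      have e2 : l * signSum x (Fin.cons false e) ^ 2 =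
          (l * u + l * y ^ 2) + -(2 * l * x 0 * y) := by
        simp only [signSum_cons, sgn, hu]; norm_num; ring
      rw [e1, e2, Real.exp_add, Real.exp_add _ (-_), ← mul_add]
      have e3 := Real.cosh_le_exp_half_sq (2 * l * x 0 * y)
      rw [Real.cosh_eq] at e3
      calc _ ≤ Real.exp (l * u + l * y ^ 2) * (2 * Real.exp ((2 * l * x 0 * y) ^ 2 / 2)) := by
            gcongr; linarith
        _ = 2 * Real.exp (l * u) * Real.exp (l' * y ^ 2) := by
            have h5 : l * u + l * y ^ 2 + (2 * l * x 0 * y) ^ 2 / 2 = l * u + l' * y ^ 2 := by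
              rw [hl', hu]; ring
            rw [mul_left_comm, ← Real.exp_add, h5, Real.exp_add, ← mul_assoc]
    have hden : 0 < 1 - 2 * l * (u + S) := by linarith
    have hcond : 2 * l' * S < 1 := by
      rw [hl']
      have h1 : 2 * (l * S) < 1 - 2 * (l * u) := by linarith
      have h2 : 2 * (l * S) * (1 + 2 * (l * u)) ≤ (1 - 2 * (l * u)) * (1 + 2 * (l * u)) := by
        gcongr
      by_cases h0 : l * u = 0
      · nlinarith
      · have : 0 < l * u := lt_of_le_of_ne hlu (Ne.symm h0)
        nlinarith
    have hIH := ih (Fin.tail x) l' hl'0 hcond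
    have e0 : ∑ j, Fin.tail x j ^ 2 = S := rfl
    rw [e0] at hIH
    have hfin : l * u + l' * S / (1 - 2 * l' * S) ≤ l * (u + S) / (1 - 2 * l * (u + S)) := by
      have hd' : 0 < 1 - 2 * l' * S := by linarith
      have k1 : l' * S / (1 - 2 * l' * S) ≤ l * S / (1 - 2 * l * (u + S)) := by
        rw [div_le_div_iff₀ hd' hden]
        have : l' * S * (1 - 2 * l * (u + S)) - l * S * (1 - 2 * l' * S) =
          -(4 * (l * u) ^ 2 * (l * S)) := by rw [hl']; ring
        nlinarith [mul_nonneg (sq_nonneg (l * u)) hlS]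
      have k2 : l * u ≤ l * u / (1 - 2 * l * (u + S)) := by
        rw [le_div_iff₀ hden]; nlinarith
      have : l * (u + S) / (1 - 2 * l * (u + S)) = l * u / (1 - 2 * l * (u + S)) +
        l * S / (1 - 2 * l * (u + S)) := by rw [mul_add, add_div]
      linarith
    calc _ ≤ ∑ e : Fin N → Bool, 2 * Real.exp (l * u) *
          Real.exp (l' * signSum (Fin.tail x) e ^ 2) := Finset.sum_le_sum fun e _ => hstep e
      _ = 2 * Real.exp (l * u) * ∑ e, Real.exp (l' * signSum (Fin.tail x) e ^ 2) := by
          rw [Finset.mul_sum]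
      _ ≤ 2 * Real.exp (l * u) * (2 ^ N * Real.exp (l' * S / (1 - 2 * l' * S))) := by gcongr
      _ = 2 ^ (N + 1) * Real.exp (l * u + l' * S / (1 - 2 * l' * S)) := by
          rw [Real.exp_add, pow_succ]; ring
      _ ≤ _ := by gcongr

/-- Use exp(-t) ≤ 1 - t + t²/2 with t = s²/3. The second moment is 1 and the fourth at most 3, so
the mean is at most 1 - 1/3 + 3/18 = 5/6. -/
theorem sum_exp_neg_signSum {N : ℕ} (x : Fin N → ℝ) (hx : ∑ j, x j ^ 2 = 1) :
    ∑ e, Real.exp (-(signSum x e ^ 2 / 3)) ≤ 2 ^ N * (5 / 6) := by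
  have h : ∀ t : ℝ, 0 ≤ t → Real.exp (-t) ≤ 1 - t + t ^ 2 / 2 := by
    intro t ht
    rw [Real.exp_neg, inv_le_iff_one_le_mul₀ (Real.exp_pos t)]
    have := Real.quadratic_le_exp_of_nonneg ht
    have h2 : 0 < 1 - t + t ^ 2 / 2 := by nlinarith [sq_nonneg (t - 1)]
    calc (1:ℝ) ≤ (1 - t + t ^ 2 / 2) * (1 + t + t ^ 2 / 2) := by nlinarith [sq_nonneg (t ^ 2)]
      _ ≤ _ := by gcongr
  calc _ ≤ ∑ e, (1 - signSum x e ^ 2 / 3 + signSum x e ^ 4 / 18) := by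
        refine Finset.sum_le_sum fun e _ => (h _ (by positivity)).trans (le_of_eq ?_)
        ring
    _ = 2 ^ N - (∑ e, signSum x e ^ 2) / 3 + (∑ e, signSum x e ^ 4) / 18 := by
        rw [Finset.sum_add_distrib, Finset.sum_sub_distrib, Finset.sum_div, Finset.sum_div]
        simp
    _ ≤ _ := by
        have := sum_signSum_pow_four x
        rw [sum_signSum_sq, hx]
        rw [hx] at this
        linarith

/-- The squared length of the sketch of `x` by the sign matrix `w`. -/
def sketchSq {m N : ℕ} (w : Fin m → Fin N → Bool) (x : Fin N → ℝ) : ℝ :=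
  ∑ l, signSum x (w l) ^ 2

/-- Chernoff bound with exponent 1/4: each row contributes a mean of at most e^(1/2) against the
threshold factor e^(-1), which leaves e^(-m/2). Probabilities are expressed as counts of sign
matrices. -/
theorem card_sketch_large {m N : ℕ} (x : Fin N → ℝ) (hx : ∑ j, x j ^ 2 = 1) :
    ((Finset.univ.filter fun w : Fin m → Fin N → Bool => 4 * m < sketchSq w x).card : ℝ) ≤
      2 ^ (N * m) * Real.exp (-(m / 12 : ℝ)) := by
  have h1 : ((Finset.univ.filter fun w : Fin m → Fin N → Bool => 4 * m < sketchSq w x).card : ℝ) ≤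
      ∑ w : Fin m → Fin N → Bool, Real.exp (-m) * ∏ l, Real.exp (1 / 4 * signSum x (w l) ^ 2) := by
    rw [Finset.card_filter, Nat.cast_sum]
    refine Finset.sum_le_sum fun w _ => ?_
    rw [← Real.exp_sum, ← Finset.mul_sum, ← Real.exp_add]
    split_ifs with h
    · rw [Nat.cast_one]
      refine Real.one_le_exp ?_
      simp only [sketchSq] at h
      linarith
    · simpa using (Real.exp_pos _).le
  refine h1.trans ?_
  rw [← Finset.mul_sum, ← Fintype.sum_pow (fun e => Real.exp (1 / 4 * signSum x e ^ 2))]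
  have h2 := sum_exp_signSum x (1 / 4) (by norm_num) (by rw [hx]; norm_num)
  rw [hx] at h2
  calc _ ≤ Real.exp (-m) * (2 ^ N * Real.exp (1 / 4 * 1 / (1 - 2 * (1 / 4) * 1))) ^ m := by
        gcongr
    _ = 2 ^ (N * m) * Real.exp (-(m / 2 : ℝ)) := by
        rw [mul_pow, ← pow_mul, ← Real.exp_nat_mul, mul_left_comm, ← Real.exp_add]
        congr 2; ring
    _ ≤ _ := by
        gcongr
        have : (0:ℝ) ≤ m := Nat.cast_nonneg _
        linarith

/-- Chernoff bound with exponent -1/3: the threshold m/4 costs e^(m/12), each row gains 5/6 ≤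
e^(-1/6), and e^(-m/12) remains. -/
theorem card_sketch_small {m N : ℕ} (x : Fin N → ℝ) (hx : ∑ j, x j ^ 2 = 1) :
    ((Finset.univ.filter fun w : Fin m → Fin N → Bool => sketchSq w x < m / 4).card : ℝ) ≤
      2 ^ (N * m) * Real.exp (-(m / 12 : ℝ)) := by
  have h1 : ((Finset.univ.filter fun w : Fin m → Fin N → Bool =>
      sketchSq w x < m / 4).card : ℝ) ≤
      ∑ w : Fin m → Fin N → Bool, Real.exp (m / 12) * ∏ l, Real.exp (-(signSum x (w l) ^ 2 / 3)) := by
    rw [Finset.card_filter, Nat.cast_sum]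
    refine Finset.sum_le_sum fun w _ => ?_
    rw [← Real.exp_sum, Finset.sum_neg_distrib, ← Finset.sum_div, ← Real.exp_add]
    split_ifs with h
    · rw [Nat.cast_one]
      refine Real.one_le_exp ?_
      simp only [sketchSq] at h
      linarith
    · simpa using (Real.exp_pos _).le
  refine h1.trans ?_
  rw [← Finset.mul_sum, ← Fintype.sum_pow (fun e => Real.exp (-(signSum x e ^ 2 / 3)))]
  have h2 := sum_exp_neg_signSum x hx
  have h3 : (5 / 6 : ℝ) ≤ Real.exp (-(1 / 6)) := by
    have := Real.add_one_le_exp (-(1 / 6) : ℝ)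
    linarith
  calc _ ≤ Real.exp (m / 12) * (2 ^ N * Real.exp (-(1 / 6))) ^ m := by
        gcongr
        exact h2.trans (by gcongr)
    _ = 2 ^ (N * m) * Real.exp (-(m / 12 : ℝ)) := by
        rw [mul_pow, ← pow_mul, ← Real.exp_nat_mul, mul_left_comm, ← Real.exp_add]
        congr 2; ring

theorem signSum_smul {N : ℕ} (c : ℝ) (x : Fin N → ℝ) (e : Fin N → Bool) :
    signSum (fun j => c * x j) e = c * signSum x e := by
  simp only [signSum, Finset.mul_sum]
  refine Finset.sum_congr rfl fun j _ => by ring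

/-- The sketch `w` distorts the length of `x` by at most a constant factor. -/
def VecGood {m N : ℕ} (w : Fin m → Fin N → Bool) (x : Fin N → ℝ) : Prop :=
  m / 4 * ∑ j, x j ^ 2 ≤ sketchSq w x ∧ sketchSq w x ≤ 4 * m * ∑ j, x j ^ 2

theorem card_not_vecGood {m N : ℕ} (x : Fin N → ℝ) :
    ({w : Fin m → Fin N → Bool | ¬ VecGood w x}.ncard : ℝ) ≤
      2 ^ (N * m) * (2 * Real.exp (-(m / 12 : ℝ))) := by
  classical
  by_cases h0 : ∑ j, x j ^ 2 = 0
  · have hx : ∀ j, x j = 0 := fun j => by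
      have := (Finset.sum_eq_zero_iff_of_nonneg fun i _ => sq_nonneg (x i)).1 h0 j
        (Finset.mem_univ j)
      simpa using this
    have : {w : Fin m → Fin N → Bool | ¬ VecGood w x} = ∅ := by
      ext w
      simp [VecGood, sketchSq, signSum, hx]
    rw [this]
    simp only [Set.ncard_empty, Nat.cast_zero]
    positivity
  · have hpos : 0 < ∑ j, x j ^ 2 :=
      lt_of_le_of_ne (Finset.sum_nonneg fun _ _ => sq_nonneg _) (Ne.symm h0)
    set S := ∑ j, x j ^ 2 with hS
    set c := (Real.sqrt S)⁻¹ with hc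
    have hc2 : c ^ 2 * S = 1 := by
      rw [hc, inv_pow, Real.sq_sqrt hpos.le, inv_mul_cancel₀ h0]
    have hx1 : ∑ j, (c * x j) ^ 2 = 1 := by
      simp only [mul_pow, ← Finset.mul_sum]
      exact hc2
    have hsk : ∀ w : Fin m → Fin N → Bool, sketchSq w (fun j => c * x j) = c ^ 2 * sketchSq w x := by
      intro w
      simp only [sketchSq, signSum_smul, mul_pow, ← Finset.mul_sum]
    have hsub : {w : Fin m → Fin N → Bool | ¬ VecGood w x} ⊆
        ↑((Finset.univ.filter fun w : Fin m → Fin N → Bool =>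
          4 * m < sketchSq w (fun j => c * x j)) ∪
        (Finset.univ.filter fun w : Fin m → Fin N → Bool =>
          sketchSq w (fun j => c * x j) < m / 4)) := by
      intro w hw
      simp only [Finset.coe_union, Finset.coe_filter, Finset.mem_univ, true_and, Set.mem_union,
        Set.mem_ofPred_eq, hsk]
      by_contra hcon
      push Not at hcon
      apply hw
      have hS' : sketchSq w x = S * (c ^ 2 * sketchSq w x) := by
        rw [← mul_assoc, mul_comm S, hc2, one_mul]
      constructor
      · rw [hS']; nlinarith
      · rw [hS']; nlinarith
    have h1 := Set.ncard_le_ncard hsub (Finset.finite_toSet _)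
    rw [Set.ncard_coe_finset] at h1
    have h2 := h1.trans (Finset.card_union_le _ _)
    have h3 := card_sketch_large (m := m) (fun j => c * x j) hx1
    have h4 := card_sketch_small (m := m) (fun j => c * x j) hx1
    have h5 : ({w : Fin m → Fin N → Bool | ¬ VecGood w x}.ncard : ℝ) ≤ _ := Nat.cast_le.2 h2
    push_cast at h5
    linarith

/-! ### A net -/

section Net

variable {r m : ℕ}

/-- A linear map that distorts the lengths of all grid points by at most a constant factor distorts
all lengths by at most a constant factor. -/
theorem norm_bounds_of_grid {E F : Type*} [NormedAddCommGroup E] [InnerProductSpace ℝ E]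
    [NormedAddCommGroup F] [InnerProductSpace ℝ F] [FiniteDimensional ℝ E]
    (T : E →L[ℝ] F) (M : ℝ) (hM : 0 ≤ M) (Z : Set E)
    (hZ : ∀ y : E, ‖y‖ = 1 → ∃ z ∈ Z, ‖y - z‖ ≤ 1 / 10)
    (h1 : ∀ z ∈ Z, M / 2 * ‖z‖ ≤ ‖T z‖) (h2 : ∀ z ∈ Z, ‖T z‖ ≤ 2 * M * ‖z‖) (y : E) :
    M / 5 * ‖y‖ ≤ ‖T y‖ ∧ ‖T y‖ ≤ 5 / 2 * M * ‖y‖ := by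
  have key : ∀ y : E, ‖y‖ = 1 → ‖T y‖ ≤ 11 / 5 * M + ‖T‖ / 10 ∧
      9 / 20 * M - ‖T‖ / 10 ≤ ‖T y‖ := by
    intro y hy
    obtain ⟨z, hz, hyz⟩ := hZ y hy
    have e1 : ‖T (y - z)‖ ≤ ‖T‖ / 10 := (T.le_opNorm _).trans (by nlinarith [norm_nonneg T])
    rw [map_sub] at e1
    have n1 : ‖z‖ ≤ 11 / 10 := by
      have := norm_sub_norm_le z y
      rw [norm_sub_rev] at this
      linarith
    have n2 : 9 / 10 ≤ ‖z‖ := by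
      have := norm_sub_norm_le y z
      linarith
    have e2 := norm_sub_norm_le (T y) (T z)
    have e3 := norm_sub_norm_le (T z) (T y)
    rw [norm_sub_rev] at e3
    have e4 := h1 z hz
    have e5 := h2 z hz
    constructor <;> nlinarith
  -- The estimate on the net contains ‖T‖ itself. Absorbing ‖T‖/10 gives ‖T‖ ≤ 22/9 · M ≤ 5/2 · M,
  -- and then the lower bound is at least (9/20 - 1/4) M = M/5.
  have hT : ‖T‖ ≤ 11 / 5 * M + ‖T‖ / 10 := by
    refine ContinuousLinearMap.opNorm_le_of_unit_norm (by positivity) fun x hx => (key x hx).1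
  have hT' : ‖T‖ ≤ 5 / 2 * M := by linarith
  refine ⟨?_, (T.le_opNorm y).trans (by gcongr)⟩
  by_cases hy : y = 0
  · simp [hy]
  have hy' : 0 < ‖y‖ := norm_pos_iff.2 hy
  have h3 := (key ((‖y‖⁻¹ : ℝ) • y) (by rw [norm_smul]; simp [hy])).2
  rw [map_smul, norm_smul, norm_inv, norm_norm] at h3
  have h4 : M / 5 ≤ ‖y‖⁻¹ * ‖T y‖ := by linarith
  calc M / 5 * ‖y‖ ≤ (‖y‖⁻¹ * ‖T y‖) * ‖y‖ := by gcongr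
    _ = ‖T y‖ := by field_simp

def gridPoint (α r : ℕ) (k : Fin r → Fin (20 * α + 1)) : EuclideanSpace ℝ (Fin r) :=
  WithLp.toLp 2 fun i => ((k i : ℕ) - 10 * α : ℝ) / (10 * α)

/-- Rounding each of at most α coordinates down to a multiple of 1/(10α) gives an error of norm at
most √α / (10α) ≤ 1/10. -/
theorem exists_gridPoint {α r : ℕ} (hr : r ≤ α) (y : EuclideanSpace ℝ (Fin r)) (hy : ‖y‖ = 1) :
    ∃ k, ‖y - gridPoint α r k‖ ≤ 1 / 10 := by
  by_cases hr0 : r = 0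
  · subst hr0
    exact ⟨fun i => i.elim0, by rw [Subsingleton.elim (y - _) 0]; simp⟩
  have hα : (1 : ℝ) ≤ α := by exact_mod_cast (by omega : 1 ≤ α)
  have hc : ∀ i, |y i| ≤ 1 := fun i => by
    have := EuclideanSpace.norm_eq y
    have h2 := PiLp.norm_apply_le y i
    rw [hy] at h2
    simpa using h2
  have hex : ∀ i, ∃ k : Fin (20 * α + 1),
      |y i - ((k : ℕ) - 10 * α : ℝ) / (10 * α)| ≤ 1 / (10 * α) := by
    intro i
    have h1 := abs_le.1 (hc i)
    have h0 : 0 ≤ (y i + 1) * (10 * α) := by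
      have := h1.1
      have : 0 ≤ y i + 1 := by linarith
      positivity
    have hle : ⌊(y i + 1) * (10 * α)⌋₊ ≤ 20 * α := by
      refine Nat.floor_le_of_le ?_
      push_cast
      nlinarith [h1.2]
    refine ⟨⟨⌊(y i + 1) * (10 * α)⌋₊, by omega⟩, ?_⟩
    have e1 := Nat.floor_le h0
    have e2 := Nat.lt_floor_add_one ((y i + 1) * (10 * α))
    set k : ℝ := ((⌊(y i + 1) * (10 * α)⌋₊ : ℕ) : ℝ)
    have e3 : y i - (k - 10 * α) / (10 * α) = ((y i + 1) * (10 * α) - k) / (10 * α) := by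
      field_simp; ring
    simp only
    rw [e3, abs_div, abs_of_nonneg (by linarith), abs_of_pos (by positivity)]
    gcongr
    linarith
  choose k hk using hex
  refine ⟨k, ?_⟩
  rw [EuclideanSpace.norm_eq]
  refine Real.sqrt_le_iff.2 ⟨by norm_num, ?_⟩
  calc ∑ i, ‖(y - gridPoint α r k) i‖ ^ 2 ≤ ∑ i : Fin r, (1 / (10 * α) : ℝ) ^ 2 := by
        refine Finset.sum_le_sum fun i _ => ?_
        gcongr
        simpa [gridPoint] using hk i
    _ = r * (1 / (10 * α) : ℝ) ^ 2 := by simp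
    _ ≤ α * (1 / (10 * α) : ℝ) ^ 2 := by gcongr
    _ ≤ (1 / 10) ^ 2 := by
        rw [div_pow, div_pow, mul_pow, one_pow, mul_one_div, div_le_div_iff₀ (by positivity)
          (by positivity)]
        nlinarith

end Net

/-- The sketch `w` distorts the lengths of all vectors in the column space of `X` by at most a
constant factor. -/
def SketchGood {m N α : ℕ} (w : Fin m → Fin N → Bool) (X : Matrix (Fin N) (Fin α) ℝ) : Prop :=
  ∀ x : Fin α → ℝ, m / 25 * ∑ j, X.mulVec x j ^ 2 ≤ sketchSq w (X.mulVec x) ∧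
    sketchSq w (X.mulVec x) ≤ 25 / 4 * m * ∑ j, X.mulVec x j ^ 2

/-- The column space has dimension at most α, so it is an isometric image of a Euclidean space of
that dimension and the grid there serves as a net. If the sketch is good on the (20α + 1)^r ≤ (20α +
1)^α images of grid points, it is good on the whole space. The factors 1/4 and 4 for squared lengths
are 1/2 and 2 for lengths; `norm_bounds_of_grid` weakens them to 1/5 and 5/2, whose squares appear
in `SketchGood`. -/
theorem card_not_sketchGood {m N α : ℕ} (X : Matrix (Fin N) (Fin α) ℝ) :
    ({w : Fin m → Fin N → Bool | ¬ SketchGood w X}.ncard : ℝ) ≤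
      2 ^ (N * m) * ((20 * α + 1) ^ α * (2 * Real.exp (-(m / 12 : ℝ)))) := by
  classical
  let S : Submodule ℝ (EuclideanSpace ℝ (Fin N)) := LinearMap.range (Matrix.toEuclideanLin X)
  have hr : Module.finrank ℝ S ≤ α := by
    have := LinearMap.finrank_range_le (Matrix.toEuclideanLin X)
    simpa using this
  set r := Module.finrank ℝ S with hrdef
  let O : EuclideanSpace ℝ (Fin r) →ₗᵢ[ℝ] EuclideanSpace ℝ (Fin N) :=
    S.subtypeₗᵢ.comp (stdOrthonormalBasis ℝ S).repr.symm.toLinearIsometry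
  have hO : ∀ x : Fin α → ℝ, ∃ y, O y = WithLp.toLp 2 (X.mulVec x) := by
    intro x
    have hmem : WithLp.toLp 2 (X.mulVec x) ∈ S :=
      ⟨WithLp.toLp 2 x, by simp [Matrix.toEuclideanLin]⟩
    refine ⟨(stdOrthonormalBasis ℝ S).repr ⟨_, hmem⟩, ?_⟩
    simp [O]
  let vec : (Fin r → Fin (20 * α + 1)) → (Fin N → ℝ) := fun k j => O (gridPoint α r k) j
  have hnsq : ∀ v : EuclideanSpace ℝ (Fin N), ∑ j, v j ^ 2 = ‖v‖ ^ 2 := by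
    intro v
    rw [EuclideanSpace.norm_sq_eq]
    simp
  have hsub : {w : Fin m → Fin N → Bool | ¬ SketchGood w X} ⊆
      ⋃ k ∈ (Finset.univ : Finset (Fin r → Fin (20 * α + 1))), {w | ¬ VecGood w (vec k)} := by
    intro w hw
    by_contra hcon
    simp only [Finset.mem_univ, Set.iUnion_true, Set.mem_iUnion, Set.mem_ofPred_eq, not_exists,
      not_not] at hcon
    apply hw
    let Pi : Matrix (Fin m) (Fin N) ℝ := Matrix.of fun l j => sgn (w l j)
    let T0 : EuclideanSpace ℝ (Fin N) →L[ℝ] EuclideanSpace ℝ (Fin m) :=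
      (Matrix.toEuclideanLin Pi).toContinuousLinearMap
    have hT0 : ∀ v, ‖T0 v‖ ^ 2 = sketchSq w (fun j => v j) := by
      intro v
      rw [EuclideanSpace.norm_sq_eq]
      refine Finset.sum_congr rfl fun l _ => ?_
      rw [Real.norm_eq_abs, sq_abs]
      simp [T0, Matrix.toEuclideanLin, Pi, Matrix.mulVec, dotProduct, signSum]
    let T : EuclideanSpace ℝ (Fin r) →L[ℝ] EuclideanSpace ℝ (Fin m) :=
      T0.comp O.toContinuousLinearMap
    have hT : ∀ y, ‖T y‖ ^ 2 = sketchSq w (fun j => O y j) := fun y => hT0 (O y)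
    set M := Real.sqrt m with hM
    have hM2 : M ^ 2 = m := Real.sq_sqrt (Nat.cast_nonneg _)
    have hM0 : 0 ≤ M := Real.sqrt_nonneg _
    have hb := norm_bounds_of_grid T M hM0 (Set.range (gridPoint α r))
      (fun y hy => by
        obtain ⟨k, hk⟩ := exists_gridPoint hr y hy
        exact ⟨_, ⟨k, rfl⟩, hk⟩)
      (by
        rintro _ ⟨k, rfl⟩
        have h1 := (hcon k).1
        have h2 : ∑ j, vec k j ^ 2 = ‖gridPoint α r k‖ ^ 2 := by
          rw [← O.norm_map]; exact hnsq _
        rw [h2] at h1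
        refine le_of_sq_le_sq ?_ (norm_nonneg _)
        rw [hT, mul_pow, div_pow, hM2]
        norm_num
        exact h1)
      (by
        rintro _ ⟨k, rfl⟩
        have h1 := (hcon k).2
        have h2 : ∑ j, vec k j ^ 2 = ‖gridPoint α r k‖ ^ 2 := by
          rw [← O.norm_map]; exact hnsq _
        rw [h2] at h1
        refine le_of_sq_le_sq ?_ (by positivity)
        rw [hT, mul_pow, mul_pow, hM2]
        norm_num
        exact h1)
    intro x
    obtain ⟨y, hy⟩ := hO x
    obtain ⟨b1, b2⟩ := hb y
    have h2 : ∑ j, X.mulVec x j ^ 2 = ‖y‖ ^ 2 := by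
      rw [← O.norm_map, hy, ← hnsq]
    have h3 : sketchSq w (X.mulVec x) = ‖T y‖ ^ 2 := by
      rw [hT, hy]
    rw [h2, h3]
    constructor
    · have := pow_le_pow_left₀ (by positivity) b1 2
      rw [mul_pow, div_pow, hM2] at this
      norm_num at this
      exact this
    · have := pow_le_pow_left₀ (norm_nonneg _) b2 2
      rw [mul_pow, mul_pow, hM2] at this
      norm_num at this
      exact this
  have hfin : (⋃ k ∈ (Finset.univ : Finset (Fin r → Fin (20 * α + 1))),
      {w : Fin m → Fin N → Bool | ¬ VecGood w (vec k)}).Finite := Set.toFinite _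
  have h1 := (Set.ncard_le_ncard hsub hfin).trans (Finset.set_ncard_biUnion_le _ _)
  have h2 : ({w : Fin m → Fin N → Bool | ¬ SketchGood w X}.ncard : ℝ) ≤ _ := Nat.cast_le.2 h1
  rw [Nat.cast_sum] at h2
  refine h2.trans ((Finset.sum_le_sum fun k _ => card_not_vecGood (vec k)).trans ?_)
  rw [Finset.sum_const, Finset.card_univ, nsmul_eq_mul]
  simp only [Fintype.card_pi, Fintype.card_fin, Finset.prod_const, Finset.card_univ]
  push_cast
  have h3 : ((20 : ℝ) * α + 1) ^ r ≤ (20 * α + 1) ^ α :=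
    pow_le_pow_right₀ (by have : (0:ℝ) ≤ α := Nat.cast_nonneg _
                          linarith) hr
  calc _ ≤ ((20 : ℝ) * α + 1) ^ α * (2 ^ (N * m) * (2 * Real.exp (-(m / 12 : ℝ)))) := by gcongr
    _ = _ := by ring

/-! ### Reading the signs from the coins -/

/-- The sign matrix whose rows are read one after the other from the coins. -/
def coinMatrix (m N : ℕ) (coins : ℕ → Bool) : Fin m → Fin N → Bool :=
  fun l j => coins (l * N + j)

/-- Each sign matrix corresponds to a cylinder that fixes the first N·m coins and has measure
2^(-N·m). Subadditivity over the matrices in S suffices. -/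
theorem coinLaw_coinMatrix_le (m N : ℕ) (S : Set (Fin m → Fin N → Bool)) :
    RealRAM.coinLaw {coins | coinMatrix m N coins ∈ S} ≤
      ENNReal.ofReal (S.ncard / 2 ^ (N * m)) := by
  classical
  have h1 : {coins | coinMatrix m N coins ∈ S} ⊆
      ⋃ w ∈ S.toFinset, {coins | coinMatrix m N coins = w} := by
    intro c hc
    simp only [Set.mem_toFinset, Set.mem_iUnion]
    exact ⟨_, hc, rfl⟩
  have hcyl : ∀ w : Fin m → Fin N → Bool,
      RealRAM.coinLaw {coins | coinMatrix m N coins = w} = (2⁻¹ : ENNReal) ^ (N * m) := by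
    intro w
    let w' : ℕ → Bool := fun i => if h : i / N < m ∧ i % N < N then w ⟨i / N, h.1⟩ ⟨i % N, h.2⟩
      else false
    have e : {coins | coinMatrix m N coins = w} =
        Set.pi (Finset.range (N * m)) fun i => {w' i} := by
      ext c
      simp only [Set.mem_ofPred_eq, Set.mem_pi, Finset.coe_range, Set.mem_Iio, Set.mem_singleton_iff]
      constructor
      · rintro rfl i hi
        have hN : 0 < N := Nat.pos_of_ne_zero (by rintro rfl; simp at hi)
        have h : i / N < m ∧ i % N < N :=
          ⟨Nat.div_lt_of_lt_mul (by linarith), Nat.mod_lt _ hN⟩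
        simp only [w', dif_pos h, coinMatrix]
        rw [Nat.div_add_mod']
      · intro h
        funext l j
        have hN : 0 < N := j.pos
        have h2 : (l : ℕ) * N + j < N * m := by
          have := l.2
          have := j.2
          calc (l : ℕ) * N + j < (l : ℕ) * N + N := by omega
            _ = (l + 1) * N := by ring
            _ ≤ m * N := Nat.mul_le_mul_right _ (by omega)
            _ = _ := by ring
        have h3 : ((l : ℕ) * N + j) / N = l := by
          rw [mul_comm, Nat.mul_add_div hN, Nat.div_eq_of_lt j.2, add_zero]
        have h4 : ((l : ℕ) * N + j) % N = j := by
          rw [mul_comm, Nat.mul_add_mod, Nat.mod_eq_of_lt j.2]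
        simp only [coinMatrix]
        rw [h _ h2]
        simp only [w']
        rw [dif_pos ⟨by rw [h3]; exact l.2, by rw [h4]; exact j.2⟩]
        have h5 : (⟨((l : ℕ) * N + j) / N, by rw [h3]; exact l.2⟩ : Fin m) = l := Fin.ext h3
        have h6 : (⟨((l : ℕ) * N + j) % N, by rw [h4]; exact j.2⟩ : Fin N) = j := Fin.ext h4
        rw [h5, h6]
    rw [e, RealRAM.coinLaw, MeasureTheory.Measure.infinitePi_pi _ (fun i _ => measurableSet_singleton _)]
    have : ∀ b : Bool, (PMF.uniformOfFintype Bool).toMeasure {b} = 2⁻¹ := by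
      intro b
      rw [PMF.toMeasure_apply_singleton _ _ (measurableSet_singleton _)]
      simp
    simp [this]
  refine (MeasureTheory.measure_mono h1).trans ((MeasureTheory.measure_biUnion_finset_le _ _).trans ?_)
  simp only [hcyl, Finset.sum_const, nsmul_eq_mul]
  rw [Set.ncard_eq_toFinset_card', div_eq_mul_inv, ENNReal.ofReal_mul (Nat.cast_nonneg _),
    ENNReal.ofReal_natCast, ENNReal.ofReal_inv_of_pos (by positivity),
    ENNReal.ofReal_pow (by norm_num), ENNReal.inv_pow]
  simp

end InverseMaintenance

namespace InverseMaintenance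

open Matrix

/-! ### The Loewner order -/

section Loewner

variable {ι κ : Type*} [Fintype ι] [DecidableEq ι] [Fintype κ] [DecidableEq κ]

theorem isSymm_of_nonneg {M : Matrix ι ι ℝ} (h : 0 ≤ M) : Mᵀ = M := by
  have := (nonneg_iff_posSemidef.1 h).1
  rwa [IsHermitian, conjTranspose_eq_transpose_of_trivial] at this

theorem conj_nonneg {M : Matrix ι ι ℝ} (h : 0 ≤ M) (B : Matrix κ ι ℝ) : 0 ≤ B * M * Bᵀ := by
  have := (nonneg_iff_posSemidef.1 h).mul_mul_conjTranspose_same B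
  rw [conjTranspose_eq_transpose_of_trivial] at this
  exact nonneg_iff_posSemidef.2 this

theorem conj_le {M N : Matrix ι ι ℝ} (h : M ≤ N) (B : Matrix κ ι ℝ) :
    B * M * Bᵀ ≤ B * N * Bᵀ := by
  rw [← sub_nonneg] at h ⊢
  have := conj_nonneg h B
  rwa [Matrix.mul_sub, Matrix.sub_mul] at this

theorem smul_nonneg' {M : Matrix ι ι ℝ} (h : 0 ≤ M) {c : ℝ} (hc : 0 ≤ c) : 0 ≤ c • M :=
  nonneg_iff_posSemidef.2 ((nonneg_iff_posSemidef.1 h).smul hc)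

theorem smul_le_smul' {M N : Matrix ι ι ℝ} (h : M ≤ N) {c : ℝ} (hc : 0 ≤ c) : c • M ≤ c • N := by
  rw [← sub_nonneg] at h ⊢
  rw [← smul_sub]
  exact smul_nonneg' h hc

theorem smul_le_smul_left' {M : Matrix ι ι ℝ} (h : 0 ≤ M) {c d : ℝ} (hc : c ≤ d) :
    c • M ≤ d • M := by
  rw [← sub_nonneg, ← sub_smul]
  exact smul_nonneg' h (sub_nonneg.2 hc)

theorem posDef_of_le {M N : Matrix ι ι ℝ} (hM : M.PosDef) (h : M ≤ N) : N.PosDef := by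
  have := hM.add_posSemidef (le_iff.1 h)
  rwa [add_sub_cancel] at this

theorem isSymm_of_posDef {M : Matrix ι ι ℝ} (h : M.PosDef) : Mᵀ = M :=
  isSymm_of_nonneg (nonneg_iff_posSemidef.2 h.posSemidef)

theorem isUnit_det_of_posDef {M : Matrix ι ι ℝ} (h : M.PosDef) : IsUnit M.det :=
  (isUnit_iff_isUnit_det _).1 h.isUnit

theorem inv_nonneg_of_posDef {M : Matrix ι ι ℝ} (h : M.PosDef) : 0 ≤ M⁻¹ :=
  nonneg_iff_posSemidef.2 h.inv.posSemidef

/-- With Δ = M⁻¹ - N⁻¹ one has Δ = ΔMΔᵀ + N⁻¹(N - M)N⁻¹, a sum of two positive semidefinite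
matrices. -/
theorem inv_le_inv_of_le {M N : Matrix ι ι ℝ} (hM : M.PosDef) (h : M ≤ N) : N⁻¹ ≤ M⁻¹ := by
  have hN := posDef_of_le hM h
  have uM := isUnit_det_of_posDef hM
  have uN := isUnit_det_of_posDef hN
  have e : M⁻¹ - N⁻¹ = (M⁻¹ - N⁻¹) * M * (M⁻¹ - N⁻¹)ᵀ + N⁻¹ * (N - M) * (N⁻¹)ᵀ := by
    rw [transpose_sub, isSymm_of_posDef hM.inv, isSymm_of_posDef hN.inv]
    simp only [sub_mul, mul_sub, nonsing_inv_mul _ uM, nonsing_inv_mul _ uN, one_mul]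
    rw [Matrix.mul_assoc N⁻¹ M M⁻¹, mul_nonsing_inv _ uM, mul_one]
    abel
  rw [← sub_nonneg, e]
  exact add_nonneg (conj_nonneg (nonneg_iff_posSemidef.2 hM.posSemidef) _)
    (conj_nonneg (sub_nonneg.2 h) _)

theorem inv_smul' {M : Matrix ι ι ℝ} (hM : M.PosDef) {c : ℝ} (hc : c ≠ 0) :
    (c • M)⁻¹ = c⁻¹ • M⁻¹ := by
  refine inv_eq_right_inv ?_
  rw [smul_mul_smul_comm, mul_inv_cancel₀ hc, one_smul, mul_nonsing_inv _ (isUnit_det_of_posDef hM)]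

end Loewner

/-! ### Preconditioned Richardson iteration -/

section Richardson

variable {ι κ : Type*} [Fintype ι] [DecidableEq ι] [Fintype κ] [DecidableEq κ]

/-- The linear operator after `t` steps of the iteration `z ↦ z + Y (y - Z z)` from `0`. -/
def richardson (Y Z : Matrix ι ι ℝ) : ℕ → Matrix ι ι ℝ
  | 0 => 0
  | t + 1 => richardson Y Z t + Y * (1 - Z * richardson Y Z t)

variable {Y Z : Matrix ι ι ℝ} {q : ℝ}

theorem sub_richardson (hZ : Z.PosDef) (t : ℕ) :
    Z⁻¹ - richardson Y Z t = (1 - Y * Z) ^ t * Z⁻¹ := by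
  induction t with
  | zero => simp [richardson]
  | succ t ih =>
    rw [pow_succ', Matrix.mul_assoc, ← ih, richardson, sub_mul, one_mul, Matrix.mul_assoc,
      Matrix.mul_sub Z, mul_nonsing_inv _ (isUnit_det_of_posDef hZ)]
    abel

/-- With C = 1 - YZ and V_t = C^t Z⁻¹ one has V_{t+2} = C V_t Cᵀ. Congruence by C preserves both
claims, so they pass from t to t + 2 and only t = 0 and t = 1 need an argument. -/
theorem richardson_aux (hZ : Z.PosDef) (hq : 0 < q) (hY : Yᵀ = Y) (h0 : Y ≤ Z⁻¹)
    (h1 : Z⁻¹ - Y ≤ q • Z⁻¹) (t : ℕ) :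
    0 ≤ (1 - Y * Z) ^ t * Z⁻¹ ∧
      (1 - Y * Z) ^ (t + 1) * Z⁻¹ ≤ q • ((1 - Y * Z) ^ t * Z⁻¹) := by
  have uZ := isUnit_det_of_posDef hZ
  set C := 1 - Y * Z with hC
  have hCt : Cᵀ = 1 - Z * Y := by
    rw [hC, transpose_sub, transpose_one, transpose_mul, hY, isSymm_of_posDef hZ]
  have hV : C * Z⁻¹ = Z⁻¹ - Y := by
    rw [hC, sub_mul, one_mul, Matrix.mul_assoc, mul_nonsing_inv _ uZ, mul_one]
  have hV' : Z⁻¹ * Cᵀ = Z⁻¹ - Y := by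
    rw [hCt, mul_sub, mul_one, ← Matrix.mul_assoc, nonsing_inv_mul _ uZ, one_mul]
  have hstep : ∀ t, C ^ (t + 2) * Z⁻¹ = C * (C ^ t * Z⁻¹) * Cᵀ := by
    intro t
    rw [pow_succ, Matrix.mul_assoc _ C, hV, ← hV', pow_succ']
    simp only [Matrix.mul_assoc]
  induction t using Nat.twoStepInduction with
  | zero =>
    rw [zero_add, pow_one, pow_zero, one_mul, hV]
    exact ⟨inv_nonneg_of_posDef hZ, h1⟩
  | one =>
    rw [hstep 0, pow_one, pow_zero, one_mul, hV]
    refine ⟨sub_nonneg.2 h0, ?_⟩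
    set V := Z⁻¹ - Y with hVd
    have hVt : Vᵀ = V := isSymm_of_nonneg (sub_nonneg.2 h0)
    set W := q • Z⁻¹ - V with hW
    have hWt : Wᵀ = W := isSymm_of_nonneg (sub_nonneg.2 h1)
    have hZt := isSymm_of_posDef hZ
    have e1 : V * Z * W = q • V - V * Z * V := by
      rw [hW, Matrix.mul_sub, Matrix.mul_smul, Matrix.mul_assoc V Z Z⁻¹, mul_nonsing_inv _ uZ,
        mul_one]
    have e2 : W * Z * V = q • V - V * Z * V := by
      rw [hW, Matrix.sub_mul, Matrix.sub_mul, Matrix.smul_mul, Matrix.smul_mul,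
        nonsing_inv_mul _ uZ, one_mul]
    have e3 : Cᵀ = Z * V := by
      rw [hCt, hVd, Matrix.mul_sub, mul_nonsing_inv _ uZ]
    rw [e3, ← Matrix.mul_assoc, ← sub_nonneg]
    -- For t = 1 the claim is VZV ⪯ qV. With W = qZ⁻¹ - V ⪰ 0 the difference qV - VZV is a
    -- combination of the congruences VZ·W·ZV and WZ·V·ZW, both positive semidefinite.
    have e4 : q • V - V * Z * V = q⁻¹ • (V * Z * W * (V * Z)ᵀ + W * Z * V * (W * Z)ᵀ) := by
      rw [e1, e2, ← Matrix.mul_add, transpose_mul, transpose_mul, hVt, hWt, hZt, ← Matrix.mul_add,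
        hW, add_sub_cancel, Matrix.mul_smul, mul_nonsing_inv _ uZ, Matrix.mul_smul, mul_one,
        smul_smul, inv_mul_cancel₀ hq.ne', one_smul]
    rw [e4]
    refine smul_nonneg' (add_nonneg ?_ ?_) (inv_nonneg.2 hq.le)
    · exact conj_nonneg (sub_nonneg.2 h1) (V * Z)
    · exact conj_nonneg (sub_nonneg.2 h0) (W * Z)
  | more t ih1 ih2 =>
    rw [hstep, hstep (t + 1)]
    refine ⟨conj_nonneg ih1.1 C, ?_⟩
    have := conj_le ih1.2 C
    rwa [mul_smul_comm, smul_mul_assoc] at this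

theorem sub_richardson_le (hZ : Z.PosDef) (hq : 0 < q) (hY : Yᵀ = Y) (h0 : Y ≤ Z⁻¹)
    (h1 : Z⁻¹ - Y ≤ q • Z⁻¹) (t : ℕ) :
    0 ≤ Z⁻¹ - richardson Y Z t ∧ Z⁻¹ - richardson Y Z t ≤ q ^ t • Z⁻¹ := by
  rw [sub_richardson hZ]
  refine ⟨(richardson_aux hZ hq hY h0 h1 t).1, ?_⟩
  induction t with
  | zero => simp
  | succ t ih =>
    refine (richardson_aux hZ hq hY h0 h1 t).2.trans ?_
    rw [pow_succ', ← smul_smul]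
    exact smul_le_smul' ih hq.le

/-- The Woodbury identity. -/
theorem woodbury {B : Matrix ι ι ℝ} (hB : B.PosDef) (U : Matrix κ ι ℝ) :
    (B + Uᵀ * U)⁻¹ = B⁻¹ - B⁻¹ * Uᵀ * (1 + U * B⁻¹ * Uᵀ)⁻¹ * U * B⁻¹ := by
  have uB := isUnit_det_of_posDef hB
  have hN : 0 ≤ U * B⁻¹ * Uᵀ := conj_nonneg (inv_nonneg_of_posDef hB) U
  have hZ : (1 + U * B⁻¹ * Uᵀ).PosDef :=
    PosDef.one.add_posSemidef (nonneg_iff_posSemidef.1 hN)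
  have uZ := isUnit_det_of_posDef hZ
  set Z := 1 + U * B⁻¹ * Uᵀ with hZd
  refine inv_eq_right_inv ?_
  have e : (B + Uᵀ * U) * (B⁻¹ * Uᵀ) = Uᵀ * Z := by
    rw [Matrix.add_mul, ← Matrix.mul_assoc, mul_nonsing_inv _ uB, hZd, Matrix.mul_add,
      Matrix.one_mul, Matrix.mul_one]
    simp only [Matrix.mul_assoc]
  rw [Matrix.mul_sub, Matrix.mul_assoc (B⁻¹ * Uᵀ * Z⁻¹), Matrix.mul_assoc (B⁻¹ * Uᵀ),
    ← Matrix.mul_assoc, e, Matrix.mul_assoc Uᵀ Z, ← Matrix.mul_assoc Z, mul_nonsing_inv _ uZ,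
    Matrix.one_mul, Matrix.add_mul, mul_nonsing_inv _ uB, Matrix.mul_assoc Uᵀ]
  abel

/-- An approximate inverse of `B + Uᵀ U` from an approximation `M` of `U B⁻¹ Uᵀ`. -/
theorem approx_inverse {B : Matrix ι ι ℝ} (hB : B.PosDef) (U : Matrix κ ι ℝ) {M : Matrix κ κ ℝ}
    {a b : ℝ} (ha : 0 < a) (ha1 : a ≤ 1) (hb : 1 ≤ b) (hab : a < b)
    (h0 : a • (U * B⁻¹ * Uᵀ) ≤ M) (h1 : M ≤ b • (U * B⁻¹ * Uᵀ)) (t : ℕ) :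
    let K := B⁻¹ - B⁻¹ * Uᵀ * richardson (a • (1 + M)⁻¹) (1 + U * B⁻¹ * Uᵀ) t * U * B⁻¹
    Kᵀ = K ∧ (B + Uᵀ * U)⁻¹ ≤ K ∧ K ≤ (B + Uᵀ * U)⁻¹ + (1 - a / b) ^ t • B⁻¹ := by
  intro K
  have hBi := inv_nonneg_of_posDef hB
  have hN : 0 ≤ U * B⁻¹ * Uᵀ := conj_nonneg hBi U
  set N := U * B⁻¹ * Uᵀ with hNd
  have hZ : (1 + N).PosDef := PosDef.one.add_posSemidef (nonneg_iff_posSemidef.1 hN)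
  have hone : (0 : Matrix κ κ ℝ) ≤ 1 := nonneg_iff_posSemidef.2 .one
  have hM0 : 0 ≤ M := (smul_nonneg' hN ha.le).trans h0
  have hM : (1 + M).PosDef := PosDef.one.add_posSemidef (nonneg_iff_posSemidef.1 hM0)
  have hb0 : 0 < b := by linarith
  set Y := a • (1 + M)⁻¹ with hYd
  have hYt : Yᵀ = Y := by rw [hYd, transpose_smul, isSymm_of_posDef hM.inv]
  have l1 : a • (1 + N) ≤ 1 + M := by
    rw [smul_add]
    refine add_le_add ?_ h0
    simpa using smul_le_smul_left' hone ha1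
  have l2 : 1 + M ≤ b • (1 + N) := by
    rw [smul_add]
    refine add_le_add ?_ h1
    simpa using smul_le_smul_left' hone hb
  have hY0 : Y ≤ (1 + N)⁻¹ := by
    have := smul_le_smul' (inv_le_inv_of_le (hZ.smul ha) l1) ha.le
    rwa [inv_smul' hZ ha.ne', smul_smul, mul_inv_cancel₀ ha.ne', one_smul] at this
  have hY1 : (1 + N)⁻¹ - Y ≤ (1 - a / b) • (1 + N)⁻¹ := by
    have := smul_le_smul' (inv_le_inv_of_le hM l2) ha.le
    rw [inv_smul' hZ hb0.ne', smul_smul, ← div_eq_mul_inv] at this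
    rw [sub_smul, one_smul]
    exact sub_le_sub_left this _
  have hq : 0 < 1 - a / b := by rw [sub_pos, div_lt_one hb0]; exact hab
  obtain ⟨r1, r2⟩ := sub_richardson_le hZ hq hYt hY0 hY1 t
  set S := richardson Y (1 + N) t with hS
  have hW := woodbury hB U
  rw [← hNd] at hW
  have hBt := isSymm_of_posDef hB.inv
  -- By the Woodbury identity K exceeds the exact inverse by a congruence of the error of the
  -- iteration. This error is positive semidefinite, so K errs on one side only.
  have hK : K = (B + Uᵀ * U)⁻¹ + B⁻¹ * Uᵀ * ((1 + N)⁻¹ - S) * (B⁻¹ * Uᵀ)ᵀ := by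
    rw [hW, transpose_mul, transpose_transpose, hBt, Matrix.mul_sub, Matrix.sub_mul,
      ← Matrix.mul_assoc, ← Matrix.mul_assoc]
    simp only [K]
    abel
  have hH : (B + Uᵀ * U).PosDef := by
    have := posSemidef_conjTranspose_mul_self U
    rw [conjTranspose_eq_transpose_of_trivial] at this
    exact hB.add_posSemidef this
  have hpos := conj_nonneg r1 (B⁻¹ * Uᵀ)
  refine ⟨?_, ?_, ?_⟩
  · rw [hK, transpose_add, isSymm_of_posDef hH.inv, isSymm_of_nonneg hpos]
  · rw [hK]; exact le_add_of_nonneg_right hpos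
  · rw [hK]
    refine add_le_add_right ((conj_le r2 (B⁻¹ * Uᵀ)).trans ?_) _
    rw [Matrix.mul_smul, Matrix.smul_mul]
    refine smul_le_smul' ?_ (pow_nonneg hq.le _)
    -- The same congruence of the exact (1 + N)⁻¹ is, by Woodbury again, the drop from B⁻¹ to (B +
    -- UᵀU)⁻¹, hence at most B⁻¹.
    have : B⁻¹ * Uᵀ * (1 + N)⁻¹ * (B⁻¹ * Uᵀ)ᵀ = B⁻¹ - (B + Uᵀ * U)⁻¹ := by
      rw [hW, transpose_mul, transpose_transpose, hBt, ← Matrix.mul_assoc, sub_sub_cancel]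
    rw [this]
    exact sub_le_self _ (inv_nonneg_of_posDef hH)

end Richardson

/-- The approximation of `(B + θ B₀)⁻¹` obtained above also approximates `B⁻¹`. -/
theorem spectralApprox_of_le {d : ℕ} {B B0 B2 H K : Matrix (Fin d) (Fin d) ℝ} {β q : ℝ}
    (hβ : 2 < β) (hq : 2 * β ^ 2 * q ≤ 1) (hq0 : 0 ≤ q) (hB : B.PosDef) (hB0 : B0.PosDef)
    (h1 : β⁻¹ • B0 ≤ B) (h2 : B ≤ β • B0) (hB2 : β⁻¹ • B0 ≤ B2) (hH : H = B + β⁻¹ • B0)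
    (hK1 : H⁻¹ ≤ K) (hK2 : K ≤ H⁻¹ + q • B2⁻¹) : SpectralApprox 1 K B⁻¹ := by
  have hβ0 : 0 < β := by linarith
  have hB0n : 0 ≤ B0 := nonneg_iff_posSemidef.2 hB0.posSemidef
  have hBi := inv_nonneg_of_posDef hB
  have a1 : B ≤ H := by rw [hH]; exact le_add_of_nonneg_right (smul_nonneg' hB0n (by positivity))
  have hHp := posDef_of_le hB a1
  have a2 : H ≤ (2 : ℝ) • B := by
    rw [hH, two_smul]
    exact add_le_add_right h1 _
  have a3 : H⁻¹ ≤ B⁻¹ := inv_le_inv_of_le hB a1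
  have a4 : (2⁻¹ : ℝ) • B⁻¹ ≤ H⁻¹ := by
    rw [← inv_smul' hB two_ne_zero]
    exact inv_le_inv_of_le hHp a2
  have a5 : B0⁻¹ ≤ β • B⁻¹ := by
    have := smul_le_smul' (inv_le_inv_of_le hB h2) hβ0.le
    rwa [inv_smul' hB0 hβ0.ne', smul_smul, mul_inv_cancel₀ hβ0.ne', one_smul] at this
  have a6 : B2⁻¹ ≤ β • B0⁻¹ := by
    have := inv_le_inv_of_le (hB0.smul (inv_pos.2 hβ0)) hB2
    rwa [inv_smul' hB0 (inv_ne_zero hβ0.ne'), inv_inv] at this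
  -- B2 is only known to dominate β⁻¹B0, and B0 to dominate β⁻¹B. The loss of β² is the reason for
  -- the tolerance 1/(2β²), which leaves K ⪯ (1 + 1/2) B⁻¹.
  have a7 : B2⁻¹ ≤ (β ^ 2) • B⁻¹ := by
    refine a6.trans ?_
    rw [pow_two, ← smul_smul]
    exact smul_le_smul' a5 hβ0.le
  constructor
  · refine le_trans ?_ (a4.trans hK1)
    refine smul_le_smul_left' hBi ?_
    rw [Real.exp_neg]
    refine inv_anti₀ two_pos ?_
    have := Real.add_one_le_exp (1 : ℝ)
    linarith
  · refine hK2.trans (le_trans (add_le_add a3 (smul_le_smul' a7 hq0)) ?_)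
    rw [smul_smul]
    nth_rw 1 [← one_smul ℝ B⁻¹]
    rw [← add_smul]
    refine smul_le_smul_left' hBi ?_
    have := Real.add_one_le_exp (1 : ℝ)
    linarith

end InverseMaintenance

namespace InverseMaintenance

open Matrix

/-! ### The matrices of one round -/

section Capacitance

variable {ν ι κ μ : Type*} [Fintype ν] [DecidableEq ν] [Fintype ι] [DecidableEq ι] [Fintype κ]
  [DecidableEq κ] [Fintype μ] [DecidableEq μ]

/-- The capacitance matrix for passing from γ⁻¹B0 to γ⁻¹B0 + Fᵀ diag(δ) F, with M in the place of F
B0⁻¹ Fᵀ. -/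
def capX (γ : ℝ) (M : Matrix κ κ ℝ) (δ : κ → ℝ) : Matrix κ κ ℝ := 1 + γ • (M * diagonal δ)

/-- The capacitance matrix is not symmetric, while the inversion program needs a positive definite
input; hence the normal equations. -/
def leftInv (X : Matrix κ κ ℝ) : Matrix κ κ ℝ := (Xᵀ * X)⁻¹ * Xᵀ

/-- Stands for F B2⁻¹ Fᵀ; it equals this matrix except for entries between two new rows. -/
def capT (γ : ℝ) (M : Matrix κ κ ℝ) (δ : κ → ℝ) : Matrix κ κ ℝ :=
  γ • (leftInv (capX γ M δ) * M)

/-- J is the sketch taken with the initial weights and B0⁻¹, and S consists of the columns of the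
sign matrix that belong to the changed rows. The formula moves the sketch to the current weights and
to B2⁻¹. -/
def sketchR (γ : ℝ) (M : Matrix κ κ ℝ) (δ ε : κ → ℝ) (J S : Matrix μ κ ℝ) : Matrix μ κ ℝ :=
  Real.sqrt γ • J + (S * diagonal ε - Real.sqrt γ • (J * diagonal δ)) * capT γ M δ

/-- The preconditioner obtained from a sketch `R` with `m` rows. -/
def precond (m : ℝ) (R : Matrix μ κ ℝ) : Matrix κ κ ℝ :=
  (1 / 25 : ℝ) • (1 + m⁻¹ • (Rᵀ * R))⁻¹

theorem leftInv_eq {X : Matrix κ κ ℝ} (h : IsUnit X.det) : leftInv X = X⁻¹ := by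
  have ht : IsUnit Xᵀ.det := by rwa [det_transpose]
  rw [leftInv, Matrix.mul_inv_rev, Matrix.mul_assoc, nonsing_inv_mul _ ht, mul_one]

theorem posDef_transpose_mul_self {X : Matrix κ κ ℝ} (h : IsUnit X.det) : (Xᵀ * X).PosDef := by
  have := PosDef.conjTranspose_mul_self X
    (mulVec_injective_iff_isUnit.2 ((isUnit_iff_isUnit_det _).2 h))
  rwa [conjTranspose_eq_transpose_of_trivial] at this

variable {B0 B2 : Matrix ι ι ℝ} {F : Matrix κ ι ℝ} {δ ε : κ → ℝ} {γ : ℝ} {M : Matrix κ κ ℝ}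

/-- Multiply B2 B2⁻¹ = 1 by γB0⁻¹. Thus B2⁻¹ can be applied once F B2⁻¹ is available, using only
B0⁻¹ of full size. -/
theorem inv_eq_of_lowRank (hγ : 0 < γ) (hB0 : B0.PosDef) (hB2 : B2.PosDef)
    (h : B2 = γ⁻¹ • B0 + Fᵀ * diagonal δ * F) :
    B2⁻¹ = γ • (B0⁻¹ * (1 - Fᵀ * diagonal δ * (F * B2⁻¹))) := by
  have u0 := isUnit_det_of_posDef hB0
  have u2 := isUnit_det_of_posDef hB2
  have e : γ⁻¹ • B0 * B2⁻¹ = 1 - Fᵀ * diagonal δ * (F * B2⁻¹) := by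
    rw [eq_sub_iff_add_eq, ← Matrix.mul_assoc, ← Matrix.add_mul, ← h, mul_nonsing_inv _ u2]
  rw [← e, ← Matrix.mul_assoc, Matrix.mul_smul, nonsing_inv_mul _ u0, Matrix.smul_mul, one_mul,
    smul_smul, mul_inv_cancel₀ hγ.ne', one_smul]

/-- By det(1 + UV) = det(1 + VU) the determinant is that of γ B2 B0⁻¹. -/
theorem isUnit_capX (hγ : 0 < γ) (hB0 : B0.PosDef) (hB2 : B2.PosDef)
    (h : B2 = γ⁻¹ • B0 + Fᵀ * diagonal δ * F)
    (hM : M * diagonal δ = F * B0⁻¹ * Fᵀ * diagonal δ) : IsUnit (capX γ M δ).det := by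
  have u0 := isUnit_det_of_posDef hB0
  have e : capX γ M δ = 1 + (γ • (F * B0⁻¹)) * (Fᵀ * diagonal δ) := by
    rw [capX, hM, Matrix.smul_mul]
    simp only [Matrix.mul_assoc]
  have e2 : 1 + (Fᵀ * diagonal δ) * (γ • (F * B0⁻¹)) = γ • (B2 * B0⁻¹) := by
    rw [h, Matrix.add_mul, Matrix.smul_mul, mul_nonsing_inv _ u0, smul_add, smul_smul,
      mul_inv_cancel₀ hγ.ne', one_smul, Matrix.mul_smul]
    simp only [Matrix.mul_assoc]
  rw [e, det_one_add_mul_comm, e2, det_smul, det_mul]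
  exact (IsUnit.mk0 _ (pow_ne_zero _ hγ.ne')).mul
    ((isUnit_det_of_posDef hB2).mul (isUnit_det_of_posDef hB0.inv))

/-- Writing X for the capacitance matrix, X F = γ F B0⁻¹ B2. Multiply by B2⁻¹ on the right and by
X⁻¹ on the left. -/
theorem capX_mul (hγ : 0 < γ) (hB0 : B0.PosDef) (hB2 : B2.PosDef)
    (h : B2 = γ⁻¹ • B0 + Fᵀ * diagonal δ * F)
    (hM : M * diagonal δ = F * B0⁻¹ * Fᵀ * diagonal δ) :
    γ • (leftInv (capX γ M δ) * F * B0⁻¹) = F * B2⁻¹ := by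
  have u0 := isUnit_det_of_posDef hB0
  have uX := isUnit_capX hγ hB0 hB2 h hM
  have e : capX γ M δ * (F * B2⁻¹) = γ • (F * B0⁻¹) := by
    have e1 : capX γ M δ * F = γ • (F * B0⁻¹ * B2) := by
      rw [h, Matrix.mul_add, Matrix.mul_smul, Matrix.mul_assoc F B0⁻¹ B0, nonsing_inv_mul _ u0,
        Matrix.mul_one, smul_add, smul_smul, mul_inv_cancel₀ hγ.ne', one_smul, capX, hM,
        Matrix.add_mul, Matrix.one_mul, Matrix.smul_mul]
      simp only [Matrix.mul_assoc]
    rw [← Matrix.mul_assoc, e1, Matrix.smul_mul, Matrix.mul_assoc,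
      mul_nonsing_inv _ (isUnit_det_of_posDef hB2), Matrix.mul_one]
  rw [leftInv_eq uX, Matrix.mul_assoc, ← Matrix.mul_smul, ← e, ← Matrix.mul_assoc,
    nonsing_inv_mul _ uX, Matrix.one_mul]

/-- The sketch of the current matrix, computed from that of the initial one. -/
theorem sketchR_eq {A : Matrix ν ι ℝ} {w w2 : ν → ℝ} {pos : κ → ν} {τ : κ → Prop}
    (Q : Matrix μ ν ℝ) (hγ : 0 < γ) (hB0 : B0.PosDef)
    (hB2 : B2.PosDef) (h : B2 = γ⁻¹ • B0 + Fᵀ * diagonal δ * F)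
    (hM : ∀ e f, τ e ∨ τ f → M e f = (F * B0⁻¹ * Fᵀ) e f)
    (hδ : ∀ e, ¬ τ e → δ e = 0) (hε : ∀ e, ¬ τ e → ε e = 0)
    (hF : ∀ e, τ e → ∀ j, F e j = A (pos e) j)
    (hw : ∀ i, Real.sqrt (w2 i) = (Real.sqrt γ)⁻¹ * Real.sqrt (w i) +
      ∑ e, if pos e = i then ε e else 0) :
    sketchR γ M δ ε (Q * diagonal (fun i => Real.sqrt (w i)) * (A * B0⁻¹) * Fᵀ)
        (Q.submatrix id pos) =
      Q * (diagonal (fun i => Real.sqrt (w2 i)) * A * B2⁻¹ * Fᵀ) := by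
  -- The error of M. It lives on pairs of new rows, where the weights δ and ε vanish, so diag(δ) and
  -- diag(ε) annihilate it.
  set D := M - F * B0⁻¹ * Fᵀ with hD
  have hD0 : ∀ e f, τ e ∨ τ f → D e f = 0 := fun e f h => by
    rw [hD, Matrix.sub_apply, hM e f h, sub_self]
  have hDδ : D * diagonal δ = 0 := by
    ext e f
    rw [mul_diagonal, Matrix.zero_apply]
    by_cases hf : τ f
    · rw [hD0 e f (.inr hf), zero_mul]
    · rw [hδ f hf, mul_zero]
  have hδD : diagonal δ * D = 0 := by
    ext e f
    rw [diagonal_mul, Matrix.zero_apply]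
    by_cases hf : τ e
    · rw [hD0 e f (.inl hf), mul_zero]
    · rw [hδ e hf, zero_mul]
  have hεD : diagonal ε * D = 0 := by
    ext e f
    rw [diagonal_mul, Matrix.zero_apply]
    by_cases hf : τ e
    · rw [hD0 e f (.inl hf), mul_zero]
    · rw [hε e hf, zero_mul]
  have hM0 : M = F * B0⁻¹ * Fᵀ + D := by rw [hD]; abel
  have hMδ : M * diagonal δ = F * B0⁻¹ * Fᵀ * diagonal δ := by
    rw [hM0, Matrix.add_mul, hDδ, add_zero]
  have uX := isUnit_capX hγ hB0 hB2 h hMδ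
  have hXF := capX_mul hγ hB0 hB2 h hMδ
  -- X acts as the identity on D, so the error passes through the inverse unchanged and survives in
  -- `capT` only as γ D. The factors ε and δ to its left remove it in the end.
  have hXD : leftInv (capX γ M δ) * D = D := by
    have : capX γ M δ * D = D := by
      rw [capX, Matrix.add_mul, one_mul, Matrix.smul_mul, Matrix.mul_assoc, hδD, Matrix.mul_zero,
        smul_zero, add_zero]
    nth_rw 1 [← this]
    rw [leftInv_eq uX, ← Matrix.mul_assoc, nonsing_inv_mul _ uX, one_mul]
  have hT : capT γ M δ = F * B2⁻¹ * Fᵀ + γ • D := by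
    rw [capT]
    nth_rw 2 [hM0]
    rw [Matrix.mul_add, hXD, smul_add, ← hXF, Matrix.smul_mul]
    simp only [Matrix.mul_assoc]
  set Sel : Matrix ν κ ℝ := Matrix.of fun i e => if pos e = i then 1 else 0 with hSel
  have hQs : Q.submatrix id pos = Q * Sel := by
    ext l e
    simp [mul_apply, hSel]
  -- The square roots of the new weights are those of (1 + θ) times the initial ones, corrected at
  -- the changed rows by ε.
  have hdiag : diagonal (fun i => Real.sqrt (w2 i)) =
      (Real.sqrt γ)⁻¹ • diagonal (fun i => Real.sqrt (w i)) + Sel * diagonal ε * Selᵀ := by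
    ext i j
    rw [Matrix.add_apply, Matrix.smul_apply, mul_apply]
    simp only [mul_diagonal, transpose_apply, hSel, of_apply, diagonal_apply]
    by_cases hij : i = j
    · subst hij
      rw [if_pos rfl, if_pos rfl, hw, smul_eq_mul]
      congr 1
      refine Finset.sum_congr rfl fun e _ => ?_
      split_ifs <;> simp
    · rw [if_neg hij, if_neg hij, smul_zero, zero_add, Finset.sum_eq_zero]
      intro e _
      by_cases h1 : pos e = i
      · rw [if_neg (show ¬ pos e = j from fun h2 => hij (h1.symm.trans h2)), mul_zero]
      · rw [if_neg h1, zero_mul, zero_mul]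
  have hεF : diagonal ε * (Selᵀ * A) = diagonal ε * F := by
    ext e j
    rw [diagonal_mul, diagonal_mul]
    by_cases he : τ e
    · rw [hF e he]
      simp [mul_apply, hSel]
    · rw [hε e he, zero_mul, zero_mul]
  have hinv := inv_eq_of_lowRank hγ hB0 hB2 h
  have hs : (Real.sqrt γ)⁻¹ * γ = Real.sqrt γ := by
    have h1 := Real.sqrt_pos.2 hγ
    field_simp
    exact (Real.sq_sqrt hγ.le).symm
  set W := diagonal (fun i => Real.sqrt (w i)) with hW
  set J := Q * W * (A * B0⁻¹) * Fᵀ with hJ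
  have hfirst : Q * ((Real.sqrt γ)⁻¹ • W * A * B2⁻¹ * Fᵀ) =
      Real.sqrt γ • (J - J * diagonal δ * (F * B2⁻¹ * Fᵀ)) := by
    have : W * A * B2⁻¹ * Fᵀ = γ • (W * A * B0⁻¹ * Fᵀ -
        W * A * B0⁻¹ * Fᵀ * diagonal δ * (F * B2⁻¹ * Fᵀ)) := by
      nth_rw 1 [hinv]
      rw [Matrix.mul_smul, Matrix.smul_mul, Matrix.mul_sub, Matrix.mul_one, Matrix.mul_sub,
        Matrix.sub_mul]
      simp only [Matrix.mul_assoc]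
    rw [Matrix.smul_mul, Matrix.smul_mul, Matrix.smul_mul, this, smul_smul, hs, Matrix.mul_smul,
      Matrix.mul_sub, hJ]
    simp only [Matrix.mul_assoc]
  rw [hdiag, Matrix.add_mul, Matrix.add_mul, Matrix.add_mul, Matrix.mul_add, hfirst, sketchR, hT,
    Matrix.mul_add, Matrix.sub_mul, Matrix.sub_mul, Matrix.mul_smul, Matrix.mul_assoc _ (diagonal ε) D,
    hεD, Matrix.smul_mul _ _ (γ • D), Matrix.mul_smul (J * diagonal δ), Matrix.mul_assoc J _ D, hδD, hQs]
  have e5 : Q * (Sel * diagonal ε * Selᵀ * A * B2⁻¹ * Fᵀ) =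
      Q * Sel * diagonal ε * (F * B2⁻¹ * Fᵀ) := by
    have : Sel * diagonal ε * Selᵀ * A = Sel * diagonal ε * F := by
      rw [Matrix.mul_assoc (Sel * diagonal ε), Matrix.mul_assoc Sel, hεF, Matrix.mul_assoc]
    rw [this]
    simp only [Matrix.mul_assoc]
  rw [e5]
  simp only [Matrix.mul_zero, smul_zero, sub_zero, add_zero, smul_sub, Matrix.smul_mul]
  abel

/-- The inner factor Aᵀ diag(w2) A is B2 itself and cancels one B2⁻¹. This exhibits U B2⁻¹ Uᵀ as the
Gram matrix of a tall matrix, which can be sketched. -/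
theorem gram_sqrt {A : Matrix ν ι ℝ} {w2 : ν → ℝ} (hw : ∀ i, 0 ≤ w2 i) (hB2 : B2.PosDef)
    (h : B2 = Aᵀ * diagonal w2 * A) (U : Matrix κ ι ℝ) :
    (diagonal (fun i => Real.sqrt (w2 i)) * A * B2⁻¹ * Uᵀ)ᵀ *
      (diagonal (fun i => Real.sqrt (w2 i)) * A * B2⁻¹ * Uᵀ) = U * B2⁻¹ * Uᵀ := by
  have hd : diagonal (fun i => Real.sqrt (w2 i)) * diagonal (fun i => Real.sqrt (w2 i)) =
      diagonal w2 := by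
    rw [diagonal_mul_diagonal]
    congr 1
    funext i
    exact Real.mul_self_sqrt (hw i)
  have e : U * B2⁻¹ * (Aᵀ * diagonal w2 * A) * B2⁻¹ * Uᵀ = U * B2⁻¹ * Uᵀ := by
    rw [← h, Matrix.mul_assoc U B2⁻¹ B2, nonsing_inv_mul _ (isUnit_det_of_posDef hB2),
      Matrix.mul_one]
  rw [← e, ← hd]
  simp only [transpose_mul, transpose_transpose, isSymm_of_posDef hB2.inv, diagonal_transpose,
    Matrix.mul_assoc]

end Capacitance

/-- The sketching matrix with the given signs. -/
def signMatrix {m N : ℕ} (w : Fin m → Fin N → Bool) : Matrix (Fin m) (Fin N) ℝ :=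
  Matrix.of fun l j => sgn (w l j)

theorem sketchSq_eq {m N : ℕ} (w : Fin m → Fin N → Bool) (x : Fin N → ℝ) :
    sketchSq w x = (signMatrix w *ᵥ x) ⬝ᵥ (signMatrix w *ᵥ x) := by
  simp [sketchSq, dotProduct, signSum, mulVec, signMatrix, pow_two]

theorem dotProduct_gram_mulVec {μ κ : Type*} [Fintype μ] [Fintype κ] (X : Matrix μ κ ℝ)
    (x : κ → ℝ) : x ⬝ᵥ ((Xᵀ * X) *ᵥ x) = (X *ᵥ x) ⬝ᵥ (X *ᵥ x) := by
  rw [← mulVec_mulVec, dotProduct_mulVec, vecMul_transpose]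

theorem transpose_mul_self_le {μ ν κ : Type*} [Fintype μ] [Fintype ν] [Fintype κ] [DecidableEq κ]
    {X : Matrix μ κ ℝ} {Y : Matrix ν κ ℝ} {a b : ℝ}
    (h : ∀ x, a * ((X *ᵥ x) ⬝ᵥ (X *ᵥ x)) ≤ b * ((Y *ᵥ x) ⬝ᵥ (Y *ᵥ x))) :
    a • (Xᵀ * X) ≤ b • (Yᵀ * Y) := by
  rw [le_iff]
  refine PosSemidef.of_dotProduct_mulVec_nonneg ?_ fun x => ?_
  · rw [IsHermitian, conjTranspose_eq_transpose_of_trivial]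
    simp
  · rw [star_trivial, sub_mulVec, smul_mulVec, smul_mulVec, dotProduct_sub, dotProduct_smul,
      dotProduct_smul, dotProduct_gram_mulVec, dotProduct_gram_mulVec, smul_eq_mul, smul_eq_mul]
    linarith [h x]

theorem SketchGood.gram {m N α : ℕ} {w : Fin m → Fin N → Bool} {X : Matrix (Fin N) (Fin α) ℝ}
    (h : SketchGood w X) (hm : 1 ≤ m) :
    (1 / 25 : ℝ) • (Xᵀ * X) ≤ (m : ℝ)⁻¹ • ((signMatrix w * X)ᵀ * (signMatrix w * X)) ∧
    (m : ℝ)⁻¹ • ((signMatrix w * X)ᵀ * (signMatrix w * X)) ≤ (25 / 4 : ℝ) • (Xᵀ * X) := by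
  have hm0 : (0 : ℝ) < m := by exact_mod_cast hm
  have key : ∀ x, sketchSq w (X *ᵥ x) =
      ((signMatrix w * X) *ᵥ x) ⬝ᵥ ((signMatrix w * X) *ᵥ x) := fun x => by
    rw [sketchSq_eq, mulVec_mulVec]
  have key2 : ∀ x, ∑ j, X.mulVec x j ^ 2 = (X *ᵥ x) ⬝ᵥ (X *ᵥ x) := fun x => by
    simp [dotProduct, pow_two]
  constructor
  · refine transpose_mul_self_le fun x => ?_
    have := (h x).1
    rw [key, key2] at this
    rw [inv_mul_eq_div, le_div_iff₀ hm0]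
    linarith
  · refine transpose_mul_self_le fun x => ?_
    have := (h x).2
    rw [key, key2] at this
    rw [inv_mul_eq_div, div_le_iff₀ hm0]
    linarith

end InverseMaintenance

namespace RealRAM

open Matrix

/-! ### Procedures on matrices -/

/-- The upper left corner of a table is the given matrix. -/
def Rep (f : ℕ → ℕ → ℝ) {p q : ℕ} (M : Matrix (Fin p) (Fin q) ℝ) : Prop :=
  ∀ (i : Fin p) (j : Fin q), f i j = M i j

/-- Only real tables with names at least `k` have changed. -/
structure Frame (k : ℕ) (s s' : Store) : Prop where
  idx : s'.idx = s.idx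
  val : s'.val = s.val
  idxTab : s'.idxTab = s.idxTab
  valTab : ∀ t < k, s'.valTab t = s.valTab t

theorem Frame.refl (k : ℕ) (s : Store) : Frame k s s := ⟨rfl, rfl, rfl, fun _ _ => rfl⟩

theorem Frame.setVT {k : ℕ} {s s' : Store} (h : Frame k s s') {t : ℕ} (ht : k ≤ t)
    (f : ℕ → ℕ → ℝ) : Frame k s (s'.setVT t f) :=
  ⟨h.idx, h.val, h.idxTab, fun t' ht' => by
    rw [Store.setVT_valTab, if_neg (by omega), h.valTab t' ht']⟩

/-- The side conditions of `Tri.fill` as a Boolean, so that each use is settled by evaluation. The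
bound 100 on the lengths of the expressions gives all fills the same constant. -/
def fillOk (tab : ℕ) (oi oj p q n : IE) (e : RE) : Bool :=
  decide (tab < 60) && oi.Ok false 60 && oj.Ok false 60 && p.Ok false 60 && q.Ok false 60 &&
    n.Ok false 60 && e.Ok true 60 &&
    decide (oi.cost + oj.cost + p.cost + q.cost + n.cost + e.cost ≤ 100)

theorem Tri.fillAt {b : Bool} {tab : ℕ} {oi oj p q n : IE} {e : RE}
    (hok : fillOk tab oi oj p q n e = true) (s : Store) {u v P Q N : ℕ} (hu : oi.eval s = u)
    (hv : oj.eval s = v) (hp : p.eval s = P)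
    (hq : q.eval s = Q) (hn : n.eval s = N) (F : Fin P → Fin Q → Fin N → ℝ)
    (hf : ∀ (i : Fin P) (j : Fin Q) (k : Fin N) (g : ℕ → ℕ → ℝ),
      g (u + i) (v + j) = s.valTab tab (u + i) (v + j) →
      e.eval ((s.setVT tab g).setLoop i j k) = F i j k) :
    ∃ f, (∀ (i : Fin P) (j : Fin Q), f (u + i) (v + j) = ∑ k, F i j k) ∧
      (∀ x y, ¬ ((u ≤ x ∧ x < u + P) ∧ (v ≤ y ∧ y < v + Q)) → f x y = s.valTab tab x y) ∧
      Tri b 60 (RealRAM.fill tab oi oj p q n e) s (2000 * ((P + 1) * (Q + 1) * (N + 1)))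
        (s.setVT tab f) := by
  subst hu hv hp hq hn
  simp only [fillOk, Bool.and_eq_true, decide_eq_true_eq] at hok
  obtain ⟨⟨⟨⟨⟨⟨⟨h1, h2⟩, h3⟩, h4⟩, h5⟩, h6⟩, h7⟩, h8⟩ := hok
  have t := Tri.fill (b := b) tab (by omega) (by norm_num) oi oj p q n e h2 h3 h4 h5 h6 h7 s
    (fun i j k => if hi : i < p.eval s then if hj : j < q.eval s then if hk : k < n.eval s then
      F ⟨i, hi⟩ ⟨j, hj⟩ ⟨k, hk⟩ else 0 else 0 else 0)
    (by
      intro i hi j hj k hk g hg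
      rw [dif_pos hi, dif_pos hj, dif_pos hk]
      exact hf ⟨i, hi⟩ ⟨j, hj⟩ ⟨k, hk⟩ g hg) h1
  refine ⟨_, ?_, ?_, t.mono ?_⟩
  · intro i j
    rw [fillFun, if_pos ⟨⟨by omega, by omega⟩, by omega, by omega⟩, Finset.sum_range]
    simp
  · intro x y h
    rw [fillFun, if_neg h]
  · gcongr
    rw [fillK]
    have : ((oi.cost + oj.cost + p.cost + q.cost + n.cost + e.cost + 100 : ℕ) : ℝ) ≤ 200 := by
      exact_mod_cast by omega
    linarith

theorem Tri.fillM {b : Bool} {tab : ℕ} {p q n : IE} {e : RE}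
    (hok : fillOk tab (.lit 0) (.lit 0) p q n e = true) (s : Store) {P Q N : ℕ}
    (hp : p.eval s = P) (hq : q.eval s = Q) (hn : n.eval s = N) (M : Matrix (Fin P) (Fin Q) ℝ)
    (F : Fin P → Fin Q → Fin N → ℝ) (hF : ∀ i j, M i j = ∑ k, F i j k)
    (hf : ∀ (i : Fin P) (j : Fin Q) (k : Fin N) (g : ℕ → ℕ → ℝ),
      g i j = s.valTab tab i j → e.eval ((s.setVT tab g).setLoop i j k) = F i j k) :
    ∃ f, Rep f M ∧ Tri b 60 (RealRAM.fill tab (.lit 0) (.lit 0) p q n e) s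
      (2000 * ((P + 1) * (Q + 1) * (N + 1))) (s.setVT tab f) := by
  obtain ⟨f, h1, -, h2⟩ := Tri.fillAt (b := b) hok s (u := 0) (v := 0) rfl rfl hp hq hn F
    (by simpa using hf)
  exact ⟨f, fun i j => by simpa [hF] using h1 i j, h2⟩

/-- A table filled entry by entry. -/
theorem Tri.fillE {b : Bool} {tab : ℕ} {p q : IE} {e : RE}
    (hok : fillOk tab (.lit 0) (.lit 0) p q (.lit 1) e = true) (s : Store) {P Q : ℕ}
    (hp : p.eval s = P) (hq : q.eval s = Q) (M : Matrix (Fin P) (Fin Q) ℝ)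
    (hf : ∀ (i : Fin P) (j : Fin Q) (g : ℕ → ℕ → ℝ),
      g i j = s.valTab tab i j → e.eval ((s.setVT tab g).setLoop i j 0) = M i j) :
    ∃ f, Rep f M ∧ Tri b 60 (RealRAM.fill tab (.lit 0) (.lit 0) p q (.lit 1) e) s
      (4000 * ((P + 1) * (Q + 1))) (s.setVT tab f) := by
  obtain ⟨f, h1, h2⟩ := Tri.fillM (b := b) hok s hp hq (N := 1) rfl M (fun i j _ => M i j)
    (by simp) (fun i j k g hg => by
      have := hf i j g hg
      simpa [Subsingleton.elim k 0] using this)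
  exact ⟨f, h1, h2.mono (by norm_num; linarith)⟩

variable {ω C : ℝ} {P : Prog}

theorem Tri.mulM (hω : 2 ≤ ω) (hC : 0 ≤ C) (hP : IsMulProg ω C P) {a b c p q r bs : ℕ}
    (hlt : a < 60 ∧ b < 60 ∧ c < 60 ∧ p < 60 ∧ q < 60 ∧ r < 60 ∧ bs < 60 ∧ a ≠ c ∧ b ≠ c)
    (s : Store) {p' q' r' B : ℕ} (hp : s.idx p = p') (hq : s.idx q = q') (hr : s.idx r = r')
    (hB : s.idx bs = B) (hB1 : 1 ≤ B) {X : Matrix (Fin p') (Fin q') ℝ}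
    {Y : Matrix (Fin q') (Fin r') ℝ} (hX : Rep (s.valTab a) X) (hY : Rep (s.valTab b) Y) :
    ∃ f, Rep f (X * Y) ∧ Tri false 60 (RealRAM.matMul P a b c p q r bs) s
      (20 * (C + 100000) * ((p' + B) * (q' + B) * (r' + B) * (B : ℝ) ^ (ω - 3)))
      (s.setVT c f) := by
  obtain ⟨h1, h2, h3, h4, h5, h6, h7, h8, h9⟩ := hlt
  have t := Tri.matMul (L := 60) hω hC hP (by norm_num) h1 h2 h3 h4 h5 h6 h7 h8 h9 s
    (by rw [hB]; exact hB1)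
  rw [hp, hq, hr, hB] at t
  refine ⟨_, ?_, t.mono (le_of_eq ?_)⟩
  · intro i j
    simp only [fillFun, zero_le, zero_add, Fin.is_lt, and_self, if_true, Nat.sub_zero]
    rw [mul_apply, Finset.sum_range]
    exact Finset.sum_congr rfl fun k _ => by rw [hX, hY]
  · have hB0 : (0 : ℝ) < B := by exact_mod_cast hB1
    have : (B : ℝ) ^ ω = (B : ℝ) ^ (ω - 3) * B ^ 3 := by
      rw [← Real.rpow_natCast, ← Real.rpow_add hB0]
      norm_num
    rw [this]
    field_simp

theorem Tri.invM (hω : 2 ≤ ω) (hC : 0 ≤ C) (hP : IsMulProg ω C P) {n a c : ℕ}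
    (hlt : n < 60 ∧ a < 60 ∧ c < 60) (s : Store) {N : ℕ} (hN : s.idx n = N) (hN1 : 1 ≤ N)
    {X : Matrix (Fin N) (Fin N) ℝ} (hX : Rep (s.valTab a) X) (hpos : X.PosDef) :
    ∃ f, Rep f X⁻¹ ∧ Tri false 60 (RealRAM.invert P n a c) s
      (20000 * (C + 100000) * ((N : ℝ) ^ ω * (Nat.log 2 N + 1))) (s.setVT c f) := by
  have e : (Matrix.of fun i j : Fin N => s.valTab a i j) = X := by
    ext i j
    exact hX i j
  obtain ⟨f, h1, h2⟩ := Tri.invert (L := 60) hω hC hP le_rfl hlt.1 hlt.2.1 hlt.2.2 s hN hN1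
    (by rw [e]; exact hpos)
  exact ⟨f, fun i j => by rw [h1, e], h2⟩

/-- `1` on the diagonal and `0` elsewhere. -/
def RE.eye : RE := .ite .I .J (.nat (.lit 0)) (.ite .J .I (.nat (.lit 0)) (.nat (.lit 1)))

theorem RE.eye_eval (s : Store) {p : ℕ} (i j : Fin p) (k : ℕ) :
    RE.eye.eval (s.setLoop i j k) = (1 : Matrix (Fin p) (Fin p) ℝ) i j := by
  simp only [RE.eye, RE.eval, IE.eval, IE.I, IE.J, Store.setLoop_idx]
  rcases lt_trichotomy i j with h | h | h
  · simp [Fin.lt_def.1 h, one_apply_ne h.ne]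
  · subst h
    simp
  · simp [Fin.lt_def.1 h, one_apply_ne h.ne', (Fin.lt_def.1 h).not_gt]

end RealRAM

/-! ### The small linear systems of a round -/

namespace InverseMaintenance

open RealRAM Matrix

/-- Solve the small system of a round: from `M` (table 20), `J` (table 12) and `W` (table 22) to the
inverse of the capacitance matrix (table 15) and the preconditioner (table 16). -/
def solve (P : Prog) : Prog :=
  .seq (fill 23 (.lit 0) (.lit 0) (.reg 3) (.reg 3) (.lit 1)
    (.add .eye (.mul (.reg 2) (.mul (.ld 20 .I .J) (.ld 14 .J (.lit 0)))))) <|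
  .seq (fill 24 (.lit 0) (.lit 0) (.reg 3) (.reg 3) (.lit 1) (.ld 23 .J .I)) <|
  .seq (matMul P 24 23 25 3 3 3 3) <|
  .seq (invert P 3 25 26) <|
  .seq (matMul P 26 24 15 3 3 3 3) <|
  .seq (matMul P 15 20 27 3 3 3 3) <|
  .seq (fill 28 (.lit 0) (.lit 0) (.reg 3) (.reg 3) (.lit 1) (.mul (.reg 2) (.ld 27 .I .J))) <|
  .seq (matMul P 22 28 29 6 3 3 3) <|
  .seq (fill 30 (.lit 0) (.lit 0) (.reg 6) (.reg 3) (.lit 1)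
    (.mul (.add (.mul (.reg 3) (.ld 12 .I .J)) (.ld 29 .I .J)) (.ld 14 .J (.lit 2)))) <|
  .seq (fill 31 (.lit 0) (.lit 0) (.reg 3) (.reg 6) (.lit 1) (.ld 30 .J .I)) <|
  .seq (matMul P 31 30 32 3 6 3 3) <|
  .seq (fill 33 (.lit 0) (.lit 0) (.reg 3) (.reg 3) (.lit 1)
    (.add .eye (.div (.ld 32 .I .J) (.nat (.reg 6))))) <|
  .seq (invert P 3 33 34) <|
  fill 16 (.lit 0) (.lit 0) (.reg 3) (.reg 3) (.lit 1)
    (.mul (.div (.nat (.lit 1)) (.nat (.lit 25))) (.ld 34 .I .J))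

variable {ω C : ℝ} {P : Prog}

/-- All matrices have sides α and m ≥ α and are multiplied in blocks of size α, which costs m
α^(ω-1). The logarithm in the cost of the inversions is paid by the assumption m ≥ α (log₂ α + 1).
Both inverted matrices are positive definite: one is XᵀX, the other is 1 plus a Gram matrix. -/
theorem Tri.solve (hω : 2 ≤ ω) (hC : 0 ≤ C) (hP : IsMulProg ω C P) (s : Store) {α m : ℕ}
    (hα : s.idx 3 = α) (hα1 : 1 ≤ α) (hm : s.idx 6 = m) (hαm : α * (Nat.log 2 α + 1) ≤ m)
    {γ : ℝ} (hγ : s.val 2 = γ) (hγ' : s.val 3 = Real.sqrt γ) {δ g : Fin α → ℝ}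
    (hδ : ∀ e : Fin α, s.valTab 14 e 0 = δ e) (hg : ∀ e : Fin α, s.valTab 14 e 2 = g e)
    {M : Matrix (Fin α) (Fin α) ℝ} {J W : Matrix (Fin m) (Fin α) ℝ} (hM : Rep (s.valTab 20) M)
    (hJ : Rep (s.valTab 12) J) (hW : Rep (s.valTab 22) W) (hX : IsUnit (capX γ M δ).det) :
    ∃ s', Tri false 60 (solve P) s (1000000 * (C + 100000) * (m * (α : ℝ) ^ (ω - 1))) s' ∧
      Frame 15 s s' ∧ Rep (s'.valTab 15) (leftInv (capX γ M δ)) ∧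
      Rep (s'.valTab 16)
        (precond m ((Real.sqrt γ • J + W * capT γ M δ) * diagonal g)) := by
  set X := capX γ M δ with hXd
  set R := (Real.sqrt γ • J + W * capT γ M δ) * diagonal g with hR
  have hα0 : (1 : ℝ) ≤ α := by exact_mod_cast hα1
  have hlm : (α : ℝ) * (Nat.log 2 α + 1) ≤ m := by exact_mod_cast hαm
  have hl0 : (0 : ℝ) ≤ Nat.log 2 α := Nat.cast_nonneg _
  have hm' : (α : ℝ) ≤ m := by nlinarith
  set E := (m : ℝ) * (α : ℝ) ^ (ω - 1) with hE
  have hp1 : (α : ℝ) ^ (ω - 1) = (α : ℝ) ^ (ω - 3) * α ^ 2 := by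
    rw [← Real.rpow_natCast, ← Real.rpow_add (by linarith)]
    congr 1
    push_cast
    ring
  have hp2 : (α : ℝ) ≤ (α : ℝ) ^ (ω - 1) := by
    nth_rw 1 [← Real.rpow_one (α : ℝ)]
    exact Real.rpow_le_rpow_of_exponent_le hα0 (by linarith)
  have hp3 : (α : ℝ) ^ ω = α * (α : ℝ) ^ (ω - 1) := by
    nth_rw 2 [← Real.rpow_one (α : ℝ)]
    rw [← Real.rpow_add (by linarith)]
    norm_num
  have hE1 : (m : ℝ) * α ≤ E := by rw [hE]; gcongr
  have hK : 100000 ≤ C + 100000 := by linarith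
  have c1 : (4000 : ℝ) * ((m + 1) * (α + 1)) ≤ 20000 * (C + 100000) * E := by
    have : ((m : ℝ) + 1) * (α + 1) ≤ 4 * E := by nlinarith
    have hE0 : 0 ≤ E := by positivity
    nlinarith
  have c2 : (4000 : ℝ) * ((α + 1) * (α + 1)) ≤ 20000 * (C + 100000) * E := by
    refine le_trans ?_ c1
    gcongr
  have c2' : (4000 : ℝ) * ((α + 1) * (m + 1)) ≤ 20000 * (C + 100000) * E := by
    rwa [mul_comm ((α : ℝ) + 1)]
  have c3 : 20 * (C + 100000) * ((m + α) * (α + α) * (α + α) * (α : ℝ) ^ (ω - 3)) ≤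
      20000 * (C + 100000) * E := by
    have h1 : (m + α) * (α + α) * (α + α) * (α : ℝ) ^ (ω - 3) ≤ 8 * E := by
      have : (m + α) * (α + α) * (α + α) * (α : ℝ) ^ (ω - 3) =
          4 * ((m + α) * (α : ℝ) ^ (ω - 1)) := by rw [hp1]; ring
      rw [this, hE]
      have : (m + α) * (α : ℝ) ^ (ω - 1) ≤ (m + m) * (α : ℝ) ^ (ω - 1) := by gcongr
      linarith
    have h0 : 0 ≤ (C + 100000) * E := by positivity
    nlinarith
  have c4 : 20 * (C + 100000) * ((α + α) * (α + α) * (α + α) * (α : ℝ) ^ (ω - 3)) ≤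
      20000 * (C + 100000) * E := by
    refine le_trans ?_ c3
    gcongr
  have c5 : 20 * (C + 100000) * ((α + α) * (m + α) * (α + α) * (α : ℝ) ^ (ω - 3)) ≤
      20000 * (C + 100000) * E := by
    refine le_trans (le_of_eq ?_) c3
    ring
  have c6 : 20000 * (C + 100000) * ((α : ℝ) ^ ω * (Nat.log 2 α + 1)) ≤
      20000 * (C + 100000) * E := by
    rw [hp3]
    have : α * (α : ℝ) ^ (ω - 1) * (Nat.log 2 α + 1) ≤ E := by
      rw [hE]
      calc _ = α * (Nat.log 2 α + 1) * (α : ℝ) ^ (ω - 1) := by ring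
        _ ≤ _ := by gcongr
    gcongr
  obtain ⟨f1, r1, t1⟩ := Tri.fillE (b := false) (tab := 23) (p := .reg 3) (q := .reg 3)
    (e := .add .eye (.mul (.reg 2) (.mul (.ld 20 .I .J) (.ld 14 .J (.lit 0))))) (by decide) s hα hα X
    (by
      intro i j g' _
      rw [RE.eval, RE.eye_eval]
      simp [RE.eval, IE.eval, IE.I, IE.J, hγ, hM i j, hδ, hXd, capX])
  obtain ⟨f2, r2, t2⟩ := Tri.fillE (b := false) (tab := 24) (p := .reg 3) (q := .reg 3)
    (e := .ld 23 .J .I) (by decide) (s.setVT 23 f1) hα hα Xᵀ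
    (by
      intro i j g' _
      simp [RE.eval, IE.eval, IE.I, IE.J, r1 j i])
  obtain ⟨f3, r3, t3⟩ := Tri.mulM hω hC hP (a := 24) (b := 23) (c := 25) (p := 3) (q := 3) (r := 3)
    (bs := 3) (by decide) ((s.setVT 23 f1).setVT 24 f2) hα hα hα hα hα1 (X := Xᵀ) (Y := X)
    (by simpa using r2) (by simpa using r1)
  obtain ⟨f4, r4, t4⟩ := Tri.invM hω hC hP (n := 3) (a := 25) (c := 26) (by decide)
    (((s.setVT 23 f1).setVT 24 f2).setVT 25 f3) hα hα1 (by simpa using r3)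
    (posDef_transpose_mul_self hX)
  set s4 := (((s.setVT 23 f1).setVT 24 f2).setVT 25 f3).setVT 26 f4 with hs4
  obtain ⟨f5, r5, t5⟩ := Tri.mulM hω hC hP (a := 26) (b := 24) (c := 15) (p := 3) (q := 3) (r := 3)
    (bs := 3) (by decide) s4 hα hα hα hα hα1 (X := (Xᵀ * X)⁻¹) (Y := Xᵀ)
    (by simpa [hs4] using r4) (by simpa [hs4] using r2)
  have r5' : Rep f5 (leftInv X) := r5
  obtain ⟨f6, r6, t6⟩ := Tri.mulM hω hC hP (a := 15) (b := 20) (c := 27) (p := 3) (q := 3) (r := 3)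
    (bs := 3) (by decide) (s4.setVT 15 f5) hα hα hα hα hα1 (X := leftInv X) (Y := M)
    (by simpa using r5') (by simpa [hs4] using hM)
  obtain ⟨f7, r7, t7⟩ := Tri.fillE (b := false) (tab := 28) (p := .reg 3) (q := .reg 3)
    (e := .mul (.reg 2) (.ld 27 .I .J)) (by decide) ((s4.setVT 15 f5).setVT 27 f6) hα hα
    (capT γ M δ)
    (by
      intro i j g' _
      simp [RE.eval, IE.eval, IE.I, IE.J, r6 i j, hs4, hγ, capT, hXd])
  set s7 := ((s4.setVT 15 f5).setVT 27 f6).setVT 28 f7 with hs7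
  obtain ⟨f8, r8, t8⟩ := Tri.mulM hω hC hP (a := 22) (b := 28) (c := 29) (p := 6) (q := 3) (r := 3)
    (bs := 3) (by decide) s7 hm hα hα hα hα1 (X := W) (Y := capT γ M δ)
    (by simpa [hs7, hs4] using hW) (by simpa [hs7] using r7)
  obtain ⟨f9, r9, t9⟩ := Tri.fillE (b := false) (tab := 30) (p := .reg 6) (q := .reg 3)
    (e := .mul (.add (.mul (.reg 3) (.ld 12 .I .J)) (.ld 29 .I .J)) (.ld 14 .J (.lit 2)))
    (by decide) (s7.setVT 29 f8) hm hα R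
    (by
      intro i j g' _
      rw [hR, mul_diagonal]
      simp [RE.eval, IE.eval, IE.I, IE.J, r8 i j, hJ i j, hg, hs7, hs4, hγ'])
  obtain ⟨f10, r10, t10⟩ := Tri.fillE (b := false) (tab := 31) (p := .reg 3) (q := .reg 6)
    (e := .ld 30 .J .I) (by decide) ((s7.setVT 29 f8).setVT 30 f9) hα hm Rᵀ
    (by
      intro i j g' _
      simp [RE.eval, IE.eval, IE.I, IE.J, r9 j i])
  obtain ⟨f11, r11, t11⟩ := Tri.mulM hω hC hP (a := 31) (b := 30) (c := 32) (p := 3) (q := 6)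
    (r := 3) (bs := 3) (by decide) (((s7.setVT 29 f8).setVT 30 f9).setVT 31 f10) hα hm hα hα hα1
    (X := Rᵀ) (Y := R) (by simpa using r10) (by simpa using r9)
  set s11 := (((s7.setVT 29 f8).setVT 30 f9).setVT 31 f10).setVT 32 f11 with hs11
  have hm7 : s7.idx 6 = m := hm
  obtain ⟨f12, r12, t12⟩ := Tri.fillE (b := false) (tab := 33) (p := .reg 3) (q := .reg 3)
    (e := .add .eye (.div (.ld 32 .I .J) (.nat (.reg 6)))) (by decide) s11 hα hα
    (1 + (m : ℝ)⁻¹ • (Rᵀ * R))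
    (by
      intro i j g' _
      rw [RE.eval, RE.eye_eval]
      simp [RE.eval, IE.eval, IE.I, IE.J, hm7, hs11, r11 i j, div_eq_inv_mul])
  have hpos : (1 + (m : ℝ)⁻¹ • (Rᵀ * R)).PosDef := by
    have := posSemidef_conjTranspose_mul_self R
    rw [conjTranspose_eq_transpose_of_trivial] at this
    exact PosDef.one.add_posSemidef (this.smul (by positivity))
  obtain ⟨f13, r13, t13⟩ := Tri.invM hω hC hP (n := 3) (a := 33) (c := 34) (by decide)
    (s11.setVT 33 f12) hα hα1 (by simpa using r12) hpos
  obtain ⟨f14, r14, t14⟩ := Tri.fillE (b := false) (tab := 16) (p := .reg 3) (q := .reg 3)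
    (e := .mul (.div (.nat (.lit 1)) (.nat (.lit 25))) (.ld 34 .I .J)) (by decide)
    ((s11.setVT 33 f12).setVT 34 f13) hα hα (precond m R)
    (by
      intro i j g' _
      simp [RE.eval, IE.eval, IE.I, IE.J, r13 i j, precond])
  refine ⟨_, (((t1.mono c2).seq <| (t2.mono c2).seq <| (t3.mono c4).seq <| (t4.mono c6).seq <|
    (t5.mono c4).seq <| (t6.mono c4).seq <| (t7.mono c2).seq <| (t8.mono c3).seq <|
    (t9.mono c1).seq <| (t10.mono c2').seq <| (t11.mono c5).seq <| (t12.mono c2).seq <|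
    (t13.mono c6).seq (t14.mono c2))).mono ?_, ?_, ?_, ?_⟩
  · have h0 : 0 ≤ (C + 100000) * E := by positivity
    nlinarith
  · have F4 : Frame 15 s s4 := ((((Frame.refl 15 s).setVT (by norm_num) f1).setVT (by norm_num)
      f2).setVT (by norm_num) f3).setVT (by norm_num) f4
    have F7 : Frame 15 s s7 := ((F4.setVT (by norm_num) f5).setVT (by norm_num) f6).setVT
      (by norm_num) f7
    have F11 : Frame 15 s s11 := (((F7.setVT (by norm_num) f8).setVT (by norm_num) f9).setVT
      (by norm_num) f10).setVT (by norm_num) f11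
    exact ((F11.setVT (by norm_num) f12).setVT (by norm_num) f13).setVT (by norm_num) f14
  · simpa [hs11, hs7, hs4] using r5'
  · simpa using r14

end InverseMaintenance

/-! ### Procedures on vectors and the query program -/

namespace RealRAM

open Matrix

/-- The first column of a table starts with the given vector. -/
def RepV (f : ℕ → ℕ → ℝ) {p : ℕ} (x : Fin p → ℝ) : Prop := ∀ i : Fin p, f i 0 = x i

theorem Tri.fillV {b : Bool} {tab : ℕ} {p n : IE} {e : RE}
    (hok : fillOk tab (.lit 0) (.lit 0) p (.lit 1) n e = true) (s : Store) {P N : ℕ}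
    (hp : p.eval s = P) (hn : n.eval s = N) (x : Fin P → ℝ)
    (F : Fin P → Fin N → ℝ) (hF : ∀ i, x i = ∑ k, F i k)
    (hf : ∀ (i : Fin P) (k : Fin N) (g : ℕ → ℕ → ℝ),
      g i 0 = s.valTab tab i 0 → e.eval ((s.setVT tab g).setLoop i 0 k) = F i k) :
    ∃ f, RepV f x ∧ Tri b 60 (RealRAM.fill tab (.lit 0) (.lit 0) p (.lit 1) n e) s
      (4000 * ((P + 1) * (N + 1))) (s.setVT tab f) := by
  obtain ⟨f, h1, h2⟩ := Tri.fillM (b := b) hok s hp (Q := 1) rfl hn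
    (Matrix.of fun i (_ : Fin 1) => x i) (fun i _ k => F i k) (fun i j => by simp [hF])
    (fun i j k g hg => by
      obtain rfl : j = 0 := Subsingleton.elim _ _
      exact hf i k g hg)
  exact ⟨f, fun i => by simpa using h1 i 0, h2.mono (by norm_num; linarith)⟩

theorem Tri.fillV1 {b : Bool} {tab : ℕ} {p : IE} {e : RE}
    (hok : fillOk tab (.lit 0) (.lit 0) p (.lit 1) (.lit 1) e = true) (s : Store) {P : ℕ}
    (hp : p.eval s = P) (x : Fin P → ℝ)
    (hf : ∀ (i : Fin P) (g : ℕ → ℕ → ℝ),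
      g i 0 = s.valTab tab i 0 → e.eval ((s.setVT tab g).setLoop i 0 0) = x i) :
    ∃ f, RepV f x ∧ Tri b 60 (RealRAM.fill tab (.lit 0) (.lit 0) p (.lit 1) (.lit 1) e) s
      (8000 * (P + 1)) (s.setVT tab f) := by
  obtain ⟨f, h1, h2⟩ := Tri.fillV (b := b) hok s hp (N := 1) rfl x (fun i _ => x i)
    (by simp) (fun i k g hg => by
      have := hf i g hg
      simpa [Subsingleton.elim k 0] using this)
  exact ⟨f, h1, h2.mono (by norm_num; linarith)⟩

/-- The two memories agree in the index registers, in the index tables, in the real registers `V`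
and in the real tables `T`. -/
structure Agree (V T : ℕ → Bool) (s s' : Store) : Prop where
  idx : s'.idx = s.idx
  idxTab : s'.idxTab = s.idxTab
  val : ∀ x, V x = true → s'.val x = s.val x
  valTab : ∀ t, T t = true → s'.valTab t = s.valTab t

namespace Agree

variable {V T : ℕ → Bool} {s s' s'' : Store}

theorem refl (s : Store) : Agree V T s s := ⟨rfl, rfl, fun _ _ => rfl, fun _ _ => rfl⟩

theorem trans (h : Agree V T s s') (h' : Agree V T s' s'') : Agree V T s s'' :=
  ⟨h'.idx.trans h.idx, h'.idxTab.trans h.idxTab, fun x hx => (h'.val x hx).trans (h.val x hx),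
    fun t ht => (h'.valTab t ht).trans (h.valTab t ht)⟩

theorem setVT (h : Agree V T s s') {t : ℕ} (ht : T t = false) (f : ℕ → ℕ → ℝ) :
    Agree V T s (s'.setVT t f) :=
  ⟨h.idx, h.idxTab, h.val, fun t' ht' => by
    rw [Store.setVT_valTab, if_neg (by rintro rfl; simp_all), h.valTab t' ht']⟩

theorem setR (h : Agree V T s s') {x : ℕ} (hx : V x = false) (v : ℝ) :
    Agree V T s (s'.setR x v) :=
  ⟨h.idx, h.idxTab, fun x' hx' => by
    rw [Store.setR_val, if_neg (by rintro rfl; simp_all), h.val x' hx'], h.valTab⟩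

end Agree

end RealRAM

namespace InverseMaintenance

open RealRAM Matrix

/-- The vector `γ X F G x` for the vector `x` in table `src`, left in table 42. -/
def tvec (src : ℕ) : Prog :=
  .seq (fill 40 (.lit 0) (.lit 0) (.reg 1) (.lit 1) (.reg 1)
    (.mul (.ld 7 .I .K) (.ld src .K (.lit 0)))) <|
  .seq (fill 41 (.lit 0) (.lit 0) (.reg 3) (.lit 1) (.reg 1)
    (.mul (.ld 11 .I .K) (.ld 40 .K (.lit 0)))) <|
  fill 42 (.lit 0) (.lit 0) (.reg 3) (.lit 1) (.reg 3)
    (.mul (.reg 2) (.mul (.ld 15 .I .K) (.ld 41 .K (.lit 0))))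

/-- One step of the Richardson iteration for the vector in table 44. -/
def refineStep : Prog :=
  .seq (fill 45 (.lit 0) (.lit 0) (.reg 1) (.lit 1) (.reg 3)
    (.mul (.ld 11 .K .I) (.mul (.ld 14 .K (.lit 2)) (.ld 44 .K (.lit 0))))) <|
  .seq (tvec 45) <|
  .seq (fill 46 (.lit 0) (.lit 0) (.reg 3) (.lit 1) (.lit 1)
    (.sub (.sub (.ld 43 .I (.lit 0)) (.ld 44 .I (.lit 0)))
      (.mul (.ld 14 .I (.lit 2)) (.ld 42 .I (.lit 0))))) <|
  .seq (fill 47 (.lit 0) (.lit 0) (.reg 3) (.lit 1) (.reg 3)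
    (.mul (.ld 16 .I .K) (.ld 46 .K (.lit 0)))) <|
  .seq (fill 44 (.lit 0) (.lit 0) (.reg 3) (.lit 1) (.lit 1)
    (.add (.ld 44 .I (.lit 0)) (.ld 47 .I (.lit 0)))) <|
  -- Real register 5 holds (621/625)^t, the bound on the relative error after t steps; the loop ends
  -- when it has dropped to the tolerance in register 4.
  assignR 5 (.mul (.reg 5) (.div (.nat (.lit 621)) (.nat (.lit 625))))

/-- The program for queries. -/
def applyProg : Prog :=
  .seq (tvec 2) <|
  .seq (fill 43 (.lit 0) (.lit 0) (.reg 3) (.lit 1) (.lit 1)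
    (.mul (.ld 14 .I (.lit 2)) (.ld 42 .I (.lit 0)))) <|
  .seq (fill 44 (.lit 0) (.lit 0) (.reg 3) (.lit 1) (.lit 1) (.nat (.lit 0))) <|
  .seq (assignR 5 (.nat (.lit 1))) <|
  .seq (.loop (.valLt 4 5) refineStep) <|
  .seq (fill 45 (.lit 0) (.lit 0) (.reg 1) (.lit 1) (.reg 3)
    (.mul (.ld 11 .K .I) (.mul (.ld 14 .K (.lit 2)) (.ld 44 .K (.lit 0))))) <|
  .seq (fill 48 (.lit 0) (.lit 0) (.reg 1) (.lit 1) (.lit 1)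
    (.sub (.ld 2 .I (.lit 0)) (.ld 45 .I (.lit 0)))) <|
  .seq (tvec 48) <|
  .seq (fill 49 (.lit 0) (.lit 0) (.reg 1) (.lit 1) (.reg 3)
    (.mul (.ld 11 .K .I) (.mul (.ld 14 .K (.lit 0)) (.ld 42 .K (.lit 0))))) <|
  .seq (fill 50 (.lit 0) (.lit 0) (.reg 1) (.lit 1) (.lit 1)
    (.sub (.ld 48 .I (.lit 0)) (.ld 49 .I (.lit 0)))) <|
  fill 3 (.lit 0) (.lit 0) (.reg 1) (.lit 1) (.reg 1)
    (.mul (.reg 2) (.mul (.ld 7 .I .K) (.ld 50 .K (.lit 0))))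

/-- The data that queries use. -/
structure QueryData (d α : ℕ) where
  γ : ℝ
  thr : ℝ
  G : Matrix (Fin d) (Fin d) ℝ
  F : Matrix (Fin α) (Fin d) ℝ
  δ : Fin α → ℝ
  g : Fin α → ℝ
  X : Matrix (Fin α) (Fin α) ℝ
  Y : Matrix (Fin α) (Fin α) ℝ

structure QueryData.Holds {d α : ℕ} (D : QueryData d α) (s : Store) : Prop where
  dim : s.idx 1 = d
  slots : s.idx 3 = α
  γ : s.val 2 = D.γ
  thr : s.val 4 = D.thr
  G : Rep (s.valTab 7) D.G
  F : Rep (s.valTab 11) D.F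
  δ : ∀ e : Fin α, s.valTab 14 e 0 = D.δ e
  g : ∀ e : Fin α, s.valTab 14 e 2 = D.g e
  X : Rep (s.valTab 15) D.X
  Y : Rep (s.valTab 16) D.Y

/-- What queries keep. -/
def keepV (x : ℕ) : Bool := x != 5
def keepT (t : ℕ) : Bool := t != 3 && decide (t < 40)
-- Table 43 holds the right-hand side of the iteration and must survive the refinement steps as
-- well.
def keepT' (t : ℕ) : Bool := t != 3 && decide (t < 40) || t == 43

theorem QueryData.Holds.congr {d α : ℕ} {D : QueryData d α} {s s' : Store} (h : D.Holds s)
    (h' : Agree keepV keepT s s') : D.Holds s' := by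
  constructor
  · rw [h'.idx]; exact h.dim
  · rw [h'.idx]; exact h.slots
  · rw [h'.val 2 rfl]; exact h.γ
  · rw [h'.val 4 rfl]; exact h.thr
  · rw [h'.valTab 7 rfl]; exact h.G
  · rw [h'.valTab 11 rfl]; exact h.F
  · rw [h'.valTab 14 rfl]; exact h.δ
  · rw [h'.valTab 14 rfl]; exact h.g
  · rw [h'.valTab 15 rfl]; exact h.X
  · rw [h'.valTab 16 rfl]; exact h.Y

theorem _root_.RealRAM.Agree.weaken {s s' : Store} (h : Agree keepV keepT' s s') : Agree keepV keepT s s' :=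
  ⟨h.idx, h.idxTab, h.val, fun t ht => h.valTab t (by simp [keepT, keepT'] at ht ⊢; omega)⟩

section

variable {d α : ℕ} {D : QueryData d α} {s : Store}

theorem vec_cost {p q : ℕ} (hp : p ≤ d) (hq : q ≤ d) (hd : 1 ≤ d) :
    (4000 : ℝ) * ((p + 1) * (q + 1)) ≤ 16000 * (d : ℝ) ^ 2 := by
  have h1 : (p : ℝ) + 1 ≤ 2 * d := by exact_mod_cast by omega
  have h2 : (q : ℝ) + 1 ≤ 2 * d := by exact_mod_cast by omega
  have : ((p : ℝ) + 1) * (q + 1) ≤ (2 * d) * (2 * d) := by gcongr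
  nlinarith

theorem vec_cost1 {p : ℕ} (hp : p ≤ d) (hd : 1 ≤ d) :
    (8000 : ℝ) * (p + 1) ≤ 16000 * (d : ℝ) ^ 2 := by
  have h1 : (p : ℝ) + 1 ≤ 2 * d := by exact_mod_cast by omega
  have h2 : (1 : ℝ) ≤ d := by exact_mod_cast hd
  nlinarith

/-- When X is the inverse capacitance matrix and G = B0⁻¹, this is F B2⁻¹ x. -/
def QueryData.tv (D : QueryData d α) (x : Fin d → ℝ) : Fin α → ℝ :=
  D.γ • (D.X *ᵥ (D.F *ᵥ (D.G *ᵥ x)))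

theorem Tri.tvec (h : D.Holds s) (hd : 1 ≤ d) (hα : α ≤ d) {src : ℕ}
    (hsrc : src = 2 ∨ src = 45 ∨ src = 48) {x : Fin d → ℝ}
    (hx : RepV (s.valTab src) x) : ∃ f0 f1 f2, RepV f2 (D.tv x) ∧
      Tri false 60 (tvec src) s (48000 * (d : ℝ) ^ 2)
        (((s.setVT 40 f0).setVT 41 f1).setVT 42 f2) := by
  have hn : src ≠ 40 ∧ src ≠ 41 := by omega
  obtain ⟨f0, r0, t0⟩ := Tri.fillV (b := false) (tab := 40) (p := .reg 1) (n := .reg 1)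
    (e := .mul (.ld 7 .I .K) (.ld src .K (.lit 0))) (by rcases hsrc with rfl | rfl | rfl <;> decide)
    s h.dim h.dim (D.G *ᵥ x) (fun i k => D.G i k * x k) (fun i => rfl)
    (by
      intro i k g _
      simp [RE.eval, IE.eval, IE.I, IE.K, h.G i k, hx k, hn])
  obtain ⟨f1, r1, t1⟩ := Tri.fillV (b := false) (tab := 41) (p := .reg 3) (n := .reg 1)
    (e := .mul (.ld 11 .I .K) (.ld 40 .K (.lit 0))) (by decide)
    (s.setVT 40 f0) h.slots h.dim (D.F *ᵥ (D.G *ᵥ x)) (fun i k => D.F i k * (D.G *ᵥ x) k) (fun i => rfl)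
    (by
      intro i k g _
      simp [RE.eval, IE.eval, IE.I, IE.K, h.F i k, r0 k])
  obtain ⟨f2, r2, t2⟩ := Tri.fillV (b := false) (tab := 42) (p := .reg 3) (n := .reg 3)
    (e := .mul (.reg 2) (.mul (.ld 15 .I .K) (.ld 41 .K (.lit 0)))) (by decide)
    ((s.setVT 40 f0).setVT 41 f1) h.slots h.slots (D.tv x)
    (fun i k => D.γ * (D.X i k * (D.F *ᵥ (D.G *ᵥ x)) k))
    (fun i => by rw [← Finset.mul_sum]; rfl)
    (by
      intro i k g _
      simp [RE.eval, IE.eval, IE.I, IE.K, h.X i k, r1 k, h.γ])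
  refine ⟨f0, f1, f2, r2, ((t0.mono (vec_cost le_rfl le_rfl hd)).seq
    ((t1.mono (vec_cost hα le_rfl hd)).seq (t2.mono (vec_cost hα hα hd)))).mono ?_⟩
  linarith

/-- Richardson iteration for 1 + U B2⁻¹ Uᵀ with U = diag(g) F. The matrix is never formed; it is
applied factor by factor. -/
def QueryData.iter (D : QueryData d α) (y : Fin α → ℝ) : ℕ → Fin α → ℝ
  | 0 => 0
  | t + 1 => D.iter y t + D.Y *ᵥ (y - D.iter y t - D.g * D.tv (D.Fᵀ *ᵥ (D.g * D.iter y t)))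

theorem Tri.refineStep (h : D.Holds s) (hd : 1 ≤ d) (hα : α ≤ d) {y : Fin α → ℝ} {t : ℕ}
    (hy : RepV (s.valTab 43) y) (hz : RepV (s.valTab 44) (D.iter y t)) : ∃ s',
      Tri false 60 refineStep s (113000 * (d : ℝ) ^ 2) s' ∧ Agree keepV keepT' s s' ∧
      RepV (s'.valTab 44) (D.iter y (t + 1)) ∧ s'.val 5 = s.val 5 * (621 / 625) := by
  obtain ⟨f0, r0, t0⟩ := Tri.fillV (b := false) (tab := 45) (p := .reg 1) (n := .reg 3)
    (e := .mul (.ld 11 .K .I) (.mul (.ld 14 .K (.lit 2)) (.ld 44 .K (.lit 0)))) (by decide)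
    s h.dim h.slots (D.Fᵀ *ᵥ (D.g * D.iter y t)) (fun i k => D.F k i * (D.g k * D.iter y t k))
    (fun i => rfl)
    (by
      intro i k g _
      simp [RE.eval, IE.eval, IE.I, IE.K, h.F k i, hz k, h.g])
  obtain ⟨f1, f2, f3, r3, t3⟩ := Tri.tvec (h.congr ((Agree.refl s).setVT (t := 45) rfl f0)) hd hα
    (src := 45) (by simp) (by simpa using r0)
  set s1 := (((s.setVT 45 f0).setVT 40 f1).setVT 41 f2).setVT 42 f3 with hs1
  obtain ⟨f4, r4, t4⟩ := Tri.fillV1 (b := false) (tab := 46) (p := .reg 3)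
    (e := .sub (.sub (.ld 43 .I (.lit 0)) (.ld 44 .I (.lit 0)))
      (.mul (.ld 14 .I (.lit 2)) (.ld 42 .I (.lit 0)))) (by decide) s1 h.slots
    (y - D.iter y t - D.g * D.tv (D.Fᵀ *ᵥ (D.g * D.iter y t)))
    (by
      intro i g _
      simp [RE.eval, IE.eval, IE.I, hy i, hz i, r3 i, h.g, hs1])
  obtain ⟨f5, r5, t5⟩ := Tri.fillV (b := false) (tab := 47) (p := .reg 3) (n := .reg 3)
    (e := .mul (.ld 16 .I .K) (.ld 46 .K (.lit 0))) (by decide) (s1.setVT 46 f4) h.slots h.slots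
    (D.Y *ᵥ (y - D.iter y t - D.g * D.tv (D.Fᵀ *ᵥ (D.g * D.iter y t)))) (fun i k => D.Y i k * _)
    (fun i => rfl)
    (by
      intro i k g _
      simp [RE.eval, IE.eval, IE.I, IE.K, h.Y i k, r4 k, hs1])
  obtain ⟨f6, r6, t6⟩ := Tri.fillV1 (b := false) (tab := 44) (p := .reg 3)
    (e := .add (.ld 44 .I (.lit 0)) (.ld 47 .I (.lit 0))) (by decide)
    ((s1.setVT 46 f4).setVT 47 f5) h.slots (D.iter y (t + 1))
    (by
      intro i g hg
      have : g i 0 = D.iter y t i := by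
        rw [hg, ← hz i]
        simp [hs1]
      simp [RE.eval, IE.eval, IE.I, this, r5 i, QueryData.iter])
  have t7 := Tri.assignR (b := false) (L := 60) (by norm_num) 5 (by norm_num)
    (.mul (.reg 5) (.div (.nat (.lit 621)) (.nat (.lit 625)))) (by decide)
    (((s1.setVT 46 f4).setVT 47 f5).setVT 44 f6)
  refine ⟨_, ((t0.mono (vec_cost le_rfl hα hd)).seq (t3.seq ((t4.mono (vec_cost1 hα hd)).seq
    ((t5.mono (vec_cost hα hα hd)).seq ((t6.mono (vec_cost1 hα hd)).seq t7))))).mono ?_, ?_, ?_, ?_⟩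
  · have h2 : (1 : ℝ) ≤ d := by exact_mod_cast hd
    simp only [RE.cost, IE.cost]
    norm_num
    nlinarith
  · exact ((((((((Agree.refl s).setVT rfl f0).setVT rfl f1).setVT rfl f2).setVT rfl f3).setVT rfl
      f4).setVT rfl f5).setVT rfl f6).setR rfl _
  · simpa using r6
  · simp [RE.eval, IE.eval, hs1]

/-- The answer to a query. -/
def QueryData.answer (D : QueryData d α) (T : ℕ) (v : Fin d → ℝ) : Fin d → ℝ :=
  let x := v - D.Fᵀ *ᵥ (D.g * D.iter (D.g * D.tv v) T)
  D.γ • (D.G *ᵥ (x - D.Fᵀ *ᵥ (D.δ * D.tv x)))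

/-- The hypotheses on T identify it as the exact number of passes of the loop. Each pass consists of
products of a vector with stored matrices of sides at most d. -/
theorem Tri.applyProg (h : D.Holds s) (hd : 1 ≤ d) (hα : α ≤ d) {v : Fin d → ℝ}
    (hv : RepV (s.valTab 2) v) {T : ℕ} (hT : (621 / 625 : ℝ) ^ T ≤ D.thr)
    (hT' : ∀ t < T, D.thr < (621 / 625 : ℝ) ^ t) :
    ∃ s', Tri false 60 applyProg s (300000 * ((d : ℝ) ^ 2 * (T + 1))) s' ∧
      Agree keepV keepT s s' ∧ RepV (s'.valTab 3) (D.answer T v) := by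
  obtain ⟨f1, f2, f3, r3, t3⟩ := Tri.tvec h hd hα (src := 2) (by simp) hv
  set s1 := ((s.setVT 40 f1).setVT 41 f2).setVT 42 f3 with hs1
  set y := D.g * D.tv v with hy
  obtain ⟨f4, r4, t4⟩ := Tri.fillV1 (b := false) (tab := 43) (p := .reg 3)
    (e := .mul (.ld 14 .I (.lit 2)) (.ld 42 .I (.lit 0))) (by decide) s1 h.slots y
    (by
      intro i g _
      simp [RE.eval, IE.eval, IE.I, r3 i, h.g, hs1, hy])
  obtain ⟨f5, r5, t5⟩ := Tri.fillV1 (b := false) (tab := 44) (p := .reg 3)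
    (e := .nat (.lit 0)) (by decide) (s1.setVT 43 f4) h.slots (D.iter y 0)
    (by
      intro i g _
      simp [RE.eval, IE.eval, QueryData.iter])
  have t6 := Tri.assignR (b := false) (L := 60) (by norm_num) 5 (by norm_num)
    (.nat (.lit 1)) (by decide) ((s1.setVT 43 f4).setVT 44 f5)
  set s2 := ((s1.setVT 43 f4).setVT 44 f5).setR 5 (RE.eval ((s1.setVT 43 f4).setVT 44 f5)
    (.nat (.lit 1))) with hs2
  have A2 : Agree keepV keepT s s2 :=
    ((((((Agree.refl s).setVT rfl f1).setVT rfl f2).setVT rfl f3).setVT rfl f4).setVT rfl f5).setR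
      rfl _
  obtain ⟨s3, ⟨a3, b3, c3⟩, t7⟩ := Tri.while (b := false) (L := 60) (P := InverseMaintenance.refineStep)
    (cd := .valLt 4 5) ⟨by norm_num, by norm_num⟩ (N := T) (c := fun _ => 113000 * (d : ℝ) ^ 2)
    (fun t s' => Agree keepV keepT' s2 s' ∧ RepV (s'.valTab 44) (D.iter y t) ∧
      s'.val 5 = (621 / 625 : ℝ) ^ t)
    (by
      rintro t ht s' ⟨h1, h2, h3⟩
      have hQ := h.congr (A2.trans h1.weaken)
      refine ⟨?_, ?_⟩
      · simp only [Cond.Holds, h3, hQ.thr]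
        exact hT' t ht
      · obtain ⟨s'', u1, u2, u3, u4⟩ := Tri.refineStep hQ hd hα (y := y) (t := t)
          (by rw [h1.valTab 43 rfl]; simpa [hs2] using r4) h2
        exact ⟨s'', u1, h1.trans u2, u3, by rw [u4, h3, pow_succ]⟩)
    (by
      rintro s' ⟨h1, h2, h3⟩
      have hQ := h.congr (A2.trans h1.weaken)
      simp only [Cond.Holds, h3, hQ.thr, not_lt]
      exact hT)
    (s := s2) ⟨.refl _, by simpa [hs2] using r5, by simp [hs2, RE.eval, IE.eval]⟩
  have h3 := h.congr (A2.trans a3.weaken)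
  have hv3 : RepV (s3.valTab 2) v := by rw [a3.valTab 2 rfl, A2.valTab 2 rfl]; exact hv
  set z := D.iter y T with hz
  obtain ⟨f8, r8, t8⟩ := Tri.fillV (b := false) (tab := 45) (p := .reg 1) (n := .reg 3)
    (e := .mul (.ld 11 .K .I) (.mul (.ld 14 .K (.lit 2)) (.ld 44 .K (.lit 0)))) (by decide)
    s3 h3.dim h3.slots (D.Fᵀ *ᵥ (D.g * z)) (fun i k => D.F k i * (D.g k * z k))
    (fun i => rfl)
    (by
      intro i k g _
      simp [RE.eval, IE.eval, IE.I, IE.K, h3.F k i, b3 k, h3.g])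
  set x := v - D.Fᵀ *ᵥ (D.g * z) with hx
  obtain ⟨f9, r9, t9⟩ := Tri.fillV1 (b := false) (tab := 48) (p := .reg 1)
    (e := .sub (.ld 2 .I (.lit 0)) (.ld 45 .I (.lit 0))) (by decide) (s3.setVT 45 f8) h3.dim x
    (by
      intro i g _
      simp [RE.eval, IE.eval, IE.I, r8 i, hv3 i, hx])
  have A9 : Agree keepV keepT s3 ((s3.setVT 45 f8).setVT 48 f9) :=
    ((Agree.refl s3).setVT rfl f8).setVT rfl f9
  obtain ⟨g1, g2, g3, r10, t10⟩ := Tri.tvec (h3.congr A9) hd hα (src := 48) (by simp)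
    (by simpa using r9)
  set s4 := ((((s3.setVT 45 f8).setVT 48 f9).setVT 40 g1).setVT 41 g2).setVT 42 g3 with hs4
  have A4 : Agree keepV keepT s3 s4 := ((A9.setVT rfl g1).setVT rfl g2).setVT rfl g3
  have h4 := h3.congr A4
  obtain ⟨f11, r11, t11⟩ := Tri.fillV (b := false) (tab := 49) (p := .reg 1) (n := .reg 3)
    (e := .mul (.ld 11 .K .I) (.mul (.ld 14 .K (.lit 0)) (.ld 42 .K (.lit 0)))) (by decide)
    s4 h4.dim h4.slots (D.Fᵀ *ᵥ (D.δ * D.tv x)) (fun i k => D.F k i * (D.δ k * D.tv x k))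
    (fun i => rfl)
    (by
      intro i k g _
      have e1 : s4.valTab 42 k 0 = D.tv x k := by simpa [hs4] using r10 k
      simp [RE.eval, IE.eval, IE.I, IE.K, h4.F k i, e1, h4.δ])
  obtain ⟨f12, r12, t12⟩ := Tri.fillV1 (b := false) (tab := 50) (p := .reg 1)
    (e := .sub (.ld 48 .I (.lit 0)) (.ld 49 .I (.lit 0))) (by decide) (s4.setVT 49 f11) h4.dim
    (x - D.Fᵀ *ᵥ (D.δ * D.tv x))
    (by
      intro i g _
      simp [RE.eval, IE.eval, IE.I, r9 i, r11 i, hs4])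
  have A5 : Agree keepV keepT s4 ((s4.setVT 49 f11).setVT 50 f12) :=
    ((Agree.refl s4).setVT rfl f11).setVT rfl f12
  have h5 := h4.congr A5
  obtain ⟨f13, r13, t13⟩ := Tri.fillV (b := false) (tab := 3) (p := .reg 1) (n := .reg 1)
    (e := .mul (.reg 2) (.mul (.ld 7 .I .K) (.ld 50 .K (.lit 0)))) (by decide)
    ((s4.setVT 49 f11).setVT 50 f12) h5.dim h5.dim (D.answer T v)
    (fun i k => D.γ * (D.G i k * (x - D.Fᵀ *ᵥ (D.δ * D.tv x)) k))
    (fun i => by rw [← Finset.mul_sum]; rfl)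
    (by
      intro i k g _
      simp [RE.eval, IE.eval, IE.I, IE.K, h4.G i k, r12 k, h4.γ])
  refine ⟨_, (t3.seq <| (t4.mono (vec_cost1 hα hd)).seq <| (t5.mono (vec_cost1 hα hd)).seq <|
    t6.seq <| t7.seq <| (t8.mono (vec_cost le_rfl hα hd)).seq <|
    (t9.mono (vec_cost1 le_rfl hd)).seq <| t10.seq <| (t11.mono (vec_cost le_rfl hα hd)).seq <|
    (t12.mono (vec_cost1 le_rfl hd)).seq (t13.mono (vec_cost le_rfl le_rfl hd))).mono ?_, ?_, ?_⟩
  · have h2 : (1 : ℝ) ≤ (d : ℝ) ^ 2 := one_le_pow₀ (by exact_mod_cast hd)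
    have h3 : (0 : ℝ) ≤ T := Nat.cast_nonneg _
    simp only [RE.cost, IE.cost, Finset.sum_const, Finset.card_range, nsmul_eq_mul]
    norm_num
    nlinarith
  · exact (((A2.trans a3.weaken).trans A4).trans A5).setVT rfl f13
  · simpa using r13

end

end InverseMaintenance

namespace InverseMaintenance

open RealRAM Matrix

/-! ### The record of changed rows -/

/-- The rows that have been changed so far, in order (`row e` for `e < cnt`), the last position of
each row in this list (counted from `1`), and the current weights. -/
structure Log where
  cnt : ℕ
  row : ℕ → ℕ
  slot : ℕ → ℕ
  cur : ℕ → ℝ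

namespace Log

def push (L : Log) (i : ℕ) (x : ℝ) : Log where
  cnt := L.cnt + 1
  row := Function.update L.row L.cnt i
  slot := Function.update L.slot i (L.cnt + 1)
  cur := Function.update L.cur i x

def pushes (L : Log) (i : ℕ → ℕ) (x : ℕ → ℝ) : ℕ → Log
  | 0 => L
  | u + 1 => (L.pushes i x u).push (i u) (x u)

variable (L : Log) (i : ℕ → ℕ) (x : ℕ → ℝ)

theorem pushes_cnt (u : ℕ) : (L.pushes i x u).cnt = L.cnt + u := by
  induction u with
  | zero => rfl
  | succ u ih => simp only [pushes, push, ih]; omega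

theorem pushes_row_lt (u : ℕ) {e : ℕ} (he : e < L.cnt) : (L.pushes i x u).row e = L.row e := by
  induction u with
  | zero => rfl
  | succ u ih =>
    simp only [pushes, push]
    rw [Function.update_of_ne, ih]
    rw [pushes_cnt]; omega

theorem pushes_row_add (u : ℕ) {e : ℕ} (he : e < u) : (L.pushes i x u).row (L.cnt + e) = i e := by
  induction u with
  | zero => omega
  | succ u ih =>
    simp only [pushes, push, pushes_cnt]
    by_cases h : e = u
    · subst h; simp
    · rw [Function.update_of_ne (by omega), ih (by omega)]

end Log

/-- The quantities fixed by the preprocessing. -/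
structure Setup (N d m α : ℕ) where
  θ : ℝ
  γ : ℝ
  thr : ℝ
  A : ℕ → ℕ → ℝ
  w0 : ℕ → ℝ
  pos : ℕ → Fin N
  G : Matrix (Fin d) (Fin d) ℝ
  P : Matrix (Fin N) (Fin d) ℝ
  Q : Matrix (Fin m) (Fin d) ℝ
  S : Matrix (Fin m) (Fin N) ℝ

namespace Setup

variable {N d m α : ℕ} (D : Setup N d m α) (L : Log)

/-- The changed rows. -/
def F : Matrix (Fin α) (Fin d) ℝ :=
  Matrix.of fun e j => if (e : ℕ) < L.cnt then D.A (L.row e) j else 0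

/-- The rows of `P` that belong to the changed rows. -/
def PF : Matrix (Fin α) (Fin d) ℝ :=
  Matrix.of fun e j => if (e : ℕ) < L.cnt then D.P (D.pos (L.row e)) j else 0

/-- Sketch and precomputed rows are stacked so that one product with the arriving rows extends both
Q Fᵀ and PF Fᵀ. -/
def QP : Matrix (Fin (m + α)) (Fin d) ℝ :=
  Matrix.of fun l j => Fin.addCases (fun a => D.Q a j) (fun e => D.PF L e j) l

/-- The position `e` is the last one of its row, and the weight of this row was nonzero at first. -/
def old (e : Fin α) : Prop :=
  ((e : ℕ) < L.cnt ∧ L.slot (L.row e) < e + 2) ∧ 0 < (D.pos (L.row e) : ℕ)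

/-- The position `e` is the last one of its row, and the weight of this row was zero at first. -/
def new (e : Fin α) : Prop :=
  ((e : ℕ) < L.cnt ∧ L.slot (L.row e) < e + 2) ∧ ¬ 0 < (D.pos (L.row e) : ℕ)

open Classical in
-- Only the last entry of a row in the record is active; earlier entries of the same row get weight
-- 0.
def δ (e : Fin α) : ℝ :=
  if D.old L e then L.cur (L.row e) - D.w0 (L.row e) else 0

open Classical in
-- The change of the square root of the weight of an old row in B₂, relative to its value while the
-- row is unchanged.
def ε (e : Fin α) : ℝ :=
  if D.old L e then Real.sqrt (L.cur (L.row e) + D.θ * D.w0 (L.row e)) -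
    Real.sqrt ((1 + D.θ) * D.w0 (L.row e)) else 0

open Classical in
-- The rows of diag(g) F are those of U: new rows scaled by the root of their weight.
def g (e : Fin α) : ℝ :=
  if D.new L e then Real.sqrt (L.cur (L.row e)) else 0

/-- A row of P is available only for rows with nonzero initial weight. If e is not such a row, the
symmetric entry is used. Entries between two new rows need not be those of F B₀⁻¹ Fᵀ; `sketchR_eq`
shows that they cancel. -/
def M : Matrix (Fin α) (Fin α) ℝ :=
  Matrix.of fun e f => if 0 < (D.pos (L.row e) : ℕ) then (D.PF L * (D.F L)ᵀ) e f
    else (D.PF L * (D.F L)ᵀ) f e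

def J : Matrix (Fin m) (Fin α) ℝ := D.Q * (D.F L)ᵀ

def W : Matrix (Fin m) (Fin α) ℝ :=
  D.S.submatrix id (fun e : Fin α => D.pos (L.row e)) * diagonal (D.ε L) -
    Real.sqrt D.γ • (D.J L * diagonal (D.δ L))

def X : Matrix (Fin α) (Fin α) ℝ := leftInv (capX D.γ (D.M L) (D.δ L))

def Y : Matrix (Fin α) (Fin α) ℝ :=
  precond m ((Real.sqrt D.γ • D.J L + D.W L * capT D.γ (D.M L) (D.δ L)) * diagonal (D.g L))

def query : QueryData d α where
  γ := D.γ
  thr := D.thr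
  G := D.G
  F := D.F L
  δ := D.δ L
  g := D.g L
  X := D.X L
  Y := D.Y L

theorem QP_castAdd (a : Fin m) (j : Fin d) : D.QP L (Fin.castAdd α a) j = D.Q a j := by
  simp [QP]

theorem QP_natAdd (e : Fin α) (j : Fin d) : D.QP L (Fin.natAdd m e) j = D.PF L e j := by
  simp [QP]

/-- The memory between two procedures; the record of the changed rows is `L`, and the matrices are
those of the record `L0`. -/
structure Holds (L0 L : Log) (s : Store) : Prop where
  dim : s.idx 1 = d
  slots : s.idx 3 = α
  sketch : s.idx 6 = m
  cnt : s.idx 8 = L.cnt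
  sum : s.idx 9 = m + α
  θ : s.val 1 = D.θ
  γ : s.val 2 = D.γ
  sqrtγ : s.val 3 = Real.sqrt D.γ
  thr : s.val 4 = D.thr
  pos : ∀ i, s.idxTab 1 i 0 = D.pos i
  row : ∀ e, s.idxTab 2 e 0 = L.row e
  slot : ∀ i, s.idxTab 3 i 0 = L.slot i
  A : s.valTab 0 = D.A
  S : Rep (s.valTab 4) D.S
  G : Rep (s.valTab 7) D.G
  QP : Rep (s.valTab 8) (D.QP L0)
  P : Rep (s.valTab 9) D.P
  cur : ∀ i, s.valTab 10 i 0 = L.cur i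
  F : Rep (s.valTab 11) (D.F L0)
  JL : Rep (s.valTab 12) (D.QP L0 * (D.F L0)ᵀ)
  w0 : ∀ i, s.valTab 13 i 0 = D.w0 i

variable {D} {L0 : Log} {L : Log} {s s' : Store}

/-- The memory that has to be kept outside the tables for records. -/
def keepT (t : ℕ) : Bool := t == 0 || t == 4 || (decide (7 ≤ t) && decide (t < 14))

theorem Holds.congr (h : D.Holds L0 L s)
    (hi : ∀ a, a = 1 ∨ a = 3 ∨ a = 6 ∨ a = 8 ∨ a = 9 → s'.idx a = s.idx a)
    (hit : ∀ t, 1 ≤ t → t ≤ 3 → s'.idxTab t = s.idxTab t)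
    (hv : ∀ x, 1 ≤ x → x ≤ 4 → s'.val x = s.val x)
    (hvt : ∀ t, keepT t = true → s'.valTab t = s.valTab t) : D.Holds L0 L s' := by
  constructor
  · rw [hi _ (by omega)]; exact h.dim
  · rw [hi _ (by omega)]; exact h.slots
  · rw [hi _ (by omega)]; exact h.sketch
  · rw [hi _ (by omega)]; exact h.cnt
  · rw [hi _ (by omega)]; exact h.sum
  · rw [hv _ (by omega) (by omega)]; exact h.θ
  · rw [hv _ (by omega) (by omega)]; exact h.γ
  · rw [hv _ (by omega) (by omega)]; exact h.sqrtγ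
  · rw [hv _ (by omega) (by omega)]; exact h.thr
  · rw [hit _ (by omega) (by omega)]; exact h.pos
  · rw [hit _ (by omega) (by omega)]; exact h.row
  · rw [hit _ (by omega) (by omega)]; exact h.slot
  · rw [hvt _ rfl]; exact h.A
  · rw [hvt _ rfl]; exact h.S
  · rw [hvt _ rfl]; exact h.G
  · rw [hvt _ rfl]; exact h.QP
  · rw [hvt _ rfl]; exact h.P
  · rw [hvt _ rfl]; exact h.cur
  · rw [hvt _ rfl]; exact h.F
  · rw [hvt _ rfl]; exact h.JL
  · rw [hvt _ rfl]; exact h.w0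

theorem Holds.setVT (h : D.Holds L0 L s) {t : ℕ} (ht : keepT t = false) (f : ℕ → ℕ → ℝ) :
    D.Holds L0 L (s.setVT t f) :=
  h.congr (fun _ _ => rfl) (fun _ _ _ => rfl) (fun _ _ _ => rfl) fun t' ht' => by
    rw [Store.setVT_valTab, if_neg (by rintro rfl; simp_all)]

end Setup

/-- Append the listed changes to the record. -/
def record : Prog :=
  .seq (assignI 11 (.reg 8)) <| forLoop 10 4 <|
    .seq (storeI 2 (.reg 8) (.lit 0) (.ld 0 (.reg 10) (.lit 0))) <|
    .seq (storeI 3 (.ld 0 (.reg 10) (.lit 0)) (.lit 0) (.add (.reg 8) (.lit 1))) <|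
    .seq (storeR 10 (.ld 0 (.reg 10) (.lit 0)) (.lit 0) (.ld 1 (.reg 10) (.lit 0))) <|
    assignI 8 (.add (.reg 8) (.lit 1))

section

variable {N d m α : ℕ} {D : Setup N d m α} {L : Log} {s : Store}

theorem Tri.record {b : Bool} (h : D.Holds L L s) {u : ℕ} (hu : s.idx 4 = u) {i : ℕ → ℕ} {x : ℕ → ℝ}
    (hi : ∀ a, s.idxTab 0 a 0 = i a) (hx : ∀ a, s.valTab 1 a 0 = x a) : ∃ s',
      Tri b 60 record s (100 * (u + 1)) s' ∧ D.Holds L (L.pushes i x u) s' ∧ s'.idx 4 = u ∧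
      s'.idx 11 = L.cnt ∧ ∀ a, s'.idxTab 0 a 0 = i a := by
  have t0 := Tri.assignI (b := b) (L := 60) (by norm_num) 11 (by norm_num) (.reg 8) (by decide) s
  simp only [IE.eval, h.cnt] at t0
  obtain ⟨s', ⟨-, h1, h2, h3, h4, h5⟩, t1⟩ := Tri.forLoop (b := b) (L := 60) (by norm_num)
    (a := 10) (n := 4) (by norm_num) (by norm_num) (P :=
      .seq (storeI 2 (.reg 8) (.lit 0) (.ld 0 (.reg 10) (.lit 0))) <|
      .seq (storeI 3 (.ld 0 (.reg 10) (.lit 0)) (.lit 0) (.add (.reg 8) (.lit 1))) <|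
      .seq (storeR 10 (.ld 0 (.reg 10) (.lit 0)) (.lit 0) (.ld 1 (.reg 10) (.lit 0))) <|
      assignI 8 (.add (.reg 8) (.lit 1))) (N := u) (c := 50) (by norm_num)
    (fun a s' => s'.idx 10 = a ∧ D.Holds L (L.pushes i x a) s' ∧ s'.idx 4 = u ∧
      s'.idx 11 = L.cnt ∧ (∀ a, s'.idxTab 0 a 0 = i a) ∧ ∀ a, s'.valTab 1 a 0 = x a)
    (fun a s' h => ⟨h.1, h.2.2.1⟩)
    (by
      rintro a ha s' ⟨h1, h2, h3, h4, h5, h6⟩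
      have u1 := Tri.storeI (b := b) (L := 60) (by norm_num) 2 (.reg 8) (.lit 0)
        (.ld 0 (.reg 10) (.lit 0)) rfl rfl rfl (by norm_num) s'
      simp only [IE.eval, h1, h2.cnt, h5] at u1
      set s1 := s'.setIT 2 (upd (s'.idxTab 2) (L.pushes i x a).cnt 0 (i a)) with hs1
      have u2 := Tri.storeI (b := b) (L := 60) (by norm_num) 3 (.ld 0 (.reg 10) (.lit 0)) (.lit 0)
        (.add (.reg 8) (.lit 1)) rfl rfl rfl (by norm_num) s1
      simp [IE.eval, hs1, h1, h2.cnt, h5] at u2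
      rw [← hs1] at u2
      set s2 := s1.setIT 3 (upd (s'.idxTab 3) (i a) 0 ((L.pushes i x a).cnt + 1)) with hs2
      have u3 := Tri.storeR (b := b) (L := 60) (by norm_num) 10 (.ld 0 (.reg 10) (.lit 0)) (.lit 0)
        (.ld 1 (.reg 10) (.lit 0)) rfl rfl rfl (by norm_num) s2
      simp [IE.eval, RE.eval, hs1, hs2, h1, h5, h6] at u3
      rw [← hs1, ← hs2] at u3
      set s3 := s2.setVT 10 (upd (s'.valTab 10) (i a) 0 (x a)) with hs3
      have u4 := Tri.assignI (b := b) (L := 60) (by norm_num) 8 (by norm_num)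
        (.add (.reg 8) (.lit 1)) (by decide) s3
      simp [IE.eval, hs1, hs2, hs3, h2.cnt] at u4
      rw [← hs1, ← hs2, ← hs3] at u4
      refine ⟨_, (u1.seq (u2.seq (u3.seq u4))).mono (by norm_num [IE.cost, RE.cost]), ?_, ?_, ?_,
        ?_, ?_, ?_, ?_⟩
      · simpa [hs1, hs2, hs3] using h1
      · simp
      · constructor
        · simpa [hs1, hs2, hs3] using h2.dim
        · simpa [hs1, hs2, hs3] using h2.slots
        · simpa [hs1, hs2, hs3] using h2.sketch
        · simp [Log.pushes, Log.push]
        · simpa [hs1, hs2, hs3] using h2.sum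
        · exact h2.θ
        · exact h2.γ
        · exact h2.sqrtγ
        · exact h2.thr
        · simpa [hs1, hs2, hs3] using h2.pos
        · intro e
          simp [hs1, hs2, hs3, Log.pushes, Log.push, upd, Function.update_apply, h2.row]
        · intro e
          simp [hs2, hs3, Log.pushes, Log.push, upd, Function.update_apply, h2.slot]
        · simpa [hs1, hs2, hs3] using h2.A
        · simpa [hs1, hs2, hs3] using h2.S
        · simpa [hs1, hs2, hs3] using h2.G
        · simpa [hs1, hs2, hs3] using h2.QP
        · simpa [hs1, hs2, hs3] using h2.P
        · intro e
          simp [hs3, Log.pushes, Log.push, upd, Function.update_apply, h2.cur]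
        · simpa [hs1, hs2, hs3] using h2.F
        · simpa [hs1, hs2, hs3] using h2.JL
        · simpa [hs1, hs2, hs3] using h2.w0
      · simpa [hs1, hs2, hs3] using h3
      · simpa [hs1, hs2, hs3] using h4
      · simpa [hs1, hs2, hs3] using h5
      · simpa [hs1, hs2, hs3] using h6)
    (s := s.setI 11 L.cnt) ⟨by simp, h.congr (by rintro a (rfl | rfl | rfl | rfl | rfl) <;> simp)
      (fun _ _ _ => rfl) (fun _ _ _ => rfl) (fun _ _ => rfl), by simpa using hu, by simp, hi, hx⟩
  refine ⟨s', (t0.seq t1).mono ?_, h1, h2, h3, h4⟩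
  norm_num [IE.cost]
  nlinarith [(Nat.cast_nonneg u : (0:ℝ) ≤ u)]

end

end InverseMaintenance

namespace RealRAM

theorem Tri.fillAtE {b : Bool} {tab : ℕ} {oi oj p q : IE} {e : RE}
    (hok : fillOk tab oi oj p q (.lit 1) e = true) (s : Store) {u v P Q : ℕ} (hu : oi.eval s = u)
    (hv : oj.eval s = v) (hp : p.eval s = P)
    (hq : q.eval s = Q) (F : Fin P → Fin Q → ℝ)
    (hf : ∀ (i : Fin P) (j : Fin Q) (g : ℕ → ℕ → ℝ),
      g (u + i) (v + j) = s.valTab tab (u + i) (v + j) →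
      e.eval ((s.setVT tab g).setLoop i j 0) = F i j) :
    ∃ f, (∀ (i : Fin P) (j : Fin Q), f (u + i) (v + j) = F i j) ∧
      (∀ x y, ¬ ((u ≤ x ∧ x < u + P) ∧ (v ≤ y ∧ y < v + Q)) → f x y = s.valTab tab x y) ∧
      Tri b 60 (RealRAM.fill tab oi oj p q (.lit 1) e) s (4000 * ((P + 1) * (Q + 1)))
        (s.setVT tab f) := by
  obtain ⟨f, h1, h2, h3⟩ := Tri.fillAt (b := b) hok s hu hv hp hq (N := 1) rfl (fun i j _ => F i j)
    (fun i j k g hg => by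
      have := hf i j g hg
      simpa [Subsingleton.elim k 0] using this)
  exact ⟨f, by simpa using h1, h2, h3.mono (by norm_num; linarith)⟩

end RealRAM

/-! ### Extending the stored products by newly changed rows -/

namespace InverseMaintenance

open RealRAM Matrix

/-- Update the matrices after `u ≥ 1` changes have been recorded. -/
def newRows (P : Prog) : Prog :=
  .seq (fill 11 (.reg 11) (.lit 0) (.reg 4) (.reg 1) (.lit 1)
    (.ld 0 (.ld 0 .I (.lit 0)) .J)) <|
  .seq (fill 8 (.add (.reg 6) (.reg 11)) (.lit 0) (.reg 4) (.reg 1) (.lit 1)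
    (.ld 9 (.ld 1 (.ld 0 .I (.lit 0)) (.lit 0)) .J)) <|
  .seq (fill 20 (.lit 0) (.lit 0) (.reg 1) (.reg 4) (.lit 1)
    (.ld 0 (.ld 0 .J (.lit 0)) .I)) <|
  .seq (matMul P 8 20 21 9 1 4 4) <|
  .seq (fill 12 (.lit 0) (.reg 11) (.reg 9) (.reg 4) (.lit 1) (.ld 21 .I .J)) <|
  .seq (fill 22 (.lit 0) (.lit 0) (.reg 4) (.reg 1) (.lit 1)
    (.ld 9 (.ld 1 (.ld 0 .I (.lit 0)) (.lit 0)) .J)) <|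
  .seq (fill 23 (.lit 0) (.lit 0) (.reg 1) (.reg 3) (.lit 1) (.ld 11 .J .I)) <|
  .seq (matMul P 22 23 24 4 1 3 4) <|
  fill 12 (.add (.reg 6) (.reg 11)) (.lit 0) (.reg 4) (.reg 3) (.lit 1) (.ld 24 .I .J)

variable {N d m α : ℕ} {D : Setup N d m α} {L : Log} {s : Store} {i : ℕ → ℕ} {x : ℕ → ℝ} {u : ℕ}

theorem Setup.F_pushes (e : Fin α) (j : Fin d) : D.F (L.pushes i x u) e j =
    if L.cnt ≤ e ∧ (e : ℕ) < L.cnt + u then D.A (i (e - L.cnt)) j else D.F L e j := by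
  simp only [F, of_apply, Log.pushes_cnt]
  by_cases h1 : (e : ℕ) < L.cnt
  · rw [if_pos (by omega), if_neg (by omega), if_pos h1, Log.pushes_row_lt _ _ _ _ h1]
  · by_cases h2 : (e : ℕ) < L.cnt + u
    · rw [if_pos h2, if_pos (by omega)]
      obtain ⟨k, hk⟩ := Nat.exists_eq_add_of_le (not_lt.1 h1)
      rw [hk, Log.pushes_row_add _ _ _ _ (by omega), Nat.add_sub_cancel_left]
    · rw [if_neg h2, if_neg (by omega), if_neg h1]

theorem Setup.PF_pushes (e : Fin α) (j : Fin d) : D.PF (L.pushes i x u) e j =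
    if L.cnt ≤ e ∧ (e : ℕ) < L.cnt + u then D.P (D.pos (i (e - L.cnt))) j else D.PF L e j := by
  simp only [PF, of_apply, Log.pushes_cnt]
  by_cases h1 : (e : ℕ) < L.cnt
  · rw [if_pos (by omega), if_neg (by omega), if_pos h1, Log.pushes_row_lt _ _ _ _ h1]
  · by_cases h2 : (e : ℕ) < L.cnt + u
    · rw [if_pos h2, if_pos (by omega)]
      obtain ⟨k, hk⟩ := Nat.exists_eq_add_of_le (not_lt.1 h1)
      rw [hk, Log.pushes_row_add _ _ _ _ (by omega), Nat.add_sub_cancel_left]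
    · rw [if_neg h2, if_neg (by omega), if_neg h1]

theorem Setup.QP_pushes (l : Fin (m + α)) (j : Fin d) : D.QP (L.pushes i x u) l j =
    if m + L.cnt ≤ l ∧ (l : ℕ) < m + L.cnt + u then D.P (D.pos (i (l - (m + L.cnt)))) j
    else D.QP L l j := by
  refine Fin.addCases (fun a => ?_) (fun e => ?_) l
  · rw [QP_castAdd, QP_castAdd, if_neg]
    simp only [Fin.val_castAdd]
    omega
  · rw [QP_natAdd, QP_natAdd, PF_pushes]
    simp only [Fin.val_natAdd]
    by_cases h : L.cnt ≤ e ∧ (e : ℕ) < L.cnt + u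
    · rw [if_pos h, if_pos (by omega), show m + (e : ℕ) - (m + L.cnt) = e - L.cnt by omega]
    · rw [if_neg h, if_neg (by omega)]

variable {ω C : ℝ} {P : Prog}

/-- Appending u rows to F changes only u columns of the stored product `QP * Fᵀ` and, in its lower
part, u rows. Both strips are computed in blocks of size u, which costs about (m/u)(d/u) u^ω = m d
u^(ω-2). -/
theorem Tri.newRows (hω : 2 ≤ ω) (hC : 0 ≤ C) (hP : IsMulProg ω C P)
    (h : D.Holds L (L.pushes i x u) s) (hu : s.idx 4 = u) (hu1 : 1 ≤ u) (hc : s.idx 11 = L.cnt)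
    (hi : ∀ a, s.idxTab 0 a 0 = i a) (hα : L.cnt + u ≤ α) (hαd : α ≤ d) (hαm : α ≤ m) : ∃ s',
    Tri false 60 (newRows P) s (10000 * (C + 100000) * (m * d * (u : ℝ) ^ (ω - 2))) s' ∧
      D.Holds (L.pushes i x u) (L.pushes i x u) s' := by
  set L' := L.pushes i x u with hL'
  set c0 := L.cnt with hc0
  obtain ⟨f1, a1, b1, t1⟩ := Tri.fillAtE (b := false) (tab := 11) (oi := .reg 11) (oj := .lit 0)
    (p := .reg 4) (q := .reg 1) (e := .ld 0 (.ld 0 .I (.lit 0)) .J) (by decide) s hc (v := 0) rfl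
    hu h.dim (fun a j => D.A (i a) j)
    (by
      intro a j g _
      simp [RE.eval, IE.eval, IE.I, IE.J, hi, h.A])
  have r1 : Rep f1 (D.F L') := by
    intro e j
    rw [hL', Setup.F_pushes]
    split_ifs with h1
    · have := a1 ⟨e - c0, by omega⟩ j
      simp only [zero_add] at this
      rw [← this, Nat.add_sub_cancel' h1.1]
    · rw [b1 _ _ (by omega), h.F]
  obtain ⟨f2, a2, b2, t2⟩ := Tri.fillAtE (b := false) (tab := 8) (oi := .add (.reg 6) (.reg 11))
    (oj := .lit 0) (p := .reg 4) (q := .reg 1)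
    (e := .ld 9 (.ld 1 (.ld 0 .I (.lit 0)) (.lit 0)) .J) (by decide) (s.setVT 11 f1)
    (u := m + c0) (by simp [IE.eval, h.sketch, hc]) (v := 0) rfl
    hu h.dim (fun a j => D.P (D.pos (i a)) j)
    (by
      intro a j g _
      simp [RE.eval, IE.eval, IE.I, IE.J, hi, h.pos, h.P _ j])
  have r2 : Rep f2 (D.QP L') := by
    intro l j
    rw [hL', Setup.QP_pushes]
    split_ifs with h1
    · have := a2 ⟨l - (m + c0), by omega⟩ j
      simp only [zero_add] at this
      rw [← this, Nat.add_sub_cancel' h1.1]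
    · rw [b2 _ _ (by omega)]
      simp [h.QP l j]
  set s2 := (s.setVT 11 f1).setVT 8 f2 with hs2
  obtain ⟨f3, r3, t3⟩ := Tri.fillE (b := false) (tab := 20) (p := .reg 1) (q := .reg 4)
    (e := .ld 0 (.ld 0 .J (.lit 0)) .I) (by decide) s2 h.dim hu
    (Matrix.of fun (j : Fin d) (a : Fin u) => D.A (i a) j)
    (by
      intro a j g _
      simp [RE.eval, IE.eval, IE.I, IE.J, hi, h.A, hs2])
  obtain ⟨f4, r4, t4⟩ := Tri.mulM hω hC hP (a := 8) (b := 20) (c := 21) (p := 9) (q := 1)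
    (r := 4) (bs := 4) (by decide) (s2.setVT 20 f3) h.sum h.dim hu hu hu1
    (X := D.QP L') (by simpa [hs2] using r2) (by simpa using r3)
  set s4 := (s2.setVT 20 f3).setVT 21 f4 with hs4
  obtain ⟨f5, a5, b5, t5⟩ := Tri.fillAtE (b := false) (tab := 12) (oi := .lit 0)
    (oj := .reg 11) (p := .reg 9) (q := .reg 4)
    (e := .ld 21 .I .J) (by decide) s4 (u := 0) rfl (v := c0) hc h.sum hu
    (fun l a => (D.QP L' * Matrix.of fun (j : Fin d) (a : Fin u) => D.A (i a) j) l a)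
    (by
      intro l a g _
      simp [RE.eval, IE.eval, IE.I, IE.J, r4 l a, hs4])
  obtain ⟨f6, r6, t6⟩ := Tri.fillE (b := false) (tab := 22) (p := .reg 4) (q := .reg 1)
    (e := .ld 9 (.ld 1 (.ld 0 .I (.lit 0)) (.lit 0)) .J) (by decide) (s4.setVT 12 f5) hu h.dim
    (Matrix.of fun (a : Fin u) (j : Fin d) => D.P (D.pos (i a)) j)
    (by
      intro a j g _
      simp [RE.eval, IE.eval, IE.I, IE.J, hi, h.pos, hs2, hs4, h.P _ j])
  obtain ⟨f7, r7, t7⟩ := Tri.fillE (b := false) (tab := 23) (p := .reg 1) (q := .reg 3)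
    (e := .ld 11 .J .I) (by decide) ((s4.setVT 12 f5).setVT 22 f6) h.dim h.slots
    (D.F L')ᵀ
    (by
      intro j e g _
      simp [RE.eval, IE.eval, IE.I, IE.J, hs2, hs4, r1 e j])
  obtain ⟨f8, r8, t8⟩ := Tri.mulM hω hC hP (a := 22) (b := 23) (c := 24) (p := 4) (q := 1)
    (r := 3) (bs := 4) (by decide) (((s4.setVT 12 f5).setVT 22 f6).setVT 23 f7) hu h.dim h.slots hu
    hu1 (by simpa using r6) (by simpa using r7)
  obtain ⟨f9, a9, b9, t9⟩ := Tri.fillAtE (b := false) (tab := 12)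
    (oi := .add (.reg 6) (.reg 11)) (oj := .lit 0) (p := .reg 4) (q := .reg 3)
    (e := .ld 24 .I .J) (by decide) ((((s4.setVT 12 f5).setVT 22 f6).setVT 23 f7).setVT 24 f8)
    (u := m + c0) (by simp [IE.eval, hs4, hs2, h.sketch, hc]) (v := 0) rfl hu h.slots
    (fun a e => ((Matrix.of fun (a : Fin u) (j : Fin d) => D.P (D.pos (i a)) j) * (D.F L')ᵀ) a e)
    (by
      intro a e g _
      simp [RE.eval, IE.eval, IE.I, IE.J, r8 a e])
  have r9 : Rep f9 (D.QP L' * (D.F L')ᵀ) := by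
    intro l e
    -- Three kinds of entries: those in new rows come from the last fill, those in new columns from
    -- the previous one, and the others are still valid because neither factor has changed there.
    by_cases hl : m + c0 ≤ l ∧ (l : ℕ) < m + c0 + u
    · have := a9 ⟨l - (m + c0), by omega⟩ e
      simp only [zero_add] at this
      rw [Nat.add_sub_cancel' hl.1] at this
      rw [this, mul_apply, mul_apply]
      refine Finset.sum_congr rfl fun j _ => ?_
      rw [hL', Setup.QP_pushes, if_pos hl]
      rfl
    · rw [b9 _ _ (by omega)]
      simp only [Store.setVT_valTab]
      norm_num
      by_cases he : c0 ≤ e ∧ (e : ℕ) < c0 + u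
      · have := a5 l ⟨e - c0, by omega⟩
        simp only [zero_add] at this
        rw [Nat.add_sub_cancel' he.1] at this
        rw [this, mul_apply, mul_apply]
        refine Finset.sum_congr rfl fun j _ => ?_
        rw [transpose_apply, hL', Setup.F_pushes, if_pos he]
        rfl
      · rw [b5 _ _ (by omega)]
        have : s4.valTab 12 l e = s.valTab 12 l e := by simp [hs4, hs2]
        rw [this, h.JL l e, mul_apply, mul_apply]
        refine Finset.sum_congr rfl fun j _ => ?_
        rw [transpose_apply, transpose_apply, hL', Setup.F_pushes, if_neg he, Setup.QP_pushes,
          if_neg hl]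
  refine ⟨_, (t1.seq <| t2.seq <| t3.seq <| t4.seq <| t5.seq <| t6.seq <| t7.seq <|
    t8.seq t9).mono ?_, ?_⟩
  · have hu' : (1 : ℝ) ≤ u := by exact_mod_cast hu1
    have hud : (u : ℝ) ≤ α := by exact_mod_cast (by omega : u ≤ α)
    have had : (α : ℝ) ≤ d := by exact_mod_cast hαd
    have ham : (α : ℝ) ≤ m := by exact_mod_cast hαm
    have hp : (u : ℝ) ^ (ω - 2) = u * (u : ℝ) ^ (ω - 3) := by
      nth_rw 2 [← Real.rpow_one (u : ℝ)]
      rw [← Real.rpow_add (by linarith)]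
      congr 1
      ring
    have hp1 : 1 ≤ (u : ℝ) ^ (ω - 2) := Real.one_le_rpow hu' (by linarith)
    set E := (m : ℝ) * d * (u : ℝ) ^ (ω - 2) with hE
    have hmd : (m : ℝ) * d ≤ E := le_mul_of_one_le_right (by positivity) hp1
    have c1 : ((u : ℝ) + 1) * (d + 1) ≤ 4 * E := by
      calc ((u : ℝ) + 1) * (d + 1) ≤ (m + m) * (d + d) := by gcongr <;> linarith
        _ ≤ 4 * E := by linarith
    have c2 : ((d : ℝ) + 1) * (u + 1) ≤ 4 * E := by rwa [mul_comm]
    have c3 : ((d : ℝ) + 1) * (α + 1) ≤ 4 * E := by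
      calc ((d : ℝ) + 1) * (α + 1) ≤ (d + d) * (m + m) := by gcongr <;> linarith
        _ ≤ 4 * E := by linarith
    have c4 : ((m + α : ℕ) + 1 : ℝ) * (u + 1) ≤ 6 * E := by
      push_cast
      calc ((m : ℝ) + α + 1) * (u + 1) ≤ (m + m + m) * (d + d) := by gcongr <;> linarith
        _ ≤ 6 * E := by linarith
    have c5 : ((u : ℝ) + 1) * (α + 1) ≤ 4 * E := by
      calc ((u : ℝ) + 1) * (α + 1) ≤ (m + m) * (d + d) := by gcongr <;> linarith
        _ ≤ 4 * E := by linarith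
    have c6 : ((m + α : ℕ) + u : ℝ) * (d + u) * (u + u) * (u : ℝ) ^ (ω - 3) ≤ 12 * E := by
      push_cast
      calc ((m : ℝ) + α + u) * (d + u) * (u + u) * (u : ℝ) ^ (ω - 3) ≤
          (m + m + m) * (d + d) * (u + u) * (u : ℝ) ^ (ω - 3) := by gcongr <;> linarith
        _ = 12 * E := by rw [hE, hp]; ring
    have c7 : ((u : ℝ) + u) * (d + u) * (α + u) * (u : ℝ) ^ (ω - 3) ≤ 8 * E := by
      calc ((u : ℝ) + u) * (d + u) * (α + u) * (u : ℝ) ^ (ω - 3) ≤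
          (u + u) * (d + d) * (m + m) * (u : ℝ) ^ (ω - 3) := by gcongr <;> linarith
        _ = 8 * E := by rw [hE, hp]; ring
    have hK : 100000 ≤ C + 100000 := by linarith
    have c6' := mul_le_mul_of_nonneg_left c6 (show 0 ≤ 20 * (C + 100000) by linarith)
    have c7' := mul_le_mul_of_nonneg_left c7 (show 0 ≤ 20 * (C + 100000) by linarith)
    have hE0 : 0 ≤ E := by positivity
    have hKE : 100000 * E ≤ (C + 100000) * E := by gcongr
    linarith
  · have h5 : ∀ t, t ≠ 8 → t ≠ 11 → t ≠ 12 → Setup.keepT t = true →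
        (((((s4.setVT 12 f5).setVT 22 f6).setVT 23 f7).setVT 24 f8).setVT 12 f9).valTab t =
          s.valTab t := by
      intro t h1 h2 h3 h4
      have h5 : t ≠ 20 ∧ t ≠ 21 ∧ t ≠ 22 ∧ t ≠ 23 ∧ t ≠ 24 := by
        simp [Setup.keepT] at h4
        omega
      simp [hs4, hs2, h1, h2, h3, h5]
    constructor
    · exact h.dim
    · exact h.slots
    · exact h.sketch
    · exact h.cnt
    · exact h.sum
    · exact h.θ
    · exact h.γ
    · exact h.sqrtγ
    · exact h.thr
    · exact h.pos
    · exact h.row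
    · exact h.slot
    · rw [h5 _ (by norm_num) (by norm_num) (by norm_num) rfl]; exact h.A
    · rw [h5 _ (by norm_num) (by norm_num) (by norm_num) rfl]; exact h.S
    · rw [h5 _ (by norm_num) (by norm_num) (by norm_num) rfl]; exact h.G
    · simpa [hs4, hs2] using r2
    · rw [h5 _ (by norm_num) (by norm_num) (by norm_num) rfl]; exact h.P
    · rw [h5 _ (by norm_num) (by norm_num) (by norm_num) rfl]; exact h.cur
    · simpa [hs4, hs2] using r1
    · simpa using r9
    · rw [h5 _ (by norm_num) (by norm_num) (by norm_num) rfl]; exact h.w0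

end InverseMaintenance

/-! ### The weights of the record and the update program -/

namespace InverseMaintenance

open RealRAM Matrix

def rowExp (i : IE) : IE := .ld 2 i (.lit 0)
def posExp (i : IE) : IE := .ld 1 (rowExp i) (.lit 0)
def slotExp (i : IE) : IE := .ld 3 (rowExp i) (.lit 0)
def curExp (i : IE) : RE := .ld 10 (rowExp i) (.lit 0)
def w0Exp (i : IE) : RE := .ld 13 (rowExp i) (.lit 0)

/-- `x` if the loop position `I` is the last one of its row, and `0` otherwise. -/
def activeExp (x : RE) : RE :=
  .ite .I (.reg 8) (.ite (slotExp .I) (.add .I (.lit 2)) x (.nat (.lit 0))) (.nat (.lit 0))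

def deltaExp : RE :=
  activeExp (.ite (.lit 0) (posExp .I) (.sub (curExp .I) (w0Exp .I)) (.nat (.lit 0)))

def epsExp : RE :=
  activeExp (.ite (.lit 0) (posExp .I) (.sub (.sqrt (.add (curExp .I) (.mul (.reg 1) (w0Exp .I))))
    (.sqrt (.mul (.add (.nat (.lit 1)) (.reg 1)) (w0Exp .I)))) (.nat (.lit 0)))

def gExp : RE :=
  activeExp (.ite (.lit 0) (posExp .I) (.nat (.lit 0)) (.sqrt (curExp .I)))

def weights : Prog :=
  .seq (fill 14 (.lit 0) (.lit 0) (.reg 3) (.lit 1) (.lit 1) deltaExp) <|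
  .seq (fill 14 (.lit 0) (.lit 1) (.reg 3) (.lit 1) (.lit 1) epsExp) <|
  .seq (fill 14 (.lit 0) (.lit 2) (.reg 3) (.lit 1) (.lit 1) gExp) <|
  .seq (fill 20 (.lit 0) (.lit 0) (.reg 3) (.reg 3) (.lit 1)
    (.ite (.lit 0) (posExp .I) (.ld 12 (.add (.reg 6) .I) .J) (.ld 12 (.add (.reg 6) .J) .I))) <|
  fill 22 (.lit 0) (.lit 0) (.reg 6) (.reg 3) (.lit 1)
    (.sub (.mul (.ld 4 .I (posExp .J)) (.ld 14 .J (.lit 1)))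
      (.mul (.reg 3) (.mul (.ld 12 .I .J) (.ld 14 .J (.lit 0)))))

/-- The program for the update of a round. -/
def updateProg (P : Prog) : Prog :=
  .seq record <| .seq (assignI 12 (.lit 0)) <| .seq (.ite (.idxLt 12 4) (newRows P) .skip) <|
  .seq weights (solve P)

variable {N d m α : ℕ} {D : Setup N d m α} {L : Log} {s : Store}

theorem Setup.Holds.J (h : D.Holds L L s) : Rep (s.valTab 12) (D.J L) := by
  intro l e
  have := h.JL (Fin.castAdd α l) e
  rw [Fin.val_castAdd] at this
  rw [this, Setup.J, mul_apply, mul_apply]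
  exact Finset.sum_congr rfl fun j _ => by rw [Setup.QP_castAdd]

theorem Setup.Holds.PFF (h : D.Holds L L s) (e f : Fin α) :
    s.valTab 12 (m + e) f = (D.PF L * (D.F L)ᵀ) e f := by
  have := h.JL (Fin.natAdd m e) f
  rw [Fin.val_natAdd] at this
  rw [this, mul_apply, mul_apply]
  exact Finset.sum_congr rfl fun j _ => by rw [Setup.QP_natAdd]

theorem Setup.Holds.activeExp_eval {L0 : Log} (h : D.Holds L0 L s) (x : RE) (e : Fin α) (k : ℕ)
    (f : ℕ → ℕ → ℝ) : (activeExp x).eval ((s.setVT 14 f).setLoop e k 0) =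
    if (e : ℕ) < L.cnt ∧ L.slot (L.row e) < e + 2 then x.eval ((s.setVT 14 f).setLoop e k 0)
    else 0 := by
  simp [activeExp, RE.eval, IE.eval, IE.I, h.cnt, slotExp, rowExp, h.slot, h.row, ite_and]

theorem Tri.weights (h : D.Holds L L s) (hα : 1 ≤ α) (hαm : α ≤ m) : ∃ s',
    Tri false 60 weights s (100000 * (m * α)) s' ∧ D.Holds L L s' ∧
      (∀ e : Fin α, s'.valTab 14 e 0 = D.δ L e) ∧ (∀ e : Fin α, s'.valTab 14 e 2 = D.g L e) ∧
      Rep (s'.valTab 20) (D.M L) ∧ Rep (s'.valTab 22) (D.W L) := by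
  obtain ⟨f0, a0, b0, t0⟩ := Tri.fillAtE (b := false) (tab := 14) (oi := .lit 0) (oj := .lit 0)
    (p := .reg 3) (q := .lit 1) (e := deltaExp) (by decide) s (u := 0) rfl (v := 0) rfl
    h.slots (Q := 1) rfl (fun e _ => D.δ L e)
    (by
      intro e j f _
      rw [deltaExp, h.activeExp_eval, Setup.δ, Setup.old]
      simp [RE.eval, IE.eval, IE.I, posExp, curExp, w0Exp, rowExp, h.pos, h.row, h.cur, h.w0]
      split_ifs <;> simp_all)
  obtain ⟨f1, a1, b1, t1⟩ := Tri.fillAtE (b := false) (tab := 14) (oi := .lit 0) (oj := .lit 1)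
    (p := .reg 3) (q := .lit 1) (e := epsExp) (by decide) (s.setVT 14 f0) (u := 0) rfl (v := 1) rfl
    h.slots (Q := 1) rfl (fun e _ => D.ε L e)
    (by
      intro e j f _
      rw [epsExp, (h.setVT (t := 14) rfl f0).activeExp_eval, Setup.ε, Setup.old]
      simp [RE.eval, IE.eval, IE.I, posExp, curExp, w0Exp, rowExp, h.pos, h.row, h.cur, h.w0,
        h.θ]
      split_ifs <;> simp_all)
  obtain ⟨f2, a2, b2, t2⟩ := Tri.fillAtE (b := false) (tab := 14) (oi := .lit 0) (oj := .lit 2)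
    (p := .reg 3) (q := .lit 1) (e := gExp) (by decide) ((s.setVT 14 f0).setVT 14 f1) (u := 0) rfl
    (v := 2) rfl h.slots (Q := 1) rfl (fun e _ => D.g L e)
    (by
      intro e j f _
      rw [gExp, ((h.setVT (t := 14) rfl f0).setVT (t := 14) rfl f1).activeExp_eval, Setup.g,
        Setup.new]
      simp only [RE.eval, IE.eval, IE.I, posExp, curExp, rowExp, Store.setLoop_idxTab,
        Store.setVT_idxTab, Store.setLoop_idx, h.row, h.pos, Store.setLoop_valTab,
        Store.setVT_valTab]
      norm_num [h.row, h.pos, h.cur]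
      split_ifs <;> simp_all)
  set s2 := ((s.setVT 14 f0).setVT 14 f1).setVT 14 f2 with hs2
  have h2 : D.Holds L L s2 := ((h.setVT rfl f0).setVT rfl f1).setVT rfl f2
  have e0 : ∀ e : Fin α, s2.valTab 14 e 0 = D.δ L e := by
    intro e
    have := a0 e 0
    simp only [zero_add, Fin.val_zero] at this
    simp [hs2]
    rw [b2 _ _ (by omega)]
    simp
    rw [b1 _ _ (by omega)]
    simpa using this
  have e1 : ∀ e : Fin α, s2.valTab 14 e 1 = D.ε L e := by
    intro e
    have := a1 e 0
    simp only [zero_add, Fin.val_zero] at this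
    simp [hs2]
    rw [b2 _ _ (by omega)]
    simpa using this
  have e2 : ∀ e : Fin α, s2.valTab 14 e 2 = D.g L e := by
    intro e
    have := a2 e 0
    simp only [zero_add, Fin.val_zero] at this
    simpa [hs2] using this
  obtain ⟨f3, r3, t3⟩ := Tri.fillE (b := false) (tab := 20) (p := .reg 3) (q := .reg 3)
    (e := .ite (.lit 0) (posExp .I) (.ld 12 (.add (.reg 6) .I) .J)
      (.ld 12 (.add (.reg 6) .J) .I)) (by decide) s2 h2.slots h2.slots (D.M L)
    (by
      intro e f g _
      simp [RE.eval, IE.eval, IE.I, IE.J, posExp, rowExp, h2.pos, h2.row, h2.sketch, h2.PFF,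
        Setup.M])
  obtain ⟨f4, r4, t4⟩ := Tri.fillE (b := false) (tab := 22) (p := .reg 6) (q := .reg 3)
    (e := .sub (.mul (.ld 4 .I (posExp .J)) (.ld 14 .J (.lit 1)))
      (.mul (.reg 3) (.mul (.ld 12 .I .J) (.ld 14 .J (.lit 0))))) (by decide) (s2.setVT 20 f3)
    h2.sketch h2.slots (D.W L)
    (by
      intro l e g _
      simp [RE.eval, IE.eval, IE.I, IE.J, posExp, rowExp, h2.pos, h2.row, h2.S l _, e0, e1,
        h2.sqrtγ, h2.J l e, Setup.W])
  refine ⟨_, (t0.seq <| t1.seq <| t2.seq <| t3.seq t4).mono ?_, (h2.setVT rfl f3).setVT rfl f4,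
    ?_, ?_, ?_, ?_⟩
  · have h3 : (1 : ℝ) ≤ α := by exact_mod_cast hα
    have h4 : (α : ℝ) ≤ m := by exact_mod_cast hαm
    have h5 : (α : ℝ) * α ≤ m * α := by gcongr
    norm_num
    nlinarith
  · simpa using e0
  · simpa using e2
  · simpa using r3
  · simpa using r4

variable {ω C : ℝ} {P : Prog}

/-- Recording costs O(u), extending the products m d u^(ω-2), and the small systems m α^(ω-1). The
last term also pays for the weights and for rounds without any change. -/
theorem Tri.updateProg (hω : 2 ≤ ω) (hC : 0 ≤ C) (hP : IsMulProg ω C P) (h : D.Holds L L s)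
    {i : ℕ → ℕ} {x : ℕ → ℝ} {u : ℕ} (hu : s.idx 4 = u) (hi : ∀ a, s.idxTab 0 a 0 = i a)
    (hx : ∀ a, s.valTab 1 a 0 = x a) (hα1 : 1 ≤ α) (hα : L.cnt + u ≤ α) (hαd : α ≤ d)
    (hαm : α * (Nat.log 2 α + 1) ≤ m)
    (hX : IsUnit (capX D.γ (D.M (L.pushes i x u)) (D.δ (L.pushes i x u))).det) : ∃ s',
    Tri false 60 (updateProg P) s (2000000 * (C + 100000) *
      ((if u = 0 then 0 else m * d * (u : ℝ) ^ (ω - 2)) + m * (α : ℝ) ^ (ω - 1))) s' ∧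
      D.Holds (L.pushes i x u) (L.pushes i x u) s' ∧ (D.query (L.pushes i x u)).Holds s' := by
  have hαm' : α ≤ m := le_trans (Nat.le_mul_of_pos_right _ (by omega)) hαm
  obtain ⟨s1, t1, h1, hu1, hc1, hi1⟩ := Tri.record (b := false) h hu hi hx
  set L' := L.pushes i x u with hL'
  have t2 := Tri.assignI (b := false) (L := 60) (by norm_num) 12 (by norm_num) (.lit 0) rfl s1
  have h2 : D.Holds L L' (s1.setI 12 0) := h1.congr
    (by rintro a (rfl | rfl | rfl | rfl | rfl) <;> simp) (fun _ _ _ => rfl) (fun _ _ _ => rfl)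
    (fun _ _ => rfl)
  set E : ℝ := if u = 0 then 0 else m * d * (u : ℝ) ^ (ω - 2) with hE
  have hE0 : 0 ≤ E := by rw [hE]; split_ifs <;> positivity
  have hKE : 0 ≤ (C + 100000) * E := by positivity
  have key : ∃ s3, Tri false 60 (.ite (.idxLt 12 4) (InverseMaintenance.newRows P) .skip) (s1.setI 12 0)
      (10000 * (C + 100000) * E + 2) s3 ∧ D.Holds L' L' s3 := by
    -- The extension is skipped when nothing has changed: its block size is u, which has to be
    -- positive.
    by_cases h0 : u = 0
    · refine ⟨_, (Tri.ite_false (L := 60) (cd := .idxLt 12 4) ⟨by norm_num, by norm_num⟩ ?_ (Tri.skip _)).mono ?_, ?_⟩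
      · simp [Cond.Holds, hu1, h0]
      · linarith
      · have : L' = L := by rw [hL', h0]; rfl
        rw [this] at h2 ⊢
        exact h2
    · obtain ⟨s3, t3, h3⟩ := Tri.newRows hω hC hP h2 (by simpa using hu1) (by omega)
        (by simpa using hc1) (by simpa using hi1) hα hαd hαm'
      refine ⟨s3, (Tri.ite_true (L := 60) (cd := .idxLt 12 4) ⟨by norm_num, by norm_num⟩ ?_ t3).mono ?_, h3⟩
      · simp [Cond.Holds, hu1]; omega
      · rw [hE, if_neg h0]; linarith
  obtain ⟨s3, t3, h3⟩ := key
  obtain ⟨s4, t4, h4, hδ, hg, hM, hW⟩ := Tri.weights h3 hα1 hαm'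
  obtain ⟨s5, t5, fr, hX', hY⟩ := Tri.solve hω hC hP s4 h4.slots hα1 h4.sketch hαm h4.γ h4.sqrtγ
    hδ hg hM h4.J hW hX
  have h5 : D.Holds L' L' s5 := h4.congr (fun a _ => by rw [fr.idx]) (fun t _ _ => by rw [fr.idxTab])
    (fun x _ _ => by rw [fr.val]) (fun t ht => fr.valTab t (by simp [Setup.keepT] at ht; omega))
  refine ⟨s5, (t1.seq <| t2.seq <| t3.seq <| t4.seq t5).mono ?_, h5, ?_⟩
  · have a1 : (1 : ℝ) ≤ α := by exact_mod_cast hα1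
    have a2 : (α : ℝ) ≤ m := by exact_mod_cast hαm'
    have a3 : (u : ℝ) ≤ α := by exact_mod_cast (by omega : u ≤ α)
    have hp2 : (α : ℝ) ≤ (α : ℝ) ^ (ω - 1) := by
      nth_rw 1 [← Real.rpow_one (α : ℝ)]
      exact Real.rpow_le_rpow_of_exponent_le a1 (by linarith)
    set E' := (m : ℝ) * (α : ℝ) ^ (ω - 1) with hE'
    have h6 : (m : ℝ) * α ≤ E' := by rw [hE']; gcongr
    have h7 : (1 : ℝ) * α ≤ m * α := by gcongr; linarith
    have h8 : 100000 * E' ≤ (C + 100000) * E' := by gcongr; linarith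
    norm_num [IE.cost]
    linarith
  · constructor
    · exact h5.dim
    · exact h5.slots
    · exact h5.γ
    · exact h5.thr
    · exact h5.G
    · exact h5.F
    · rw [fr.valTab 14 (by norm_num)]; exact hδ
    · rw [fr.valTab 14 (by norm_num)]; exact hg
    · exact hX'
    · exact hY

end InverseMaintenance

/-! ### Size of the sketch and drawing the signs -/

namespace RealRAM

theorem Tri.flip {L a : ℕ} (s : Store) :
    Tri true L (.op (.flip a)) s 1 ((Instr.flip a).effect s) := by
  intro σ hσ
  refine ⟨_, 1, .op _ _, by simp, ?_⟩
  have hc := hσ.coins rfl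
  refine ⟨⟨fun x hx => ?_, hσ.val, hσ.idxTab, hσ.valTab⟩, fun _ => ?_⟩
  · simp only [Instr.effect, hc, Function.update_apply]
    split_ifs
    · rfl
    · rfl
    · exact hσ.idx x hx
  · simp only [Instr.effect, hc]

/-- `c * x`. -/
def IE.nsmul (x : IE) : ℕ → IE
  | 0 => .lit 0
  | c + 1 => .add (x.nsmul c) x

theorem IE.nsmul_eval (x : IE) (s : Store) (c : ℕ) : (x.nsmul c).eval s = c * x.eval s := by
  induction c with
  | zero => simp [nsmul, eval]
  | succ c ih => simp only [nsmul, eval, ih]; ring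

theorem IE.nsmul_ok {lv : Bool} {L : ℕ} {x : IE} (h : x.Ok lv L = true) (c : ℕ) :
    (x.nsmul c).Ok lv L = true := by
  induction c with
  | zero => rfl
  | succ c ih => simp [nsmul, Ok, ih, h]

theorem IE.nsmul_cost (x : IE) (c : ℕ) : (x.nsmul c).cost = c * (x.cost + 1) + 1 := by
  induction c with
  | zero => simp [nsmul, cost]
  | succ c ih => simp only [nsmul, cost, ih]; ring

end RealRAM

namespace InverseMaintenance

open RealRAM Matrix

/-- Compute the dimension of the sketch in register 6. -/
def sketchSize (c : ℕ) : Prog :=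
  .seq (assignI 16 ((IE.reg 3).nsmul c)) <|
  .seq (assignI 15 (.add (.reg 0) (.lit 1))) <|
  .seq (assignI 14 (.lit 1)) <|
  .seq (assignI 6 (.lit 0)) <|
  .loop (.idxLt 14 15) (.seq (assignI 14 (.add (.reg 14) (.reg 14)))
    (assignI 6 (.add (.reg 6) (.reg 16))))

/-- Fill the sketching matrix (table 4, with `idx 6` rows and `idx 5` columns) with random signs. -/
def drawSigns : Prog :=
  forLoop 17 6 <| forLoop 18 5 <|
    .seq (.op (.flip 19)) (storeR 4 (.reg 17) (.reg 18)
      (.ite (.lit 0) (.reg 19) (.nat (.lit 1)) (.sub (.nat (.lit 0)) (.nat (.lit 1)))))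

/-- Natural numbers cannot be multiplied or rounded from reals. Doubling from 1 up to n + 1 takes
⌈log₂(n + 1)⌉ passes, and each pass adds cα to the size. -/
theorem Tri.sketchSize {b : Bool} (c : ℕ) (s : Store) {n α : ℕ} (hn : s.idx 0 = n)
    (hα : s.idx 3 = α) : ∃ s', Tri b 60 (sketchSize c) s (50 * (c + 1) * (Nat.clog 2 (n + 1) + 1)) s' ∧
      s'.idx 6 = Nat.clog 2 (n + 1) * (c * α) ∧
      (∀ a, a ≠ 6 → a < 14 ∨ 16 < a → s'.idx a = s.idx a) ∧
      s'.val = s.val ∧ s'.idxTab = s.idxTab ∧ s'.valTab = s.valTab ∧ s'.coins = s.coins := by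
  have t1 := Tri.assignI (b := b) (L := 60) (by norm_num) 16 (by norm_num) ((IE.reg 3).nsmul c)
    (IE.nsmul_ok rfl c) s
  rw [IE.nsmul_eval, IE.nsmul_cost] at t1
  simp only [IE.eval, hα] at t1
  have t2 := Tri.assignI (b := b) (L := 60) (by norm_num) 15 (by norm_num)
    (.add (.reg 0) (.lit 1)) rfl (s.setI 16 (c * α))
  have t3 := Tri.assignI (b := b) (L := 60) (by norm_num) 14 (by norm_num)
    (.lit 1) rfl ((s.setI 16 (c * α)).setI 15 (n + 1))
  have t4 := Tri.assignI (b := b) (L := 60) (by norm_num) 6 (by norm_num)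
    (.lit 0) rfl (((s.setI 16 (c * α)).setI 15 (n + 1)).setI 14 1)
  simp [IE.eval, hn] at t2
  simp only [IE.eval] at t3 t4
  set s0 := (((s.setI 16 (c * α)).setI 15 (n + 1)).setI 14 1).setI 6 0 with hs0
  obtain ⟨s', ⟨h1, h2, h3, h4, h5, h6, h7, h8⟩, t5⟩ := Tri.while (b := b) (L := 60)
    (P := .seq (RealRAM.assignI 14 (.add (.reg 14) (.reg 14)))
      (RealRAM.assignI 6 (.add (.reg 6) (.reg 16))))
    (cd := .idxLt 14 15) ⟨by norm_num, by norm_num⟩ (N := Nat.clog 2 (n + 1)) (c := fun _ => 20)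
    (fun t s' => s'.idx 14 = 2 ^ t ∧ s'.idx 6 = t * (c * α) ∧ s'.idx 15 = n + 1 ∧
      (∀ a, a ≠ 6 → a ≠ 14 → s'.idx a = s0.idx a) ∧
      s'.val = s.val ∧ s'.idxTab = s.idxTab ∧ s'.valTab = s.valTab ∧ s'.coins = s.coins)
    (by
      rintro t ht s' ⟨h1, h2, h3, h4, h5, h6, h7, h8⟩
      refine ⟨?_, ?_⟩
      · simp only [Cond.Holds, h1, h3]
        exact (Nat.lt_clog_iff_pow_lt (by norm_num)).1 ht
      · have u1 := Tri.assignI (b := b) (L := 60) (by norm_num) 14 (by norm_num)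
          (.add (.reg 14) (.reg 14)) rfl s'
        have u2 := Tri.assignI (b := b) (L := 60) (by norm_num) 6 (by norm_num)
          (.add (.reg 6) (.reg 16)) rfl (s'.setI 14 (IE.eval s' (.add (.reg 14) (.reg 14))))
        have h16 : s'.idx 16 = c * α := by rw [h4 _ (by norm_num) (by norm_num)]; simp [hs0]
        refine ⟨_, (u1.seq u2).mono (by norm_num [IE.cost]), ?_, ?_, ?_, ?_, h5, h6, h7, h8⟩
        · simp [IE.eval, h1]; ring
        · simp [IE.eval, h2, h16]; ring
        · simpa using h3
        · intro a ha ha'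
          simp [ha, ha', h4])
    (by
      rintro s' ⟨h1, h2, h3, h4⟩
      simp only [Cond.Holds, h1, h3, not_lt]
      exact Nat.le_pow_clog (by norm_num) _)
    (s := s0) ⟨by simp [hs0], by simp [hs0], by simp [hs0], fun _ _ _ => rfl, rfl, rfl, rfl, rfl⟩
  refine ⟨s', (t1.seq (t2.seq (t3.seq (t4.seq t5)))).mono ?_, h2, ?_, h5, h6, h7, h8⟩
  · simp [IE.cost]
    have : (0:ℝ) ≤ Nat.clog 2 (n + 1) := Nat.cast_nonneg _
    have : (0:ℝ) ≤ c := Nat.cast_nonneg _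
    nlinarith
  · intro a ha ha'
    rw [h4 a ha (by omega)]
    simp [hs0, ha, show a ≠ 14 by omega, show a ≠ 15 by omega, show a ≠ 16 by omega]

/-- The invariant relates the remaining stream to the original one: after a full rows and e entries
of the next, a·N + e coins have been read. This identifies the table with `coinMatrix`. -/
theorem Tri.drawSigns (s : Store) {m N : ℕ} (hm : s.idx 6 = m) (hN : s.idx 5 = N) :
    ∃ s', Tri true 60 drawSigns s ((m + 1) * ((N + 1) * 50 + 10)) s' ∧
      Rep (s'.valTab 4) (signMatrix (coinMatrix m N s.coins)) ∧
      (∀ a, a < 17 ∨ 19 < a → s'.idx a = s.idx a) ∧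
      s'.val = s.val ∧ s'.idxTab = s.idxTab ∧ ∀ t, t ≠ 4 → s'.valTab t = s.valTab t := by
  let C : Store → Prop := fun s' => (∀ a, a < 17 ∨ 19 < a → s'.idx a = s.idx a) ∧
      s'.val = s.val ∧ s'.idxTab = s.idxTab ∧ ∀ t, t ≠ 4 → s'.valTab t = s.valTab t
  obtain ⟨s', ⟨h1, h2, h3, h4⟩, t⟩ := Tri.forLoop (b := true) (L := 60) (by norm_num)
    (a := 17) (n := 6) (by norm_num) (by norm_num) (P := RealRAM.forLoop 18 5 <|
    .seq (.op (.flip 19)) (RealRAM.storeR 4 (.reg 17) (.reg 18)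
      (.ite (.lit 0) (.reg 19) (.nat (.lit 1)) (.sub (.nat (.lit 0)) (.nat (.lit 1)))))) (N := m)
    (c := (N + 1) * (40 + 10)) (by positivity)
    (fun a s' => s'.idx 17 = a ∧ C s' ∧ (∀ k, s'.coins k = s.coins (a * N + k)) ∧
      ∀ l < a, ∀ j < N, s'.valTab 4 l j = sgn (s.coins (l * N + j)))
    (fun a s' h => ⟨h.1, (h.2.1.1 6 (by norm_num)).trans hm⟩)
    (by
      rintro a ha s' ⟨h1, h2, h3, h4⟩
      obtain ⟨s'', ⟨g1, g2, g3, g4, g5, g6⟩, t⟩ := Tri.forLoop (b := true) (L := 60) (by norm_num)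
        (a := 18) (n := 5) (by norm_num) (by norm_num) (P := .seq (.op (.flip 19))
        (RealRAM.storeR 4 (.reg 17) (.reg 18)
        (.ite (.lit 0) (.reg 19) (.nat (.lit 1)) (.sub (.nat (.lit 0)) (.nat (.lit 1)))))) (N := N)
        (c := 40) (by norm_num)
        (fun e s' => s'.idx 18 = e ∧ s'.idx 17 = a ∧ C s' ∧
          (∀ k, s'.coins k = s.coins (a * N + e + k)) ∧
          (∀ l < a, ∀ j < N, s'.valTab 4 l j = sgn (s.coins (l * N + j))) ∧
          ∀ j < e, s'.valTab 4 a j = sgn (s.coins (a * N + j)))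
        (fun e s' h => ⟨h.1, (h.2.2.1.1 5 (by norm_num)).trans hN⟩)
        (by
          rintro e he s' ⟨h0, h1, h2, h3, h4, h5⟩
          have u1 := Tri.flip (L := 60) (a := 19) s'
          have u2 := Tri.storeR (b := true) (L := 60) (by norm_num) 4 (.reg 17) (.reg 18)
            (.ite (.lit 0) (.reg 19) (.nat (.lit 1)) (.sub (.nat (.lit 0)) (.nat (.lit 1))))
            rfl rfl rfl (by norm_num) ((Instr.flip 19).effect s')
          have hv : RE.eval ((Instr.flip 19).effect s') (.ite (.lit 0) (.reg 19) (.nat (.lit 1))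
              (.sub (.nat (.lit 0)) (.nat (.lit 1)))) = sgn (s.coins (a * N + e)) := by
            have := h3 0
            rw [add_zero] at this
            simp only [RE.eval, IE.eval, Instr.effect, Function.update_self, this, sgn]
            cases s.coins (a * N + e) <;> simp
          have h17 : ((Instr.flip 19).effect s').idx 17 = a := by simp [Instr.effect, h1]
          have h18 : ((Instr.flip 19).effect s').idx 18 = e := by simp [Instr.effect, h0]
          rw [hv] at u2
          simp only [IE.eval, h17, h18] at u2
          refine ⟨_, (u1.seq u2).mono (by norm_num [IE.cost, RE.cost]), ?_, ?_, ?_, ⟨?_, ?_, ?_, ?_⟩,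
            ?_, ?_, ?_⟩
          · simp [h18]
          · simp
          · simp [h17]
          · intro x hx
            have : x ≠ 18 ∧ x ≠ 19 := by omega
            simp [Instr.effect, this, h2.1 x hx]
          · exact h2.2.1
          · exact h2.2.2.1
          · intro t ht
            simp [ht, Instr.effect, h2.2.2.2 t ht]
          · intro k
            simp only [Store.setI_coins, Store.setVT_coins, Instr.effect, h3]
            congr 1
            ring
          · intro l hl j hj
            simp [upd, hl.ne, Instr.effect, h4 l hl j hj]
          · intro j hj
            simp only [Store.setI_valTab, Store.setVT_valTab, if_true, upd, true_and, Instr.effect]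
            split_ifs with h
            · rw [h]
            · exact h5 j (by omega))
        (s := s') ⟨by simp, by simpa using h1, ⟨fun x hx => by
            simp [show x ≠ 18 by omega, h2.1 x hx], h2.2⟩, by simpa using h3, h4, by simp⟩
      refine ⟨s'', t, g2, by simp, ⟨fun x hx => by simp [show x ≠ 17 by omega, g3.1 x hx], g3.2⟩,
        ?_, ?_⟩
      · intro k
        rw [Store.setI_coins, g4]
        congr 1
        ring
      · intro l hl j hj
        rcases Nat.lt_succ_iff_lt_or_eq.1 hl with h | h
        · exact g5 l h j hj
        · subst h; exact g6 j hj)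
    (s := s) ⟨by simp, ⟨fun x hx => by simp [show x ≠ 17 by omega], rfl, rfl, fun _ _ => rfl⟩,
      by simp, by simp⟩
  refine ⟨s', t.mono (le_of_eq (by ring)), ?_, h2⟩
  intro l j
  rw [h4 l l.2 j j.2]
  rfl

end InverseMaintenance

/-! ### The matrices of the preprocessing -/

namespace InverseMaintenance

open RealRAM Matrix

def emptyLog : Log := ⟨0, fun _ => 0, fun _ => 0, fun _ => 0⟩

theorem Log.slot_pushes_le (L : Log) (h : ∀ i, L.slot i ≤ L.cnt) (i : ℕ → ℕ) (x : ℕ → ℝ) (u : ℕ) :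
    ∀ a, (L.pushes i x u).slot a ≤ (L.pushes i x u).cnt := by
  induction u with
  | zero => exact h
  | succ u ih =>
    intro a
    simp only [Log.pushes, Log.push, Function.update_apply]
    split_ifs
    · exact le_rfl
    · exact (ih a).trans (Nat.le_succ _)

/-- The rows with nonzero initial weight in the order of the list, counted from 1. Row 0 is zero and
stands for all other rows, so that every row of A has a position. -/
def supportMatrix (d s0 : ℕ) (A : ℕ → ℕ → ℝ) (ev : ℕ → ℕ) : Matrix (Fin (s0 + 1)) (Fin d) ℝ :=
  Matrix.of fun i j => if 0 < (i : ℕ) then A (ev (i - 1)) j else 0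

def supportWeight (s0 : ℕ) (ex : ℕ → ℝ) (i : Fin (s0 + 1)) : ℝ :=
  if 0 < (i : ℕ) then ex (i - 1) else 0

def initGram (d s0 : ℕ) (A : ℕ → ℕ → ℝ) (ev : ℕ → ℕ) (ex : ℕ → ℝ) : Matrix (Fin d) (Fin d) ℝ :=
  (supportMatrix d s0 A ev)ᵀ * diagonal (supportWeight s0 ex) * supportMatrix d s0 A ev

/-- The number of rows of the sketch. -/
def sketchDim (n α c : ℕ) : ℕ := Nat.clog 2 (n + 1) * (c * α)

/-- θ is the weight of B₀ in the regularized matrix, γ⁻¹ = 1 + θ, and `thr` is the tolerance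
1/(2β²). Position 0 marks a row with zero initial weight; the minimum in `pos` is never attained by
its second argument alone and only provides the bound. G is B₀⁻¹, P is AB₀⁻¹ restricted to the
nonzero rows, and Q is the sketch of D₀^{1/2} A B₀⁻¹. -/
def mkSetup (n d s0 α c : ℕ) (β : ℝ) (A : ℕ → ℕ → ℝ) (ev : ℕ → ℕ) (ex : ℕ → ℝ) (coins : ℕ → Bool) :
    Setup (s0 + 1) d (sketchDim n α c) α where
  θ := 1 / β
  γ := 1 / (1 + 1 / β)
  thr := 1 / (2 * (β * β))
  A := A
  w0 := (emptyLog.pushes ev ex s0).cur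
  pos i := ⟨min ((emptyLog.pushes ev ex s0).slot i) s0, by omega⟩
  G := (initGram d s0 A ev ex)⁻¹
  P := supportMatrix d s0 A ev * (initGram d s0 A ev ex)⁻¹
  Q := signMatrix (coinMatrix (sketchDim n α c) (s0 + 1) coins) *
    (diagonal (fun i => Real.sqrt (supportWeight s0 ex i)) *
      (supportMatrix d s0 A ev * (initGram d s0 A ev ex)⁻¹))
  S := signMatrix (coinMatrix (sketchDim n α c) (s0 + 1) coins)

/-- Store the initial weights, and the positions of the rows with nonzero weight. -/
def scatter : Prog :=
  forLoop 10 4 <|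
    .seq (storeI 1 (.ld 0 (.reg 10) (.lit 0)) (.lit 0) (.add (.reg 10) (.lit 1))) <|
    .seq (storeR 10 (.ld 0 (.reg 10) (.lit 0)) (.lit 0) (.ld 1 (.reg 10) (.lit 0)))
    (storeR 13 (.ld 0 (.reg 10) (.lit 0)) (.lit 0) (.ld 1 (.reg 10) (.lit 0)))

def weightExp : RE := .ite (.lit 0) .I (.ld 1 (.sub .I (.lit 1)) (.lit 0)) (.nat (.lit 0))

/-- The matrices of the preprocessing. -/
def initMatrices (P : Prog) : Prog :=
  .seq (fill 5 (.lit 0) (.lit 0) (.reg 5) (.reg 1) (.lit 1)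
    (.ite (.lit 0) .I (.ld 0 (.ld 0 (.sub .I (.lit 1)) (.lit 0)) .J) (.nat (.lit 0)))) <|
  .seq (fill 20 (.lit 0) (.lit 0) (.reg 1) (.reg 5) (.lit 1) (.ld 5 .J .I)) <|
  .seq (fill 21 (.lit 0) (.lit 0) (.reg 5) (.reg 1) (.lit 1) (.mul weightExp (.ld 5 .I .J))) <|
  .seq (matMul P 20 21 22 1 5 1 1) <|
  .seq (invert P 1 22 7) <|
  .seq (matMul P 5 7 9 5 1 1 1) <|
  .seq (fill 23 (.lit 0) (.lit 0) (.reg 5) (.reg 1) (.lit 1)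
    (.mul (.sqrt weightExp) (.ld 9 .I .J))) <|
  .seq (matMul P 4 23 8 6 5 1 1) <|
  .seq (fill 8 (.reg 6) (.lit 0) (.reg 3) (.reg 1) (.lit 1) (.nat (.lit 0))) <|
  .seq (fill 11 (.lit 0) (.lit 0) (.reg 3) (.reg 1) (.lit 1) (.nat (.lit 0))) <|
  fill 12 (.lit 0) (.lit 0) (.reg 9) (.reg 3) (.lit 1) (.nat (.lit 0))

theorem Tri.scatter {b : Bool} {s : Store} {u : ℕ} (hu : s.idx 4 = u) {i : ℕ → ℕ} {x : ℕ → ℝ}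
    (hi : ∀ a, s.idxTab 0 a 0 = i a) (hx : ∀ a, s.valTab 1 a 0 = x a)
    (h1 : ∀ a, s.idxTab 1 a 0 = 0) (h10 : ∀ a, s.valTab 10 a 0 = 0)
    (h13 : ∀ a, s.valTab 13 a 0 = 0) : ∃ s',
      Tri b 60 scatter s (100 * (u + 1)) s' ∧ (∀ a, a ≠ 10 → s'.idx a = s.idx a) ∧
      s'.val = s.val ∧ (∀ t, t ≠ 1 → s'.idxTab t = s.idxTab t) ∧
      (∀ t, t ≠ 10 → t ≠ 13 → s'.valTab t = s.valTab t) ∧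
      (∀ a, s'.idxTab 1 a 0 = (emptyLog.pushes i x u).slot a) ∧
      (∀ a, s'.valTab 10 a 0 = (emptyLog.pushes i x u).cur a) ∧
      ∀ a, s'.valTab 13 a 0 = (emptyLog.pushes i x u).cur a := by
  obtain ⟨s', ⟨-, h⟩, t1⟩ := Tri.forLoop (b := b) (L := 60) (by norm_num)
    (a := 10) (n := 4) (by norm_num) (by norm_num) (P :=
      .seq (storeI 1 (.ld 0 (.reg 10) (.lit 0)) (.lit 0) (.add (.reg 10) (.lit 1))) <|
      .seq (storeR 10 (.ld 0 (.reg 10) (.lit 0)) (.lit 0) (.ld 1 (.reg 10) (.lit 0)))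
      (storeR 13 (.ld 0 (.reg 10) (.lit 0)) (.lit 0) (.ld 1 (.reg 10) (.lit 0)))) (N := u) (c := 50)
    (by norm_num)
    (fun k s' => s'.idx 10 = k ∧ (∀ a, a ≠ 10 → s'.idx a = s.idx a) ∧
      s'.val = s.val ∧ (∀ t, t ≠ 1 → s'.idxTab t = s.idxTab t) ∧
      (∀ t, t ≠ 10 → t ≠ 13 → s'.valTab t = s.valTab t) ∧
      (∀ a, s'.idxTab 1 a 0 = (emptyLog.pushes i x k).slot a) ∧
      (∀ a, s'.valTab 10 a 0 = (emptyLog.pushes i x k).cur a) ∧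
      ∀ a, s'.valTab 13 a 0 = (emptyLog.pushes i x k).cur a)
    (fun a s' h => ⟨h.1, (h.2.1 4 (by norm_num)).trans hu⟩)
    (by
      rintro k hk s' ⟨g1, g2, g3, g4, g5, g6, g7, g8⟩
      have hi' : ∀ a, s'.idxTab 0 a 0 = i a := by rw [g4 0 (by norm_num)]; exact hi
      have hx' : ∀ a, s'.valTab 1 a 0 = x a := by rw [g5 1 (by norm_num) (by norm_num)]; exact hx
      have u1 := Tri.storeI (b := b) (L := 60) (by norm_num) 1 (.ld 0 (.reg 10) (.lit 0)) (.lit 0)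
        (.add (.reg 10) (.lit 1)) rfl rfl rfl (by norm_num) s'
      simp only [IE.eval, g1, hi'] at u1
      set s1 := s'.setIT 1 (upd (s'.idxTab 1) (i k) 0 (k + 1)) with hs1
      have u2 := Tri.storeR (b := b) (L := 60) (by norm_num) 10 (.ld 0 (.reg 10) (.lit 0)) (.lit 0)
        (.ld 1 (.reg 10) (.lit 0)) rfl rfl rfl (by norm_num) s1
      simp [IE.eval, RE.eval, hs1, g1, hi', hx'] at u2
      rw [← hs1] at u2
      set s2 := s1.setVT 10 (upd (s'.valTab 10) (i k) 0 (x k)) with hs2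
      have u3 := Tri.storeR (b := b) (L := 60) (by norm_num) 13 (.ld 0 (.reg 10) (.lit 0)) (.lit 0)
        (.ld 1 (.reg 10) (.lit 0)) rfl rfl rfl (by norm_num) s2
      simp [IE.eval, RE.eval, hs1, hs2, g1, hi', hx'] at u3
      rw [← hs1, ← hs2] at u3
      refine ⟨_, (u1.seq (u2.seq u3)).mono (by norm_num [IE.cost, RE.cost]), ?_, ?_, ?_, ?_, ?_, ?_,
        ?_, ?_, ?_⟩
      · simpa [hs1, hs2] using g1
      · simp
      · intro a ha
        simp [hs1, hs2, ha, g2 a ha]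
      · exact g3
      · intro t ht
        simp [hs1, hs2, ht, g4 t ht]
      · intro t ht ht'
        simp [hs1, hs2, ht, ht', g5 t ht ht']
      · intro a
        simp [hs1, hs2, upd, Log.pushes, Log.push, Function.update_apply, Log.pushes_cnt, g6,
          emptyLog]
      · intro a
        simp [hs2, upd, Log.pushes, Log.push, Function.update_apply, g7]
      · intro a
        simp [upd, Log.pushes, Log.push, Function.update_apply, g8])
    (s := s) ⟨by simp, fun a ha => by simp [ha], rfl, fun _ _ => rfl, fun _ _ _ => rfl,
      by simpa [Log.pushes, emptyLog] using h1, by simpa [Log.pushes, emptyLog] using h10,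
      by simpa [Log.pushes, emptyLog] using h13⟩
  refine ⟨s', t1.mono ?_, h⟩
  nlinarith [(Nat.cast_nonneg u : (0:ℝ) ≤ u)]

variable {ω C : ℝ} {P : Prog}

/-- The tables that `initMatrices` keeps. -/
def keepInit (t : ℕ) : Bool := decide (t < 5) || t == 10 || t == 13

/-- All products use blocks of size d. Those with sides s and d cost (s + d) d^(ω-1). The sketch has
m ≤ c·l·d rows, which gives the factors c and l for its product; l also covers the logarithm of the
inversion. -/
theorem Tri.initMatrices (hω : 2 ≤ ω) (hC : 0 ≤ C) (hP : IsMulProg ω C P) {s : Store}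
    {d s0 α m : ℕ} {A : ℕ → ℕ → ℝ} {ev : ℕ → ℕ} {ex : ℕ → ℝ} (hd : s.idx 1 = d) (hα : s.idx 3 = α)
    (hN : s.idx 5 = s0 + 1) (hm : s.idx 6 = m) (hmα : s.idx 9 = m + α)
    (hi : ∀ a, s.idxTab 0 a 0 = ev a) (hx : ∀ a, s.valTab 1 a 0 = ex a) (hA : s.valTab 0 = A)
    {S : Matrix (Fin m) (Fin (s0 + 1)) ℝ} (hS : Rep (s.valTab 4) S)
    (hB : (initGram d s0 A ev ex).PosDef) (hd1 : 1 ≤ d) (hαd : α ≤ d) {c l : ℕ} (hc : 1 ≤ c)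
    (hm' : m ≤ c * (l * d)) (hl : Nat.log 2 d + 1 ≤ l) :
    ∃ s', Tri false 60 (initMatrices P) s
        (1000000 * (C + 100000) * c * (l * ((s0 + 1 + d) * (d : ℝ) ^ (ω - 1)))) s' ∧
      Agree (fun _ => true) keepInit s s' ∧
      Rep (s'.valTab 7) (initGram d s0 A ev ex)⁻¹ ∧
      Rep (s'.valTab 9) (supportMatrix d s0 A ev * (initGram d s0 A ev ex)⁻¹) ∧
      (∀ (a : Fin m) (j : Fin d), s'.valTab 8 a j = (S *
        (diagonal (fun i => Real.sqrt (supportWeight s0 ex i)) *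
        (supportMatrix d s0 A ev * (initGram d s0 A ev ex)⁻¹))) a j) ∧
      (∀ (e : Fin α) (j : Fin d), s'.valTab 8 (m + e) j = 0) ∧
      Rep (s'.valTab 11) (0 : Matrix (Fin α) (Fin d) ℝ) ∧
      Rep (s'.valTab 12) (0 : Matrix (Fin (m + α)) (Fin α) ℝ) := by
  set Ab := supportMatrix d s0 A ev with hAb
  set w := supportWeight s0 ex with hw
  set B := initGram d s0 A ev ex with hBd
  obtain ⟨f1, r1, t1⟩ := Tri.fillE (b := false) (tab := 5) (p := .reg 5) (q := .reg 1)
    (e := .ite (.lit 0) .I (.ld 0 (.ld 0 (.sub .I (.lit 1)) (.lit 0)) .J) (.nat (.lit 0)))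
    (by decide) s hN hd Ab
    (by
      intro i j g _
      simp [RE.eval, IE.eval, IE.I, IE.J, hi, hA, hAb, supportMatrix])
  obtain ⟨f2, r2, t2⟩ := Tri.fillE (b := false) (tab := 20) (p := .reg 1) (q := .reg 5)
    (e := .ld 5 .J .I) (by decide) (s.setVT 5 f1) hd hN Abᵀ
    (by
      intro i j g _
      simp [RE.eval, IE.eval, IE.I, IE.J, r1 j i])
  obtain ⟨f3, r3, t3⟩ := Tri.fillE (b := false) (tab := 21) (p := .reg 5) (q := .reg 1)
    (e := .mul weightExp (.ld 5 .I .J)) (by decide) ((s.setVT 5 f1).setVT 20 f2) hN hd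
    (diagonal w * Ab)
    (by
      intro i j g _
      rw [diagonal_mul]
      simp [RE.eval, IE.eval, IE.I, IE.J, r1 i j, weightExp, hx, hw, supportWeight])
  obtain ⟨f4, r4, t4⟩ := Tri.mulM hω hC hP (a := 20) (b := 21) (c := 22) (p := 1) (q := 5)
    (r := 1) (bs := 1) (by decide) (((s.setVT 5 f1).setVT 20 f2).setVT 21 f3) hd hN hd hd hd1
    (by simpa using r2) (by simpa using r3)
  rw [← Matrix.mul_assoc] at r4
  have r4 : Rep f4 B := r4
  set s4 := (((s.setVT 5 f1).setVT 20 f2).setVT 21 f3).setVT 22 f4 with hs4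
  obtain ⟨f5, r5, t5⟩ := Tri.invM hω hC hP (n := 1) (a := 22) (c := 7) (by decide) s4 hd hd1
    (X := B) (by simpa [hs4] using r4) hB
  obtain ⟨f6, r6, t6⟩ := Tri.mulM hω hC hP (a := 5) (b := 7) (c := 9) (p := 5) (q := 1)
    (r := 1) (bs := 1) (by decide) (s4.setVT 7 f5) hN hd hd hd hd1 (X := Ab) (Y := B⁻¹)
    (by simpa [hs4] using r1) (by simpa using r5)
  obtain ⟨f7, r7, t7⟩ := Tri.fillE (b := false) (tab := 23) (p := .reg 5) (q := .reg 1)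
    (e := .mul (.sqrt weightExp) (.ld 9 .I .J)) (by decide) ((s4.setVT 7 f5).setVT 9 f6) hN hd
    (diagonal (fun i => Real.sqrt (w i)) * (Ab * B⁻¹))
    (by
      intro i j g _
      rw [diagonal_mul]
      simp [RE.eval, IE.eval, IE.I, IE.J, r6 i j, weightExp, hx, hw, supportWeight, hs4])
  set s7 := ((s4.setVT 7 f5).setVT 9 f6).setVT 23 f7 with hs7
  obtain ⟨f8, r8, t8⟩ := Tri.mulM hω hC hP (a := 4) (b := 23) (c := 8) (p := 6) (q := 5)
    (r := 1) (bs := 1) (by decide) s7 hm hN hd hd hd1 (X := S)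
    (Y := diagonal (fun i => Real.sqrt (w i)) * (Ab * B⁻¹))
    (by simpa [hs7, hs4] using hS) (by simpa [hs7] using r7)
  obtain ⟨f9, a9, b9, t9⟩ := Tri.fillAtE (b := false) (tab := 8) (oi := .reg 6) (oj := .lit 0)
    (p := .reg 3) (q := .reg 1) (e := .nat (.lit 0)) (by decide) (s7.setVT 8 f8) hm (v := 0) rfl
    hα hd (fun _ _ => 0) (by intro i j g _; simp [RE.eval, IE.eval])
  obtain ⟨f10, r10, t10⟩ := Tri.fillE (b := false) (tab := 11) (p := .reg 3) (q := .reg 1)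
    (e := .nat (.lit 0)) (by decide) ((s7.setVT 8 f8).setVT 8 f9) hα hd 0
    (by intro i j g _; simp [RE.eval, IE.eval])
  obtain ⟨f11, r11, t11⟩ := Tri.fillE (b := false) (tab := 12) (p := .reg 9) (q := .reg 3)
    (e := .nat (.lit 0)) (by decide) (((s7.setVT 8 f8).setVT 8 f9).setVT 11 f10) hmα hα 0
    (by intro i j g _; simp [RE.eval, IE.eval])
  refine ⟨_, (t1.seq <| t2.seq <| t3.seq <| t4.seq <| t5.seq <| t6.seq <| t7.seq <|
    t8.seq <| t9.seq <| t10.seq t11).mono ?_, ?_, ?_, ?_, ?_, ?_, ?_, ?_⟩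
  · have d1 : (1 : ℝ) ≤ d := by exact_mod_cast hd1
    push_cast
    set N : ℝ := (s0 : ℝ) + 1 with hNd
    have n1 : (1 : ℝ) ≤ N := by rw [hNd]; linarith [(Nat.cast_nonneg s0 : (0 : ℝ) ≤ s0)]
    have c1 : (1 : ℝ) ≤ c := by exact_mod_cast hc
    have l1 : (Nat.log 2 d + 1 : ℝ) ≤ l := by exact_mod_cast hl
    have l0 : (0 : ℝ) ≤ Nat.log 2 d := Nat.cast_nonneg _
    have hl1 : (1 : ℝ) ≤ l := by linarith
    have m1 : (m : ℝ) ≤ c * (l * d) := by exact_mod_cast hm'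
    have a1 : (α : ℝ) ≤ d := by exact_mod_cast hαd
    have hp : (d : ℝ) ^ (ω - 1) = (d : ℝ) ^ (ω - 3) * d ^ 2 := by
      rw [← Real.rpow_natCast, ← Real.rpow_add (by linarith)]
      congr 1
      push_cast
      ring
    have hp2 : (d : ℝ) ≤ (d : ℝ) ^ (ω - 1) := by
      nth_rw 1 [← Real.rpow_one (d : ℝ)]
      exact Real.rpow_le_rpow_of_exponent_le d1 (by linarith)
    have hp3 : (d : ℝ) ^ ω = d * (d : ℝ) ^ (ω - 1) := by
      nth_rw 2 [← Real.rpow_one (d : ℝ)]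
      rw [← Real.rpow_add (by linarith)]
      norm_num
    set p := (d : ℝ) ^ (ω - 1) with hpd
    set E := (N + d) * p with hE
    set l' : ℝ := (l : ℝ) with hl'
    set c' : ℝ := (c : ℝ) with hc'
    have hE0 : 0 ≤ E := by positivity
    have hcl : E ≤ c' * (l' * E) := by
      have h1 : E ≤ l' * E := le_mul_of_one_le_left hE0 hl1
      have h2 : l' * E ≤ c' * (l' * E) := le_mul_of_one_le_left (by positivity) c1
      linarith
    set X := c' * (l' * E) with hX
    have hNd1 : N * d ≤ E := by
      rw [hE]; gcongr; linarith
    have hdd : (d : ℝ) * d ≤ E := by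
      rw [hE]; gcongr; linarith
    have k1 : (N + 1) * (d + 1) ≤ 4 * X := by nlinarith
    have k2 : ((d : ℝ) + 1) * (N + 1) ≤ 4 * X := by rwa [mul_comm]
    have k3 : ((d : ℝ) + d) * (N + d) * (d + d) * (d : ℝ) ^ (ω - 3) ≤ 4 * X := by
      calc _ = 4 * E := by rw [hE, hp]; ring
        _ ≤ _ := by linarith
    have k4 : (d : ℝ) ^ ω * (Nat.log 2 d + 1) ≤ X := by
      calc (d : ℝ) ^ ω * (Nat.log 2 d + 1) ≤ (d * p) * l' := by rw [hp3]; gcongr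
        _ ≤ E * l' := by
            rw [hE]
            gcongr
            linarith
        _ = 1 * (l' * E) := by ring
        _ ≤ X := by rw [hX]; gcongr
    have k5 : (N + d) * (d + d) * (d + d) * (d : ℝ) ^ (ω - 3) ≤ 4 * X := by
      calc _ = 4 * E := by rw [hE, hp]; ring
        _ ≤ _ := by linarith
    have hd' : (d : ℝ) ≤ c' * (l' * d) := by
      have h1 : (d : ℝ) ≤ l' * d := le_mul_of_one_le_left (by positivity) hl1
      have h2 : l' * d ≤ c' * (l' * d) := le_mul_of_one_le_left (by positivity) c1
      linarith
    have k6 : ((m : ℝ) + d) * (N + d) * (d + d) * (d : ℝ) ^ (ω - 3) ≤ 4 * X := by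
      calc ((m : ℝ) + d) * (N + d) * (d + d) * (d : ℝ) ^ (ω - 3) ≤
          (c' * (l' * d) + c' * (l' * d)) * (N + d) * (d + d) * (d : ℝ) ^ (ω - 3) := by gcongr
        _ = 4 * X := by rw [hX, hE, hp]; ring
    have k7 : ((α : ℝ) + 1) * (d + 1) ≤ 4 * X := by
      calc ((α : ℝ) + 1) * (d + 1) ≤ (d + d) * (d + d) := by gcongr
        _ ≤ 4 * X := by linarith
    have k8 : ((m + α : ℕ) + 1 : ℝ) * (α + 1) ≤ 6 * X := by
      push_cast
      calc ((m : ℝ) + α + 1) * (α + 1) ≤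
          (c' * (l' * d) + c' * (l' * d) + c' * (l' * d)) * (d + d) := by gcongr <;> linarith
        _ = 6 * (c' * (l' * (d * d))) := by ring
        _ ≤ 6 * X := by rw [hX]; gcongr
    have hK : 0 ≤ C + 100000 := by linarith
    have q3 := mul_le_mul_of_nonneg_left k3 hK
    have q4 := mul_le_mul_of_nonneg_left k4 hK
    have q5 := mul_le_mul_of_nonneg_left k5 hK
    have q6 := mul_le_mul_of_nonneg_left k6 hK
    have hX0 : 0 ≤ X := by linarith
    have hKX : 100000 * X ≤ (C + 100000) * X := by gcongr; linarith
    have : 1000000 * (C + 100000) * c' * (l' * E) = 1000000 * ((C + 100000) * X) := by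
      rw [hX]; ring
    rw [this]
    push_cast at k8
    linarith
  · exact (((((((((((Agree.refl s).setVT rfl f1).setVT rfl f2).setVT rfl f3).setVT rfl f4).setVT rfl
      f5).setVT rfl f6).setVT rfl f7).setVT rfl f8).setVT rfl f9).setVT rfl f10).setVT rfl f11
  · simpa [hs7] using r5
  · simpa [hs7] using r6
  · intro a j
    simp
    rw [b9 _ _ (by omega)]
    simp
    exact r8 a j
  · intro e j
    simpa using a9 e j
  · simpa using r10
  · simpa using r11

end InverseMaintenance

/-! ### The complete preprocessing -/

namespace InverseMaintenance

open RealRAM Matrix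

/-- The record of changed rows before the first round. -/
def startLog (s0 : ℕ) (ev : ℕ → ℕ) (ex : ℕ → ℝ) : Log :=
  ⟨0, fun _ => 0, fun _ => 0, (emptyLog.pushes ev ex s0).cur⟩

def setScalars : Prog :=
  .seq (assignR 1 (.div (.nat (.lit 1)) (.reg 0))) <|
  .seq (assignR 2 (.div (.nat (.lit 1)) (.add (.nat (.lit 1)) (.reg 1)))) <|
  .seq (assignR 3 (.sqrt (.reg 2)))
  (assignR 4 (.div (.nat (.lit 1)) (.mul (.nat (.lit 2)) (.mul (.reg 0) (.reg 0)))))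

/-- The part of the preprocessing that reads the coins. -/
def coinProg (c : ℕ) : Prog :=
  .seq (assignI 5 (.add (.reg 4) (.lit 1))) <|
  .seq (sketchSize c) <|
  .seq (assignI 9 (.add (.reg 6) (.reg 3))) <|
  .seq (assignI 8 (.lit 0)) <|
  .seq drawSigns <|
  .seq setScalars scatter

/-- The signs are drawn before the first multiplication, since the multiplication program may flip
coins itself and would shift the stream. -/
def initProg (P : Prog) (c : ℕ) : Prog := .seq (coinProg c) (initMatrices P)

theorem Tri.setScalars {b : Bool} (s : Store) {β : ℝ} (hβ : s.val 0 = β) : ∃ s',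
    Tri b 60 setScalars s 100 s' ∧ s'.val 1 = 1 / β ∧ s'.val 2 = 1 / (1 + 1 / β) ∧
      s'.val 3 = Real.sqrt (1 / (1 + 1 / β)) ∧ s'.val 4 = 1 / (2 * (β * β)) ∧
      s'.idx = s.idx ∧ s'.idxTab = s.idxTab ∧ s'.valTab = s.valTab := by
  have t1 := Tri.assignR (b := b) (L := 60) (by norm_num) 1 (by norm_num)
    (.div (.nat (.lit 1)) (.reg 0)) rfl s
  simp only [RE.eval, IE.eval, hβ] at t1
  set s1 := s.setR 1 (((1 : ℕ) : ℝ) / β) with hs1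
  have t2 := Tri.assignR (b := b) (L := 60) (by norm_num) 2 (by norm_num)
    (.div (.nat (.lit 1)) (.add (.nat (.lit 1)) (.reg 1))) rfl s1
  set s2 := s1.setR 2 (RE.eval s1 (.div (.nat (.lit 1)) (.add (.nat (.lit 1)) (.reg 1)))) with hs2
  have t3 := Tri.assignR (b := b) (L := 60) (by norm_num) 3 (by norm_num)
    (.sqrt (.reg 2)) rfl s2
  set s3 := s2.setR 3 (RE.eval s2 (.sqrt (.reg 2))) with hs3
  have t4 := Tri.assignR (b := b) (L := 60) (by norm_num) 4 (by norm_num)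
    (.div (.nat (.lit 1)) (.mul (.nat (.lit 2)) (.mul (.reg 0) (.reg 0)))) rfl s3
  refine ⟨_, (t1.seq (t2.seq (t3.seq t4))).mono (by norm_num [RE.cost, IE.cost]), ?_, ?_, ?_, ?_,
    rfl, rfl, rfl⟩ <;> simp [hs3, hs2, hs1, RE.eval, IE.eval, hβ]

theorem Log.slot_emptyLog_le (ev : ℕ → ℕ) (ex : ℕ → ℝ) (u i : ℕ) :
    (emptyLog.pushes ev ex u).slot i ≤ u := by
  have := emptyLog.slot_pushes_le (fun _ => le_rfl) ev ex u i
  rwa [Log.pushes_cnt, emptyLog, Nat.zero_add] at this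

theorem Tri.coinProg (c : ℕ) {s : Store} {n d α s0 : ℕ} {β : ℝ}
    {ev : ℕ → ℕ} {ex : ℕ → ℝ} (hn : s.idx 0 = n) (hd : s.idx 1 = d) (hα : s.idx 3 = α)
    (hs : s.idx 4 = s0) (hβ : s.val 0 = β) (hi : ∀ a, s.idxTab 0 a 0 = ev a)
    (hx : ∀ a, s.valTab 1 a 0 = ex a) (h1 : ∀ a, s.idxTab 1 a 0 = 0)
    (h10 : ∀ a, s.valTab 10 a 0 = 0) (h13 : ∀ a, s.valTab 13 a 0 = 0) :
    ∃ s', Tri true 60 (coinProg c) s (1000 * ((c + 1) * (Nat.clog 2 (n + 1) + 1)) +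
        1000 * ((sketchDim n α c + 1) * (s0 + 1))) s' ∧
      s'.idx 1 = d ∧ s'.idx 3 = α ∧ s'.idx 5 = s0 + 1 ∧ s'.idx 6 = sketchDim n α c ∧
      s'.idx 8 = 0 ∧ s'.idx 9 = sketchDim n α c + α ∧
      s'.val 1 = 1 / β ∧ s'.val 2 = 1 / (1 + 1 / β) ∧
      s'.val 3 = Real.sqrt (1 / (1 + 1 / β)) ∧ s'.val 4 = 1 / (2 * (β * β)) ∧
      (∀ a, s'.idxTab 0 a 0 = ev a) ∧ (∀ a, s'.valTab 1 a 0 = ex a) ∧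
      s'.valTab 0 = s.valTab 0 ∧ s'.idxTab 2 = s.idxTab 2 ∧ s'.idxTab 3 = s.idxTab 3 ∧
      Rep (s'.valTab 4) (signMatrix (coinMatrix (sketchDim n α c) (s0 + 1) s.coins)) ∧
      (∀ a, s'.idxTab 1 a 0 = (emptyLog.pushes ev ex s0).slot a) ∧
      (∀ a, s'.valTab 10 a 0 = (emptyLog.pushes ev ex s0).cur a) ∧
      ∀ a, s'.valTab 13 a 0 = (emptyLog.pushes ev ex s0).cur a := by
  have t1 := Tri.assignI (b := true) (L := 60) (by norm_num) 5 (by norm_num)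
    (.add (.reg 4) (.lit 1)) rfl s
  simp only [IE.eval, hs] at t1
  obtain ⟨s2, t2, b2, c2, d2, e2, f2, g2⟩ := Tri.sketchSize (b := true) c (s.setI 5 (s0 + 1))
    (n := n) (α := α) (by simpa using hn) (by simpa using hα)
  have t3 := Tri.assignI (b := true) (L := 60) (by norm_num) 9 (by norm_num)
    (.add (.reg 6) (.reg 3)) rfl s2
  simp only [IE.eval, b2, c2 3 (by norm_num) (by norm_num)] at t3
  have t4 := Tri.assignI (b := true) (L := 60) (by norm_num) 8 (by norm_num)
    (.lit 0) rfl (s2.setI 9 (Nat.clog 2 (n + 1) * (c * α) + (s.setI 5 (s0 + 1)).idx 3))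
  simp only [IE.eval] at t4
  set s4 := (s2.setI 9 (Nat.clog 2 (n + 1) * (c * α) + (s.setI 5 (s0 + 1)).idx 3)).setI 8 0 with hs4
  have i4 : ∀ a, a < 14 → a ≠ 5 → a ≠ 6 → a ≠ 8 → a ≠ 9 → s4.idx a = s.idx a := by
    intro a h1 h2 h3 h4 h5
    simp [hs4, h4, h5, c2 a h3 (Or.inl h1), h2]
  obtain ⟨s5, t5, b5, c5, d5, e5, f5⟩ := Tri.drawSigns s4 (m := sketchDim n α c) (N := s0 + 1)
    (by simpa [hs4, sketchDim] using b2) (by simp [hs4, c2 5])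
  obtain ⟨s6, t6, a6, b6, c6, d6, e6, f6, g6⟩ := Tri.setScalars (b := true) s5 (β := β)
    (by rw [d5]; simpa [hs4, d2] using hβ)
  obtain ⟨s7, t7, a7, b7, c7, d7, e7, f7, g7⟩ := Tri.scatter (b := true) (s := s6) (u := s0)
    (i := ev) (x := ex) (by rw [e6, c5 4 (by norm_num), i4 4] <;> first | exact hs | norm_num)
    (by rw [f6, e5]; simpa [hs4, e2] using hi) (by rw [g6, f5 1 (by norm_num)]; simpa [hs4, f2] using hx)
    (by rw [f6, e5]; simpa [hs4, e2] using h1)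
    (by rw [g6, f5 10 (by norm_num)]; simpa [hs4, f2] using h10)
    (by rw [g6, f5 13 (by norm_num)]; simpa [hs4, f2] using h13)
  have i7 : ∀ a, a < 10 → s7.idx a = s4.idx a := by
    intro a ha
    rw [a7 a (by omega), e6, c5 a (by omega)]
  refine ⟨s7, (t1.seq <| t2.seq <| t3.seq <| t4.seq <| t5.seq <| t6.seq t7).mono ?_, ?_, ?_, ?_,
    ?_, ?_, ?_, ?_, ?_, ?_, ?_, ?_, ?_, ?_, ?_, ?_, ?_, e7, f7, g7⟩
  · simp only [IE.cost]
    push_cast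
    have h1 : (0 : ℝ) ≤ Nat.clog 2 (n + 1) := Nat.cast_nonneg _
    have h2 : (0 : ℝ) ≤ c := Nat.cast_nonneg _
    have h3 : (0 : ℝ) ≤ s0 := Nat.cast_nonneg _
    have h4 : (0 : ℝ) ≤ sketchDim n α c := Nat.cast_nonneg _
    have h5 := mul_nonneg h3 h4
    have h6 := mul_nonneg h1 h2
    nlinarith
  · rw [i7 1 (by norm_num), i4 1] <;> first | exact hd | norm_num
  · rw [i7 3 (by norm_num), i4 3] <;> first | exact hα | norm_num
  · rw [i7 5 (by norm_num)]; simp [hs4, c2 5]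
  · rw [i7 6 (by norm_num)]; simpa [hs4, sketchDim] using b2
  · rw [i7 8 (by norm_num)]; simp [hs4]
  · rw [i7 9 (by norm_num)]; simp [hs4, hα, sketchDim]
  · rw [b7, a6]
  · rw [b7, b6]
  · rw [b7, c6]
  · rw [b7, d6]
  · rw [c7 0 (by norm_num), f6, e5]; simpa [hs4, e2] using hi
  · rw [d7 1 (by norm_num) (by norm_num), g6, f5 1 (by norm_num)]; simpa [hs4, f2] using hx
  · rw [d7 0 (by norm_num) (by norm_num), g6, f5 0 (by norm_num)]; simp [hs4, f2]
  · rw [c7 2 (by norm_num), f6, e5]; simp [hs4, e2]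
  · rw [c7 3 (by norm_num), f6, e5]; simp [hs4, e2]
  · rw [d7 4 (by norm_num) (by norm_num), g6]
    have : s4.coins = s.coins := by simp [hs4, g2]
    rwa [this] at b5

variable {ω C : ℝ} {P : Prog}

theorem Tri.initProg (hω : 2 ≤ ω) (hC : 0 ≤ C) (hP : IsMulProg ω C P) {s : Store}
    {n d α s0 : ℕ} {β : ℝ} {ev : ℕ → ℕ} {ex : ℕ → ℝ} (hn : s.idx 0 = n) (hd : s.idx 1 = d)
    (hα : s.idx 3 = α) (hs : s.idx 4 = s0) (hβ : s.val 0 = β)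
    (hi : ∀ a, s.idxTab 0 a 0 = ev a) (hx : ∀ a, s.valTab 1 a 0 = ex a)
    (h1 : ∀ a, s.idxTab 1 a 0 = 0) (h2 : ∀ a, s.idxTab 2 a 0 = 0) (h3 : ∀ a, s.idxTab 3 a 0 = 0)
    (h10 : ∀ a, s.valTab 10 a 0 = 0) (h13 : ∀ a, s.valTab 13 a 0 = 0)
    (hB : (initGram d s0 (s.valTab 0) ev ex).PosDef) (hd1 : 1 ≤ d) (hαd : α ≤ d) (hdn : d ≤ n)
    {c : ℕ} (hc : 1 ≤ c) :
    ∃ τ t s', Exec (initProg P c) s τ t ∧ (t : ℝ) ≤ 2000000 * (C + 100000) * c *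
        ((Nat.clog 2 (n + 1) : ℕ) * ((s0 + 1 + d) * (d : ℝ) ^ (ω - 1))) ∧ Sim false 60 τ s' ∧
      (mkSetup n d s0 α c β (s.valTab 0) ev ex s.coins).Holds (startLog s0 ev ex)
        (startLog s0 ev ex) s' := by
  have hl : Nat.log 2 d + 1 ≤ Nat.clog 2 (n + 1) := by
    rw [Nat.succ_le_iff, Nat.lt_clog_iff_pow_lt (by norm_num)]
    exact (Nat.pow_log_le_self 2 (by omega)).trans_lt (by omega)
  obtain ⟨s1, t1, a1, a2, a3, a4, a5, a6, a7, a8, a9, a10, a11, a12, a13, a14, a15, a16, a17, a18,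
    a19⟩ := Tri.coinProg c hn hd hα hs hβ hi hx h1 h10 h13
  obtain ⟨s2, t2, b1, b2, b3, b4, b5, b6, b7⟩ := Tri.initMatrices hω hC hP (m := sketchDim n α c)
    a1 a2 a3 a4 a6 a11 a12 a13 a16 hB hd1 hαd hc (l := Nat.clog 2 (n + 1))
    (by
      rw [sketchDim, mul_left_comm]
      gcongr) hl
  obtain ⟨τ1, u1, x1, y1, z1⟩ := t1.forget s (Sim.refl _ _ _)
  obtain ⟨τ2, u2, x2, y2, z2⟩ := t2 τ1 z1
  refine ⟨τ2, u1 + u2, s2, .seq x1 x2, ?_, z2, ?_⟩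
  · have e1 : (1 : ℝ) ≤ d := by exact_mod_cast hd1
    have e2 : (1 : ℝ) ≤ c := by exact_mod_cast hc
    have e3 : (1 : ℝ) ≤ Nat.clog 2 (n + 1) := by exact_mod_cast (by omega)
    have e4 : (0 : ℝ) ≤ s0 := Nat.cast_nonneg _
    have e5 : (α : ℝ) ≤ d := by exact_mod_cast hαd
    have hp2 : (d : ℝ) ≤ (d : ℝ) ^ (ω - 1) := by
      nth_rw 1 [← Real.rpow_one (d : ℝ)]
      exact Real.rpow_le_rpow_of_exponent_le e1 (by linarith)
    set l : ℝ := ((Nat.clog 2 (n + 1) : ℕ) : ℝ) with hl'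
    set p := (d : ℝ) ^ (ω - 1) with hp
    set c' : ℝ := (c : ℝ) with hc'
    have hm : (sketchDim n α c : ℝ) = l * (c' * α) := by rw [sketchDim]; push_cast; rfl
    set X := c' * (l * ((s0 + 1 + d) * p)) with hX
    have q1 : (c' + 1) * (l + 1) ≤ 4 * X := by
      calc (c' + 1) * (l + 1) ≤ (c' + c') * (l + l) := by gcongr
        _ = 4 * (c' * (l * (1 * 1))) := by ring
        _ ≤ 4 * X := by rw [hX]; gcongr <;> linarith
    have q2 : (sketchDim n α c + 1 : ℝ) * (s0 + 1) ≤ 2 * X := by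
      have h1 : (1 : ℝ) ≤ l * (c' * p) := by
        calc (1 : ℝ) = 1 * (1 * 1) := by norm_num
          _ ≤ l * (c' * p) := by gcongr; linarith
      calc (sketchDim n α c + 1 : ℝ) * (s0 + 1) ≤ (l * (c' * p) + l * (c' * p)) * (s0 + 1 + d) := by
            rw [hm]
            gcongr <;> linarith
        _ = 2 * X := by rw [hX]; ring
    have hX0 : 0 ≤ X := by positivity
    have q3 : 100000 * X ≤ (C + 100000) * X := by gcongr; linarith
    have q4 : 2000000 * (C + 100000) * c' * (l * ((s0 + 1 + d) * p)) =
      2000000 * ((C + 100000) * X) := by rw [hX]; ring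
    have q5 : 1000000 * (C + 100000) * c' * (l * ((s0 + 1 + d) * p)) =
      1000000 * ((C + 100000) * X) := by rw [hX]; ring
    rw [q4]
    rw [q5] at y2
    push_cast
    linarith
  · have hF : (mkSetup n d s0 α c β (s.valTab 0) ev ex s.coins).F (startLog s0 ev ex) = 0 := by
      ext e j; simp [Setup.F, startLog]
    have hPF : (mkSetup n d s0 α c β (s.valTab 0) ev ex s.coins).PF (startLog s0 ev ex) = 0 := by
      ext e j; simp [Setup.PF, startLog]
    constructor
    · rw [b1.idx]; exact a1
    · rw [b1.idx]; exact a2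
    · rw [b1.idx]; exact a4
    · rw [b1.idx]; exact a5
    · rw [b1.idx]; exact a6
    · rw [b1.val 1 rfl]; exact a7
    · rw [b1.val 2 rfl]; exact a8
    · rw [b1.val 3 rfl]; exact a9
    · rw [b1.val 4 rfl]; exact a10
    · intro i
      rw [b1.idxTab, a17]
      exact (min_eq_left (Log.slot_emptyLog_le ev ex s0 i)).symm
    · intro e
      rw [b1.idxTab, a14]
      exact h2 e
    · intro e
      rw [b1.idxTab, a15]
      exact h3 e
    · rw [b1.valTab 0 rfl]; exact a13
    · rw [b1.valTab 4 rfl]; exact a16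
    · exact b2
    · intro l j
      induction l using Fin.addCases with
      | left a => rw [Setup.QP_castAdd]; exact b4 a j
      | right e => rw [Setup.QP_natAdd, hPF]; exact b5 e j
    · exact b3
    · intro i
      rw [b1.valTab 10 rfl]; exact a18 i
    · rw [hF]; exact b6
    · rw [hF, Matrix.transpose_zero, Matrix.mul_zero]; exact b7
    · intro i
      rw [b1.valTab 13 rfl]; exact a19 i

end InverseMaintenance

namespace InverseMaintenance

open RealRAM Matrix

/-! ### The record of the changes of a sequence of weights -/

section Entries

variable {n : ℕ} (S : Finset (Fin n)) (v : Fin n → ℝ)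

/-- The list of indices presented by `loadEntries`. -/
def entryIdx (j : ℕ) : ℕ := ((S.sort (· ≤ ·))[j]?).elim 0 (fun i => (i : ℕ))

/-- The list of values presented by `loadEntries`. -/
def entryVal (j : ℕ) : ℝ := ((S.sort (· ≤ ·))[j]?).elim 0 v

variable {S}

theorem entryIdx_eq {e : ℕ} (he : e < S.card) : ∃ h : e < (S.sort (· ≤ ·)).length,
    entryIdx S e = (S.sort (· ≤ ·))[e] ∧ entryVal S v e = v (S.sort (· ≤ ·))[e] := by
  have h : e < (S.sort (· ≤ ·)).length := by rwa [Finset.length_sort]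
  refine ⟨h, ?_, ?_⟩
  · rw [entryIdx, List.getElem?_eq_getElem h]; rfl
  · rw [entryVal, List.getElem?_eq_getElem h]; rfl

theorem entryIdx_mem {e : ℕ} (he : e < S.card) : ∃ i ∈ S, entryIdx S e = i := by
  obtain ⟨h, h1, -⟩ := entryIdx_eq (fun _ => 0) he
  exact ⟨_, (Finset.mem_sort _).1 (List.getElem_mem h), h1⟩

theorem entryIdx_injOn {e f : ℕ} (he : e < S.card) (hf : f < S.card)
    (h : entryIdx S e = entryIdx S f) : e = f := by
  obtain ⟨h1, h2, -⟩ := entryIdx_eq (fun _ => 0) he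
  obtain ⟨h3, h4, -⟩ := entryIdx_eq (fun _ => 0) hf
  rw [h2, h4] at h
  exact (List.Nodup.getElem_inj_iff (S.sort_nodup _)).1 (Fin.ext h)

end Entries

/-- The record `L` lists the changes from the weights `w0` to the weights `w1`. -/
structure Log.Tracks {n : ℕ} (L : Log) (w0 w1 : Fin n → ℝ) : Prop where
  lt : ∀ e < L.cnt, L.row e < n
  slot : ∀ i : Fin n, L.slot i ≠ 0 → L.slot i ≤ L.cnt ∧ L.row (L.slot i - 1) = i
  le : ∀ e < L.cnt, e < L.slot (L.row e)
  same : ∀ i : Fin n, L.slot i = 0 → w1 i = w0 i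
  cur : ∀ i : Fin n, L.cur i = w1 i

namespace Log.Tracks

variable {n : ℕ} {L : Log} {w0 w1 : Fin n → ℝ}

theorem push (h : L.Tracks w0 w1) (i : Fin n) (x : ℝ) :
    (L.push i x).Tracks w0 (Function.update w1 i x) := by
  constructor
  · intro e he
    simp only [Log.push, Function.update_apply] at he ⊢
    split_ifs
    · exact i.2
    · exact h.lt e (by omega)
  · intro j hj
    simp only [Log.push, Function.update_apply] at hj ⊢
    by_cases hji : (j : ℕ) = i
    · simp [hji]
    · rw [if_neg hji] at hj ⊢
      have := h.slot j hj
      rw [if_neg (by omega)]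
      exact ⟨by omega, this.2⟩
  · intro e he
    simp only [Log.push, Function.update_apply] at he ⊢
    by_cases hec : e = L.cnt
    · simp [hec]
    · rw [if_neg hec]
      split_ifs
      · omega
      · exact h.le e (by omega)
  · intro j hj
    simp only [Log.push, Function.update_apply] at hj
    split_ifs at hj with hji
    rw [Function.update_of_ne (fun h => hji (by rw [h])), h.same j hj]
  · intro j
    simp only [Log.push, Function.update_apply, Fin.val_inj]
    split_ifs
    · rfl
    · exact h.cur j

/-- Induction along the sorted list: after u pushes the weights are the new ones on the first u
listed rows and the old ones elsewhere. -/
theorem entries (h : L.Tracks w0 w1) {S : Finset (Fin n)} {v : Fin n → ℝ}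
    (hv : ∀ i ∉ S, v i = w1 i) :
    (L.pushes (entryIdx S) (entryVal S v) S.card).Tracks w0 v := by
  have key : ∀ u ≤ S.card, (L.pushes (entryIdx S) (entryVal S v) u).Tracks w0
      (fun i => if i ∈ (S.sort (· ≤ ·)).take u then v i else w1 i) := by
    intro u
    induction u with
    | zero => simpa [Log.pushes] using h
    | succ u ih =>
      intro hu
      obtain ⟨hl, h1, h2⟩ := entryIdx_eq v (show u < S.card by omega)
      have := (ih (by omega)).push (S.sort (· ≤ ·))[u] (v (S.sort (· ≤ ·))[u])
      rw [← h1, ← h2] at this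
      refine (congrArg (Log.Tracks _ w0) (funext fun i => ?_)).mpr this
      simp only [List.take_succ_eq_append_getElem hl, List.mem_append, List.mem_singleton, h2,
        Function.update_apply]
      by_cases hi : i = (S.sort (· ≤ ·))[u]
      · rw [if_pos (Or.inr hi), if_pos hi, hi]
      · simp only [hi, or_false, if_false]
  have := key _ le_rfl
  rw [List.take_of_length_le (by rw [Finset.length_sort])] at this
  convert this using 1
  funext i
  simp only [Finset.mem_sort]
  split_ifs with hi
  · rfl
  · exact hv i hi

/-- The active positions, those with the last entry of their row, correspond bijectively to the rows
with nonzero `slot`. Sums over the slots of the record thus become sums over the rows of A. -/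
theorem sum_eq (h : L.Tracks w0 w1) {α : ℕ} (hα : L.cnt ≤ α) {M : Type*} [AddCommMonoid M]
    {f : Fin n → M} {g : Fin α → M}
    (hg : ∀ e : Fin α, ((e : ℕ) < L.cnt ∧ L.slot (L.row e) < e + 2) → ∀ i : Fin n,
      L.row e = i → g e = f i)
    (hg0 : ∀ e : Fin α, ¬ ((e : ℕ) < L.cnt ∧ L.slot (L.row e) < e + 2) → g e = 0) :
    ∑ e, g e = ∑ i : Fin n, if L.slot i ≠ 0 then f i else 0 := by
  classical
  rw [← Finset.sum_filter, ← Finset.sum_filter_of_ne (p := fun e : Fin α => (e : ℕ) < L.cnt ∧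
    L.slot (L.row e) < e + 2) fun e _ he => by_contra fun h' => he (hg0 e h')]
  -- Since `slot` points at the last occurrence and counts from 1, it is at least e + 1; the test
  -- against e + 2 therefore forces equality.
  have key : ∀ e : Fin α, (e : ℕ) < L.cnt ∧ L.slot (L.row e) < e + 2 →
      L.slot (L.row e) = e + 1 := fun e he => by have := h.le e he.1; omega
  refine Finset.sum_bij (fun e he => ⟨L.row e, h.lt e (Finset.mem_filter.1 he).2.1⟩) ?_ ?_ ?_ ?_
  · intro e he
    have := key e (Finset.mem_filter.1 he).2
    simp [this]
  · intro e he f hf hef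
    have h1 := key e (Finset.mem_filter.1 he).2
    have h2 := key f (Finset.mem_filter.1 hf).2
    rw [Fin.mk.injEq] at hef
    rw [hef, h2] at h1
    exact Fin.ext (by omega)
  · intro i hi
    obtain ⟨h1, h2⟩ := h.slot i (Finset.mem_filter.1 hi).2
    have h0 := (Finset.mem_filter.1 hi).2
    refine ⟨⟨L.slot i - 1, by omega⟩, Finset.mem_filter.2 ⟨Finset.mem_univ _, ?_, ?_⟩, Fin.ext h2⟩
    · show L.slot i - 1 < L.cnt
      omega
    · show L.slot (L.row (L.slot i - 1)) < L.slot i - 1 + 2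
      rw [h2]
      omega
  · intro e he
    exact hg e (Finset.mem_filter.1 he).2 _ rfl

end Log.Tracks

/-! ### The setup of an instance -/

section

variable {n d : ℕ} (α c : ℕ) (β : ℝ) (A : Matrix (Fin n) (Fin d) ℝ) (w : Fin n → ℝ)
  (coins : ℕ → Bool)

/-- The real table that holds a matrix. -/
def tableOf (i j : ℕ) : ℝ := if h : i < n ∧ j < d then A ⟨i, h.1⟩ ⟨j, h.2⟩ else 0

/-- The set of the nonzero coordinates. -/
def support : Finset (Fin n) := Finset.univ.filter fun i => w i ≠ 0

abbrev rows : Matrix (Fin ((support w).card + 1)) (Fin d) ℝ :=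
  supportMatrix d (support w).card (tableOf A) (entryIdx (support w))

abbrev rowWeights : Fin ((support w).card + 1) → ℝ :=
  supportWeight (support w).card (entryVal (support w) w)

def entryLog : Log :=
  emptyLog.pushes (entryIdx (support w)) (entryVal (support w) w) (support w).card

def instSetup : Setup ((support w).card + 1) d (sketchDim n α c) α :=
  mkSetup n d (support w).card α c β (tableOf A) (entryIdx (support w)) (entryVal (support w) w) coins

def posOf (i : ℕ) : Fin ((support w).card + 1) :=
  ⟨min ((entryLog w).slot i) (support w).card, by omega⟩

theorem entryLog_cnt : (entryLog w).cnt = (support w).card := by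
  rw [entryLog, Log.pushes_cnt, emptyLog, Nat.zero_add]

theorem entryLog_tracks : (entryLog w).Tracks (0 : Fin n → ℝ) w :=
  Log.Tracks.entries (w1 := 0) ⟨by simp [emptyLog], by simp [emptyLog], by simp [emptyLog],
    by simp, by simp [emptyLog]⟩ (by simp [support])

theorem entryLog_row {e : ℕ} (he : e < (support w).card) :
    (entryLog w).row e = entryIdx (support w) e := by
  have := emptyLog.pushes_row_add (entryIdx (support w)) (entryVal (support w) w) _ he
  rwa [emptyLog, Nat.zero_add] at this

theorem coe_posOf (i : ℕ) : (posOf w i : ℕ) = (entryLog w).slot i :=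
  min_eq_left (Log.slot_emptyLog_le _ _ _ _)

variable {w}

theorem posOf_pos (i : Fin n) : 0 < (posOf w i : ℕ) ↔ w i ≠ 0 := by
  have ht := entryLog_tracks w
  rw [coe_posOf, pos_iff_ne_zero]
  refine ⟨fun h => ?_, mt (ht.same i)⟩
  obtain ⟨h1, h2⟩ := ht.slot i h
  rw [entryLog_cnt] at h1
  rw [entryLog_row w (by omega)] at h2
  obtain ⟨j, hj, hji⟩ := entryIdx_mem (S := support w) (e := (entryLog w).slot i - 1) (by omega)
  rw [hji, Fin.val_inj] at h2
  rw [← h2]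
  exact (Finset.mem_filter.1 hj).2

theorem entryIdx_posOf {i : Fin n} (hi : w i ≠ 0) : entryIdx (support w) (posOf w i - 1) = i := by
  have h0 := (posOf_pos i).2 hi
  rw [coe_posOf] at h0 ⊢
  obtain ⟨h1, h2⟩ := (entryLog_tracks w).slot i h0.ne'
  rw [entryLog_cnt] at h1
  rwa [entryLog_row w (by omega)] at h2

theorem rows_posOf {i : Fin n} (hi : w i ≠ 0) (j : Fin d) : rows A w (posOf w i) j = A i j := by
  simp [rows, supportMatrix, -Fin.val_pos_iff, (posOf_pos i).2 hi, entryIdx_posOf hi, tableOf]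

theorem weights_posOf (i : Fin n) : rowWeights w (posOf w i) = w i := by
  rw [rowWeights, supportWeight]
  by_cases hi : w i = 0
  · rw [if_neg (by simpa [-Fin.val_pos_iff] using (posOf_pos (w := w) i).not.2 (by simpa using hi)), hi]
  · have h0 := (posOf_pos i).2 hi
    have h2 := (posOf w i).2
    obtain ⟨hl, h3, h4⟩ := entryIdx_eq (S := support w) w (e := posOf w i - 1) (by omega)
    rw [entryIdx_posOf hi] at h3
    rw [if_pos h0, h4, ← Fin.ext h3]

/-- Sums over the rows with nonzero weight. -/
theorem sum_posOf {M : Type*} [AddCommMonoid M] {f : Fin ((support w).card + 1) → M}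
    (h0 : ∀ a : Fin ((support w).card + 1), ¬ 0 < (a : ℕ) → f a = 0) :
    ∑ a, f a = ∑ i : Fin n, if w i ≠ 0 then f (posOf w i) else 0 := by
  have ht := entryLog_tracks w
  rw [← Finset.sum_filter]
  symm
  refine Finset.sum_of_injOn (fun i : Fin n => posOf w i) ?_ (fun _ _ => Finset.mem_coe.2 (Finset.mem_univ _)) ?_ (fun _ _ => rfl)
  · intro i hi j hj hij
    have h1 := entryIdx_posOf (Finset.mem_filter.1 hi).2
    have h2 := entryIdx_posOf (Finset.mem_filter.1 hj).2
    dsimp only at hij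
    rw [hij, h2] at h1
    exact Fin.ext h1.symm
  · intro a _ ha
    refine h0 a fun hp => ha ?_
    have ha2 := a.2
    obtain ⟨i, hi, hia⟩ := entryIdx_mem (S := support w) (e := a - 1) (by omega)
    refine ⟨i, by simpa [support] using hi, ?_⟩
    have hi0 : w i ≠ 0 := (Finset.mem_filter.1 hi).2
    have h1 := entryIdx_posOf hi0
    have h2 := (posOf_pos i).2 hi0
    have h3 := (posOf w i).2
    have := entryIdx_injOn (S := support w) (by omega) (by omega) (h1.trans hia.symm)
    exact Fin.ext (show (posOf w i : ℕ) = a by omega)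

theorem gram_apply {ν : Type*} [Fintype ν] [DecidableEq ν] (B : Matrix ν (Fin d) ℝ) (u : ν → ℝ)
    (j k : Fin d) : (Bᵀ * diagonal u * B) j k = ∑ a, u a * (B a j * B a k) := by
  rw [mul_apply]
  refine Finset.sum_congr rfl fun a _ => ?_
  rw [mul_diagonal, transpose_apply]
  ring

/-- The Gram matrix of the rows with nonzero weight, with other weights. -/
theorem gram_rows {u : Fin ((support w).card + 1) → ℝ} {u' : Fin n → ℝ}
    (h : ∀ i, w i ≠ 0 → u (posOf w i) = u' i) (h0 : ∀ i, w i = 0 → u' i = 0) :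
    (rows A w)ᵀ * diagonal u * rows A w = weightedGram A u' := by
  ext j k
  rw [weightedGram, gram_apply, gram_apply, sum_posOf]
  · refine Finset.sum_congr rfl fun i _ => ?_
    split_ifs with hi
    · rw [h i hi, rows_posOf A hi, rows_posOf A hi]
    · rw [h0 i (not_not.1 hi), zero_mul]
  · intro a ha
    simp only [rows, supportMatrix, of_apply, if_neg ha, mul_zero]

theorem initGram_eq : initGram d (support w).card (tableOf A) (entryIdx (support w))
    (entryVal (support w) w) = weightedGram A w :=
  gram_rows A (fun i _ => weights_posOf i) fun _ h => h

end

end InverseMaintenance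

namespace InverseMaintenance

open RealRAM Matrix

/-! ### Correctness of the queries of one round -/

section

variable {d α : ℕ} {D : QueryData d α} {B : Matrix (Fin d) (Fin d) ℝ}

theorem mul_eq_diagonal_mulVec {κ : Type*} [Fintype κ] [DecidableEq κ] (g z : κ → ℝ) :
    g * z = diagonal g *ᵥ z := by
  funext e
  rw [mulVec_diagonal, Pi.mul_apply]

theorem QueryData.tv_eq (hX : D.γ • (D.X * D.F * D.G) = D.F * B) (x : Fin d → ℝ) :
    D.tv x = (D.F * B) *ᵥ x := by
  rw [← hX, tv, smul_mulVec, mulVec_mulVec, mulVec_mulVec, Matrix.mul_assoc]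

theorem QueryData.iter_eq (hX : D.γ • (D.X * D.F * D.G) = D.F * B) (y : Fin α → ℝ) (t : ℕ) :
    D.iter y t = richardson D.Y
      (1 + diagonal D.g * D.F * B * (diagonal D.g * D.F)ᵀ) t *ᵥ y := by
  induction t with
  | zero => simp [iter, richardson]
  | succ t ih =>
    have key : ∀ N S : Matrix (Fin α) (Fin α) ℝ, (D.Y * (1 - (1 + N) * S)) *ᵥ y =
        D.Y *ᵥ (y - S *ᵥ y - N *ᵥ (S *ᵥ y)) := fun N S => by
      rw [← mulVec_mulVec, sub_mulVec, one_mulVec, ← mulVec_mulVec, add_mulVec, one_mulVec,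
        sub_add_eq_sub_sub]
    rw [iter, richardson, add_mulVec, key, tv_eq hX, ih, mul_eq_diagonal_mulVec,
      mul_eq_diagonal_mulVec]
    simp only [mulVec_mulVec, transpose_mul, diagonal_transpose, Matrix.mul_assoc]

/-- The last stage of a query applies B to x = v - Uᵀ S U B v, where B is the exact inverse of B₂ in
the application and S the operator of the iteration. Hence the answer is linear in v. -/
theorem QueryData.answer_eq (hX : D.γ • (D.X * D.F * D.G) = D.F * B)
    (hG : B = D.γ • (D.G * (1 - D.Fᵀ * diagonal D.δ * (D.F * B)))) (T : ℕ) (v : Fin d → ℝ) :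
    D.answer T v = (B - B * (diagonal D.g * D.F)ᵀ * richardson D.Y
      (1 + diagonal D.g * D.F * B * (diagonal D.g * D.F)ᵀ) T * (diagonal D.g * D.F) * B) *ᵥ v := by
  have h : ∀ x, D.γ • (D.G *ᵥ (x - D.Fᵀ *ᵥ (D.δ * D.tv x))) = B *ᵥ x := by
    intro x
    rw [tv_eq hX, mul_eq_diagonal_mulVec]
    conv_rhs => rw [hG, smul_mulVec, ← mulVec_mulVec, sub_mulVec, one_mulVec]
    simp only [mulVec_mulVec, Matrix.mul_assoc]
  rw [answer, h, iter_eq hX, tv_eq hX, mul_eq_diagonal_mulVec, mul_eq_diagonal_mulVec, mulVec_sub,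
    sub_mulVec]
  simp only [mulVec_mulVec, transpose_mul, diagonal_transpose, Matrix.mul_assoc]

end

section

variable {n d α c : ℕ} {β : ℝ} {A : Matrix (Fin n) (Fin d) ℝ} {w w1 : Fin n → ℝ}
  {coins : ℕ → Bool} {L : Log}

theorem weightedGram_mono {u u' : Fin n → ℝ} (h : ∀ i, u i ≤ u' i) :
    weightedGram A u ≤ weightedGram A u' := by
  have := conj_le (M := diagonal u) (N := diagonal u') (by
    rw [le_iff, diagonal_sub]
    exact PosSemidef.diagonal fun i => sub_nonneg.2 (h i)) Aᵀ
  rwa [transpose_transpose] at this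

theorem weightedGram_apply (u : Fin n → ℝ) (j k : Fin d) :
    weightedGram A u j k = ∑ i, u i * (A i j * A i k) := gram_apply A u j k

/-- The weights of the rows that had nonzero weight at first. -/
def midRows (β : ℝ) (w : Fin n → ℝ) (L : Log) : Fin ((support w).card + 1) → ℝ :=
  supportWeight _ fun x => L.cur (entryIdx (support w) x) + 1 / β * entryVal (support w) w x

/-- The matrix B₂ between B₀ and H. The summand w/β in the weights keeps it above β⁻¹B₀ even when
old weights drop to zero. -/
def midGram (β : ℝ) (A : Matrix (Fin n) (Fin d) ℝ) (w : Fin n → ℝ) (L : Log) :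
    Matrix (Fin d) (Fin d) ℝ :=
  (rows A w)ᵀ * diagonal (midRows β w L) * rows A w

/-- The factor by which the rows with zero initial weight enter the inverse. -/
def lowRank (α c : ℕ) (β : ℝ) (A : Matrix (Fin n) (Fin d) ℝ) (w : Fin n → ℝ) (L : Log) :
    Matrix (Fin α) (Fin d) ℝ :=
  -- The coins are fixed arbitrarily because neither g nor F depends on them. So the matrix to be
  -- sketched is determined before the coins are flipped.
  diagonal ((instSetup α c β A w fun _ => false).g L) * (instSetup α c β A w fun _ => false).F L

/-- The matrix that is sketched. -/
def sketched (α c : ℕ) (β : ℝ) (A : Matrix (Fin n) (Fin d) ℝ) (w : Fin n → ℝ) (L : Log) :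
    Matrix (Fin ((support w).card + 1)) (Fin α) ℝ :=
  diagonal (fun a => Real.sqrt (midRows β w L a)) * rows A w * (midGram β A w L)⁻¹ *
    (lowRank α c β A w L)ᵀ

theorem instSetup_w0 (i : Fin n) : (instSetup α c β A w coins).w0 i = w i :=
  (entryLog_tracks w).cur i

theorem midRows_posOf (h : L.Tracks w w1) {i : Fin n} (hi : w i ≠ 0) :
    midRows β w L (posOf w i) = w1 i + 1 / β * w i := by
  have h1 := weights_posOf (w := w) i
  rw [rowWeights, supportWeight, if_pos ((posOf_pos i).2 hi)] at h1
  rw [midRows, supportWeight, if_pos ((posOf_pos i).2 hi), h1, entryIdx_posOf hi, h.cur]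

theorem midGram_eq (h : L.Tracks w w1) : midGram β A w L =
    weightedGram A fun i => if w i ≠ 0 then w1 i + 1 / β * w i else 0 :=
  gram_rows A (fun i hi => by rw [if_pos hi, midRows_posOf h hi])
    fun i hi => by rw [if_neg (not_not.2 hi)]

theorem Setup.F_of_row {e : Fin α} (he : (e : ℕ) < L.cnt) {i : Fin n}
    (hi : L.row e = i) (j : Fin d) : (instSetup α c β A w coins).F L e j = A i j := by
  rw [Setup.F, of_apply, if_pos he, hi]
  simp [instSetup, mkSetup, tableOf]

theorem Setup.old_iff {e : Fin α} (he : (e : ℕ) < L.cnt ∧ L.slot (L.row e) < e + 2) {i : Fin n}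
    (hi : L.row e = i) : (instSetup α c β A w coins).old L e ↔ w i ≠ 0 := by
  rw [Setup.old, and_iff_right he, hi]
  exact posOf_pos i

theorem Setup.new_iff {e : Fin α} (he : (e : ℕ) < L.cnt ∧ L.slot (L.row e) < e + 2) {i : Fin n}
    (hi : L.row e = i) : (instSetup α c β A w coins).new L e ↔ w i = 0 := by
  rw [Setup.new, and_iff_right he, hi]
  exact (posOf_pos i).not.trans not_not

theorem one_add_pos (hβ : 0 < β) : 0 < 1 + 1 / β := by positivity

/-- For an old row, w1 + θw = (1 + θ) w + (w1 - w), and the second part vanishes unless the row is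
in the record. -/
theorem midGram_lowRank (h : L.Tracks w w1) (hα : L.cnt ≤ α) :
    midGram β A w L = (instSetup α c β A w coins).γ⁻¹ • weightedGram A w +
      ((instSetup α c β A w coins).F L)ᵀ * diagonal ((instSetup α c β A w coins).δ L) *
      (instSetup α c β A w coins).F L := by
  have hγ : (instSetup α c β A w coins).γ⁻¹ = 1 + 1 / β := by
    show (1 / (1 + 1 / β))⁻¹ = _
    rw [one_div, inv_inv]
  ext j k
  rw [midGram_eq h, hγ, Matrix.add_apply, Matrix.smul_apply, gram_apply,
    h.sum_eq hα (f := fun i => if w i ≠ 0 then (w1 i - w i) * (A i j * A i k) else 0),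
    weightedGram_apply, weightedGram_apply, smul_eq_mul, Finset.mul_sum, ← Finset.sum_add_distrib]
  · refine Finset.sum_congr rfl fun i _ => ?_
    by_cases hi : w i = 0
    · simp [hi]
    · by_cases hs : L.slot i = 0
      · simp only [ne_eq, hi, not_false_eq_true, if_true, hs, not_true_eq_false, if_false, h.same i hs]
        ring
      · simp only [ne_eq, hi, not_false_eq_true, if_true, hs]
        ring
  · intro e he i hi
    rw [Setup.δ, Setup.F_of_row he.1 hi, Setup.F_of_row he.1 hi]
    simp only [Setup.old_iff he hi, hi, h.cur, instSetup_w0]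
    split_ifs <;> simp
  · intro e he
    rw [Setup.δ, if_neg (fun h' => he h'.1), zero_mul]

/-- Compare weights row by row: an old row already has w1 + θw, a recorded new row gets w1 from g²,
and any other row has weight zero on both sides. -/
theorem midGram_add (h : L.Tracks w w1) (hα : L.cnt ≤ α) (hw1 : ∀ i, 0 ≤ w1 i) :
    midGram β A w L + (lowRank α c β A w L)ᵀ * lowRank α c β A w L =
      weightedGram A w1 + β⁻¹ • weightedGram A w := by
  ext j k
  have e1 : (lowRank α c β A w L)ᵀ * lowRank α c β A w L =
      ((instSetup α c β A w fun _ => false).F L)ᵀ *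
      diagonal (fun e => (instSetup α c β A w fun _ => false).g L e *
        (instSetup α c β A w fun _ => false).g L e) * (instSetup α c β A w fun _ => false).F L := by
    rw [lowRank, transpose_mul, diagonal_transpose, ← diagonal_mul_diagonal]
    simp only [Matrix.mul_assoc]
  rw [e1, midGram_eq h, Matrix.add_apply, Matrix.add_apply, Matrix.smul_apply, gram_apply,
    h.sum_eq hα (f := fun i => if w i = 0 then w1 i * (A i j * A i k) else 0),
    weightedGram_apply, weightedGram_apply, weightedGram_apply, smul_eq_mul, Finset.mul_sum,
    ← Finset.sum_add_distrib, ← Finset.sum_add_distrib]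
  · refine Finset.sum_congr rfl fun i _ => ?_
    by_cases hi : w i = 0
    · by_cases hs : L.slot i = 0
      · simp [hi, hs, h.same i hs]
      · simp [hi, hs]
    · simp [hi]
      ring
  · intro e he i hi
    rw [Setup.g, Setup.F_of_row he.1 hi, Setup.F_of_row he.1 hi]
    simp only [Setup.new_iff he hi, hi, h.cur]
    split_ifs
    · rw [Real.mul_self_sqrt (hw1 i)]
    · simp
  · intro e he
    rw [Setup.g, if_neg (fun h' => he h'.1), zero_mul, zero_mul]

theorem le_midGram (h : L.Tracks w w1) (hw1 : ∀ i, 0 ≤ w1 i) :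
    β⁻¹ • weightedGram A w ≤ midGram β A w L := by
  have : β⁻¹ • weightedGram A w = weightedGram A (β⁻¹ • w) := by
    rw [weightedGram, weightedGram, diagonal_smul, Matrix.mul_smul, Matrix.smul_mul]
  rw [this, midGram_eq h]
  refine weightedGram_mono fun i => ?_
  rw [Pi.smul_apply, smul_eq_mul, one_div]
  split_ifs with hi
  · linarith [hw1 i]
  · rw [not_not.1 hi, mul_zero]

theorem midGram_posDef (hβ : 0 < β) (h : L.Tracks w w1) (hw1 : ∀ i, 0 ≤ w1 i)
    (hB : (weightedGram A w).PosDef) : (midGram β A w L).PosDef :=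
  posDef_of_le (hB.smul (inv_pos.2 hβ)) (le_midGram h hw1)

theorem instSetup_G : (instSetup α c β A w coins).G = (weightedGram A w)⁻¹ :=
  congrArg (·⁻¹) (initGram_eq A)

theorem instSetup_P : (instSetup α c β A w coins).P = rows A w * (weightedGram A w)⁻¹ :=
  congrArg (rows A w * ·⁻¹) (initGram_eq A)

theorem rows_eq_F (h : L.Tracks w w1) {e : Fin α} (he : (e : ℕ) < L.cnt)
    (hp : 0 < (posOf w (L.row e) : ℕ)) (j : Fin d) :
    (instSetup α c β A w coins).F L e j = rows A w (posOf w (L.row e)) j := by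
  obtain ⟨i, hi⟩ : ∃ i : Fin n, L.row e = i := ⟨⟨_, h.lt e he⟩, rfl⟩
  rw [hi] at hp ⊢
  rw [rows_posOf A ((posOf_pos i).1 hp), Setup.F_of_row he hi]

theorem Setup.PF_eq (h : L.Tracks w w1) {e : Fin α} (hp : 0 < (posOf w (L.row e) : ℕ)) (j : Fin d) :
    (instSetup α c β A w coins).PF L e j =
      ((instSetup α c β A w coins).F L * (weightedGram A w)⁻¹) e j := by
  rw [Setup.PF, of_apply, instSetup_P, mul_apply]
  split_ifs with he
  · rw [mul_apply]
    exact Finset.sum_congr rfl fun k _ => by rw [rows_eq_F h he hp]; rfl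
  · rw [mul_apply]
    refine (Finset.sum_eq_zero fun k _ => ?_).symm
    rw [Setup.F, of_apply, if_neg he, zero_mul]

/-- If e is not an old row then f is, and the entry was taken from the transposed position of a
symmetric matrix. -/
theorem Setup.M_eq (h : L.Tracks w w1) (hB : (weightedGram A w).PosDef) {e f : Fin α}
    (hef : (instSetup α c β A w coins).old L e ∨ (instSetup α c β A w coins).old L f) :
    (instSetup α c β A w coins).M L e f = ((instSetup α c β A w coins).F L * (weightedGram A w)⁻¹ *
      ((instSetup α c β A w coins).F L)ᵀ) e f := by
  have key : ∀ e f : Fin α, 0 < (posOf w (L.row e) : ℕ) →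
      ((instSetup α c β A w coins).PF L * ((instSetup α c β A w coins).F L)ᵀ) e f =
      ((instSetup α c β A w coins).F L * (weightedGram A w)⁻¹ *
      ((instSetup α c β A w coins).F L)ᵀ) e f := by
    intro e f hp
    rw [mul_apply, mul_apply]
    exact Finset.sum_congr rfl fun k _ => by rw [Setup.PF_eq h hp]
  rw [Setup.M, of_apply]
  split_ifs with hp
  · exact key e f hp
  · rcases hef with he | hf
    · exact absurd he.2 hp
    · rw [key f e hf.2]
      refine congrFun (congrFun (?_ : ((instSetup α c β A w coins).F L * (weightedGram A w)⁻¹ *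
        ((instSetup α c β A w coins).F L)ᵀ)ᵀ = _) e) f
      rw [transpose_mul, transpose_mul, transpose_transpose, isSymm_of_posDef hB.inv,
        Matrix.mul_assoc]

/-- At most one active position belongs to a given row, so the sum has at most one nonzero term, and
ε was defined to be exactly the missing difference. At row 0 everything vanishes, since old rows
have positive position. -/
theorem sqrt_midRows (hβ : 0 < β) (h : L.Tracks w w1) (hα : L.cnt ≤ α)
    (a : Fin ((support w).card + 1)) : Real.sqrt (midRows β w L a) =
      (Real.sqrt (instSetup α c β A w coins).γ)⁻¹ * Real.sqrt (rowWeights w a) +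
      ∑ e : Fin α, if posOf w (L.row e) = a then (instSetup α c β A w coins).ε L e else 0 := by
  have hγ : (Real.sqrt (instSetup α c β A w coins).γ)⁻¹ = Real.sqrt (1 + 1 / β) := by
    show (Real.sqrt (1 / (1 + 1 / β)))⁻¹ = _
    rw [← Real.sqrt_inv, one_div, inv_inv]
  by_cases ha : 0 < (a : ℕ)
  · obtain ⟨i, hi, rfl⟩ : ∃ i : Fin n, w i ≠ 0 ∧ posOf w i = a := by
      by_contra hno
      push Not at hno
      have := sum_posOf (w := w) (f := fun b => if b = a then 1 else 0)
        (fun b hb => if_neg (by rintro rfl; exact hb ha))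
      rw [Finset.sum_ite_eq' Finset.univ a, if_pos (Finset.mem_univ _), Finset.sum_eq_zero] at this
      · exact one_ne_zero this
      · intro i _
        split_ifs with h1 h2
        · exact absurd h2 (hno i h1)
        · rfl
        · rfl
    rw [midRows_posOf h hi, weights_posOf, hγ, ← Real.sqrt_mul (one_add_pos hβ).le,
      h.sum_eq hα (f := fun i' => if i' = i then Real.sqrt (w1 i + 1 / β * w i) -
        Real.sqrt ((1 + 1 / β) * w i) else 0)]
    · rw [Finset.sum_eq_single i]
      · by_cases hs : L.slot i = 0
        · rw [if_neg (not_not.2 hs), h.same i hs, add_zero]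
          congr 1
          ring
        · rw [if_pos hs, if_pos rfl]
          ring
      · intro j _ hj
        simp [hj]
      · simp
    · intro e he j hj
      rw [hj]
      by_cases hij : j = i
      · subst hij
        rw [if_pos rfl, if_pos rfl, Setup.ε, if_pos ((Setup.old_iff he hj).2 hi), hj, h.cur,
          instSetup_w0]
        rfl
      · rw [if_neg hij]
        split_ifs with hp
        · rw [Setup.ε, if_neg]
          rw [Setup.old_iff he hj]
          intro hj0
          have h1 := entryIdx_posOf hj0
          rw [hp, entryIdx_posOf hi] at h1
          exact hij (Fin.ext h1.symm)
        · rfl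
    · intro e he
      split_ifs
      · rw [Setup.ε, if_neg (fun h' => he h'.1)]
      · rfl
  · rw [midRows, rowWeights, supportWeight, supportWeight, if_neg ha, if_neg ha, Real.sqrt_zero,
      mul_zero, zero_add, Finset.sum_eq_zero]
    intro e _
    split_ifs with he
    · rw [Setup.ε, if_neg]
      rintro ⟨-, h2⟩
      subst he
      exact ha h2
    · rfl

end

end InverseMaintenance

/-! ### Correctness of the maintained inverse -/

namespace InverseMaintenance

open RealRAM Matrix

section

variable {n d α c : ℕ} {β : ℝ} {A : Matrix (Fin n) (Fin d) ℝ} {w w1 : Fin n → ℝ}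
  {coins : ℕ → Bool} {L : Log}

theorem Setup.M_mul (h : L.Tracks w w1) (hB : (weightedGram A w).PosDef) :
    let D := instSetup α c β A w coins
    D.M L * diagonal (D.δ L) = D.F L * (weightedGram A w)⁻¹ * (D.F L)ᵀ * diagonal (D.δ L) := by
  intro D
  ext e f
  rw [mul_diagonal, mul_diagonal]
  by_cases hf : D.old L f
  · rw [Setup.M_eq h hB (.inr hf)]
  · rw [Setup.δ, if_neg hf, mul_zero, mul_zero]

theorem gamma_pos (hβ : 0 < β) : 0 < (instSetup α c β A w coins).γ :=
  one_div_pos.2 (one_add_pos hβ)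

theorem Setup.isUnit_capX (hβ : 0 < β) (h : L.Tracks w w1) (hα : L.cnt ≤ α)
    (hw1 : ∀ i, 0 ≤ w1 i) (hB : (weightedGram A w).PosDef) :
    IsUnit (capX (instSetup α c β A w coins).γ ((instSetup α c β A w coins).M L)
      ((instSetup α c β A w coins).δ L)).det :=
  InverseMaintenance.isUnit_capX (gamma_pos hβ) hB (midGram_posDef hβ h hw1 hB)
    (midGram_lowRank h hα) (Setup.M_mul h hB)

/-- The program never sees the tall matrix; by `sketchR_eq` its short computation gives the same
preconditioner as applying the sign matrix to `sketched` directly. The random event thus concerns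
one fixed column space. -/
theorem Setup.Y_eq (hβ : 0 < β) (h : L.Tracks w w1) (hα : L.cnt ≤ α)
    (hw1 : ∀ i, 0 ≤ w1 i) (hB : (weightedGram A w).PosDef) :
    (instSetup α c β A w coins).Y L = precond (sketchDim n α c)
      (signMatrix (coinMatrix (sketchDim n α c) ((support w).card + 1) coins) *
        sketched α c β A w L) := by
  set D := instSetup α c β A w coins with hD
  have hQ : D.J L = D.S * diagonal (fun a => Real.sqrt (rowWeights w a)) *
      (rows A w * (weightedGram A w)⁻¹) * (D.F L)ᵀ := by
    have : D.Q = D.S * (diagonal (fun a => Real.sqrt (rowWeights w a)) *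
      (rows A w * (initGram d (support w).card (tableOf A) (entryIdx (support w))
        (entryVal (support w) w))⁻¹)) := rfl
    rw [Setup.J, this, initGram_eq]
    simp only [Matrix.mul_assoc]
  have key := sketchR_eq (w2 := midRows β w L) (pos := fun e : Fin α => posOf w (L.row e))
    (τ := D.old L) (ε := D.ε L) D.S (gamma_pos hβ) hB (midGram_posDef hβ h hw1 hB)
    (midGram_lowRank (c := c) (coins := coins) h hα) (fun e f hef => Setup.M_eq h hB hef)
    (fun e he => if_neg he) (fun e he => if_neg he)
    (fun e he j => rows_eq_F h he.1.1 he.2 j) (sqrt_midRows hβ h hα)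
  rw [← hD, ← hQ] at key
  have e1 : (Real.sqrt D.γ • D.J L + D.W L * capT D.γ (D.M L) (D.δ L)) * diagonal (D.g L) =
      D.S * sketched α c β A w L := by
    have : Real.sqrt D.γ • D.J L + D.W L * capT D.γ (D.M L) (D.δ L) = _ := key
    rw [this, sketched, lowRank, transpose_mul, diagonal_transpose]
    simp only [Matrix.mul_assoc]
    rfl
  rw [Setup.Y, e1]
  rfl

/-- A good sketch makes its Gram matrix comparable with U B₂⁻¹ Uᵀ, so `approx_inverse` applies with
B₂ as base, and `spectralApprox_of_le` passes from H to the matrix of the round. The computed answer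
is the same matrix applied to v, by `QueryData.answer_eq`. -/
theorem query_correct (hβ : 2 < β) (h : L.Tracks w w1) (hα : L.cnt ≤ α)
    (hw : ∀ i, 0 ≤ w i) (hw1 : ∀ i, 0 ≤ w1 i) (hB : (weightedGram A w).PosDef) (hB1 : (weightedGram A w1).PosDef)
    (h1 : β⁻¹ • weightedGram A w ≤ weightedGram A w1)
    (h2 : weightedGram A w1 ≤ β • weightedGram A w) (hm : 1 ≤ sketchDim n α c)
    (hg : SketchGood (coinMatrix (sketchDim n α c) ((support w).card + 1) coins)
      (sketched α c β A w L)) {T : ℕ} (hT : (621 / 625 : ℝ) ^ T ≤ 1 / (2 * (β * β))) :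
    ∃ K : Matrix (Fin d) (Fin d) ℝ, K.IsSymm ∧ SpectralApprox 1 K (weightedGram A w1)⁻¹ ∧
      ∀ v, ((instSetup α c β A w coins).query L).answer T v = K *ᵥ v := by
  have hβ0 : 0 < β := by linarith
  have hB2 := midGram_posDef hβ0 h hw1 hB
  have hl := midGram_lowRank (c := c) (coins := coins) h hα (A := A) (β := β)
  set D := instSetup α c β A w coins with hD
  set U := lowRank α c β A w L with hU
  obtain ⟨g1, g2⟩ := hg.gram hm
  have hgr : (sketched α c β A w L)ᵀ * sketched α c β A w L = U * (midGram β A w L)⁻¹ * Uᵀ := by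
    refine gram_sqrt (fun a => ?_) hB2 rfl U
    rw [midRows, supportWeight]
    split_ifs with ha
    · have ha2 := a.2
      obtain ⟨hl, h3, h4⟩ := entryIdx_eq (S := support w) w (e := a - 1) (by omega)
      rw [h3, h4, h.cur]
      exact add_nonneg (hw1 _) (mul_nonneg (by positivity) (hw _))
    · exact le_rfl
  rw [hgr] at g1 g2
  -- Here a = 1/25 and b = 25/4, so the error factor is 1 - a/b = 621/625.
  obtain ⟨k1, k2, k3⟩ := approx_inverse hB2 U (by norm_num) (by norm_num) (by norm_num)
    (by norm_num) g1 g2 T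
  have hY : D.Y L = (1 / 25 : ℝ) • (1 + _)⁻¹ := Setup.Y_eq hβ0 h hα hw1 hB
  refine ⟨_, k1, ?_, fun v => ?_⟩
  · rw [hU, midGram_add h hα hw1, ← hU] at k2 k3
    refine spectralApprox_of_le hβ (q := (621 / 625) ^ T) ?_ (by positivity) hB1 hB h1 h2
      (le_midGram h hw1) rfl k2 ?_
    · rw [le_div_iff₀ (by positivity)] at hT
      nlinarith
    · convert k3 using 3
      norm_num
  · rw [← hY]
    refine QueryData.answer_eq (D := D.query L) ?_ ?_ T v
    · have := capX_mul (gamma_pos hβ0) hB hB2 hl (Setup.M_mul h hB)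
      rw [← instSetup_G (α := α) (c := c) (β := β) (coins := coins)] at this
      exact this
    · have := inv_eq_of_lowRank (gamma_pos hβ0) hB hB2 hl
      rw [← instSetup_G (α := α) (c := c) (β := β) (coins := coins)] at this
      exact this

end

end InverseMaintenance

namespace InverseMaintenance

open RealRAM Matrix

/-! ### Bounds for the running time and the failure probability -/

theorem clog_le_log (n d : ℕ) : ((Nat.clog 2 (n + 1) : ℕ) : ℝ) ≤ 4 * Real.log (n + d + 2) := by
  have h2 : Real.log 2 ≤ Real.log (n + d + 2) :=
    Real.log_le_log (by norm_num) (by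
      have : (0 : ℝ) ≤ n := Nat.cast_nonneg n
      have : (0 : ℝ) ≤ d := Nat.cast_nonneg d
      linarith)
  have h3 := Real.log_two_gt_d9
  rcases Nat.eq_zero_or_pos n with rfl | hn
  · simp only [zero_add, Nat.clog_one_right, Nat.cast_zero]
    rw [Nat.cast_zero, zero_add] at h2
    linarith
  · have h1 := Nat.pow_pred_clog_lt_self (b := 2) (by norm_num) (x := n + 1) (by omega)
    have hl : 1 ≤ Nat.clog 2 (n + 1) := Nat.clog_pos (by norm_num) (by omega)
    obtain ⟨l, hl'⟩ : ∃ l, Nat.clog 2 (n + 1) = l + 1 := ⟨_, (Nat.succ_pred_eq_of_pos hl).symm⟩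
    rw [hl'] at h1 ⊢
    have h4 : ((2 : ℝ) ^ l) ≤ n + d + 2 := by
      have : ((2 ^ l : ℕ) : ℝ) ≤ ((n + 1 : ℕ) : ℝ) := by exact_mod_cast h1.le
      push_cast at this
      have : (0 : ℝ) ≤ d := Nat.cast_nonneg d
      linarith
    have h5 := Real.log_le_log (by positivity) h4
    rw [Real.log_pow] at h5
    have : (0 : ℝ) ≤ l := Nat.cast_nonneg l
    push_cast
    nlinarith

/-- The number of refinement steps of a query. -/
theorem exists_steps {β : ℝ} (hβ : 2 < β) : ∃ T : ℕ, (621 / 625 : ℝ) ^ T ≤ 1 / (2 * (β * β)) ∧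
    (∀ t < T, 1 / (2 * (β * β)) < (621 / 625 : ℝ) ^ t) ∧ (T : ℝ) + 1 ≤ 475 * Real.log β := by
  have h0 : (0 : ℝ) < 1 / (2 * (β * β)) := by positivity
  have hex := exists_pow_lt_of_lt_one h0 (by norm_num : (621 / 625 : ℝ) < 1)
  have hex' : ∃ T : ℕ, (621 / 625 : ℝ) ^ T ≤ 1 / (2 * (β * β)) := hex.imp fun _ h => h.le
  classical
  refine ⟨Nat.find hex', Nat.find_spec hex', fun t ht => not_le.1 (Nat.find_min hex' ht), ?_⟩
  have h2 := Real.log_two_gt_d9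
  have hl : Real.log 2 ≤ Real.log β := Real.log_le_log (by norm_num) hβ.le
  rcases Nat.eq_zero_or_pos (Nat.find hex') with hT | hT
  · rw [hT, Nat.cast_zero]
    linarith
  · obtain ⟨T, hT'⟩ : ∃ T, Nat.find hex' = T + 1 := ⟨_, (Nat.succ_pred_eq_of_pos hT).symm⟩
    have h1 := not_le.1 (Nat.find_min hex' (m := T) (by omega))
    rw [hT']
    have h3 := Real.log_lt_log h0 h1
    rw [Real.log_pow, one_div, Real.log_inv, Real.log_mul (by norm_num) (by positivity),
      Real.log_mul (by linarith) (by linarith)] at h3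
    -- From -log(621/625) ≥ 4/625 the last unsuccessful exponent is at most (625/4) · 3 log β < 469
    -- log β; the rest of 475 log β covers the additive 2.
    have h4 := Real.log_le_sub_one_of_pos (by norm_num : (0 : ℝ) < 621 / 625)
    have : (0 : ℝ) ≤ T := Nat.cast_nonneg T
    push_cast
    nlinarith

/-- Jensen's inequality for the concave function x ↦ x^p. It produces the shape r (α/r)^(ω-2) of the
update cost. -/
theorem sum_rpow_le {r : ℕ} (hr : 1 ≤ r) {u : ℕ → ℕ} {α : ℕ} (h : ∑ k ∈ Finset.range r, u k ≤ α)
    {p : ℝ} (hp0 : 0 ≤ p) (hp1 : p ≤ 1) :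
    ∑ k ∈ Finset.range r, (u k : ℝ) ^ p ≤ r * ((α : ℝ) / r) ^ p := by
  have hr0 : (0 : ℝ) < r := by exact_mod_cast hr
  have := (Real.concaveOn_rpow hp0 hp1).le_map_sum (t := Finset.range r) (w := fun _ => (r : ℝ)⁻¹)
    (p := fun k => (u k : ℝ)) (fun _ _ => by positivity)
    (by simp [hr0.ne']) (fun _ _ => Set.mem_Ici.2 (Nat.cast_nonneg _))
  simp only [smul_eq_mul, ← Finset.mul_sum] at this
  rw [inv_mul_le_iff₀ hr0] at this
  refine this.trans ?_
  gcongr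
  rw [div_eq_inv_mul]
  gcongr
  exact_mod_cast h

/-- The dimension of the sketch is large enough. -/
theorem failure_le {n α : ℕ} (hα : 1 ≤ α) (hαn : α ≤ n) {c : ℝ} (hc : 0 < c) {c' : ℕ}
    (hc' : 12 * (8 + c) ≤ c') :
    ((α + 1 : ℕ) : ℝ) * ((20 * α + 1) ^ α * (2 * Real.exp (-((sketchDim n α c' : ℕ) / 12)))) ≤
      (n : ℝ) ^ (-c) := by
  have hl1 : 1 ≤ Nat.clog 2 (n + 1) := Nat.clog_pos (by norm_num) (by omega)
  have hm : ((sketchDim n α c' : ℕ) : ℝ) = Nat.clog 2 (n + 1) * (c' * α) := by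
    rw [sketchDim]; push_cast; rfl
  have hn1 : ((n + 1 : ℕ) : ℝ) ≤ ((2 ^ Nat.clog 2 (n + 1) : ℕ) : ℝ) := by
    exact_mod_cast Nat.le_pow_clog (by norm_num) (n + 1)
  rw [hm]
  set l : ℝ := ((Nat.clog 2 (n + 1) : ℕ) : ℝ) with hl
  have l1 : (1 : ℝ) ≤ l := by rw [hl]; exact_mod_cast hl1
  have a1 : (1 : ℝ) ≤ α := by exact_mod_cast hα
  have an : (α : ℝ) ≤ n := by exact_mod_cast hαn
  have e1 : (2 : ℝ) ≤ Real.exp 1 := by have := Real.add_one_le_exp (1 : ℝ); linarith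
  have hn : (n : ℝ) + 1 ≤ Real.exp l := by
    push_cast at hn1
    refine hn1.trans ?_
    calc (2 : ℝ) ^ Nat.clog 2 (n + 1) ≤ Real.exp 1 ^ Nat.clog 2 (n + 1) := by gcongr
      _ = Real.exp l := by rw [← Real.exp_nat_mul, mul_one]
  have hla : l ≤ l * α := le_mul_of_one_le_right (by linarith) a1
  -- With l = ⌈log₂(n + 1)⌉, the number of records, the size of the net and the factor 2 are bounded
  -- by exponentials of 1, 6 and 1 times lα. This is the 8 in the condition 12 (8 + c) ≤ c'.
  have b1 : ((α + 1 : ℕ) : ℝ) ≤ Real.exp (l * α) := by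
    push_cast
    calc (α : ℝ) + 1 ≤ n + 1 := by linarith
      _ ≤ Real.exp l := hn
      _ ≤ _ := Real.exp_le_exp.2 hla
  have b2 : (20 * α + 1 : ℝ) ^ α ≤ Real.exp (6 * (l * α)) := by
    have h32 : (32 : ℝ) ≤ Real.exp (5 * l) := by
      calc (32 : ℝ) = 2 ^ 5 := by norm_num
        _ ≤ Real.exp 1 ^ 5 := by gcongr
        _ = Real.exp 5 := by rw [← Real.exp_nat_mul]; norm_num
        _ ≤ _ := Real.exp_le_exp.2 (by linarith)
    calc (20 * α + 1 : ℝ) ^ α ≤ (32 * (n + 1)) ^ α := by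
          gcongr
          linarith
      _ ≤ (Real.exp (5 * l) * Real.exp l) ^ α := by gcongr
      _ = Real.exp (6 * (l * α)) := by
        rw [← Real.exp_add, ← Real.exp_nat_mul]
        congr 1
        ring
  have b3 : (2 : ℝ) ≤ Real.exp (l * α) := e1.trans (Real.exp_le_exp.2 (by linarith))
  have hn0 : (0 : ℝ) < n := by linarith
  have b4 : Real.exp (-(c * (l * α))) ≤ (n : ℝ) ^ (-c) := by
    rw [Real.rpow_def_of_pos hn0]
    refine Real.exp_le_exp.2 ?_
    have : Real.log n ≤ l := by
      rw [Real.log_le_iff_le_exp hn0]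
      linarith
    nlinarith [mul_le_mul_of_nonneg_left (this.trans hla) hc.le]
  refine le_trans ?_ b4
  calc _ ≤ Real.exp (l * α) * (Real.exp (6 * (l * α)) * (Real.exp (l * α) *
        Real.exp (-(l * (c' * α) / 12)))) := by gcongr
    _ = Real.exp (l * α + (6 * (l * α) + (l * α + -(l * (c' * α) / 12)))) := by
      simp only [Real.exp_add]
    _ ≤ _ := by
      refine Real.exp_le_exp.2 ?_
      have := mul_le_mul_of_nonneg_left hc' (show 0 ≤ l * α by positivity)
      nlinarith

/-- A matrix that factors through ℝⁿ has rank at most n. Together with α ≤ d this bounds the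
logarithms of α and d by that of n. -/
theorem card_le_of_posDef {n d : ℕ} {A : Matrix (Fin n) (Fin d) ℝ} {w : Fin n → ℝ}
    (h : (weightedGram A w).PosDef) : d ≤ n := by
  have h1 := rank_of_isUnit _ h.isUnit
  have h2 := (rank_mul_le_right (Aᵀ * diagonal w) A).trans (rank_le_height A)
  rw [Fintype.card_fin] at h1
  rw [weightedGram] at h1
  omega

end InverseMaintenance

namespace InverseMaintenance

open RealRAM Matrix

/-! ### The runs of the data structure -/

/-- The data structure; `c` controls the dimension of the sketch. -/
def maintainer (P : Prog) (c : ℕ) : Maintainer := ⟨initProg P c, updateProg P, applyProg⟩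

/-- The assumptions on an instance. -/
structure Valid {n d : ℕ} (r α : ℕ) (β : ℝ) (A : Matrix (Fin n) (Fin d) ℝ)
    (w : ℕ → Fin n → ℝ) : Prop where
  one_le_r : 1 ≤ r
  one_le_α : 1 ≤ α
  α_le : α ≤ d
  two_lt : 2 < β
  nonneg : ∀ k ≤ r, ∀ i, 0 ≤ w k i
  posDef : ∀ k, 1 ≤ k → k ≤ r → (weightedGram A (w k)).PosDef
  card_le : ∑ k ∈ Finset.range r, (diffSet (w k) (w (k + 1))).card ≤ α
  approx : ∀ k, 1 ≤ k → k ≤ r → β⁻¹ • weightedGram A (w 0) ≤ weightedGram A (w k) ∧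
    weightedGram A (w k) ≤ β • weightedGram A (w 0)

section

variable {n : ℕ}

/-- The record after `k` rounds. -/
def roundLog (w : ℕ → Fin n → ℝ) : ℕ → Log
  | 0 => startLog (support (w 0)).card (entryIdx (support (w 0))) (entryVal (support (w 0)) (w 0))
  | k + 1 => (roundLog w k).pushes (entryIdx (diffSet (w k) (w (k + 1))))
      (entryVal (diffSet (w k) (w (k + 1))) (w (k + 1))) (diffSet (w k) (w (k + 1))).card

theorem roundLog_tracks (w : ℕ → Fin n → ℝ) (k : ℕ) : (roundLog w k).Tracks (w 0) (w k) := by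
  induction k with
  | zero =>
    exact ⟨by simp [roundLog, startLog], by simp [roundLog, startLog],
      by simp [roundLog, startLog], fun _ _ => rfl, (entryLog_tracks (w 0)).cur⟩
  | succ k ih => exact ih.entries fun i hi => by simpa [diffSet] using hi

theorem roundLog_cnt (w : ℕ → Fin n → ℝ) (k : ℕ) : (roundLog w k).cnt =
    ∑ j ∈ Finset.range k, (diffSet (w j) (w (j + 1))).card := by
  induction k with
  | zero => rfl
  | succ k ih => rw [roundLog, Log.pushes_cnt, ih, Finset.sum_range_succ]

end

section

variable {n d r α : ℕ} {β : ℝ} {A : Matrix (Fin n) (Fin d) ℝ} {w : ℕ → Fin n → ℝ}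

namespace Valid

/-- B₀ is not assumed positive definite; it dominates β⁻¹ times the matrix of round 1, which exists
because r ≥ 1. -/
theorem posDef_zero (h : Valid r α β A w) : (weightedGram A (w 0)).PosDef := by
  have hβ : 0 < β := by linarith [h.two_lt]
  have := smul_le_smul' (h.approx 1 le_rfl h.one_le_r).2 (inv_pos.2 hβ).le
  rw [smul_smul, inv_mul_cancel₀ hβ.ne', one_smul] at this
  exact posDef_of_le ((h.posDef 1 le_rfl h.one_le_r).smul (inv_pos.2 hβ)) this

theorem d_le (h : Valid r α β A w) : d ≤ n := card_le_of_posDef h.posDef_zero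

theorem cnt_le (h : Valid r α β A w) {k : ℕ} (hk : k ≤ r) : (roundLog w k).cnt ≤ α := by
  rw [roundLog_cnt]
  exact (Finset.sum_le_sum_of_subset (Finset.range_mono hk)).trans h.card_le

end Valid

theorem Sim.loadEntries {b : Bool} {L : ℕ} {σ s : Store} (h : Sim b L σ s) (S : Finset (Fin n))
    (v : Fin n → ℝ) : Sim b L (loadEntries S v σ) (loadEntries S v s) := by
  refine ⟨⟨fun a ha => ?_, h.val, fun a ha => ?_, fun a ha => ?_⟩, h.coins⟩
  · simp only [InverseMaintenance.loadEntries, Function.update_apply, h.idx a ha]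
  · simp only [InverseMaintenance.loadEntries, Function.update_apply, h.idxTab a ha]
  · simp only [InverseMaintenance.loadEntries, Function.update_apply, h.valTab a ha]

theorem Sim.loadQuery {b : Bool} {L : ℕ} {σ s : Store} (h : Sim b L σ s) (v : Fin d → ℝ) :
    Sim b L (loadQuery v σ) (loadQuery v s) := by
  refine ⟨⟨h.idx, h.val, h.idxTab, fun a ha => ?_⟩, h.coins⟩
  simp only [InverseMaintenance.loadQuery, Function.update_apply, h.valTab a ha]

variable {ω C : ℝ} {P : Prog} {c : ℕ} {coins : ℕ → Bool}

def costScale (C : ℝ) : ℝ := 2000000 * (C + 100000)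

def initCost (n d s c : ℕ) (ω C : ℝ) : ℝ :=
  costScale C * c * ((Nat.clog 2 (n + 1) : ℕ) * ((s + 1 + d) * (d : ℝ) ^ (ω - 1)))

def updateCost (d m α u : ℕ) (ω C : ℝ) : ℝ :=
  costScale C * ((if u = 0 then 0 else m * d * (u : ℝ) ^ (ω - 2)) + m * (α : ℝ) ^ (ω - 1))

/-- The memory during round `k`. -/
def State (α c : ℕ) (β : ℝ) (A : Matrix (Fin n) (Fin d) ℝ) (w : ℕ → Fin n → ℝ)
    (coins : ℕ → Bool) (k : ℕ) (σ : Store) : Prop :=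
  ∃ s, Sim false 60 σ s ∧
    (instSetup α c β A (w 0) coins).Holds (roundLog w k) (roundLog w k) s ∧
    (1 ≤ k → ((instSetup α c β A (w 0) coins).query (roundLog w k)).Holds s)

theorem exec_init (h : Valid r α β A w) (hω : 2 ≤ ω) (hC : 0 ≤ C) (hP : IsMulProg ω C P)
    (hc : 1 ≤ c) : ∃ τ t, Exec (maintainer P c).init (initialStore r α β A (w 0) coins) τ t ∧
      (t : ℝ) ≤ initCost n d (support (w 0)).card c ω C ∧ State α c β A w coins 0 τ := by
  have hA : (initialStore r α β A (w 0) coins).valTab 0 = tableOf A := by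
    funext i j
    simp [initialStore, InverseMaintenance.loadEntries, tableOf]
  obtain ⟨τ, t, s', h1, h2, h3, h4⟩ := Tri.initProg (c := c) (n := n) (d := d) (α := α)
    (s0 := (support (w 0)).card) (β := β)
    (ev := entryIdx (support (w 0))) (ex := entryVal (support (w 0)) (w 0)) hω hC hP
    (s := initialStore r α β A (w 0) coins)
    (by simp [initialStore, InverseMaintenance.loadEntries])
    (by simp [initialStore, InverseMaintenance.loadEntries])
    (by simp [initialStore, InverseMaintenance.loadEntries])
    (by simp [initialStore, InverseMaintenance.loadEntries, support])
    (by simp [initialStore, InverseMaintenance.loadEntries])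
    (fun a => by simp [initialStore, InverseMaintenance.loadEntries, support, entryIdx])
    (fun a => by simp [initialStore, InverseMaintenance.loadEntries, support, entryVal])
    (fun a => by simp [initialStore, InverseMaintenance.loadEntries])
    (fun a => by simp [initialStore, InverseMaintenance.loadEntries])
    (fun a => by simp [initialStore, InverseMaintenance.loadEntries])
    (fun a => by simp [initialStore, InverseMaintenance.loadEntries])
    (fun a => by simp [initialStore, InverseMaintenance.loadEntries])
    (by rw [hA, initGram_eq]; exact h.posDef_zero) (h.one_le_α.trans h.α_le) h.α_le h.d_le hc
  rw [hA] at h4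
  exact ⟨τ, t, h1, h2, s', h3, h4, by omega⟩

theorem exec_update (h : Valid r α β A w) (hω : 2 ≤ ω) (hC : 0 ≤ C) (hP : IsMulProg ω C P)
    (hc : 1 ≤ c) {k : ℕ} (hk : k < r) {σ : Store} (hσ : State α c β A w coins k σ) :
    ∃ τ t, Exec (maintainer P c).update (loadRound w k σ) τ t ∧
      (t : ℝ) ≤ updateCost d (sketchDim n α c) α (diffSet (w k) (w (k + 1))).card ω C ∧
      State α c β A w coins (k + 1) τ := by
  obtain ⟨s, h1, h2, -⟩ := hσ
  have hcnt := h.cnt_le (show k + 1 ≤ r from hk)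
  rw [roundLog, Log.pushes_cnt] at hcnt
  have hα := h.one_le_α
  have hαd := h.α_le
  have hdn := h.d_le
  obtain ⟨s', t1, t2, t3⟩ := Tri.updateProg (s := loadRound w k s) hω hC hP
    (D := instSetup α c β A (w 0) coins) (L := roundLog w k)
    (i := entryIdx (diffSet (w k) (w (k + 1))))
    (x := entryVal (diffSet (w k) (w (k + 1))) (w (k + 1))) (u := (diffSet (w k) (w (k + 1))).card)
    (h2.congr (by rintro a (rfl | rfl | rfl | rfl | rfl) <;>
        simp [loadRound, InverseMaintenance.loadEntries])
      (fun t ht ht' => by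
        simp [loadRound, InverseMaintenance.loadEntries, show t ≠ 0 by omega])
      (fun _ _ _ => rfl)
      (fun t ht => by
        have : t ≠ 1 := by rintro rfl; simp [Setup.keepT] at ht
        simp [loadRound, InverseMaintenance.loadEntries, this]))
    (by simp [loadRound, InverseMaintenance.loadEntries])
    (fun a => by simp [loadRound, InverseMaintenance.loadEntries, entryIdx])
    (fun a => by simp [loadRound, InverseMaintenance.loadEntries, entryVal]) hα hcnt hαd
    (by
      have hl : Nat.log 2 α + 1 ≤ Nat.clog 2 (n + 1) := by
        rw [Nat.succ_le_iff, Nat.lt_clog_iff_pow_lt (by norm_num)]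
        exact (Nat.pow_log_le_self 2 (by omega)).trans_lt (by omega)
      calc α * (Nat.log 2 α + 1) ≤ α * Nat.clog 2 (n + 1) * c := by
            rw [← Nat.mul_one (α * (Nat.log 2 α + 1))]
            gcongr
        _ = sketchDim n α c := by rw [sketchDim]; ring)
    (Setup.isUnit_capX (by linarith [h.two_lt]) (roundLog_tracks w (k + 1)) (h.cnt_le hk)
      (h.nonneg _ hk) h.posDef_zero)
  obtain ⟨τ, t, e1, e2, e3⟩ := t1 _ (Sim.loadEntries h1 _ _)
  exact ⟨τ, t, e1, e2, s', e3, t2, fun _ => t3⟩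

theorem exec_apply (h : Valid r α β A w) {k : ℕ} (hk : 1 ≤ k) {σ : Store}
    (hσ : State α c β A w coins k σ) (v : Fin d → ℝ) {T : ℕ}
    (hT : (621 / 625 : ℝ) ^ T ≤ 1 / (2 * (β * β)))
    (hT' : ∀ t < T, 1 / (2 * (β * β)) < (621 / 625 : ℝ) ^ t) :
    ∃ τ t, Exec (maintainer P c).apply (loadQuery v σ) τ t ∧
      (t : ℝ) ≤ 300000 * ((d : ℝ) ^ 2 * (T + 1)) ∧ State α c β A w coins k τ ∧
      ∀ i : Fin d, τ.valTab 3 i 0 =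
        ((instSetup α c β A (w 0) coins).query (roundLog w k)).answer T v i := by
  obtain ⟨s, h1, h2, h3⟩ := hσ
  have h3 := h3 hk
  have h2' : (instSetup α c β A (w 0) coins).Holds (roundLog w k) (roundLog w k)
      (loadQuery v s) :=
    h2.congr (fun _ _ => rfl) (fun _ _ _ => rfl) (fun _ _ _ => rfl) fun t ht => by
      have : t ≠ 2 := by rintro rfl; simp [Setup.keepT] at ht
      simp [InverseMaintenance.loadQuery, this]
  have h3' : ((instSetup α c β A (w 0) coins).query (roundLog w k)).Holds (loadQuery v s) := by
    refine ⟨h3.dim, h3.slots, h3.γ, h3.thr, ?_, ?_, ?_, ?_, ?_, ?_⟩ <;>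
      simp only [InverseMaintenance.loadQuery, Function.update_apply,
        Nat.reduceEqDiff, if_false]
    exacts [h3.G, h3.F, h3.δ, h3.g, h3.X, h3.Y]
  obtain ⟨s', t1, t2, t3⟩ := Tri.applyProg h3' (h.one_le_α.trans h.α_le) h.α_le (v := v)
    (fun i => by simp [InverseMaintenance.loadQuery]) hT hT'
  obtain ⟨τ, t, e1, e2, e3⟩ := t1 _ (Sim.loadQuery h1 v)
  refine ⟨τ, t, e1, e2, ⟨s', e3, h2'.congr (fun a _ => by rw [t2.idx]) (fun t _ _ => by rw [t2.idxTab])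
    (fun x hx hx' => t2.val x (by simp [keepV]; omega)) (fun t ht => t2.valTab t ?_),
    fun _ => h3'.congr t2⟩, fun i => ?_⟩
  · simp [Setup.keepT] at ht
    simp [keepT]
    omega
  · rw [e3.valTab 3 (by norm_num)]
    exact t3 i

/-- The machine is deterministic, so each step of an actual run coincides with the run constructed
for it. A query restores the state of its round, hence no sequence of queries, however chosen,
influences later rounds. -/
theorem Reach.state (h : Valid r α β A w) (hω : 2 ≤ ω) (hC : 0 ≤ C) (hP : IsMulProg ω C P)
    (hc : 1 ≤ c) {k T : ℕ} {σ : Store} (hR : Reach (maintainer P c) r α β A w coins k σ T) :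
    k ≤ r ∧ (T : ℝ) ≤ initCost n d (support (w 0)).card c ω C + ∑ j ∈ Finset.range k,
      updateCost d (sketchDim n α c) α (diffSet (w j) (w (j + 1))).card ω C ∧
    State α c β A w coins k σ := by
  induction hR with
  | init he =>
    obtain ⟨τ, t, e1, e2, e3⟩ := exec_init (coins := coins) h hω hC hP hc
    obtain ⟨rfl, rfl⟩ := he.det e1
    exact ⟨Nat.zero_le _, by simpa using e2, e3⟩
  | update _ hk he ih =>
    obtain ⟨-, i1, i2⟩ := ih
    obtain ⟨τ, t, e1, e2, e3⟩ := exec_update h hω hC hP hc hk i2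
    obtain ⟨rfl, rfl⟩ := he.det e1
    refine ⟨hk, ?_, e3⟩
    rw [Finset.sum_range_succ]
    push_cast
    linarith
  | query v _ hk he ih =>
    obtain ⟨i0, i1, i2⟩ := ih
    obtain ⟨T, a1, a2, -⟩ := exists_steps h.two_lt
    obtain ⟨τ, t, e1, -, e3, -⟩ := exec_apply (P := P) h hk i2 v a1 a2
    obtain ⟨rfl, rfl⟩ := he.det e1
    exact ⟨i0, i1, e3⟩

end

end InverseMaintenance

/-! ### Total running time and failure probability -/

namespace InverseMaintenance

open RealRAM Matrix

section

variable {n d r α c : ℕ} {β ω C : ℝ} {P : Prog} {A : Matrix (Fin n) (Fin d) ℝ}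
  {w : ℕ → Fin n → ℝ} {coins : ℕ → Bool}

theorem costScale_pos (hC : 0 ≤ C) : 200000000000 ≤ costScale C := by
  rw [costScale]; linarith

/-- The sketch has m = cα⌈log₂(n + 1)⌉ rows, so m d Σ u^(ω-2) and r m α^(ω-1) become the second and
third term of the bound, up to one logarithm. The first term is the preprocessing, with s + 1 + d
replaced by three times the maximum. -/
theorem total_cost_le (h : Valid r α β A w) (hω : 2 ≤ ω) (hω3 : ω ≤ 3) (hC : 0 ≤ C) {k : ℕ}
    (hk : k ≤ r) :
    initCost n d (support (w 0)).card c ω C + ∑ j ∈ Finset.range k,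
      updateCost d (sketchDim n α c) α (diffSet (w j) (w (j + 1))).card ω C ≤
    12 * costScale C * c * Real.log (n + d + 2) ^ (1 : ℝ) *
      ((max (nnz (w 0)) d : ℕ) * (d : ℝ) ^ (ω - 1) + α * r * d * ((α : ℝ) / r) ^ (ω - 2) +
        r * (α : ℝ) ^ ω) := by
  have hE := costScale_pos hC
  set u : ℕ → ℕ := fun j => (diffSet (w j) (w (j + 1))).card with hu
  have hup : ∀ j, 0 ≤ updateCost d (sketchDim n α c) α (u j) ω C := fun j => by
    rw [updateCost]
    split_ifs <;> positivity
  have h1 := Finset.sum_le_sum_of_subset_of_nonneg (Finset.range_mono hk) fun j _ _ => hup j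
  have hm : ((sketchDim n α c : ℕ) : ℝ) = Nat.clog 2 (n + 1) * (c * α) := by
    rw [sketchDim]; push_cast; rfl
  have h2 : ∑ j ∈ Finset.range r, updateCost d (sketchDim n α c) α (u j) ω C ≤
      costScale C * c * (Nat.clog 2 (n + 1) : ℕ) *
        (α * r * d * ((α : ℝ) / r) ^ (ω - 2) + r * (α : ℝ) ^ ω) := by
    have hle : ∀ j ∈ Finset.range r, updateCost d (sketchDim n α c) α (u j) ω C ≤
        costScale C * (sketchDim n α c * d * (u j : ℝ) ^ (ω - 2) +
          sketchDim n α c * (α : ℝ) ^ (ω - 1)) := fun j _ => by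
      rw [updateCost]
      split_ifs
      · gcongr; positivity
      · exact le_rfl
    have h3 := sum_rpow_le h.one_le_r h.card_le (p := ω - 2) (by linarith) (by linarith)
    have hα : (α : ℝ) ^ ω = α * (α : ℝ) ^ (ω - 1) := by
      have := Real.rpow_add_one (x := α) (by exact_mod_cast (by have := h.one_le_α; omega)) (ω - 1)
      rw [sub_add_cancel] at this
      rw [this, mul_comm]
    refine (Finset.sum_le_sum hle).trans ?_
    rw [← Finset.mul_sum, Finset.sum_add_distrib, ← Finset.mul_sum, Finset.sum_const,
      Finset.card_range, nsmul_eq_mul]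
    calc _ ≤ costScale C * (sketchDim n α c * d * (r * ((α : ℝ) / r) ^ (ω - 2)) +
          r * (sketchDim n α c * (α : ℝ) ^ (ω - 1))) := by gcongr
      _ = _ := by rw [hm, hα]; ring
  have d1 : (1 : ℝ) ≤ d := by exact_mod_cast h.one_le_α.trans h.α_le
  have h4 : ((support (w 0)).card + 1 + d : ℝ) ≤ 3 * (max (nnz (w 0)) d : ℕ) := by
    have e1 : ((support (w 0)).card : ℝ) ≤ (max (nnz (w 0)) d : ℕ) := by
      exact_mod_cast le_max_left _ _
    have e2 : (d : ℝ) ≤ (max (nnz (w 0)) d : ℕ) := by exact_mod_cast le_max_right _ _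
    linarith
  have h5 : initCost n d (support (w 0)).card c ω C ≤ costScale C * c * (Nat.clog 2 (n + 1) : ℕ) *
      (3 * ((max (nnz (w 0)) d : ℕ) * (d : ℝ) ^ (ω - 1))) := by
    rw [initCost, mul_assoc _ ((Nat.clog 2 (n + 1) : ℕ) : ℝ), ← mul_assoc (3 : ℝ)]
    gcongr
  set X : ℝ := (max (nnz (w 0)) d : ℕ) * (d : ℝ) ^ (ω - 1) with hX
  set Y : ℝ := α * r * d * ((α : ℝ) / r) ^ (ω - 2) + r * (α : ℝ) ^ ω with hY
  have hX0 : 0 ≤ X := by positivity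
  have hY0 : 0 ≤ Y := by positivity
  have hl := clog_le_log n d
  rw [Real.rpow_one, add_assoc X]
  calc _ ≤ costScale C * c * (Nat.clog 2 (n + 1) : ℕ) * (3 * X) +
        costScale C * c * (Nat.clog 2 (n + 1) : ℕ) * Y := add_le_add h5 (h1.trans h2)
    _ = costScale C * c * (Nat.clog 2 (n + 1) : ℕ) * (3 * X + Y) := by ring
    _ ≤ costScale C * c * (4 * Real.log (n + d + 2)) * (3 * X + 3 * Y) := by
      have hl0 : 0 ≤ 4 * Real.log (n + d + 2) := (Nat.cast_nonneg _).trans hl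
      gcongr
      linarith
    _ = _ := by ring

theorem runsInTime (h : Valid r α β A w) (hω : 2 ≤ ω) (hω3 : ω ≤ 3) (hC : 0 ≤ C)
    (hP : IsMulProg ω C P) (hc : 1 ≤ c) (coins : ℕ → Bool) :
    RunsInTime (maintainer P c) r α β A w
      (12 * costScale C * c * Real.log (n + d + 2) ^ (1 : ℝ) *
        ((max (nnz (w 0)) d : ℕ) * (d : ℝ) ^ (ω - 1) + α * r * d * ((α : ℝ) / r) ^ (ω - 2) +
          r * (α : ℝ) ^ ω))
      (12 * costScale C * c * Real.log (n + d + 2) ^ (1 : ℝ) * ((d : ℝ) ^ 2 * Real.log β))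
      coins := by
  refine ⟨?_, fun k σ T hR => ?_⟩
  · obtain ⟨τ, t, e1, -⟩ := exec_init (coins := coins) h hω hC hP hc
    exact ⟨τ, t, e1⟩
  · obtain ⟨-, h1, h2⟩ := Reach.state h hω hC hP hc hR
    have hk : k ≤ r := (Reach.state h hω hC hP hc hR).1
    refine ⟨h1.trans (total_cost_le h hω hω3 hC hk), fun hk => ?_, fun hk v => ?_⟩
    · obtain ⟨τ, t, e1, -⟩ := exec_update h hω hC hP hc hk h2
      exact ⟨τ, t, e1⟩
    · obtain ⟨S, a1, a2, a3⟩ := exists_steps h.two_lt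
      obtain ⟨τ, t, e1, e2, -⟩ := exec_apply (P := P) h hk h2 v a1 a2
      refine ⟨τ, t, e1, e2.trans ?_⟩
      have hE := costScale_pos hC
      have hβ : 0 ≤ Real.log β := Real.log_nonneg (by linarith [h.two_lt])
      have hlog : 1 / 2 ≤ Real.log (n + d + 2) := by
        have := Real.log_two_gt_d9
        have : Real.log 2 ≤ Real.log (n + d + 2) := Real.log_le_log (by norm_num) (by
          have : (0 : ℝ) ≤ n := Nat.cast_nonneg n
          have : (0 : ℝ) ≤ d := Nat.cast_nonneg d
          linarith)
        linarith
      have c1 : (1 : ℝ) ≤ c := by exact_mod_cast hc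
      rw [Real.rpow_one]
      calc (300000 : ℝ) * ((d : ℝ) ^ 2 * (S + 1)) ≤ 300000 * ((d : ℝ) ^ 2 * (475 * Real.log β)) := by
            gcongr
        _ = 142500000 * ((d : ℝ) ^ 2 * Real.log β) := by ring
        _ ≤ (12 * 200000000000 * 1 * (1 / 2)) * ((d : ℝ) ^ 2 * Real.log β) := by
          gcongr; norm_num
        _ ≤ _ := by gcongr

theorem answersCorrectly (h : Valid r α β A w) (hω : 2 ≤ ω) (hC : 0 ≤ C)
    (hP : IsMulProg ω C P) (hc : 1 ≤ c)
    (hg : ∀ k ≤ r, SketchGood (coinMatrix (sketchDim n α c) ((support (w 0)).card + 1) coins)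
      (sketched α c β A (w 0) (roundLog w k))) :
    AnswersCorrectly (maintainer P c) r α β A w 1 coins := by
  obtain ⟨S, a1, a2, -⟩ := exists_steps h.two_lt
  have hm : 1 ≤ sketchDim n α c := by
    have : 0 < Nat.clog 2 (n + 1) := by
      have := h.one_le_α
      have := h.α_le
      have := h.d_le
      exact Nat.clog_pos (by norm_num) (by omega)
    exact Nat.mul_pos this (Nat.mul_pos hc h.one_le_α)
  have key : ∀ k, ∃ K : Matrix (Fin d) (Fin d) ℝ, 1 ≤ k → k ≤ r → (K.IsSymm ∧
      SpectralApprox 1 K (weightedGram A (w k))⁻¹) ∧ ∀ v,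
      ((instSetup α c β A (w 0) coins).query (roundLog w k)).answer S v = K *ᵥ v := by
    intro k
    by_cases hk : 1 ≤ k ∧ k ≤ r
    · obtain ⟨K, h1, h2, h3⟩ := query_correct (coins := coins) h.two_lt (roundLog_tracks w k)
        (h.cnt_le hk.2) (h.nonneg 0 (Nat.zero_le _)) (h.nonneg k hk.2) h.posDef_zero
        (h.posDef k hk.1 hk.2) (h.approx k hk.1 hk.2).1 (h.approx k hk.1 hk.2).2 hm (hg k hk.2) a1
      exact ⟨K, fun _ _ => ⟨⟨h1, h2⟩, h3⟩⟩
    · exact ⟨0, fun h1 h2 => absurd ⟨h1, h2⟩ hk⟩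
  choose K hK using key
  refine ⟨K, fun k h1 h2 => (hK k h1 h2).1, fun k σ T hR hk v => ?_⟩
  obtain ⟨hkr, -, h2⟩ := Reach.state h hω hC hP hc hR
  obtain ⟨τ, t, e1, -, -, e3⟩ := exec_apply (P := P) h hk h2 v a1 a2
  exact ⟨τ, t, e1, fun i => by rw [e3, (hK k hk hkr).2 v]⟩

/-- The rounds in which the record changes. -/
def changeRounds (r : ℕ) (w : ℕ → Fin n → ℝ) : Finset ℕ :=
  insert 0 (((Finset.range r).filter fun k => (diffSet (w k) (w (k + 1))).card ≠ 0).image (· + 1))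

theorem card_changeRounds (h : Valid r α β A w) : (changeRounds r w).card ≤ α + 1 := by
  refine (Finset.card_insert_le _ _).trans (Nat.succ_le_succ (Finset.card_image_le.trans ?_))
  refine le_trans ?_ h.card_le
  rw [Finset.card_filter]
  refine Finset.sum_le_sum fun k _ => ?_
  split_ifs <;> omega

theorem exists_changeRound (w : ℕ → Fin n → ℝ) {k : ℕ} (hk : k ≤ r) :
    ∃ k' ∈ changeRounds r w, roundLog w k = roundLog w k' := by
  induction k with
  | zero => exact ⟨0, Finset.mem_insert_self _ _, rfl⟩
  | succ k ih =>
    by_cases hd : (diffSet (w k) (w (k + 1))).card = 0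
    · obtain ⟨k', h1, h2⟩ := ih (by omega)
      exact ⟨k', h1, by rw [roundLog, hd, Log.pushes, h2]⟩
    · exact ⟨k + 1, Finset.mem_insert_of_mem (Finset.mem_image.2 ⟨k, Finset.mem_filter.2
        ⟨Finset.mem_range.2 hk, hd⟩, rfl⟩), rfl⟩

/-- Rounds without changes repeat the record of an earlier round, so the union bound runs over at
most α + 1 records, independently of r. For each of them the matrix to be sketched is fixed, and one
bad event covers all queries of the rounds with this record. -/
theorem coinLaw_not_answersCorrectly (h : Valid r α β A w) (hω : 2 ≤ ω) (hC : 0 ≤ C)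
    (hP : IsMulProg ω C P) {e : ℝ} (he : 0 < e) (hc : 12 * (8 + e) ≤ c) :
    coinLaw {coins | ¬ AnswersCorrectly (maintainer P c) r α β A w 1 coins} ≤
      ENNReal.ofReal ((n : ℝ) ^ (-e)) := by
  have hc1 : 1 ≤ c := by
    have : (0 : ℝ) < c := by linarith
    exact_mod_cast this
  set m := sketchDim n α c with hm
  set N := (support (w 0)).card + 1 with hN
  set b : ℝ := (20 * α + 1) ^ α * (2 * Real.exp (-(m / 12))) with hb
  have hsub : {coins | ¬ AnswersCorrectly (maintainer P c) r α β A w 1 coins} ⊆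
      ⋃ k ∈ changeRounds r w, {coins | coinMatrix m N coins ∈
        {W | ¬ SketchGood W (sketched α c β A (w 0) (roundLog w k))}} := by
    intro coins hco
    by_contra hno
    refine hco (answersCorrectly h hω hC hP hc1 fun k hk => ?_)
    obtain ⟨k', h1, h2⟩ := exists_changeRound (r := r) w hk
    rw [h2]
    by_contra hbad
    exact hno (Set.mem_biUnion h1 hbad)
  have hone : ∀ k, coinLaw {coins | coinMatrix m N coins ∈
      {W | ¬ SketchGood W (sketched α c β A (w 0) (roundLog w k))}} ≤ ENNReal.ofReal b := by
    intro k
    refine (coinLaw_coinMatrix_le m N _).trans (ENNReal.ofReal_le_ofReal ?_)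
    rw [div_le_iff₀ (by positivity), mul_comm]
    exact card_not_sketchGood _
  calc _ ≤ _ := MeasureTheory.measure_mono hsub
    _ ≤ ∑ k ∈ changeRounds r w, _ := MeasureTheory.measure_biUnion_finset_le _ _
    _ ≤ ∑ k ∈ changeRounds r w, ENNReal.ofReal b := Finset.sum_le_sum fun k _ => hone k
    _ = ((changeRounds r w).card : ENNReal) * ENNReal.ofReal b := by
      rw [Finset.sum_const, nsmul_eq_mul]
    _ ≤ ((α + 1 : ℕ) : ENNReal) * ENNReal.ofReal b := by
      gcongr
      exact card_changeRounds h
    _ = ENNReal.ofReal (((α + 1 : ℕ) : ℝ) * b) := by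
      rw [ENNReal.ofReal_mul (p := ((α + 1 : ℕ) : ℝ)) (by positivity), ENNReal.ofReal_natCast]
    _ ≤ _ := ENNReal.ofReal_le_ofReal
      (failure_le h.one_le_α (h.α_le.trans h.d_le) he hc)

end

end InverseMaintenance

end

theorem theorem3p1 :
    -- the constant in `K ≈_{O(1)} (B⁽ᵏ⁾)⁻¹`
    ∃ κ : ℝ,
      ∀ ω : ℝ, 2 ≤ ω → ω ≤ 3 → RealRAM.IsMatMulExponent ω →
      -- with high probability: failure probability at most `n ^ (-c)`
      ∀ c : ℝ, 0 < c →
      ∃ (𝒟 : InverseMaintenance.Maintainer) (C p : ℝ),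
      ∀ (n d r α : ℕ) (β : ℝ) (A : Matrix (Fin n) (Fin d) ℝ) (w : ℕ → Fin n → ℝ),
        1 ≤ r → 1 ≤ α → α ≤ d → 2 < β →
        (∀ k ≤ r, ∀ i, 0 ≤ w k i) →
        (∀ k, 1 ≤ k → k ≤ r → (InverseMaintenance.weightedGram A (w k)).PosDef) →
        (∑ k ∈ Finset.range r, (InverseMaintenance.diffSet (w k) (w (k + 1))).card ≤ α) →
        (∀ k, 1 ≤ k → k ≤ r →
          β⁻¹ • InverseMaintenance.weightedGram A (w 0) ≤ InverseMaintenance.weightedGram A (w k) ∧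
          InverseMaintenance.weightedGram A (w k) ≤ β • InverseMaintenance.weightedGram A (w 0)) →
        (∀ coins : ℕ → Bool,
          InverseMaintenance.RunsInTime 𝒟 r α β A w
            (C * Real.log (n + d + 2) ^ p *
              ((max (InverseMaintenance.nnz (w 0)) d : ℕ) * (d : ℝ) ^ (ω - 1)
                + α * r * d * ((α : ℝ) / r) ^ (ω - 2)
                + r * (α : ℝ) ^ ω))
            (C * Real.log (n + d + 2) ^ p * ((d : ℝ) ^ 2 * Real.log β))
            coins) ∧
        RealRAM.coinLaw {coins : ℕ → Bool |
            ¬ InverseMaintenance.AnswersCorrectly 𝒟 r α β A w κ coins}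
          ≤ ENNReal.ofReal ((n : ℝ) ^ (-c)) := by
  refine ⟨1, fun ω hω hω3 hmul c hc => ?_⟩
  obtain ⟨P, C, hC, hP⟩ := hmul.exists_mulProg
  -- The factor of the sketch dimension demanded by `failure_le`, rounded up since it is part of the
  -- program text.
  have hc' := Nat.le_ceil (12 * (8 + c))
  have hc1 : 1 ≤ ⌈12 * (8 + c)⌉₊ := Nat.ceil_pos.2 (by linarith)
  refine ⟨InverseMaintenance.maintainer P ⌈12 * (8 + c)⌉₊,
    12 * InverseMaintenance.costScale C * ⌈12 * (8 + c)⌉₊, 1, ?_⟩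
  intro n d r α β A w hr hα hαd hβ hw hB hcard happ
  have h : InverseMaintenance.Valid r α β A w := ⟨hr, hα, hαd, hβ, hw, hB, hcard, happ⟩
  exact ⟨fun coins => InverseMaintenance.runsInTime h hω hω3 hC hP hc1 coins,
    InverseMaintenance.coinLaw_not_answersCorrectly h hω hC hP hc hc'⟩
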